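/- **Setting.** Let $T^m=(\mathbf C^\times)^m$ act faithfully on $\mathbf A^n$, the coordinate $x_i$ having weight $b_i\in\mathbf Z^m$, and on $T^*\mathbf A^n$, the coordinate $y_i$ having weight $-b_i$. Assume that the action is unimodular: all nonzero $m\times m$ minors of the matrix $(b_{ij})$ are $\pm1$ (in other words, the hypertoric cone below has a smooth symplectic resolution given by a GIT quotient). Let $\mu(\xi)=\sum_i\langle b_i,\xi\rangle x_iy_i$, $\xi\in\mathbf C^m=\operatorname{Lie}T^m$, be the moment map, $X=\mu^{-1}(0)/\!/T^m$ the hypertoric cone, with $\{y_i,x_j\}=\delta_{ij}$ and $\mathbf C^\times$ acting by dilation, $|x_i|=|y_i|=1$, so that the Poisson bracket has degree $-2$. Let $z\in X$, let $\tilde z\in\mu^{-1}(0)$ be a point with closed $T^m$-orbit lying over $z$, $\hat T=\operatorname{Stab}_{T^m}(\tilde z)$, $T=T^m/\hat T$, $F$ the set of $i$ such that $\hat T$ acts nontrivially on $x_i$, and $F^c$ its complement. The closure of the symplectic leaf $Z$ through $z$ is the Hamiltonian reduction of $T^*\mathbf A^{F^c}$ by $T$, and the slice is the Hamiltonian reduction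 $S$ of $T^*\mathbf A^F$ by $\hat T$. A *chart* at $z$ is a set $E$ of coordinate functions (among the $x_i,y_i$) not vanishing at $\tilde z$, together with $e\in\mathbf Z^m$, such that: (1) some monomial whose factors are exactly the coordinates in $E$ (each with positive exponent) is $T^m$-invariant; (2) there is a set $G$ of indices such that the $b_i$, $i\in G$, are linearly independent, $\hat T=\{t: t^{b_i}=1\ \forall i\in G\}$, and for each $i\in G$ exactly one coordinate $u_i\in\{x_i,y_i\}$ is in $E$; (3) the weight of each $u_i$, $i\in G$, pairs to $1$ with $e$. Given a chart, let $X^\circ\ni z$ be the open subset of $X$ where the coordinates in $E$ are nonzero, and $Z^\circ=X^\circ\cap Z$. Grade $\mathcal O(X^\circ)$ and $\mathcal O(Z^\circ)$ by dilation, and $\mathcal O(S)$ by $|x_i|=1-\langle b_i,e\rangle$, $|y_i|=1+\langle b_i,e\rangle$ for $i\in F$ (dilation corrected by the one-parameter subgroup $-e$ of $T^m$, which makes the coordinates $u_i$ invariant). Let $\mathcal D_\hbar(\mathbf A^n)$ be the $\mathbf C[\![\hbar]\!]$-algebra generated by $x_i,y_i$ with $[y_i,x_j]=\delta_{ij}\hbar$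 and all other commutators zero, and $\mu_q(\xi)=\sum_i\langle b_i,\xi\rangle x_iy_i$. Let $$A_{X^\circ}=\Bigl(\mathcal D_\hbar(\mathbf A^n)[E^{-1}]\big/\mu_q(\mathfrak t^m)\,\mathcal D_\hbar(\mathbf A^n)[E^{-1}]\Bigr)^{T^m},$$ completed $\hbar$-adically; define $A_{Z^\circ}$ in the same way from $\mathbf A^{F^c}$, $T$ and the same coordinates $E$, and $A_S$ from $\mathbf A^F$ and $\hat T$, without inverting coordinates. Each is graded by $|\hbar|=2$ and the same degrees of coordinates as the corresponding coordinate ring. **Theorem.** Every point $z\in X$ has a chart. For every chart at $z$, $A_{X^\circ}$ is a $\mathbf C^\times$-compatible deformation quantization of $\mathcal O(X^\circ)$, $A_{Z^\circ}\hat\otimes_{\mathbf C[\![\hbar]\!]}A_S$ is a $\mathbf C^\times$-compatible deformation quantization of $\mathcal O(Z^\circ)\otimes\mathcal O(S)$, and there are a $\mathbf C^\times$-equivariant Poisson isomorphism $\varphi:\mathcal O(X^\circ)\cong\mathcal O(Z^\circ)\otimes\mathcal O(S)$ and an isomorphism of $\mathbf C[\![\hbar]\!]$-algebras $$A_{X^\circ}\;\cong\;A_{Z^\circ}\,\hat\otimes_{\mathbf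 C[\![\hbar]\!]}\,A_S$$ which is compatible with the Euler derivations and reduces to $\varphi$ modulo $\hbar$. Here a $\mathbf C^\times$-compatible deformation quantization of a graded Poisson algebra $\mathcal O$ with bracket of degree $-2$ is a $\mathbf C[\![\hbar]\!]$-algebra $A$ with an algebra epimorphism $\mathrm{pr}:A\to\mathcal O$ with kernel $\hbar A$, isomorphic to $\mathcal O[\![\hbar]\!]$ as a $\mathbf C[\![\hbar]\!]$-module, with $ab-ba\equiv\hbar c\pmod{\hbar^2}$ whenever $\mathrm{pr}(c)=\{\mathrm{pr}(a),\mathrm{pr}(b)\}$, and with a derivation $\mathrm{Eu}$ of $A$, $\mathrm{Eu}(\hbar)=2\hbar$, inducing the Euler derivation of $\mathcal O$. -/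

import Mathlib

open scoped TensorProduct

noncomputable section

namespace Hypertoric

/-! ## Tori, characters, weights -/

/-- The torus `T^m = (ℂ^×)^m`. -/
abbrev Torus (m : ℕ) : Type := Fin m → ℂˣ

/-- The character `t ↦ ∏ⱼ tⱼ ^ wⱼ` of `T^m` attached to `w ∈ ℤ^m`. -/
def chi {m : ℕ} (w : Fin m → ℤ) : Torus m →* ℂˣ where
  toFun t := ∏ j, t j ^ w j
  map_one' := by simp
  map_mul' s t := by simp [mul_zpow, Finset.prod_mul_distrib]

/-- The pairing of a character `w ∈ ℤ^m` with an element `ξ` of the Lie algebra `ℂ^m`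
of `T^m`, that is, the differential of `chi w` evaluated at `ξ`. -/
def pair {m : ℕ} (w : Fin m → ℤ) (ξ : Fin m → ℂ) : ℂ := ∑ j, (w j : ℂ) * ξ j

/-- The pairing of a character with a one-parameter subgroup `e ∈ ℤ^m`. -/
def ipair {m : ℕ} (w e : Fin m → ℤ) : ℤ := ∑ j, w j * e j

/-- The Lie algebra of a (Zariski closed) subgroup `H` of `T^m`: the common kernel of the
differentials of all characters of `T^m` which are trivial on `H`. -/
def lie {m : ℕ} (H : Subgroup (Torus m)) : Set (Fin m → ℂ) :=
  {ξ | ∀ w : Fin m → ℤ, (∀ t ∈ H, chi w t = 1) → pair w ξ = 0}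

/-- Coordinates on `T^*𝔸^ι`: `Sum.inl i` stands for `xᵢ` and `Sum.inr i` for `yᵢ`. -/
abbrev Coord (ι : Type) : Type := ι ⊕ ι

/-- If `xᵢ` has weight `bᵢ`, then `yᵢ` has weight `-bᵢ`. -/
def wt {ι : Type} {m : ℕ} (b : ι → Fin m → ℤ) : Coord ι → Fin m → ℤ :=
  Sum.elim b (fun i => -b i)

/-- The commutators of the coordinates divided by `ħ`: `ω(yᵢ, xᵢ) = 1 = -ω(xᵢ, yᵢ)`, and all
others are zero (`yᵢ = ħ ∂/∂xᵢ`). -/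
def omega {ι : Type} [DecidableEq ι] : Coord ι → Coord ι → ℤ
  | Sum.inr i, Sum.inl j => if i = j then 1 else 0
  | Sum.inl i, Sum.inr j => if i = j then -1 else 0
  | _, _ => 0

/-! ## Classical Hamiltonian reduction -/

section Classical

variable {ι : Type} (E : Set (Coord ι))

/-- The multiplicative set generated by the coordinates in `E`. -/
abbrev mulSet : Submonoid (MvPolynomial (Coord ι) ℂ) :=
  Submonoid.closure (MvPolynomial.X '' E)

/-- The ring of functions on the locus in `T^*𝔸^ι` where all coordinates in `E` are
nonzero. -/
def Fun : Type := Localization (mulSet E)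

instance : CommRing (Fun E) := inferInstanceAs (CommRing (Localization (mulSet E)))

instance : Algebra (MvPolynomial (Coord ι) ℂ) (Fun E) :=
  inferInstanceAs (Algebra (MvPolynomial (Coord ι) ℂ) (Localization (mulSet E)))

instance : Algebra ℂ (Fun E) := inferInstanceAs (Algebra ℂ (Localization (mulSet E)))

instance : IsScalarTower ℂ (MvPolynomial (Coord ι) ℂ) (Fun E) :=
  inferInstanceAs (IsScalarTower ℂ (MvPolynomial (Coord ι) ℂ) (Localization (mulSet E)))

instance : IsLocalization (mulSet E) (Fun E) :=
  inferInstanceAs (IsLocalization (mulSet E) (Localization (mulSet E)))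

/-- A coordinate as a function. -/
def cf (c : Coord ι) : Fun E := algebraMap (MvPolynomial (Coord ι) ℂ) (Fun E) (MvPolynomial.X c)

variable {E} in
theorem isUnit_cf {c : Coord ι} (hc : c ∈ E) : IsUnit (cf E c) :=
  IsLocalization.map_units (Fun E)
    (⟨MvPolynomial.X c, Submonoid.subset_closure ⟨c, hc, rfl⟩⟩ : mulSet E)

theorem mulSet_unit {B : Type*} [CommRing B] [Algebra ℂ B]
    (f : MvPolynomial (Coord ι) ℂ →ₐ[ℂ] B) (h : ∀ c ∈ E, IsUnit (f (MvPolynomial.X c)))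
    (y : mulSet E) : IsUnit (f y) := by
  obtain ⟨y, hy⟩ := y
  induction hy using Submonoid.closure_induction with
  | mem x hx => obtain ⟨c, hc, rfl⟩ := hx; exact h c hc
  | one => simp
  | mul x y _ _ hx hy => simpa using hx.mul hy

/-- The algebra homomorphism out of `Fun E` with given values on the coordinates. -/
def liftFun {B : Type*} [CommRing B] [Algebra ℂ B] (g : Coord ι → B)
    (h : ∀ c ∈ E, IsUnit (g c)) : Fun E →ₐ[ℂ] B :=
  IsLocalization.liftAlgHom (M := mulSet E) (f := MvPolynomial.aeval (R := ℂ) g)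
    (mulSet_unit E _ (by simpa using h))

@[simp] theorem liftFun_cf {B : Type*} [CommRing B] [Algebra ℂ B] (g : Coord ι → B)
    (h : ∀ c ∈ E, IsUnit (g c)) (c : Coord ι) : liftFun E g h (cf E c) = g c := by
  simp [liftFun, cf]

theorem algHom_ext_fun {B : Type*} [CommRing B] [Algebra ℂ B] {f g : Fun E →ₐ[ℂ] B}
    (h : ∀ c, f (cf E c) = g (cf E c)) : f = g := by
  apply IsLocalization.algHom_ext (mulSet E)
  apply MvPolynomial.algHom_ext
  intro c
  exact h c

/-- Rescaling of the coordinates: the automorphism with `c ↦ s(c) c`. -/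
def scale (s : Coord ι → ℂˣ) : Fun E →ₐ[ℂ] Fun E :=
  liftFun E (fun c => ((s c : ℂˣ) : ℂ) • cf E c) fun c hc => by
    have := (isUnit_cf hc).smul (s c)
    simpa [Units.smul_def] using this

@[simp] theorem scale_cf (s : Coord ι → ℂˣ) (c : Coord ι) :
    scale E s (cf E c) = ((s c : ℂˣ) : ℂ) • cf E c := by simp [scale]

open Classical in
/-- The algebra homomorphism `f ↦ f + ε ∂f/∂c`. -/
def pdAux (c : Coord ι) : Fun E →ₐ[ℂ] TrivSqZeroExt (Fun E) (Fun E) :=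
  liftFun E (fun c' => TrivSqZeroExt.inl (cf E c') + TrivSqZeroExt.inr (if c' = c then (1 : Fun E) else 0))
    fun c' hc => by
      rw [TrivSqZeroExt.isUnit_iff_isUnit_fst, TrivSqZeroExt.fst_add, TrivSqZeroExt.fst_inl,
        TrivSqZeroExt.fst_inr, add_zero]
      exact isUnit_cf hc

theorem pdAux_fst (c : Coord ι) (f : Fun E) : (pdAux E c f).fst = f := by
  have : (TrivSqZeroExt.fstHom ℂ (Fun E) (Fun E)).comp (pdAux E c) = AlgHom.id ℂ _ := by
    apply algHom_ext_fun
    intro c'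
    rw [AlgHom.comp_apply, pdAux, liftFun_cf, TrivSqZeroExt.fstHom_apply, TrivSqZeroExt.fst_add,
      TrivSqZeroExt.fst_inl, TrivSqZeroExt.fst_inr, add_zero, AlgHom.id_apply]
  exact congrArg (fun g => g f) this

/-- The partial derivative `∂/∂c` on `Fun E`. -/
def pd (c : Coord ι) : Derivation ℂ (Fun E) (Fun E) :=
  Derivation.mk' ((TrivSqZeroExt.sndHom (Fun E) (Fun E)).restrictScalars ℂ ∘ₗ
    (pdAux E c).toLinearMap) fun f g => by
    simp [pdAux_fst, mul_comm]

open Classical in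
@[simp] theorem pd_cf (c c' : Coord ι) : pd E c (cf E c') = if c' = c then 1 else 0 := by
  change (pdAux E c (cf E c')).snd = _
  rw [pdAux, liftFun_cf, TrivSqZeroExt.snd_add, TrivSqZeroExt.snd_inl, TrivSqZeroExt.snd_inr,
    zero_add]


theorem fun_induction {P : Fun E → Prop} (hC : ∀ a : ℂ, P (algebraMap ℂ _ a))
    (hX : ∀ c, P (cf E c)) (hadd : ∀ f g, P f → P g → P (f + g))
    (hmul : ∀ f g, P f → P g → P (f * g)) (hinv : ∀ f g, P f → f * g = 1 → P g)
    (f : Fun E) : P f := by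
  have hpoly : ∀ g : MvPolynomial (Coord ι) ℂ, P (algebraMap _ (Fun E) g) := by
    intro g
    induction g using MvPolynomial.induction_on with
    | C a => exact hC a
    | add p q hp hq => rw [map_add]; exact hadd _ _ hp hq
    | mul_X p c hp => rw [map_mul]; exact hmul _ _ hp (hX c)
  obtain ⟨⟨g, s⟩, h⟩ := IsLocalization.surj (mulSet E) f
  obtain ⟨v, hv⟩ := (IsLocalization.map_units (Fun E) s).exists_right_inv
  have hf : f = algebraMap _ (Fun E) g * v := by
    rw [← h, mul_assoc, hv, mul_one]
  rw [hf]
  exact hmul _ _ (hpoly g) (hinv _ _ (hpoly s) hv)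

theorem pd_scale (s : Coord ι → ℂˣ) (c : Coord ι) (f : Fun E) :
    pd E c (scale E s f) = ((s c : ℂˣ) : ℂ) • scale E s (pd E c f) := by
  induction f using fun_induction with
  | hC a => simp
  | hX c' =>
    by_cases h : c' = c
    · subst h; simp
    · simp [h]
  | hadd f g hf hg => simp [hf, hg]
  | hmul f g hf hg => simp [hf, hg]
  | hinv f g hf h =>
    have h1 : scale E s f * scale E s g = 1 := by rw [← map_mul, h, map_one]
    have h2 := congrArg (pd E c) h1
    have h3 := congrArg (fun x => ((s c : ℂˣ) : ℂ) • scale E s (pd E c x)) h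
    simp only [Derivation.leibniz, Derivation.map_one_eq_zero, smul_eq_mul, map_add, map_mul,
      map_zero, smul_zero, smul_add, hf] at h2 h3
    have h4 : scale E s f * (pd E c (scale E s g) - ((s c : ℂˣ) : ℂ) • scale E s (pd E c g)) = 0 := by
      rw [mul_sub, mul_smul_comm]
      rw [mul_smul_comm] at h2
      linear_combination h2 - h3
    exact sub_eq_zero.mp ((IsUnit.of_mul_eq_one _ h1).mul_right_eq_zero.mp h4)

theorem mulSet_le : mulSet E ≤ nonZeroDivisors (MvPolynomial (Coord ι) ℂ) := by
  rw [Submonoid.closure_le]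
  rintro _ ⟨c, _, rfl⟩
  exact mem_nonZeroDivisors_of_ne_zero (MvPolynomial.X_ne_zero c)

variable [Fintype ι]

/-- The standard Poisson bracket, with `{yᵢ, xᵢ} = 1`. -/
def brk : Fun E →ₗ[ℂ] Fun E →ₗ[ℂ] Fun E :=
  LinearMap.mk₂ ℂ (fun f g => ∑ i, (pd E (Sum.inr i) f * pd E (Sum.inl i) g -
      pd E (Sum.inl i) f * pd E (Sum.inr i) g))
    (fun f f' g => by
      rw [← Finset.sum_add_distrib]
      exact Finset.sum_congr rfl fun i _ => by simp only [map_add]; ring)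
    (fun a f g => by
      rw [Finset.smul_sum]
      exact Finset.sum_congr rfl fun i _ => by
        simp only [Derivation.map_smul, smul_mul_assoc, smul_sub])
    (fun f g g' => by
      rw [← Finset.sum_add_distrib]
      exact Finset.sum_congr rfl fun i _ => by simp only [map_add]; ring)
    (fun a f g => by
      rw [Finset.smul_sum]
      exact Finset.sum_congr rfl fun i _ => by
        simp only [Derivation.map_smul, mul_smul_comm, smul_sub])

theorem brk_apply (f g : Fun E) : brk E f g =
    ∑ i, (pd E (Sum.inr i) f * pd E (Sum.inl i) g - pd E (Sum.inl i) f * pd E (Sum.inr i) g) := rfl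

theorem brk_mul_left (f g h : Fun E) : brk E (f * g) h = f * brk E g h + g * brk E f h := by
  simp only [brk_apply, Finset.mul_sum, ← Finset.sum_add_distrib, Derivation.leibniz, smul_eq_mul]
  exact Finset.sum_congr rfl fun i _ => by ring

theorem brk_swap (f g : Fun E) : brk E f g = - brk E g f := by
  simp only [brk_apply, ← Finset.sum_neg_distrib]
  exact Finset.sum_congr rfl fun i _ => by ring

variable {m : ℕ} (b : ι → Fin m → ℤ)

/-- The scalars by which `t ∈ T^m` acts on the coordinates. -/
def tscale (t : Torus m) : Coord ι → ℂˣ := fun c => chi (wt b c) t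

theorem chi_neg (w : Fin m → ℤ) (t : Torus m) : chi (-w) t = (chi w t)⁻¹ := by
  simp [chi]

theorem chi_add (w w' : Fin m → ℤ) (t : Torus m) : chi (w + w') t = chi w t * chi w' t := by
  simp [chi, zpow_add, Finset.prod_mul_distrib]

theorem pair_add (w w' : Fin m → ℤ) (ξ : Fin m → ℂ) :
    pair (w + w') ξ = pair w ξ + pair w' ξ := by
  simp [pair, add_mul, Finset.sum_add_distrib]

theorem pair_neg (w : Fin m → ℤ) (ξ : Fin m → ℂ) : pair (-w) ξ = - pair w ξ := by
  simp [pair]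

theorem brk_scale (s : Coord ι → ℂˣ) (hs : ∀ i, s (Sum.inl i) * s (Sum.inr i) = 1)
    (f g : Fun E) : brk E (scale E s f) (scale E s g) = scale E s (brk E f g) := by
  rw [brk_apply, brk_apply, map_sum]
  refine Finset.sum_congr rfl fun i _ => ?_
  have h : ((s (Sum.inl i) : ℂˣ) : ℂ) * ((s (Sum.inr i) : ℂˣ) : ℂ) = 1 := by
    rw [← Units.val_mul, hs i, Units.val_one]
  simp only [pd_scale, map_sub, map_mul, smul_mul_smul_comm, h, mul_comm ((s (Sum.inr i) : ℂˣ) : ℂ),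
    one_smul]

/-- The subalgebra of `H`-invariant functions. -/
def invSub (H : Subgroup (Torus m)) : Subalgebra ℂ (Fun E) where
  carrier := {f | ∀ t ∈ H, scale E (tscale b t) f = f}
  mul_mem' hf hg t ht := by rw [map_mul, hf t ht, hg t ht]
  add_mem' hf hg t ht := by rw [map_add, hf t ht, hg t ht]
  algebraMap_mem' a t ht := AlgHom.commutes _ a

/-- The component of the moment map along `ξ`: `∑ᵢ ⟨bᵢ, ξ⟩ xᵢ yᵢ`. -/
def mom (ξ : Fin m → ℂ) : Fun E := ∑ i, pair (b i) ξ • (cf E (Sum.inl i) * cf E (Sum.inr i))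

open Classical in
theorem brk_mom (ξ : Fin m → ℂ) (f : Fun E) : brk E (mom E b ξ) f =
    ∑ i, pair (b i) ξ • (cf E (Sum.inl i) * pd E (Sum.inl i) f -
      cf E (Sum.inr i) * pd E (Sum.inr i) f) := by
  rw [brk_apply]
  refine Finset.sum_congr rfl fun i _ => ?_
  have h1 : pd E (Sum.inr i) (mom E b ξ) = pair (b i) ξ • cf E (Sum.inl i) := by
    simp [mom]
  have h2 : pd E (Sum.inl i) (mom E b ξ) = pair (b i) ξ • cf E (Sum.inr i) := by
    simp [mom]
  rw [h1, h2, smul_mul_assoc, smul_mul_assoc, smul_sub]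

theorem brk_mom_mul (ξ : Fin m → ℂ) (f g : Fun E) : brk E (mom E b ξ) (f * g) =
    f * brk E (mom E b ξ) g + g * brk E (mom E b ξ) f := by
  rw [brk_swap, brk_mul_left, brk_swap E f, brk_swap E g]; ring

open Classical in
theorem brk_mom_cf (ξ : Fin m → ℂ) (c : Coord ι) :
    brk E (mom E b ξ) (cf E c) = pair (wt b c) ξ • cf E c := by
  rw [brk_mom]
  rcases c with i | i
  · rw [Finset.sum_eq_single i]
    · simp [wt]
    · intro j _ hj; simp [Ne.symm hj]
    · simp
  · rw [Finset.sum_eq_single i]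
    · simp only [wt, Sum.elim_inr, pair_neg, neg_smul, pd_cf]; simp
    · intro j _ hj; simp [Ne.symm hj]
    · simp

/-- `f` is homogeneous of `T^m`-weight `w`. -/
def HasWt (w : Fin m → ℤ) (f : Fun E) : Prop :=
  (∀ t, scale E (tscale b t) f = ((chi w t : ℂˣ) : ℂ) • f) ∧
    ∀ ξ, brk E (mom E b ξ) f = pair w ξ • f

theorem HasWt.mul {w w' : Fin m → ℤ} {f g : Fun E} (hf : HasWt E b w f) (hg : HasWt E b w' g) :
    HasWt E b (w + w') (f * g) := by
  constructor
  · intro t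
    rw [map_mul, hf.1, hg.1, chi_add, smul_mul_smul_comm, Units.val_mul]
  · intro ξ
    rw [brk_mom_mul, hf.2, hg.2, pair_add, add_smul, mul_smul_comm, mul_smul_comm, mul_comm g f,
      add_comm]

theorem HasWt.one : HasWt E b 0 (1 : Fun E) := by
  constructor
  · intro t; simp [chi]
  · intro ξ; simp [brk_mom, pair]

theorem HasWt.cf (c : Coord ι) : HasWt E b (wt b c) (cf E c) :=
  ⟨fun t => by simp [tscale], fun ξ => brk_mom_cf E b ξ c⟩

theorem exists_hasWt_mulSet (s : mulSet E) :
    ∃ w, HasWt E b w (algebraMap _ (Fun E) (s : MvPolynomial (Coord ι) ℂ)) := by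
  obtain ⟨y, hy⟩ := s
  induction hy using Submonoid.closure_induction with
  | mem x hx => obtain ⟨c, hc, rfl⟩ := hx; exact ⟨_, HasWt.cf E b c⟩
  | one => exact ⟨0, by simpa using HasWt.one E b⟩
  | mul x y _ _ hx hy =>
    obtain ⟨w, hw⟩ := hx
    obtain ⟨w', hw'⟩ := hy
    exact ⟨w + w', by simpa using hw.mul E b hw'⟩

theorem exists_hasWt_monomial (d : Coord ι →₀ ℕ) :
    ∃ w, HasWt E b w (algebraMap _ (Fun E) (MvPolynomial.monomial d (1 : ℂ))) := by
  induction d using Finsupp.induction with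
  | zero => exact ⟨0, by simpa using HasWt.one E b⟩
  | single_add c k d _ _ ih =>
    obtain ⟨w, hw⟩ := ih
    have h : ∀ k : ℕ, ∃ w, HasWt E b w
        (algebraMap _ (Fun E) (MvPolynomial.monomial (Finsupp.single c k) (1 : ℂ))) := by
      intro k
      induction k with
      | zero => exact ⟨0, by simpa using HasWt.one E b⟩
      | succ k ih =>
        obtain ⟨w, hw⟩ := ih
        refine ⟨w + wt b c, ?_⟩
        have := hw.mul E b (HasWt.cf E b c)
        rwa [Hypertoric.cf, ← map_mul, MvPolynomial.X, MvPolynomial.monomial_mul, mul_one,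
          ← Finsupp.single_add] at this
    obtain ⟨w', hw'⟩ := h k
    refine ⟨w' + w, ?_⟩
    have := hw'.mul E b hw
    rwa [← map_mul, MvPolynomial.monomial_mul, mul_one] at this

open Classical in
theorem brk_mom_inv {H : Subgroup (Torus m)} {ξ : Fin m → ℂ} (hξ : ξ ∈ lie H) {f : Fun E}
    (hf : f ∈ invSub E b H) : brk E (mom E b ξ) f = 0 := by
  obtain ⟨⟨g, s⟩, h⟩ := IsLocalization.surj (mulSet E) f
  obtain ⟨w, hw⟩ := exists_hasWt_mulSet E b s
  choose u hu using exists_hasWt_monomial E b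
  simp only at h
  have hinj : Function.Injective (algebraMap (MvPolynomial (Coord ι) ℂ) (Fun E)) :=
    IsLocalization.injective _ (mulSet_le E)
  let L : MvPolynomial (Coord ι) ℂ →ₐ[ℂ] Fun E := IsScalarTower.toAlgHom ℂ _ _
  have hL : ∀ p, L p = algebraMap _ (Fun E) p := fun _ => rfl
  have hg : (algebraMap _ (Fun E) g) =
      ∑ d ∈ g.support, g.coeff d • algebraMap _ (Fun E) (MvPolynomial.monomial d (1 : ℂ)) := by
    conv_lhs => rw [g.as_sum, map_sum]
    refine Finset.sum_congr rfl fun d _ => ?_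
    rw [← hL, ← hL, ← map_smul, MvPolynomial.smul_monomial, smul_eq_mul, mul_one]
  have key : ∀ d ∈ g.support, pair (u d) ξ = pair w ξ := by
    intro d hd
    have h0 : pair (u d + -w) ξ = 0 := by
      apply hξ
      intro t ht
      have h1 : scale E (tscale b t) (algebraMap _ (Fun E) g) =
          ((chi w t : ℂˣ) : ℂ) • algebraMap _ (Fun E) g := by
        rw [← h, map_mul, hf t ht, hw.1, mul_smul_comm]
      have h2 : L (∑ d ∈ g.support, (g.coeff d * (((chi (u d) t : ℂˣ) : ℂ) -
          ((chi w t : ℂˣ) : ℂ))) • MvPolynomial.monomial d (1 : ℂ)) = 0 := by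
        rw [hg, map_sum, Finset.smul_sum, ← sub_eq_zero, ← Finset.sum_sub_distrib] at h1
        rw [map_sum, ← h1]
        refine Finset.sum_congr rfl fun d _ => ?_
        rw [map_smul, map_smul, hL, (hu d).1, smul_smul, smul_smul, ← sub_smul]
        congr 1
        ring
      have h3 := congrArg (MvPolynomial.coeff d) (hinj (h2.trans (map_zero _).symm))
      rw [MvPolynomial.coeff_sum, MvPolynomial.coeff_zero, Finset.sum_eq_single d
        (fun d' _ hd' => by
          rw [MvPolynomial.coeff_smul, MvPolynomial.coeff_monomial, if_neg hd', smul_zero])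
        (fun h => absurd hd h), MvPolynomial.coeff_smul, MvPolynomial.coeff_monomial, if_pos rfl,
        smul_eq_mul, mul_one] at h3
      have h4 : chi (u d) t = chi w t := by
        rcases mul_eq_zero.mp h3 with h3 | h3
        · exact absurd h3 (MvPolynomial.mem_support_iff.mp hd)
        · exact Units.ext (sub_eq_zero.mp h3)
      rw [chi_add, chi_neg, h4, mul_inv_cancel]
    rw [pair_add, pair_neg] at h0
    linear_combination h0
  have h2 : brk E (mom E b ξ) (algebraMap _ (Fun E) g) = pair w ξ • algebraMap _ (Fun E) g := by
    rw [hg, map_sum, Finset.smul_sum]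
    refine Finset.sum_congr rfl fun d hd => ?_
    rw [map_smul, (hu d).2, key d hd, smul_comm]
  rw [← h, brk_mom_mul, hw.2, mul_smul_comm] at h2
  have h3 : algebraMap _ (Fun E) (s : MvPolynomial (Coord ι) ℂ) * brk E (mom E b ξ) f = 0 := by
    simpa using h2
  exact (IsLocalization.map_units (Fun E) s).mul_right_eq_zero.mp h3

variable (H : Subgroup (Torus m))

/-- The ideal generated by the moment map. -/
def momIdeal : Ideal (Fun E) := Ideal.span (mom E b '' lie H)

/-- The ideal `(μ) ∩ Fun^H` of the algebra of invariants. -/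
def redIdeal : Ideal (invSub E b H) := (momIdeal E b H).comap (invSub E b H).val

/-- The coordinate ring of the Hamiltonian reduction by `H` of the locus `{c ≠ 0, c ∈ E}` of
`T^*𝔸^ι`: the ring `(Fun E / (μ))^H = (Fun E)^H / ((μ) ∩ (Fun E)^H)` (the torus `H` is
reductive). -/
def Red : Type := invSub E b H ⧸ redIdeal E b H

instance : CommRing (Red E b H) := inferInstanceAs (CommRing (invSub E b H ⧸ redIdeal E b H))

instance : Algebra ℂ (Red E b H) := inferInstanceAs (Algebra ℂ (invSub E b H ⧸ redIdeal E b H))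

/-- The projection from the invariants to the reduction. -/
def redMk : invSub E b H →ₐ[ℂ] Red E b H := Ideal.Quotient.mkₐ ℂ (redIdeal E b H)

theorem redMk_eq_zero {f : invSub E b H} (hf : (f : Fun E) ∈ momIdeal E b H) : redMk E b H f = 0 :=
  Ideal.Quotient.eq_zero_iff_mem.mpr hf

theorem brk_mem_inv {f g : Fun E} (hf : f ∈ invSub E b H) (hg : g ∈ invSub E b H) :
    brk E f g ∈ invSub E b H := by
  intro t ht
  rw [← brk_scale, hf t ht, hg t ht]
  intro i
  simp [tscale, wt, chi_neg]

theorem brk_mem_momIdeal {f g : Fun E} (hf : f ∈ momIdeal E b H) (hg : g ∈ invSub E b H) :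
    brk E f g ∈ momIdeal E b H := by
  induction hf using Submodule.span_induction with
  | mem x hx =>
    obtain ⟨ξ, hξ, rfl⟩ := hx
    rw [brk_mom_inv E b hξ hg]
    exact zero_mem _
  | zero => simp
  | add x y _ _ hx hy => rw [map_add]; exact add_mem hx hy
  | smul a x hx h =>
    rw [smul_eq_mul, brk_mul_left]
    exact add_mem (Ideal.mul_mem_left _ _ h) (Ideal.mul_mem_right _ _ hx)

/-- The Poisson bracket of invariant functions. -/
def invBrk : invSub E b H →ₗ[ℂ] invSub E b H →ₗ[ℂ] invSub E b H :=
  LinearMap.mk₂ ℂ (fun f g => ⟨brk E f g, brk_mem_inv E b H f.2 g.2⟩)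
    (fun _ _ _ => Subtype.ext (by simp)) (fun _ _ _ => Subtype.ext (by simp))
    (fun _ _ _ => Subtype.ext (by simp)) (fun _ _ _ => Subtype.ext (by simp))

/-- The reduced Poisson bracket: `{[f], [g]} = [{f, g}]` for invariant `f` and `g`. -/
def redBrk : Red E b H →ₗ[ℂ] Red E b H →ₗ[ℂ] Red E b H :=
  LinearMap.liftQ₂ ((redIdeal E b H).restrictScalars ℂ) ((redIdeal E b H).restrictScalars ℂ)
    ((invBrk E b H).compr₂ (redMk E b H).toLinearMap)
    (fun f hf => LinearMap.ext fun g =>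
      redMk_eq_zero E b H (brk_mem_momIdeal E b H hf g.2))
    (fun g hg => LinearMap.ext fun f => by
      refine redMk_eq_zero E b H ?_
      change brk E (f : Fun E) (g : Fun E) ∈ momIdeal E b H
      rw [brk_swap]
      exact neg_mem (brk_mem_momIdeal E b H hg f.2))

theorem redBrk_mk (f g : invSub E b H) :
    redBrk E b H (redMk E b H f) (redMk E b H g) = redMk E b H (invBrk E b H f g) := rfl

/-- The elements of degree `N` of the reduction, for the grading in which the coordinate `c` has
degree `δ c`: the classes of the invariants `f` with `λ · f = λ^N f` for all `λ ∈ ℂ^×`. -/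
def redGr (δ : Coord ι → ℤ) (N : ℤ) : Submodule ℂ (Red E b H) :=
  Submodule.map (redMk E b H).toLinearMap
    { carrier := {f | ∀ l : ℂˣ, scale E (fun c => l ^ δ c) (f : Fun E) =
        ((l ^ N : ℂˣ) : ℂ) • (f : Fun E)}
      add_mem' := fun hf hg l => by simp [hf l, hg l]
      zero_mem' := fun l => by simp
      smul_mem' := fun a f hf l => by
        change scale E _ (a • (f : Fun E)) = _ • (a • (f : Fun E))
        rw [map_smul, hf l, smul_comm] }

end Classical

/-! ## Quantum Hamiltonian reduction -/

/-- The ring `ℂ[[ħ]]`, with `ħ = PowerSeries.X`. -/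
abbrev Ch : Type := PowerSeries ℂ

/-- The element `ħ` of a `ℂ[[ħ]]`-algebra. -/
def hbar (A : Type*) [Ring A] [Algebra Ch A] : A := algebraMap Ch A PowerSeries.X

/-- A ring homomorphism `p` from a `ℂ[[ħ]]`-algebra to a `ℂ`-algebra is `ℂ`-linear and sends
`ħ` to zero. -/
def IsSpec {A O : Type*} [Ring A] [Algebra Ch A] [CommRing O] [Algebra ℂ O] (p : A →+* O) : Prop :=
  ∀ f : Ch, p (algebraMap Ch A f) = algebraMap ℂ O (PowerSeries.constantCoeff f)

/-- The `ℂ[[ħ]]`-algebra structure on a `ℂ`-algebra in which `ħ` acts by zero. -/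
abbrev specAlgebra (O : Type*) [CommRing O] [Algebra ℂ O] : Algebra Ch O :=
  ((algebraMap ℂ O).comp PowerSeries.constantCoeff).toAlgebra

section Quantum

variable {ι : Type} [DecidableEq ι] (E : Set (Coord ι))

/-- Generators: the coordinates, and inverses of the coordinates in `E`. -/
inductive Gen : Type
  | coord (c : Coord ι) : Gen
  | inv (c : Coord ι) (hc : c ∈ E) : Gen

/-- The commutation relations `[c, c'] = ω(c, c') ħ`, and the relations saying that `inv c` is
inverse to `c`. -/
inductive Rel : FreeAlgebra Ch (Gen E) → FreeAlgebra Ch (Gen E) → Prop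
  | comm (c c' : Coord ι) : Rel
      (FreeAlgebra.ι Ch (Gen.coord c) * FreeAlgebra.ι Ch (Gen.coord c'))
      (FreeAlgebra.ι Ch (Gen.coord c') * FreeAlgebra.ι Ch (Gen.coord c) +
        omega c c' • hbar (FreeAlgebra Ch (Gen E)))
  | mul_inv (c : Coord ι) (hc : c ∈ E) : Rel
      (FreeAlgebra.ι Ch (Gen.coord c) * FreeAlgebra.ι Ch (Gen.inv c hc)) 1
  | inv_mul (c : Coord ι) (hc : c ∈ E) : Rel
      (FreeAlgebra.ι Ch (Gen.inv c hc) * FreeAlgebra.ι Ch (Gen.coord c)) 1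

/-- The algebra `𝒟_ħ(𝔸^ι)[c⁻¹, c ∈ E]`: the homogenized algebra of differential operators, over
`ℂ[[ħ]]`, generated by `xᵢ` and `yᵢ = ħ ∂/∂xᵢ`, localized at the coordinates in `E`. -/
def Weyl : Type := RingQuot (Rel E)

instance : Ring (Weyl E) := inferInstanceAs (Ring (RingQuot (Rel E)))

instance : Algebra Ch (Weyl E) := inferInstanceAs (Algebra Ch (RingQuot (Rel E)))

/-- The projection from the free algebra. -/
def toWeyl : FreeAlgebra Ch (Gen E) →ₐ[Ch] Weyl E := RingQuot.mkAlgHom Ch (Rel E)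

theorem toWeyl_rel {a a' : FreeAlgebra Ch (Gen E)} (h : Rel E a a') : toWeyl E a = toWeyl E a' :=
  RingQuot.mkAlgHom_rel Ch h

/-- The images of the generators. -/
def gen (g : Gen E) : Weyl E := toWeyl E (FreeAlgebra.ι Ch g)

/-- A coordinate as an element of `Weyl E`. -/
def qc (c : Coord ι) : Weyl E := gen E (Gen.coord c)

/-- The algebra homomorphism out of `Weyl E` with given values on the generators. -/
def liftWeyl {B : Type*} [Ring B] [Algebra Ch B] (g : Gen E → B)
    (hcomm : ∀ c c', g (Gen.coord c) * g (Gen.coord c') =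
      g (Gen.coord c') * g (Gen.coord c) + omega c c' • hbar B)
    (hmi : ∀ c hc, g (Gen.coord c) * g (Gen.inv c hc) = 1)
    (him : ∀ c hc, g (Gen.inv c hc) * g (Gen.coord c) = 1) : Weyl E →ₐ[Ch] B :=
  RingQuot.liftAlgHom Ch ⟨FreeAlgebra.lift Ch g, by
    rintro _ _ (⟨c, c'⟩ | ⟨c, hc⟩ | ⟨c, hc⟩)
    · simpa [hbar] using hcomm c c'
    · simpa using hmi c hc
    · simpa using him c hc⟩

@[simp] theorem liftWeyl_gen {B : Type*} [Ring B] [Algebra Ch B] (g : Gen E → B) (h1) (h2) (h3)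
    (a : Gen E) : liftWeyl E g h1 h2 h3 (gen E a) = g a :=
  (RingQuot.liftAlgHom_mkAlgHom_apply Ch _ _ _).trans (FreeAlgebra.lift_ι_apply g a)

theorem algHom_ext_weyl {B : Type*} [Ring B] [Algebra Ch B] {f g : Weyl E →ₐ[Ch] B}
    (h : ∀ a, f (gen E a) = g (gen E a)) : f = g := by
  apply RingQuot.ringQuot_ext' Ch
  apply FreeAlgebra.hom_ext
  funext a
  exact h a

theorem gen_comm (c c' : Coord ι) : gen E (Gen.coord c) * gen E (Gen.coord c') =
    gen E (Gen.coord c') * gen E (Gen.coord c) + omega c c' • hbar (Weyl E) := by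
  have := toWeyl_rel E (Rel.comm (E := E) c c')
  simpa [gen, hbar] using this

theorem gen_mul_inv (c : Coord ι) (hc : c ∈ E) :
    gen E (Gen.coord c) * gen E (Gen.inv c hc) = 1 := by
  have := toWeyl_rel E (Rel.mul_inv (E := E) c hc)
  simpa [gen] using this

theorem gen_inv_mul (c : Coord ι) (hc : c ∈ E) :
    gen E (Gen.inv c hc) * gen E (Gen.coord c) = 1 := by
  have := toWeyl_rel E (Rel.inv_mul (E := E) c hc)
  simpa [gen] using this

/-- The principal symbol map `Weyl E → Fun E`, which sets `ħ = 0`. -/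
def symb : Weyl E →+* Fun E :=
  letI := specAlgebra (Fun E)
  (liftWeyl E (fun
      | Gen.coord c => cf E c
      | Gen.inv _ hc => ((isUnit_cf hc).unit⁻¹ : (Fun E)ˣ))
    (fun c c' => by
      have : hbar (Fun E) = 0 := by
        change (algebraMap ℂ (Fun E)) (PowerSeries.constantCoeff PowerSeries.X) = 0
        simp
      rw [this, smul_zero, add_zero, mul_comm])
    (fun c hc => (isUnit_cf hc).mul_val_inv)
    (fun c hc => (isUnit_cf hc).val_inv_mul)).toRingHom

theorem isSpec_symb : IsSpec (symb E) := fun f =>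
  letI := specAlgebra (Fun E)
  AlgHom.commutes (liftWeyl E _ _ _ _) f

@[simp] theorem symb_qc (c : Coord ι) : symb E (qc E c) = cf E c :=
  letI := specAlgebra (Fun E)
  liftWeyl_gen E _ _ _ _ (Gen.coord c)

theorem symb_inv (c : Coord ι) (hc : c ∈ E) :
    symb E (gen E (Gen.inv c hc)) = ((isUnit_cf hc).unit⁻¹ : (Fun E)ˣ) :=
  letI := specAlgebra (Fun E)
  liftWeyl_gen E _ _ _ _ (Gen.inv c hc)

/-- The elements of degree `N`, where the coordinate `c` has degree `δ c` and `ħ` has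
degree `2`. -/
inductive IsHomog (δ : Coord ι → ℤ) : ℤ → Weyl E → Prop
  | zero (N : ℤ) : IsHomog δ N 0
  | const (a : ℂ) : IsHomog δ 0 (algebraMap Ch (Weyl E) (PowerSeries.C a))
  | hbar : IsHomog δ 2 (hbar (Weyl E))
  | coord (c : Coord ι) : IsHomog δ (δ c) (gen E (Gen.coord c))
  | inv (c : Coord ι) (hc : c ∈ E) : IsHomog δ (-δ c) (gen E (Gen.inv c hc))
  | add {N : ℤ} {d d' : Weyl E} : IsHomog δ N d → IsHomog δ N d' → IsHomog δ N (d + d')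
  | mul {N N' : ℤ} {d d' : Weyl E} : IsHomog δ N d → IsHomog δ N' d' → IsHomog δ (N + N') (d * d')

variable {m : ℕ} (b : ι → Fin m → ℤ)

/-- The action of `t ∈ T^m` on `Weyl E` by algebra automorphisms rescaling the generators. -/
def qact (t : Torus m) : Weyl E →ₐ[Ch] Weyl E :=
  liftWeyl E (fun
      | Gen.coord c => (PowerSeries.C ((tscale b t c : ℂˣ) : ℂ) : Ch) • gen E (Gen.coord c)
      | Gen.inv c hc =>
        (PowerSeries.C (((tscale b t c)⁻¹ : ℂˣ) : ℂ) : Ch) • gen E (Gen.inv c hc))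
    (fun c c' => by
      have h : omega c c' = 0 ∨ tscale b t c * tscale b t c' = 1 := by
        rcases c with i | i <;> rcases c' with j | j
        · left; rfl
        · by_cases h : i = j
          · right; subst h; simp [tscale, wt, chi_neg]
          · left; simp [omega, h]
        · by_cases h : i = j
          · right; subst h; simp [tscale, wt, chi_neg]
          · left; simp [omega, h]
        · left; rfl
      rcases h with h | h
      · rw [h, zero_smul, add_zero, smul_mul_smul_comm, smul_mul_smul_comm, gen_comm, h, zero_smul,
          add_zero, mul_comm]
      · rw [smul_mul_smul_comm, smul_mul_smul_comm, mul_comm (PowerSeries.C _) (PowerSeries.C _),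
          ← map_mul, ← Units.val_mul, mul_comm (tscale b t c'), h]
        simpa using gen_comm E c c')
    (fun c hc => by
      rw [smul_mul_smul_comm, gen_mul_inv, ← map_mul, ← Units.val_mul, mul_inv_cancel]; simp)
    (fun c hc => by
      rw [smul_mul_smul_comm, gen_inv_mul, ← map_mul, ← Units.val_mul, inv_mul_cancel]; simp)

theorem symb_qact (t : Torus m) (d : Weyl E) :
    symb E (qact E b t d) = scale E (tscale b t) (symb E d) := by
  let _ := specAlgebra (Fun E)
  let f : Weyl E →ₐ[Ch] Fun E := { (symb E).comp (qact E b t).toRingHom with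
    commutes' := fun r => by
      change symb E (qact E b t (algebraMap Ch _ r)) = _
      rw [AlgHom.commutes, isSpec_symb]; rfl }
  let g : Weyl E →ₐ[Ch] Fun E := { (scale E (tscale b t)).toRingHom.comp (symb E) with
    commutes' := fun r => by
      change scale E (tscale b t) (symb E (algebraMap Ch _ r)) = _
      rw [isSpec_symb, AlgHom.commutes]; rfl }
  have hC : ∀ (a : ℂ) (d : Weyl E), symb E ((PowerSeries.C a : Ch) • d) = a • symb E d := by
    intro a d
    rw [Algebra.smul_def, map_mul, isSpec_symb, Algebra.smul_def]; simp
  have : f = g := by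
    apply algHom_ext_weyl
    rintro (c | ⟨c, hc⟩)
    · change symb E (qact E b t (qc E c)) = scale E (tscale b t) (symb E (qc E c))
      rw [symb_qc, scale_cf, qact, qc, liftWeyl_gen, hC]
      exact congrArg _ (symb_qc E c)
    · change symb E (qact E b t (gen E (Gen.inv c hc))) =
        scale E (tscale b t) (symb E (gen E (Gen.inv c hc)))
      have h0 : symb E (qc E c) * symb E (gen E (Gen.inv c hc)) = 1 := by
        rw [← map_mul, qc, gen_mul_inv, map_one]
      have h1 : scale E (tscale b t) (symb E (qc E c)) *
          scale E (tscale b t) (symb E (gen E (Gen.inv c hc))) = 1 := by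
        rw [← map_mul, h0, map_one]
      have h2 : scale E (tscale b t) (symb E (qc E c)) *
          symb E (qact E b t (gen E (Gen.inv c hc))) = 1 := by
        rw [symb_qc, scale_cf, qact, liftWeyl_gen, hC, smul_mul_smul_comm, ← symb_qc, h0,
          ← Units.val_mul, mul_inv_cancel, Units.val_one, one_smul]
      exact (IsUnit.of_mul_eq_one _ h1).mul_left_cancel (h2.trans h1.symm)
  exact congrArg (fun k => k d) this

variable (H : Subgroup (Torus m))

/-- The algebra of `H`-invariants. -/
def qinv : Subalgebra Ch (Weyl E) where
  carrier := {d | ∀ t ∈ H, qact E b t d = d}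
  mul_mem' hf hg t ht := by rw [map_mul, hf t ht, hg t ht]
  add_mem' hf hg t ht := by rw [map_add, hf t ht, hg t ht]
  algebraMap_mem' a t ht := AlgHom.commutes _ a

variable [Fintype ι]

/-- The quantum comoment map: the vector field by which `ξ` acts on functions on `𝔸^ι`, viewed
as the (homogenized) differential operator `∑ᵢ ⟨bᵢ, ξ⟩ xᵢ yᵢ`. -/
def qmom (ξ : Fin m → ℂ) : Weyl E :=
  ∑ i, (PowerSeries.C (pair (b i) ξ) : Ch) • (qc E (Sum.inl i) * qc E (Sum.inr i))

/-- The right ideal `μ_q(Lie H) · Weyl E`. -/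
def qmomIdeal : Submodule Ch (Weyl E) :=
  Submodule.span Ch {a | ∃ ξ ∈ lie H, ∃ d, a = qmom E b ξ * d}

/-- The relation setting to zero the invariant elements of `μ_q(Lie H) · Weyl E`. -/
inductive RedRel : qinv E b H → qinv E b H → Prop
  | zero (a : qinv E b H) (ha : (a : Weyl E) ∈ qmomIdeal E b H) : RedRel a 0

/-- The quantum Hamiltonian reduction `(Weyl E / μ_q(Lie H) Weyl E)^H`, that is, the quotient
of `(Weyl E)^H` by `(Weyl E)^H ∩ μ_q(Lie H) Weyl E` (the torus `H` is reductive; since `μ_q(ξ)`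
commutes with the invariants, the intersection is a two-sided ideal). -/
def QRed : Type := RingQuot (RedRel E b H)

instance : Ring (QRed E b H) := inferInstanceAs (Ring (RingQuot (RedRel E b H)))

instance : Algebra Ch (QRed E b H) := inferInstanceAs (Algebra Ch (RingQuot (RedRel E b H)))

/-- The projection from the invariants to the quantum Hamiltonian reduction. -/
def qmk : qinv E b H →ₐ[Ch] QRed E b H := RingQuot.mkAlgHom Ch (RedRel E b H)

/-- The elements of degree `N` of the quantum Hamiltonian reduction. -/
def qredGr (δ : Coord ι → ℤ) (N : ℤ) : Set (QRed E b H) :=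
  {a | ∃ d : qinv E b H, IsHomog E δ N (d : Weyl E) ∧ qmk E b H d = a}

theorem symb_qmom (ξ : Fin m → ℂ) : symb E (qmom E b ξ) = mom E b ξ := by
  rw [qmom, map_sum, mom]
  refine Finset.sum_congr rfl fun i _ => ?_
  rw [Algebra.smul_def, map_mul, isSpec_symb, map_mul, symb_qc, symb_qc, Algebra.smul_def]
  simp

theorem symb_mem {a : Weyl E} (ha : a ∈ qmomIdeal E b H) : symb E a ∈ momIdeal E b H := by
  induction ha using Submodule.span_induction with
  | mem x hx =>
    obtain ⟨ξ, hξ, d, rfl⟩ := hx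
    rw [map_mul, symb_qmom]
    exact Ideal.mul_mem_right _ _ (Ideal.subset_span ⟨ξ, hξ, rfl⟩)
  | zero => rw [map_zero]; exact zero_mem _
  | add x y _ _ hx hy => rw [map_add]; exact add_mem hx hy
  | smul a x _ hx =>
    rw [Algebra.smul_def, map_mul]
    exact Ideal.mul_mem_left _ _ hx

/-- The map from the invariants to the classical reduction which sets `ħ = 0`. -/
def symbInv : qinv E b H →+* Red E b H :=
  (redMk E b H).toRingHom.comp
    (((symb E).comp (qinv E b H).val.toRingHom).codRestrict (invSub E b H) fun d t ht => by
      change scale E (tscale b t) (symb E (d : Weyl E)) = symb E (d : Weyl E)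
      rw [← symb_qact, d.2 t ht])

/-- The map from the quantum to the classical Hamiltonian reduction which sets `ħ = 0`. -/
def symbRed : QRed E b H →+* Red E b H :=
  RingQuot.lift ⟨symbInv E b H, by
    rintro a _ ⟨ha⟩
    rw [map_zero]
    exact redMk_eq_zero E b H (symb_mem E b H ha)⟩

theorem symbRed_qmk (d : qinv E b H) : symbRed E b H (qmk E b H d) = symbInv E b H d := by
  have : qmk E b H d = RingQuot.mkRingHom (RedRel E b H) d := by
    rw [qmk, ← RingQuot.mkAlgHom_coe Ch]; rfl
  rw [this]
  exact RingQuot.lift_mkRingHom_apply _ _ _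

theorem isSpec_symbRed : IsSpec (symbRed E b H) := by
  intro f
  rw [← AlgHom.commutes (qmk E b H), symbRed_qmk]
  rw [← AlgHom.commutes (redMk E b H)]
  exact congrArg (redMk E b H) (Subtype.ext (isSpec_symb E f))

end Quantum

/-! ## `ħ`-adic completion -/

section Completion

variable (A : Type*) [Ring A] [Algebra Ch A]

/-- The two-sided ideal `ħ^k A`. -/
def hIdeal (k : ℕ) : Ideal A := Ideal.span {hbar A ^ k}

instance (k : ℕ) : (hIdeal A k).IsTwoSided := ⟨fun {a} c ha => by
  obtain ⟨r, rfl⟩ := Ideal.mem_span_singleton'.mp ha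
  refine Ideal.mem_span_singleton'.mpr ⟨r * c, ?_⟩
  have h : hbar A ^ k = algebraMap Ch A (PowerSeries.X ^ k) := by rw [map_pow]; rfl
  rw [h, mul_assoc, mul_assoc, Algebra.commutes]⟩

theorem hIdeal_succ_le (k : ℕ) : hIdeal A (k + 1) ≤ hIdeal A k := by
  rw [hIdeal, Ideal.span_le, Set.singleton_subset_iff, pow_succ']
  exact Ideal.mul_mem_left _ _ (Ideal.subset_span rfl)

/-- The quotient `A / ħ^k A`. -/
abbrev Lvl (k : ℕ) : Type _ := A ⧸ hIdeal A k

/-- The `ħ`-adic completion of `A`, the limit of the algebras `A / ħ^k A`. -/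
def complSub : Subalgebra Ch (∀ k, Lvl A k) where
  carrier := {f | ∀ k, Ideal.Quotient.factor (hIdeal_succ_le A k) (f (k + 1)) = f k}
  mul_mem' hf hg k := by simp [hf k, hg k]
  add_mem' hf hg k := by simp [hf k, hg k]
  algebraMap_mem' _ _ := rfl

/-- The `ħ`-adic completion of `A`, as a `ℂ[[ħ]]`-algebra. -/
def Compl : Type _ := complSub A

instance : Ring (Compl A) := inferInstanceAs (Ring (complSub A))

instance : Algebra Ch (Compl A) := inferInstanceAs (Algebra Ch (complSub A))

/-- The component of an element of the completion in `A / ħ^k A`. -/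
def complEval (k : ℕ) : Compl A →ₐ[Ch] Lvl A k :=
  (Pi.evalAlgHom Ch (fun k => Lvl A k) k).comp (complSub A).val

variable {A}

/-- The elements of degree `N` of the completion of a graded algebra: those with degree `N`
modulo `ħ^k` for all `k`. -/
def complGr (gr : ℤ → Set A) (N : ℤ) : Set (Compl A) :=
  {f | ∀ k, ∃ a ∈ gr N, Ideal.Quotient.mk (hIdeal A k) a = complEval A k f}

/-- A homomorphism which sets `ħ` to zero factors through the completion. -/
def complSpec {O : Type*} [CommRing O] [Algebra ℂ O] (p : A →+* O) (hp : IsSpec p) :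
    Compl A →+* O :=
  (Ideal.Quotient.lift (hIdeal A 1) p fun a ha => by
    obtain ⟨r, rfl⟩ := Ideal.mem_span_singleton'.mp ha
    rw [map_mul, pow_one, hbar, hp]; simp).comp
  (complEval A 1).toRingHom

theorem isSpec_complSpec {O : Type*} [CommRing O] [Algebra ℂ O] (p : A →+* O) (hp : IsSpec p) :
    IsSpec (complSpec p hp) := fun f => hp f

end Completion

/-! ## Tensor products -/

section Tensor

variable {A B : Type*} [Ring A] [Algebra Ch A] [Ring B] [Algebra Ch B]
variable {O O' : Type*} [CommRing O] [Algebra ℂ O] [CommRing O'] [Algebra ℂ O']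

/-- The grading of a tensor product of graded algebras. -/
def tensGr (gA : ℤ → Set A) (gB : ℤ → Set B) (N : ℤ) : Set (A ⊗[Ch] B) :=
  AddSubgroup.closure {x | ∃ i j, i + j = N ∧ ∃ a ∈ gA i, ∃ b ∈ gB j, x = a ⊗ₜ[Ch] b}

/-- The grading of a tensor product of graded commutative algebras. -/
def tensRedGr (gO : ℤ → Submodule ℂ O) (gO' : ℤ → Submodule ℂ O') (N : ℤ) :
    Submodule ℂ (O ⊗[ℂ] O') :=
  Submodule.span ℂ {x | ∃ i j, i + j = N ∧ ∃ a ∈ gO i, ∃ b ∈ gO' j, x = a ⊗ₜ[ℂ] b}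

/-- The product Poisson bracket
`{a ⊗ a', b ⊗ b'} = {a, b} ⊗ a' b' + a b ⊗ {a', b'}`. -/
def tensBrk (P : O →ₗ[ℂ] O →ₗ[ℂ] O) (P' : O' →ₗ[ℂ] O' →ₗ[ℂ] O') :
    O ⊗[ℂ] O' →ₗ[ℂ] O ⊗[ℂ] O' →ₗ[ℂ] O ⊗[ℂ] O' :=
  TensorProduct.map₂ P (LinearMap.mul ℂ O') + TensorProduct.map₂ (LinearMap.mul ℂ O) P'

/-- The map `a ⊗ b ↦ p(a) ⊗ q(b)`. -/
def tensSpec (p : A →+* O) (hp : IsSpec p) (q : B →+* O') (hq : IsSpec q) :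
    A ⊗[Ch] B →+* O ⊗[ℂ] O' :=
  letI := specAlgebra (O ⊗[ℂ] O')
  (Algebra.TensorProduct.lift (R := Ch) (S := Ch)
    ({ (Algebra.TensorProduct.includeLeftRingHom (R := ℂ) (A := O) (B := O')).comp p with
        commutes' := fun f => by
          change p (algebraMap Ch A f) ⊗ₜ[ℂ] (1 : O') = _
          rw [hp]; rfl } : A →ₐ[Ch] O ⊗[ℂ] O')
    ({ ((Algebra.TensorProduct.includeRight (R := ℂ) (A := O) (B := O')).toRingHom).comp q with
        commutes' := fun f => by
          change (1 : O) ⊗ₜ[ℂ] q (algebraMap Ch B f) = _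
          rw [hq, ← Algebra.TensorProduct.algebraMap_apply']; rfl } : B →ₐ[Ch] O ⊗[ℂ] O')
    (fun _ _ => mul_comm _ _)).toRingHom

theorem tensSpec_tmul (p : A →+* O) (hp : IsSpec p) (q : B →+* O') (hq : IsSpec q) (a : A)
    (b : B) : tensSpec p hp q hq (a ⊗ₜ b) = p a ⊗ₜ q b := by
  change (p a ⊗ₜ[ℂ] (1 : O')) * ((1 : O) ⊗ₜ[ℂ] q b) = _
  simp

theorem isSpec_tensSpec (p : A →+* O) (hp : IsSpec p) (q : B →+* O') (hq : IsSpec q) :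
    IsSpec (tensSpec p hp q hq) := by
  intro f
  rw [Algebra.TensorProduct.algebraMap_apply, tensSpec_tmul, hp, map_one]
  rfl

end Tensor

/-! ## Graded deformation quantizations -/

/-- `A`, with the projection `pr : A → O` and the Euler derivation `Eu`, is a
`ℂ^×`-compatible deformation quantization of the Poisson algebra `O` with bracket `P`, graded by
the subspaces `grO N`, where `ħ` has degree `k`. -/
structure IsGradedQuantization {A O : Type*} [Ring A] [Algebra Ch A] [CommRing O] [Algebra ℂ O]
    (P : O →ₗ[ℂ] O →ₗ[ℂ] O) (grO : ℤ → Submodule ℂ O) (k : ℤ) (pr : A →+* O) (Eu : A →+ A) :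
    Prop where
  /-- `pr` is a homomorphism of `ℂ[[ħ]]`-algebras, where `ħ` acts by zero on `O`. -/
  spec : IsSpec pr
  surjective : Function.Surjective pr
  ker : ∀ a, pr a = 0 ↔ ∃ a', a = hbar A * a'
  /-- `A ≅ O[[ħ]]` as `ℂ[[ħ]]`-modules. -/
  free : Nonempty (A ≃ₗ[Ch] PowerSeries O)
  /-- `[a, b] ≡ ħ c` modulo `ħ²` for every lift `c` of `{pr a, pr b}`. -/
  commutator : ∀ a b c : A, pr c = P (pr a) (pr b) →
    ∃ d, a * b - b * a = hbar A * c + hbar A ^ 2 * d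
  leibniz : ∀ a b, Eu (a * b) = Eu a * b + a * Eu b
  /-- `Eu` is `ℂ`-linear, continuous, and `Eu ħ = k ħ`; so it is `k ħ d/dħ` on `ℂ[[ħ]]`. -/
  smul : ∀ (f : Ch) (a : A),
    Eu (f • a) = f • Eu a + (k • (PowerSeries.X * PowerSeries.derivative ℂ f)) • a
  /-- `Eu` induces the Euler derivation of `O`. -/
  euler : ∀ N a, pr a ∈ grO N → pr (Eu a) = N • pr a

/-! ## Hypertoric cones -/

section Hypertoric

variable {n m : ℕ} (b : Fin n → Fin m → ℤ)

/-- `T^m` acts faithfully on `𝔸^n`, where `xᵢ` has weight `bᵢ`. -/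
def Faithful : Prop := Function.Injective fun (t : Torus m) (i : Fin n) => chi (b i) t

/-- All `m × m` minors of the matrix of weights are `0` or `±1`. -/
def Unimodular : Prop := ∀ f : Fin m → Fin n,
  (Matrix.of fun k j => b (f k) j).det = 0 ∨ (Matrix.of fun k j => b (f k) j).det = 1 ∨
    (Matrix.of fun k j => b (f k) j).det = -1

/-- `p ∈ T^*𝔸^n` lies on the zero fibre of the moment map. -/
def InZeroFibre (p : Coord (Fin n) → ℂ) : Prop :=
  ∀ j, ∑ i, (b i j : ℂ) * (p (Sum.inl i) * p (Sum.inr i)) = 0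

/-- The `T^m`-orbit of `p` is closed (for orbits, Zariski closed is the same as closed). The
points of `X = μ⁻¹(0) // T^m` are the closed orbits in `μ⁻¹(0)`. -/
def ClosedOrbit (p : Coord (Fin n) → ℂ) : Prop :=
  IsClosed (Set.range fun (t : Torus m) (c : Coord (Fin n)) => ((chi (wt b c) t : ℂˣ) : ℂ) * p c)

/-- The stabilizer `T̂` of `p` in `T^m`. -/
def stab (p : Coord (Fin n) → ℂ) : Subgroup (Torus m) where
  carrier := {t | ∀ c, ((chi (wt b c) t : ℂˣ) : ℂ) * p c = p c}
  mul_mem' := fun {s t} hs ht c => by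
    rw [map_mul, Units.val_mul, mul_assoc, ht c, hs c]
  one_mem' c := by simp
  inv_mem' := fun {t} ht c => by
    rw [map_inv, Units.inv_mul_eq_iff_eq_mul, ht c]

open Classical in
/-- The set `F` of those `i` for which `T̂` acts nontrivially on the coordinate `xᵢ`. -/
def nontriv (p : Coord (Fin n) → ℂ) : Finset (Fin n) :=
  Finset.univ.filter fun i => ∃ t ∈ stab b p, chi (b i) t ≠ 1

/-- A set `E` of coordinates, and a one-parameter subgroup `e` of `T^m`, defining a
neighbourhood `X°` of the image `z ∈ X` of `p` adapted to the slice. -/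
structure IsChart (p : Coord (Fin n) → ℂ) (E : Set (Coord (Fin n))) (e : Fin m → ℤ) : Prop where
  /-- The coordinates in `E` do not vanish at `p`. -/
  ne_zero : ∀ c ∈ E, p c ≠ 0
  /-- The locus where all coordinates in `E` are nonzero is the locus where some `T^m`-invariant
  monomial is nonzero. Hence its intersection with `μ⁻¹(0)` is the preimage of a principal open
  subset `X°` of `X`. -/
  invariant : ∃ k : Coord (Fin n) → ℕ, (∀ c, k c ≠ 0 ↔ c ∈ E) ∧ ∑ c, (k c : ℤ) • wt b c = 0
  /-- There is a set `G` of `dim T` indices, such that `T = T^m / T̂` acts faithfully on `𝔸^G`,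
  for which exactly one of `xᵢ`, `yᵢ` is in `E`, for each `i ∈ G`. These coordinates have weight
  one for the one-parameter subgroup `e`. -/
  slice : ∃ G : Finset (Fin n), LinearIndependent ℤ (fun i : G => b i) ∧
    (∀ t, t ∈ stab b p ↔ ∀ i ∈ G, chi (b i) t = 1) ∧
    ∀ i ∈ G, (Sum.inl i ∈ E ∧ Sum.inr i ∉ E ∧ ipair (b i) e = 1) ∨
      (Sum.inr i ∈ E ∧ Sum.inl i ∉ E ∧ ipair (-b i) e = 1)

variable (p : Coord (Fin n) → ℂ) (E : Set (Coord (Fin n)))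

/-- The weights of `T^m` on `𝔸^{F^c}`. -/
def bZ : {i // i ∉ nontriv b p} → Fin m → ℤ := fun i => b i

/-- The weights of `T^m` on `𝔸^F`. -/
def bS : {i // i ∈ nontriv b p} → Fin m → ℤ := fun i => b i

/-- The coordinates on `T^*𝔸^{F^c}` which are in `E`. -/
def EZ : Set (Coord {i // i ∉ nontriv b p}) := Sum.map Subtype.val Subtype.val ⁻¹' E

/-- The functions on `X°`, an open subset of `X = T^*𝔸^n //// T^m`. -/
abbrev OX : Type := Red E b ⊤

/-- The functions on `Z°`, an open subset of the closure `T^*𝔸^{F^c} //// T` of the leaf `Z`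
through `z` (`T̂` acts trivially, so the reductions by `T` and by `T^m` are the same). -/
abbrev OZ : Type := Red (EZ b p E) (bZ b p) ⊤

/-- The functions on the slice `S = T^*𝔸^F //// T̂`. -/
abbrev OS : Type := Red (∅ : Set (Coord {i // i ∈ nontriv b p})) (bS b p) (stab b p)

/-- The functions on `Z° × S`. -/
def OZS : Type := OZ b p E ⊗[ℂ] OS b p

instance : CommRing (OZS b p E) := inferInstanceAs (CommRing (OZ b p E ⊗[ℂ] OS b p))

instance : Algebra ℂ (OZS b p E) := inferInstanceAs (Algebra ℂ (OZ b p E ⊗[ℂ] OS b p))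

/-- The quantization of `X°`. -/
abbrev AX : Type := Compl (QRed E b ⊤)

/-- The quantization of `Z°`. -/
abbrev AZ : Type := Compl (QRed (EZ b p E) (bZ b p) ⊤)

/-- The quantization of the slice `S`. -/
abbrev AS : Type := Compl (QRed (∅ : Set (Coord {i // i ∈ nontriv b p})) (bS b p) (stab b p))

/-- The completed tensor product `A_{Z°} ⊗̂ A_S` over `ℂ[[ħ]]`. -/
abbrev AZS : Type := Compl (AZ b p E ⊗[Ch] AS b p)

/-- The degrees of the coordinates under dilation. -/
def dil {ι : Type} : Coord ι → ℤ := fun _ => 1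

/-- The degrees of the coordinates on `T^*𝔸^F` for the slice: the dilation action is corrected by
the one-parameter subgroup `-e` of `T^m`, so as to fix the coordinates in `E` with index in
`G`. -/
def degS (e : Fin m → ℤ) : Coord {i // i ∈ nontriv b p} → ℤ :=
  fun c => 1 - ipair (wt (bS b p) c) e

/-- The projection `A_{X°} → 𝒪(X°)`. -/
def prX : AX b E →+* OX b E := complSpec (symbRed E b ⊤) (isSpec_symbRed E b ⊤)

/-- The projection `A_{Z°} → 𝒪(Z°)`. -/
def prZ : AZ b p E →+* OZ b p E := complSpec (symbRed _ _ ⊤) (isSpec_symbRed _ _ ⊤)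

/-- The projection `A_S → 𝒪(S)`. -/
def prS : AS b p →+* OS b p := complSpec (symbRed _ _ _) (isSpec_symbRed _ _ _)

/-- The projection `A_{Z°} ⊗̂ A_S → 𝒪(Z°) ⊗ 𝒪(S)`. -/
def prZS : AZS b p E →+* OZS b p E :=
  complSpec (tensSpec (prZ b p E) (isSpec_complSpec _ _) (prS b p) (isSpec_complSpec _ _))
    (isSpec_tensSpec _ _ _ _)

/-- The Poisson bracket of `X°`. -/
def brkX : OX b E →ₗ[ℂ] OX b E →ₗ[ℂ] OX b E := redBrk E b ⊤

/-- The Poisson bracket of `Z° × S`. -/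
def brkZS : OZS b p E →ₗ[ℂ] OZS b p E →ₗ[ℂ] OZS b p E :=
  tensBrk (redBrk _ _ ⊤) (redBrk _ _ (stab b p))

/-- The grading of `𝒪(X°)`. -/
def grOX (N : ℤ) : Submodule ℂ (OX b E) := redGr E b ⊤ dil N

/-- The grading of `𝒪(Z°) ⊗ 𝒪(S)`. -/
def grOZS (e : Fin m → ℤ) (N : ℤ) : Submodule ℂ (OZS b p E) :=
  tensRedGr (redGr _ _ ⊤ dil) (redGr _ _ (stab b p) (degS b p e)) N

/-- The homogeneous elements of `A_{X°}`. -/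
def grAX (N : ℤ) : Set (AX b E) := complGr (qredGr E b ⊤ dil) N

/-- The homogeneous elements of `A_{Z°} ⊗̂ A_S`. -/
def grAZS (e : Fin m → ℤ) (N : ℤ) : Set (AZS b p E) :=
  complGr (tensGr (complGr (qredGr _ _ ⊤ dil)) (complGr (qredGr _ _ (stab b p) (degS b p e)))) N

end Hypertoric

end Hypertoric

end

open Hypertoric

set_option linter.unusedSectionVars false
set_option linter.unusedVariables false

noncomputable section

namespace Hypertoric

/-! ## The homogenized Weyl algebra -/

section WeylBasics

/-! The factorization is produced by an explicit automorphism of the localized Weyl algebra, before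
any reduction. Unimodularity gives coordinates `u k` in $E$ whose weights are a basis of the
characters trivial on $\hat T$, together with dual cocharacters `e k` (`exists_slice`). Let `num k`
be $\sum_{j\in F}\langle b_j,e_k\rangle x_jy_j$. Formally, `corr ε` is conjugation by
$\exp(-\frac{\varepsilon}{\hbar}\sum_k\log(u_k)\,\mathrm{num}_k)$. This makes sense although the
logarithm does not: it multiplies a coordinate with index in $F$ by a monomial in the invertible
$u_k$, adds a multiple of $u_k^{-1}\mathrm{num}_k$ to the coordinate conjugate to $u_k$, and fixes
all other coordinates. The inverse is `corr (-ε)`.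

After `corr 1` the coordinates with index in $F$ pair to zero with all `e k`. The Weyl algebra is
the tensor product of those for $F^c$ and $F$ (`join`, `split`), and transporting this through
`corr` separates weights and moment maps simultaneously: a $T^m$-invariant tensor is built from a
$T^m$-invariant over $F^c$ and a $\hat T$-invariant over $F$ (`qmkRey_theta`), and $\mu_q(\xi)$
becomes $\mu_q(\xi)\otimes1+1\otimes\mu_q(\hat\xi)$, with $\hat\xi$ the projection of $\xi$ to
$\operatorname{Lie}\hat T$ (`psi_qmom`). Hence the quantum reductions are already isomorphic before
completion (`redEquiv`). Completing gives `complTensEquiv`, and setting $\hbar=0$ gives the Poisson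
isomorphism `specEquiv`. On $\hat T$-invariants the grading natural for `corr` agrees with the one
defined by $e$, because $e$ and $\sum_k e_k$ pair to $1$ with every $u_k$ (`degree_correction`).

That the completed reduction is a deformation quantization needs absence of $\hbar$-torsion.
Functions on $T^*\mathbf A^n$ are flat over $\mathbf C[x_1y_1,\dots,x_ny_n]$, so all relations
between components of the moment map come from that polynomial ring. The $x_iy_i$ commute in the
Weyl algebra as well, so these relations lift (`qmomIdeal_torsion`). For the Weyl algebra itself
torsion is controlled by its action on $\mathcal O[[\hbar]]$ (`weyl_torsion`). It suffices to show
that torsion is arbitrarily divisible by $\hbar$, since the completion kills it; a complete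
torsion-free algebra is then free (`free_of_complete`). The tensor product side inherits everything
by transport along the isomorphism.

Charts exist by a Kempf–Ness argument. A point of minimal norm on the closed orbit gives a positive
relation between the weights of the nonzero coordinates, and the vanishing of the moment map gives a
relation supported on the pairs with $x_iy_i\neq0$. Both can be made integral, and a suitable
combination selects exactly one nonzero coordinate from each pair that does not vanish identically
at the point (`exists_sign_relation`). -/

theorem hbar_mul_comm {A : Type*} [Ring A] [Algebra Ch A] (a : A) : hbar A * a = a * hbar A :=
  Algebra.commutes _ _

theorem mem_hIdeal {A : Type*} [Ring A] [Algebra Ch A] {k : ℕ} {a : A} :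
    a ∈ hIdeal A k ↔ ∃ r, a = hbar A ^ k * r := by
  rw [hIdeal, Ideal.mem_span_singleton']
  constructor
  · rintro ⟨r, rfl⟩
    exact ⟨r, ((show Commute (hbar A) r from hbar_mul_comm r).pow_left k).eq.symm⟩
  · rintro ⟨r, rfl⟩
    exact ⟨r, ((show Commute (hbar A) r from hbar_mul_comm r).pow_left k).eq.symm⟩

variable {ι : Type} [DecidableEq ι] (E : Set (Coord ι))

theorem weyl_induction {P : Weyl E → Prop} (hC : ∀ f : Ch, P (algebraMap Ch _ f))
    (hX : ∀ a, P (gen E a)) (hadd : ∀ f g, P f → P g → P (f + g))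
    (hmul : ∀ f g, P f → P g → P (f * g)) (d : Weyl E) : P d := by
  obtain ⟨a, rfl⟩ := RingQuot.mkAlgHom_surjective Ch (Rel E) d
  change P (toWeyl E a)
  induction a using FreeAlgebra.induction with
  | grade0 r => rw [AlgHom.commutes]; exact hC r
  | grade1 x => exact hX x
  | mul a b ha hb => rw [map_mul]; exact hmul _ _ ha hb
  | add a b ha hb => rw [map_add]; exact hadd _ _ ha hb

theorem hbar_mem_hIdeal (A : Type*) [Ring A] [Algebra Ch A] : hbar A ∈ hIdeal A 1 :=
  mem_hIdeal.mpr ⟨1, by simp⟩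

theorem mk_hbar (A : Type*) [Ring A] [Algebra Ch A] :
    Ideal.Quotient.mk (hIdeal A 1) (hbar A) = 0 :=
  Ideal.Quotient.eq_zero_iff_mem.mpr (hbar_mem_hIdeal A)

variable {E} in
theorem Commute.inv_of_mul_eq_one {A : Type*} [Ring A] {a b c : A} (h1 : a * b = 1)
    (h2 : b * a = 1) (hc : Commute a c) : Commute b c := by
  have : b * (a * c) * b = b * (c * a) * b := by rw [hc.eq]
  rw [← mul_assoc, h2, one_mul] at this
  rw [mul_assoc, mul_assoc, h1, mul_one] at this
  exact this.symm

/-- The commutators of the coordinates are multiples of $\hbar$, and an element commuting with a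
unit commutes with its inverse, so all generators commute in the quotient. Commutativity is what
allows the universal property of the localization `Fun E` to be applied to this quotient. -/
theorem weyl_mod_hbar_comm (x y : Lvl (Weyl E) 1) : x * y = y * x := by
  obtain ⟨a, rfl⟩ := Ideal.Quotient.mk_surjective x
  obtain ⟨b, rfl⟩ := Ideal.Quotient.mk_surjective y
  let q := Ideal.Quotient.mk (hIdeal (Weyl E) 1)
  have hinv1 : ∀ c hc, q (gen E (Gen.coord c)) * q (gen E (Gen.inv c hc)) = 1 := fun c hc => by
    rw [← map_mul, gen_mul_inv, map_one]
  have hinv2 : ∀ c hc, q (gen E (Gen.inv c hc)) * q (gen E (Gen.coord c)) = 1 := fun c hc => by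
    rw [← map_mul, gen_inv_mul, map_one]
  have h1 : ∀ c c', Commute (q (gen E (Gen.coord c))) (q (gen E (Gen.coord c'))) := fun c c' => by
    change _ * _ = _ * _
    rw [← map_mul, gen_comm, map_add, map_zsmul, map_mul]
    rw [show q (hbar (Weyl E)) = 0 from mk_hbar _, smul_zero, add_zero]
  have h2 : ∀ g c', Commute (q (gen E g)) (q (gen E (Gen.coord c'))) := by
    rintro (c | ⟨c, hc⟩) c'
    · exact h1 c c'
    · exact Commute.inv_of_mul_eq_one (hinv1 c hc) (hinv2 c hc) (h1 c c')
  have h3 : ∀ g g', Commute (q (gen E g)) (q (gen E g')) := by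
    rintro g (c | ⟨c, hc⟩)
    · exact h2 g c
    · exact (Commute.inv_of_mul_eq_one (hinv1 c hc) (hinv2 c hc) (h2 g c).symm).symm
  have h4 : ∀ g d, Commute (q (gen E g)) (q d) := by
    intro g d
    induction d using weyl_induction with
    | hC f =>
      change _ * _ = _ * _
      rw [← map_mul, ← map_mul, Algebra.commutes]
    | hX a => exact h3 g a
    | hadd f g hf hg => rw [map_add]; exact hf.add_right hg
    | hmul f g hf hg => rw [map_mul]; exact hf.mul_right hg
  change Commute (q a) (q b)
  induction a using weyl_induction with
  | hC f =>
    change _ * _ = _ * _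
    rw [← map_mul, ← map_mul, Algebra.commutes]
  | hX a => exact h4 a b
  | hadd f g hf hg => rw [map_add]; exact hf.add_left hg
  | hmul f g hf hg => rw [map_mul]; exact hf.mul_left hg

theorem symb_surjective : Function.Surjective (symb E) := by
  intro f
  obtain ⟨⟨g, s⟩, h⟩ := IsLocalization.surj (mulSet E) f
  have hpoly : ∀ g : MvPolynomial (Coord ι) ℂ, ∃ d, symb E d = algebraMap _ (Fun E) g := by
    intro g
    induction g using MvPolynomial.induction_on with
    | C a =>
      refine ⟨algebraMap Ch _ (PowerSeries.C a), ?_⟩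
      rw [isSpec_symb, PowerSeries.constantCoeff_C]
      rfl
    | add p q hp hq =>
      obtain ⟨d, hd⟩ := hp
      obtain ⟨d', hd'⟩ := hq
      exact ⟨d + d', by rw [map_add, map_add, hd, hd']⟩
    | mul_X p c hp =>
      obtain ⟨d, hd⟩ := hp
      exact ⟨d * qc E c, by rw [map_mul, map_mul, hd, symb_qc]; rfl⟩
  have hden : ∃ d, symb E d * algebraMap _ (Fun E) (s : MvPolynomial (Coord ι) ℂ) = 1 := by
    obtain ⟨y, hy⟩ := s
    clear h
    induction hy using Submonoid.closure_induction with
    | mem x hx =>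
      obtain ⟨c, hc, rfl⟩ := hx
      refine ⟨gen E (Gen.inv c hc), ?_⟩
      rw [symb_inv]
      exact (isUnit_cf hc).val_inv_mul
    | one => exact ⟨1, by simp⟩
    | mul x y _ _ hx hy =>
      obtain ⟨d, hd⟩ := hx
      obtain ⟨d', hd'⟩ := hy
      refine ⟨d * d', ?_⟩
      simp only at hd hd' ⊢
      rw [map_mul, map_mul, mul_mul_mul_comm, hd, hd', one_mul]
  obtain ⟨d, hd⟩ := hpoly g
  obtain ⟨d', hd'⟩ := hden
  refine ⟨d * d', ?_⟩
  simp only at h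
  rw [map_mul, hd, ← h, mul_assoc, mul_comm _ (symb E d'), hd', mul_one]

/-- The map from functions to `Weyl E / ħ`. -/
theorem exists_fun_to_mod_hbar : ∃ g : Fun E →+* Lvl (Weyl E) 1,
    ∀ d, g (symb E d) = Ideal.Quotient.mk _ d := by
  -- These local instances make the quotient a commutative $\mathbf C$-algebra, as `liftFun`
  -- requires.
  let _ : CommRing (Lvl (Weyl E) 1) :=
    { (inferInstance : Ring (Lvl (Weyl E) 1)) with mul_comm := weyl_mod_hbar_comm E }
  let _ : Algebra ℂ (Lvl (Weyl E) 1) :=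
    ((algebraMap Ch (Lvl (Weyl E) 1)).comp PowerSeries.C).toAlgebra
  let q : Weyl E →+* Lvl (Weyl E) 1 := Ideal.Quotient.mk _
  have hinv : ∀ c hc, q (gen E (Gen.coord c)) * q (gen E (Gen.inv c hc)) = 1 := fun c hc => by
    rw [← map_mul, gen_mul_inv, map_one]
  let g : Fun E →ₐ[ℂ] Lvl (Weyl E) 1 := liftFun E (fun c => q (qc E c))
    fun c hc => IsUnit.of_mul_eq_one _ (hinv c hc)
  refine ⟨g.toRingHom, fun d => ?_⟩
  change g (symb E d) = q d
  induction d using weyl_induction with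
  | hC f =>
    rw [isSpec_symb, AlgHom.commutes]
    change q (algebraMap Ch _ (PowerSeries.C _)) = _
    rw [← sub_eq_zero, ← map_sub, ← map_sub]
    obtain ⟨f', hf⟩ : PowerSeries.X ∣ (PowerSeries.C (PowerSeries.constantCoeff f) - f : Ch) := by
      rw [PowerSeries.X_dvd_iff]; simp
    rw [hf, map_mul, map_mul]
    rw [show q (algebraMap Ch (Weyl E) PowerSeries.X) = 0 from mk_hbar _, zero_mul]
  | hX a =>
    have h1 : ∀ c, g (cf E c) = q (qc E c) := fun c => liftFun_cf _ _ _ _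
    rcases a with c | ⟨c, hc⟩
    · rw [show gen E (Gen.coord c) = qc E c from rfl, symb_qc, h1]
    · have h2 : g (symb E (gen E (Gen.coord c))) * g (symb E (gen E (Gen.inv c hc))) = 1 := by
        rw [← map_mul, ← map_mul, gen_mul_inv, map_one, map_one]
      have h3 : g (symb E (gen E (Gen.coord c))) = q (qc E c) := by
        rw [show gen E (Gen.coord c) = qc E c from rfl, symb_qc, h1]
      rw [h3] at h2
      exact (IsUnit.of_mul_eq_one _ (hinv c hc)).mul_left_cancel (h2.trans (hinv c hc).symm)
  | hadd f f' hf hg => rw [map_add, map_add, map_add, hf, hg]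
  | hmul f f' hf hg => rw [map_mul, map_mul, map_mul, hf, hg]

/-- The quotient map modulo $\hbar$ factors through `symb`, so an operator with zero symbol vanishes
modulo $\hbar$. This replaces a basis theorem for the Weyl algebra. -/
theorem symb_eq_zero {d : Weyl E} : symb E d = 0 ↔ ∃ w, d = hbar (Weyl E) * w := by
  constructor
  · intro h
    obtain ⟨g, hg⟩ := exists_fun_to_mod_hbar E
    have := hg d
    rw [h, map_zero] at this
    obtain ⟨w, hw⟩ := mem_hIdeal.mp (Ideal.Quotient.eq_zero_iff_mem.mp this.symm)
    exact ⟨w, by rw [hw, pow_one]⟩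
  · rintro ⟨w, rfl⟩
    rw [map_mul, hbar, isSpec_symb]
    simp

theorem symb_eq_iff {d d' : Weyl E} : symb E d = symb E d' ↔ ∃ w, d = d' + hbar (Weyl E) * w := by
  rw [← sub_eq_zero, ← map_sub, symb_eq_zero]
  exact exists_congr fun w => by rw [sub_eq_iff_eq_add']

end WeylBasics

/-! ## Commutators -/

section Commutators

variable {ι : Type} [DecidableEq ι] [Fintype ι] (E : Set (Coord ι))

theorem brk_cf (c c' : Coord ι) : brk E (cf E c) (cf E c') = ((omega c c' : ℤ) : Fun E) := by
  classical
  rw [brk_apply]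
  rcases c with i | i <;> rcases c' with j | j
  · simp [omega]
  · simp only [pd_cf, omega]
    rw [Finset.sum_eq_single i]
    · by_cases h : i = j <;> simp [h, eq_comm]
    · intro k _ hk; simp [hk.symm]
    · simp
  · simp only [pd_cf, omega]
    rw [Finset.sum_eq_single i]
    · by_cases h : i = j <;> simp [h, eq_comm]
    · intro k _ hk; simp [hk.symm]
    · simp
  · simp [omega]

/-- The commutator of `d` and `d'` is `ħ` times an element with symbol the Poisson bracket of
the symbols. -/
def CommBrk (d d' : Weyl E) : Prop :=
  ∃ w, d * d' - d' * d = hbar (Weyl E) * w ∧ symb E w = brk E (symb E d) (symb E d')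

variable {E}

theorem CommBrk.symm {d d' : Weyl E} (h : CommBrk E d d') : CommBrk E d' d := by
  obtain ⟨w, h1, h2⟩ := h
  refine ⟨-w, ?_, ?_⟩
  · rw [mul_neg, ← h1, neg_sub]
  · rw [map_neg, h2, brk_swap, neg_neg]

theorem CommBrk.add {d₁ d₂ d' : Weyl E} (h₁ : CommBrk E d₁ d') (h₂ : CommBrk E d₂ d') :
    CommBrk E (d₁ + d₂) d' := by
  obtain ⟨w, h1, h2⟩ := h₁
  obtain ⟨w', h1', h2'⟩ := h₂
  refine ⟨w + w', ?_, ?_⟩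
  · rw [mul_add (hbar (Weyl E)), ← h1, ← h1']; noncomm_ring
  · rw [map_add, map_add, h2, h2', map_add]; rfl

theorem CommBrk.mul {d₁ d₂ d' : Weyl E} (h₁ : CommBrk E d₁ d') (h₂ : CommBrk E d₂ d') :
    CommBrk E (d₁ * d₂) d' := by
  obtain ⟨w, h1, h2⟩ := h₁
  obtain ⟨w', h1', h2'⟩ := h₂
  refine ⟨d₁ * w' + w * d₂, ?_, ?_⟩
  · have : d₁ * d₂ * d' - d' * (d₁ * d₂) = d₁ * (d₂ * d' - d' * d₂) + (d₁ * d' - d' * d₁) * d₂ := by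
      noncomm_ring
    rw [this, h1, h1', ← mul_assoc, ← hbar_mul_comm, mul_add, mul_assoc, mul_assoc]
  · rw [map_add, map_mul, map_mul, map_mul, h2, h2', brk_mul_left]; ring

theorem brk_one (f : Fun E) : brk E 1 f = 0 := by
  have := brk_mul_left E 1 1 f
  simpa using this

theorem brk_algebraMap (a : ℂ) (f : Fun E) : brk E (algebraMap ℂ _ a) f = 0 := by
  rw [Algebra.algebraMap_eq_smul_one, map_smul, LinearMap.smul_apply, brk_one, smul_zero]

theorem CommBrk.algebraMap (f : Ch) (d' : Weyl E) : CommBrk E (algebraMap Ch _ f) d' := by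
  refine ⟨0, ?_, ?_⟩
  · rw [Algebra.commutes, sub_self, mul_zero]
  · rw [isSpec_symb, brk_algebraMap, map_zero]

/-- From $[g,d']=-g[d,d']g$ when $g=d^{-1}$; the bracket of symbols obeys the same rule, by the
Leibniz identity for $\mathrm{symb}(d)\,\mathrm{symb}(g)=1$. -/
theorem CommBrk.inv {d g d' : Weyl E} (h : CommBrk E d d') (h1 : d * g = 1) (h2 : g * d = 1) :
    CommBrk E g d' := by
  obtain ⟨w, hw, hs⟩ := h
  refine ⟨-(g * w * g), ?_, ?_⟩
  · have : g * d' - d' * g = -(g * (d * d' - d' * d) * g) := by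
      have e1 : g * (d * d' - d' * d) * g = (g * d) * d' * g - g * d' * (d * g) := by noncomm_ring
      rw [e1, h1, h2]; noncomm_ring
    rw [this, hw, mul_neg, ← mul_assoc g, ← hbar_mul_comm]
    noncomm_ring
  · have e1 : symb E d * symb E g = 1 := by rw [← map_mul, h1, map_one]
    have e2 : brk E (symb E d * symb E g) (symb E d') = 0 := by rw [e1, brk_one]
    rw [brk_mul_left, ← hs] at e2
    rw [map_neg, map_mul, map_mul]
    linear_combination (-symb E g) * e2 + (brk E (symb E g)) (symb E d') * e1

/-- `CommBrk` is stable under sums, products and inverses in each argument, which leaves the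
defining commutators of two coordinates. -/
theorem commBrk (d d' : Weyl E) : CommBrk E d d' := by
  have h1 : ∀ c c', CommBrk E (gen E (Gen.coord c)) (gen E (Gen.coord c')) := by
    intro c c'
    refine ⟨(omega c c' : ℤ), ?_, ?_⟩
    · rw [gen_comm, add_sub_cancel_left, zsmul_eq_mul, Int.cast_comm]
    · rw [map_intCast, ← brk_cf, ← symb_qc, ← symb_qc]; rfl
  have h2 : ∀ a c', CommBrk E (gen E a) (gen E (Gen.coord c')) := by
    rintro (c | ⟨c, hc⟩) c'
    · exact h1 c c'
    · exact (h1 c c').inv (gen_mul_inv E c hc) (gen_inv_mul E c hc)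
  have h3 : ∀ a a', CommBrk E (gen E a) (gen E a') := by
    rintro a (c | ⟨c, hc⟩)
    · exact h2 a c
    · exact ((h2 a c).symm.inv (gen_mul_inv E c hc) (gen_inv_mul E c hc)).symm
  have h4 : ∀ a, CommBrk E (gen E a) d' := by
    intro a
    induction d' using weyl_induction with
    | hC f => exact (CommBrk.algebraMap f _).symm
    | hX a' => exact h3 a a'
    | hadd f g hf hg => exact (hf.symm.add hg.symm).symm
    | hmul f g hf hg => exact (hf.symm.mul hg.symm).symm
  induction d using weyl_induction with
  | hC f => exact CommBrk.algebraMap f _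
  | hX a => exact h4 a
  | hadd f g hf hg => exact hf.add hg
  | hmul f g hf hg => exact hf.mul hg

end Commutators

/-! ## The action of the Weyl algebra on `(Fun E)[[ħ]]` -/

section Representation

variable {ι : Type} (E : Set (Coord ι))

theorem derivation_fun_eq_zero (D : Derivation ℂ (Fun E) (Fun E)) (h : ∀ c, D (cf E c) = 0)
    (f : Fun E) : D f = 0 := by
  induction f using fun_induction with
  | hC a => simp
  | hX c => exact h c
  | hadd f g hf hg => rw [map_add, hf, hg, add_zero]
  | hmul f g hf hg => rw [Derivation.leibniz, hf, hg, smul_zero, smul_zero, add_zero]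
  | hinv f g hf h =>
    have h1 := congrArg D h
    rw [Derivation.leibniz, hf, smul_zero, add_zero, Derivation.map_one_eq_zero, smul_eq_mul] at h1
    exact (IsUnit.of_mul_eq_one _ h).mul_right_eq_zero.mp h1

theorem pd_comm (c c' : Coord ι) (f : Fun E) : pd E c (pd E c' f) = pd E c' (pd E c f) := by
  have := derivation_fun_eq_zero E ⁅pd E c, pd E c'⁆ (fun a => by
    rw [Derivation.commutator_apply, pd_cf, pd_cf]
    split_ifs <;> simp) f
  rwa [Derivation.commutator_apply, sub_eq_zero] at this

theorem coeff_smul_powerSeries {O : Type*} [CommRing O] [Algebra ℂ O] (p : Ch) (f : PowerSeries O)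
    (n : ℕ) : PowerSeries.coeff n (p • f) =
      ∑ ij ∈ Finset.HasAntidiagonal.antidiagonal n, PowerSeries.coeff ij.1 p • PowerSeries.coeff ij.2 f := by
  rw [Algebra.smul_def, PowerSeries.coeff_mul]
  exact Finset.sum_congr rfl fun ij _ => by
    rw [Algebra.smul_def]; congr 1

/-- The operator `u + ħ D` on `(Fun E)[[ħ]]`, where `D` acts on the coefficients. -/
def opAux (u : Fun E) (D : Fun E →ₗ[ℂ] Fun E) : Module.End Ch (PowerSeries (Fun E)) where
  toFun f := PowerSeries.mk fun n =>
    u * PowerSeries.coeff n f + D (PowerSeries.coeff n (PowerSeries.X * f))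
  map_add' f g := by
    ext n
    simp only [mul_add, map_add, PowerSeries.coeff_mk]
    ring
  map_smul' p f := by
    ext n
    rw [RingHom.id_apply, coeff_smul_powerSeries, PowerSeries.coeff_mk, mul_smul_comm,
      coeff_smul_powerSeries, coeff_smul_powerSeries, map_sum, Finset.mul_sum,
      ← Finset.sum_add_distrib]
    exact Finset.sum_congr rfl fun ij _ => by
      rw [PowerSeries.coeff_mk, smul_add, map_smul, mul_smul_comm]

theorem coeff_opAux (u : Fun E) (D : Fun E →ₗ[ℂ] Fun E) (f : PowerSeries (Fun E)) (n : ℕ) :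
    PowerSeries.coeff n (opAux E u D f) =
      u * PowerSeries.coeff n f + D (PowerSeries.coeff n (PowerSeries.X * f)) := by
  simp [opAux]

/-- The coefficient of $\hbar^n$ in $(u+\hbar D)f$ is $uf_n+D(f_{n-1})$. Since $u$ is invertible,
the equation is solved uniquely for one coefficient after another. This is what makes the inverted
coordinates $y_i$ act on power series. -/
theorem opAux_bijective {u : Fun E} (hu : IsUnit u) (D : Fun E →ₗ[ℂ] Fun E) :
    Function.Bijective (opAux E u D) := by
  obtain ⟨v, hv⟩ := hu.exists_right_inv
  constructor
  · rw [injective_iff_map_eq_zero]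
    intro f hf
    ext n
    rw [map_zero]
    have h : ∀ n, u * PowerSeries.coeff n f + D (PowerSeries.coeff n (PowerSeries.X * f)) = 0 :=
      fun n => by rw [← coeff_opAux, hf, map_zero]
    induction n with
    | zero =>
      have := h 0
      rw [PowerSeries.coeff_zero_X_mul, map_zero, add_zero] at this
      exact hu.mul_right_eq_zero.mp this
    | succ n ih =>
      have := h (n + 1)
      rw [PowerSeries.coeff_succ_X_mul, ih, map_zero, add_zero] at this
      exact hu.mul_right_eq_zero.mp this
  · intro f
    let g : ℕ → Fun E := fun n => Nat.rec (v * PowerSeries.coeff 0 f)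
      (fun n a => v * (PowerSeries.coeff (n + 1) f - D a)) n
    refine ⟨PowerSeries.mk g, ?_⟩
    ext n
    rw [coeff_opAux, PowerSeries.coeff_mk]
    cases n with
    | zero =>
      rw [PowerSeries.coeff_zero_X_mul, map_zero, add_zero]
      change u * (v * PowerSeries.coeff 0 f) = _
      rw [← mul_assoc, hv, one_mul]
    | succ n =>
      rw [PowerSeries.coeff_succ_X_mul, PowerSeries.coeff_mk]
      change u * (v * (PowerSeries.coeff (n + 1) f - D (g n))) + D (g n) = _
      rw [← mul_assoc, hv, one_mul, sub_add_cancel]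

/-- The first-order part of the operator by which a coordinate acts. -/
def opDer : Coord ι → Fun E →ₗ[ℂ] Fun E
  | Sum.inl _ => 0
  | Sum.inr i => (pd E (Sum.inl i) : Fun E →ₗ[ℂ] Fun E)

/-- The operators `xᵢ` and `yᵢ + ħ ∂/∂xᵢ` on `(Fun E)[[ħ]]`. -/
def opCoord (c : Coord ι) : Module.End Ch (PowerSeries (Fun E)) := opAux E (cf E c) (opDer E c)

theorem opDer_comm (c c' : Coord ι) (f : Fun E) :
    opDer E c (opDer E c' f) = opDer E c' (opDer E c f) := by
  rcases c with i | i <;> rcases c' with j | j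
  · rfl
  · simp [opDer]
  · simp [opDer]
  · exact pd_comm E _ _ f

variable [DecidableEq ι]

/-- This is the part of first order in $\hbar$ of the commutation relation for the operators
$c+\hbar D_c$. The part of order zero is commutativity of functions and the part of order two is
`opDer_comm`. -/
theorem opDer_cf_mul (c c' : Coord ι) (f : Fun E) :
    opDer E c (cf E c' * f) + cf E c * (opDer E c' f) =
      opDer E c' (cf E c * f) + cf E c' * opDer E c f + (omega c c' : ℤ) * f := by
  rcases c with i | i <;> rcases c' with j | j
  · simp [opDer, omega]
  · simp only [opDer, omega, LinearMap.zero_apply, Derivation.coeFn_coe, Derivation.leibniz,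
      smul_eq_mul, pd_cf, Sum.inl.injEq]
    by_cases h : i = j
    · simp [h]
    · simp [h]
  · simp only [opDer, omega, LinearMap.zero_apply, Derivation.coeFn_coe, Derivation.leibniz,
      smul_eq_mul, pd_cf, Sum.inl.injEq]
    by_cases h : i = j
    · simp [h, add_comm]
    · simp [h, Ne.symm h]
  · simp only [opDer, omega, Derivation.coeFn_coe, Derivation.leibniz,
      smul_eq_mul, pd_cf]
    simp; ring

theorem hbar_end_apply (f : PowerSeries (Fun E)) :
    hbar (Module.End Ch (PowerSeries (Fun E))) f = PowerSeries.X * f := by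
  rw [hbar, Module.algebraMap_end_apply, Algebra.smul_def]
  congr 1
  exact PowerSeries.map_X _

theorem opCoord_comm (c c' : Coord ι) : opCoord E c * opCoord E c' =
    opCoord E c' * opCoord E c + omega c c' • hbar (Module.End Ch (PowerSeries (Fun E))) := by
  refine LinearMap.ext fun f => PowerSeries.ext fun n => ?_
  rw [Module.End.mul_apply, LinearMap.add_apply, Module.End.mul_apply, LinearMap.smul_apply,
    map_add, map_zsmul, hbar_end_apply]
  simp only [opCoord]
  rw [coeff_opAux, coeff_opAux, coeff_opAux, coeff_opAux, zsmul_eq_mul]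
  cases n with
  | zero => simp; ring
  | succ n =>
    simp only [PowerSeries.coeff_succ_X_mul]
    rw [coeff_opAux, coeff_opAux, map_add, map_add, opDer_comm]
    linear_combination opDer_cf_mul E c c' (PowerSeries.coeff n f)

theorem isUnit_opCoord {c : Coord ι} (hc : c ∈ E) : IsUnit (opCoord E c) :=
  (Module.End.isUnit_iff _).mpr (opAux_bijective E (isUnit_cf hc) _)

/-- The action of the Weyl algebra on `(Fun E)[[ħ]]`. -/
def weylRep : Weyl E →ₐ[Ch] Module.End Ch (PowerSeries (Fun E)) :=
  liftWeyl E (fun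
    | Gen.coord c => opCoord E c
    | Gen.inv _ hc => ((isUnit_opCoord E hc).unit⁻¹ : (Module.End Ch (PowerSeries (Fun E)))ˣ))
    (fun c c' => opCoord_comm E c c')
    (fun c hc => (isUnit_opCoord E hc).mul_val_inv)
    (fun c hc => (isUnit_opCoord E hc).val_inv_mul)

theorem constantCoeff_opCoord (c : Coord ι) (f : PowerSeries (Fun E)) :
    PowerSeries.constantCoeff (opCoord E c f) = cf E c * PowerSeries.constantCoeff f := by
  rw [← PowerSeries.coeff_zero_eq_constantCoeff_apply, opCoord, coeff_opAux]
  simp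

/-- Applied to $f=1$ it shows that an operator which annihilates $1$ has zero symbol; `weyl_torsion`
rests on this. -/
theorem constantCoeff_weylRep (d : Weyl E) (f : PowerSeries (Fun E)) :
    PowerSeries.constantCoeff (weylRep E d f) = symb E d * PowerSeries.constantCoeff f := by
  induction d using weyl_induction generalizing f with
  | hC p =>
    rw [AlgHom.commutes, Module.algebraMap_end_apply, Algebra.smul_def, map_mul, isSpec_symb]
    congr 1
  | hX a =>
    have h1 : ∀ c f, PowerSeries.constantCoeff (weylRep E (gen E (Gen.coord c)) f) =
        symb E (gen E (Gen.coord c)) * PowerSeries.constantCoeff f := fun c f => by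
      rw [weylRep, liftWeyl_gen, constantCoeff_opCoord, show gen E (Gen.coord c) = qc E c from rfl,
        symb_qc]
    rcases a with c | ⟨c, hc⟩
    · exact h1 c f
    -- An inverse generator is handled by writing $f$ as the coordinate applied to its inverse
    -- applied to $f$, which reduces to the formula for coordinates.
    · have h2 : f = weylRep E (gen E (Gen.coord c)) (weylRep E (gen E (Gen.inv c hc)) f) := by
        rw [← Module.End.mul_apply, ← map_mul, gen_mul_inv, map_one, Module.End.one_apply]
      have h3 : symb E (gen E (Gen.inv c hc)) * symb E (gen E (Gen.coord c)) = 1 := by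
        rw [← map_mul, gen_inv_mul, map_one]
      conv_rhs => rw [h2, h1, ← mul_assoc, h3, one_mul]
  | hadd d d' h h' => rw [map_add, LinearMap.add_apply, map_add, h, h', map_add, add_mul]
  | hmul d d' h h' => rw [map_mul, Module.End.mul_apply, h, h', map_mul, mul_assoc]

/-- The `ħ`-torsion of the Weyl algebra is divisible by all powers of `ħ`. -/
theorem weyl_torsion {l : ℕ} {d : Weyl E} (h : hbar (Weyl E) ^ l * d = 0) (k : ℕ) :
    ∃ w, d = hbar (Weyl E) ^ k * w := by
  induction k with
  | zero => exact ⟨d, by simp⟩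
  | succ k ih =>
    obtain ⟨w, rfl⟩ := ih
    -- As $\hbar$ acts on power series by the nonzerodivisor $X$, the torsion relation forces $w$
    -- itself to annihilate $1$. Its symbol then vanishes, so one more factor $\hbar$ splits off.
    have h1 : weylRep E w 1 = 0 := by
      have h2 : weylRep E (hbar (Weyl E) ^ (l + k) * w) 1 = 0 := by
        rw [pow_add, mul_assoc, h, map_zero, LinearMap.zero_apply]
      have h3 : ∀ j (w : Weyl E) f, weylRep E (hbar (Weyl E) ^ j * w) f =
          PowerSeries.X ^ j * weylRep E w f := by
        intro j
        induction j with
        | zero => simp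
        | succ j ih =>
          intro w f
          have e : weylRep E (hbar (Weyl E)) = hbar _ := AlgHom.commutes _ _
          rw [pow_succ, mul_assoc, ih, map_mul, Module.End.mul_apply, e, hbar_end_apply, ← mul_assoc,
            ← pow_succ]
      rw [h3] at h2
      ext n
      have := congrArg (PowerSeries.coeff (n + (l + k))) h2
      rwa [PowerSeries.coeff_X_pow_mul, map_zero] at this
    have h4 := constantCoeff_weylRep E w 1
    rw [h1, map_zero, map_one, mul_one] at h4
    obtain ⟨w', rfl⟩ := (symb_eq_zero E).mp h4.symm
    exact ⟨w', by rw [pow_succ, mul_assoc]⟩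

end Representation

/-! ## The Euler derivation -/

section Euler

variable {ι : Type} [DecidableEq ι] (E : Set (Coord ι))

/-- The dual numbers over the Weyl algebra, with a power series `f` acting as `f + ε 2ħ f'`. -/
def DualWeyl : Type := TrivSqZeroExt (Weyl E) (Weyl E)

instance : Ring (DualWeyl E) := inferInstanceAs (Ring (TrivSqZeroExt (Weyl E) (Weyl E)))

/-- The derivation `2ħ d/dħ`. -/
def eulCh (f : Ch) : Ch := (2 : ℤ) • (PowerSeries.X * PowerSeries.derivative ℂ f)

theorem eulCh_add (f g : Ch) : eulCh (f + g) = eulCh f + eulCh g := by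
  simp only [eulCh, map_add, mul_add, smul_add]

theorem eulCh_mul (f g : Ch) : eulCh (f * g) = f * eulCh g + g * eulCh f := by
  simp only [eulCh, Derivation.leibniz, smul_eq_mul, zsmul_eq_mul]; ring

theorem eulCh_C (a : ℂ) : eulCh (PowerSeries.C a) = 0 := by
  simp [eulCh]

theorem eulCh_X : eulCh PowerSeries.X = (2 : ℤ) • PowerSeries.X := by
  simp [eulCh]

/-- The element `a + ε a'` of `DualWeyl`. -/
def dmk (a a' : Weyl E) : DualWeyl E :=
  (TrivSqZeroExt.inl a + TrivSqZeroExt.inr a' : TrivSqZeroExt (Weyl E) (Weyl E))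

/-- The coefficient of `1`. -/
def dfst (x : DualWeyl E) : Weyl E := TrivSqZeroExt.fst x

/-- The coefficient of `ε`. -/
def dsnd (x : DualWeyl E) : Weyl E := TrivSqZeroExt.snd x

variable {E}

theorem dual_ext {x y : DualWeyl E} (h1 : dfst E x = dfst E y) (h2 : dsnd E x = dsnd E y) : x = y :=
  TrivSqZeroExt.ext h1 h2

@[simp] theorem dfst_dmk (a a' : Weyl E) : dfst E (dmk E a a') = a := by simp [dfst, dmk]
@[simp] theorem dsnd_dmk (a a' : Weyl E) : dsnd E (dmk E a a') = a' := by simp [dsnd, dmk]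
@[simp] theorem dfst_mul (x y : DualWeyl E) : dfst E (x * y) = dfst E x * dfst E y :=
  TrivSqZeroExt.fst_mul _ _
@[simp] theorem dsnd_mul (x y : DualWeyl E) :
    dsnd E (x * y) = dfst E x * dsnd E y + dsnd E x * dfst E y := TrivSqZeroExt.snd_mul _ _
@[simp] theorem dfst_add (x y : DualWeyl E) : dfst E (x + y) = dfst E x + dfst E y := rfl
@[simp] theorem dsnd_add (x y : DualWeyl E) : dsnd E (x + y) = dsnd E x + dsnd E y := rfl
@[simp] theorem dfst_one : dfst E 1 = 1 := rfl
@[simp] theorem dsnd_one : dsnd E 1 = 0 := rfl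
@[simp] theorem dfst_zero : dfst E 0 = 0 := rfl
@[simp] theorem dsnd_zero : dsnd E 0 = 0 := rfl
@[simp] theorem dfst_zsmul (k : ℤ) (x : DualWeyl E) : dfst E (k • x) = k • dfst E x := rfl
@[simp] theorem dsnd_zsmul (k : ℤ) (x : DualWeyl E) : dsnd E (k • x) = k • dsnd E x := rfl

variable (E)

/-- The structure map of `DualWeyl`. -/
def dualWeylMap : Ch →+* DualWeyl E where
  toFun f := dmk E (algebraMap Ch (Weyl E) f) (algebraMap Ch (Weyl E) (eulCh f))
  map_one' := by
    have : eulCh 1 = 0 := by rw [show (1 : Ch) = PowerSeries.C 1 from (map_one _).symm, eulCh_C]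
    apply dual_ext <;> simp [this]
  map_zero' := by
    have : eulCh 0 = 0 := by simp [eulCh]
    apply dual_ext <;> simp [this]
  map_add' f g := by apply dual_ext <;> simp [eulCh_add]
  map_mul' f g := by
    apply dual_ext
    · simp
    · simp only [eulCh_mul, dsnd_mul, dsnd_dmk, dfst_dmk, map_add, map_mul]
      rw [Algebra.commutes g]

/-- With this structure, rather than the usual one on dual numbers, a homomorphism of $\mathbf
C[[\hbar]]$-algebras $d\mapsto d+\epsilon D(d)$ encodes a derivation that acts on scalars as
$2\hbar\,d/d\hbar$. -/
instance : Algebra Ch (DualWeyl E) := (dualWeylMap E).toAlgebra' fun f x => by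
  apply dual_ext
  · simp [dualWeylMap, Algebra.commutes]
  · simp [dualWeylMap, Algebra.commutes, add_comm]

variable {E}

@[simp] theorem dfst_algebraMap (f : Ch) :
    dfst E (algebraMap Ch _ f) = algebraMap Ch _ f := by
  change dfst E (dmk E _ _) = _; simp
@[simp] theorem dsnd_algebraMap (f : Ch) :
    dsnd E (algebraMap Ch _ f) = algebraMap Ch _ (eulCh f) := by
  change dsnd E (dmk E _ _) = _; simp
variable (E)

/-- The algebra homomorphism `d ↦ d + ε Eu(d)`. -/
def eulAux : Weyl E →ₐ[Ch] DualWeyl E :=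
  liftWeyl E (fun
    | Gen.coord c => dmk E (gen E (Gen.coord c)) (gen E (Gen.coord c))
    | Gen.inv c hc => dmk E (gen E (Gen.inv c hc)) (-gen E (Gen.inv c hc)))
    (fun c c' => by
      have h := gen_comm E c c'
      apply dual_ext
      · rw [dfst_mul, dfst_add, dfst_zsmul, dfst_mul]
        simpa only [dfst_dmk, hbar, dfst_algebraMap] using h
      -- The $\epsilon$-part of each side is twice that side of the commutation relation: a product
      -- of two coordinates and $\hbar$ both have degree two.
      · simp only [dsnd_mul, dfst_dmk, dsnd_dmk, dsnd_add, h, dsnd_zsmul, hbar, dsnd_algebraMap,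
          eulCh_X, map_zsmul]
        rw [← two_mul, mul_add, two_mul, ← two_mul, smul_comm]
        rw [show (2 : ℤ) • (omega c c' • (algebraMap Ch (Weyl E)) PowerSeries.X) =
          (2 : Weyl E) * (omega c c' • (algebraMap Ch (Weyl E)) PowerSeries.X) by
            rw [two_mul, two_smul]])
    (fun c hc => by
      apply dual_ext <;> simp [gen_mul_inv])
    (fun c hc => by
      apply dual_ext <;> simp [gen_inv_mul])

theorem dfst_eulAux (d : Weyl E) : dfst E (eulAux E d) = d := by
  induction d using weyl_induction with
  | hC f => rw [AlgHom.commutes, dfst_algebraMap]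
  | hX a => rcases a with c | ⟨c, hc⟩ <;> rw [eulAux, liftWeyl_gen, dfst_dmk]
  | hadd f g hf hg => rw [map_add, dfst_add, hf, hg]
  | hmul f g hf hg => rw [map_mul, dfst_mul, hf, hg]

/-- The Euler derivation of the Weyl algebra: the coordinates have degree one, and `ħ` has
degree two. -/
def weylEul : Weyl E →+ Weyl E where
  toFun d := dsnd E (eulAux E d)
  map_zero' := by rw [map_zero, dsnd_zero]
  map_add' d d' := by rw [map_add, dsnd_add]

theorem weylEul_mul (d d' : Weyl E) :
    weylEul E (d * d') = weylEul E d * d' + d * weylEul E d' := by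
  change dsnd E (eulAux E (d * d')) = _
  rw [map_mul, dsnd_mul, dfst_eulAux, dfst_eulAux, add_comm]; rfl

theorem weylEul_algebraMap (f : Ch) :
    weylEul E (algebraMap Ch _ f) = algebraMap Ch _ (eulCh f) := by
  change dsnd E (eulAux E _) = _
  rw [AlgHom.commutes, dsnd_algebraMap]

theorem weylEul_coord (c : Coord ι) : weylEul E (gen E (Gen.coord c)) = gen E (Gen.coord c) := by
  change dsnd E (eulAux E _) = _
  rw [eulAux, liftWeyl_gen, dsnd_dmk]

theorem weylEul_inv (c : Coord ι) (hc : c ∈ E) :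
    weylEul E (gen E (Gen.inv c hc)) = -gen E (Gen.inv c hc) := by
  change dsnd E (eulAux E _) = _
  rw [eulAux, liftWeyl_gen, dsnd_dmk]

theorem weylEul_smul (f : Ch) (d : Weyl E) :
    weylEul E (f • d) = f • weylEul E d + eulCh f • d := by
  rw [Algebra.smul_def, weylEul_mul, weylEul_algebraMap, ← Algebra.smul_def, ← Algebra.smul_def,
    add_comm]

variable {E} in
theorem weylEul_of_isHomog {N : ℤ} {d : Weyl E} (h : IsHomog E dil N d) :
    weylEul E d = N • d := by
  induction h with
  | zero N => simp
  | const a => rw [weylEul_algebraMap, eulCh_C, map_zero, zero_smul]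
  | hbar => rw [hbar, weylEul_algebraMap, eulCh_X, map_zsmul]
  | coord c => rw [weylEul_coord]; simp [dil]
  | inv c hc => rw [weylEul_inv]; simp [dil]
  | add _ _ h h' => rw [map_add, h, h', smul_add]
  | mul _ _ h h' => rw [weylEul_mul, h, h', add_smul, smul_mul_assoc, mul_smul_comm]

end Euler

/-! ## Weight decompositions of functions -/

section ClassicalWeights

variable {ι : Type} (E : Set (Coord ι)) {Λ : Type} [AddCommGroup Λ] (ω : Coord ι → Λ)

/-- The coaction on functions, for the grading in which the coordinate `c` has weight `ω c`. -/
def ccoact : Fun E →ₐ[ℂ] AddMonoidAlgebra (Fun E) Λ :=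
  liftFun E (fun c => AddMonoidAlgebra.single (ω c) (cf E c)) fun c hc => by
    obtain ⟨v, hv⟩ := (isUnit_cf hc).exists_right_inv
    refine IsUnit.of_mul_eq_one (AddMonoidAlgebra.single (-ω c) v) ?_
    rw [AddMonoidAlgebra.single_mul_single, hv, add_neg_cancel, AddMonoidAlgebra.one_def]

/-- The function `f` has weight `w`. -/
def CWt (w : Λ) (f : Fun E) : Prop :=
  ccoact E ω f = AddMonoidAlgebra.single w f ∧
    ∀ χ : Multiplicative Λ →* ℂˣ, scale E (fun c => χ (.ofAdd (ω c))) f =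
      ((χ (.ofAdd w) : ℂˣ) : ℂ) • f

variable {E ω}

theorem CWt.mul {w w' : Λ} {f f' : Fun E} (h : CWt E ω w f) (h' : CWt E ω w' f') :
    CWt E ω (w + w') (f * f') := by
  constructor
  · rw [map_mul, h.1, h'.1, AddMonoidAlgebra.single_mul_single]
  · intro χ
    rw [map_mul, h.2, h'.2, smul_mul_smul_comm, ofAdd_add, map_mul, Units.val_mul]

theorem CWt.algebraMap (a : ℂ) : CWt E ω 0 (algebraMap ℂ _ a) := by
  constructor
  · rw [AlgHom.commutes, AddMonoidAlgebra.coe_algebraMap]; rfl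
  · intro χ; simp

theorem CWt.cf (c : Coord ι) : CWt E ω (ω c) (cf E c) := by
  constructor
  · rw [ccoact, liftFun_cf]
  · intro χ; rw [scale_cf]

theorem CWt.inv {w : Λ} {f g : Fun E} (h : CWt E ω w f) (hg : f * g = 1) : CWt E ω (-w) g := by
  have hg' : g * f = 1 := by rw [mul_comm, hg]
  constructor
  · have h1 : ccoact E ω g * ccoact E ω f = 1 := by rw [← map_mul, hg', map_one]
    rw [h.1] at h1
    have h2 : AddMonoidAlgebra.single w f * AddMonoidAlgebra.single (-w) g = 1 := by
      rw [AddMonoidAlgebra.single_mul_single, hg, add_neg_cancel, AddMonoidAlgebra.one_def]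
    calc ccoact E ω g = ccoact E ω g *
        (AddMonoidAlgebra.single w f * AddMonoidAlgebra.single (-w) g) := by rw [h2, mul_one]
      _ = _ := by rw [← mul_assoc, h1, one_mul]
  · intro χ
    have h1 : scale E (fun c => χ (.ofAdd (ω c))) f * scale E (fun c => χ (.ofAdd (ω c))) g = 1 := by
      rw [← map_mul, hg, map_one]
    rw [h.2] at h1
    have h2 : ((χ (.ofAdd w) : ℂˣ) : ℂ) • f * (((χ (.ofAdd (-w)) : ℂˣ) : ℂ) • g) = 1 := by
      rw [smul_mul_smul_comm, hg, ← Units.val_mul, ← map_mul, ← ofAdd_add]; simp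
    exact (IsUnit.of_mul_eq_one _ h2).mul_left_cancel (h1.trans h2.symm)

theorem CWt.smul {w : Λ} {f : Fun E} (h : CWt E ω w f) (a : ℂ) : CWt E ω w (a • f) := by
  rw [Algebra.smul_def]
  simpa using (CWt.algebraMap a).mul h

end ClassicalWeights

/-! ### Weight decomposition of the Weyl algebra and projection to invariants -/

section QuantumWeights

variable {ι : Type} [DecidableEq ι] (E : Set (Coord ι)) {m : ℕ} (b : ι → Fin m → ℤ)

theorem wt_add_of_omega_ne_zero {c c' : Coord ι} (h : omega c c' ≠ 0) : wt b c + wt b c' = 0 := by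
  rcases c with i | i <;> rcases c' with j | j
  · exact absurd rfl h
  · have : i = j := by by_contra hij; exact h (by simp [omega, hij])
    subst this; simp [wt]
  · have : i = j := by by_contra hij; exact h (by simp [omega, hij])
    subst this; simp [wt]
  · exact absurd rfl h

/-- The coaction of the character lattice of `T^m` on the Weyl algebra. -/
def coact : Weyl E →ₐ[Ch] AddMonoidAlgebra (Weyl E) (Fin m → ℤ) :=
  liftWeyl E (fun
    | Gen.coord c => AddMonoidAlgebra.single (wt b c) (gen E (Gen.coord c))
    | Gen.inv c hc => AddMonoidAlgebra.single (-wt b c) (gen E (Gen.inv c hc)))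
    (fun c c' => by
      simp only [AddMonoidAlgebra.single_mul_single]
      rw [gen_comm, add_comm (wt b c'), AddMonoidAlgebra.single_add]
      congr 1
      by_cases h : omega c c' = 0
      · rw [h, zero_smul, zero_smul, AddMonoidAlgebra.single_zero]
      · rw [wt_add_of_omega_ne_zero b h, ← AddMonoidAlgebra.smul_single]
        rfl)
    (fun c hc => by
      simp only [AddMonoidAlgebra.single_mul_single]
      rw [gen_mul_inv, add_neg_cancel, AddMonoidAlgebra.one_def])
    (fun c hc => by
      simp only [AddMonoidAlgebra.single_mul_single]
      rw [gen_inv_mul, neg_add_cancel, AddMonoidAlgebra.one_def])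

/-- The operator `d` has weight `w`. -/
def IsWt (w : Fin m → ℤ) (d : Weyl E) : Prop :=
  coact E b d = AddMonoidAlgebra.single w d ∧
    ∀ t : Torus m, qact E b t d = (PowerSeries.C ((chi w t : ℂˣ) : ℂ) : Ch) • d

variable {E b}

theorem IsWt.mul {w w' : Fin m → ℤ} {d d' : Weyl E} (h : IsWt E b w d) (h' : IsWt E b w' d') :
    IsWt E b (w + w') (d * d') := by
  constructor
  · rw [map_mul, h.1, h'.1, AddMonoidAlgebra.single_mul_single]
  · intro t
    rw [map_mul, h.2, h'.2, smul_mul_smul_comm, chi_add, Units.val_mul, map_mul]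

theorem IsWt.algebraMap (f : Ch) : IsWt E b 0 (algebraMap Ch _ f) := by
  constructor
  · rw [AlgHom.commutes, AddMonoidAlgebra.coe_algebraMap]; rfl
  · intro t; rw [AlgHom.commutes]; simp [chi]

theorem IsWt.one : IsWt E b 0 (1 : Weyl E) := by
  simpa using IsWt.algebraMap (E := E) (b := b) 1

theorem IsWt.coord (c : Coord ι) : IsWt E b (wt b c) (gen E (Gen.coord c)) := by
  constructor
  · rw [coact, liftWeyl_gen]
  · intro t; rw [qact, liftWeyl_gen]; rfl

theorem IsWt.inv (c : Coord ι) (hc : c ∈ E) : IsWt E b (-wt b c) (gen E (Gen.inv c hc)) := by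
  constructor
  · rw [coact, liftWeyl_gen]
  · intro t; rw [qact, liftWeyl_gen, chi_neg]; rfl

theorem IsWt.zero (w : Fin m → ℤ) : IsWt E b w (0 : Weyl E) := by
  constructor
  · rw [map_zero, AddMonoidAlgebra.single_zero]
  · intro t; rw [map_zero, smul_zero]

theorem IsWt.add {w : Fin m → ℤ} {d d' : Weyl E} (h : IsWt E b w d) (h' : IsWt E b w d') :
    IsWt E b w (d + d') := by
  constructor
  · rw [map_add, h.1, h'.1, AddMonoidAlgebra.single_add]
  · intro t
    rw [map_add, h.2, h'.2, smul_add]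

theorem IsWt.smul {w : Fin m → ℤ} {d : Weyl E} (h : IsWt E b w d) (f : Ch) :
    IsWt E b w (f • d) := by
  rw [Algebra.smul_def]
  simpa using (IsWt.algebraMap f).mul h

/-- The generators are weight vectors and products of weight vectors are weight vectors, so every
operator is a finite sum of them. Additive statements may therefore be checked on weight vectors,
through `wt_induction`. -/
theorem mem_closure_isWt (d : Weyl E) : d ∈ AddSubmonoid.closure {d | ∃ w, IsWt E b w d} := by
  induction d using weyl_induction with
  | hC f => exact AddSubmonoid.subset_closure ⟨0, IsWt.algebraMap f⟩
  | hX a =>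
    rcases a with c | ⟨c, hc⟩
    · exact AddSubmonoid.subset_closure ⟨_, IsWt.coord c⟩
    · exact AddSubmonoid.subset_closure ⟨_, IsWt.inv c hc⟩
  | hadd f g hf hg => exact add_mem hf hg
  | hmul f g hf hg =>
    induction hf, hg using AddSubmonoid.closure_induction₂ with
    | mem x y hx hy =>
      obtain ⟨w, hw⟩ := hx
      obtain ⟨w', hw'⟩ := hy
      exact AddSubmonoid.subset_closure ⟨_, hw.mul hw'⟩
    | zero_left x _ => rw [zero_mul]; exact zero_mem _
    | zero_right x _ => rw [mul_zero]; exact zero_mem _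
    | add_left x y z _ _ _ h h' => rw [add_mul]; exact add_mem h h'
    | add_right x y z _ _ _ h h' => rw [mul_add]; exact add_mem h h'

variable (b) in
theorem wt_induction {P : Weyl E → Prop} (hadd : ∀ d d', P d → P d' → P (d + d'))
    (hw : ∀ w d, IsWt E b w d → P d) (d : Weyl E) : P d := by
  induction mem_closure_isWt (b := b) d using AddSubmonoid.closure_induction with
  | mem x hx => obtain ⟨w, hx⟩ := hx; exact hw w x hx
  | zero => exact hw 0 0 (IsWt.zero 0)
  | add x y _ _ hx hy => exact hadd _ _ hx hy

variable (E b) in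
/-- The operator which multiplies the component of weight `w` by the scalar `φ w`. -/
def wmap (φ : (Fin m → ℤ) → ℂ) : Weyl E →ₗ[Ch] Weyl E :=
  (Finsupp.lsum Ch fun w => (PowerSeries.C (φ w) : Ch) • (LinearMap.id : Weyl E →ₗ[Ch] Weyl E)) ∘ₗ
    (AddMonoidAlgebra.coeffLinearEquiv Ch).toLinearMap ∘ₗ (coact E b).toLinearMap

theorem wmap_apply (φ : (Fin m → ℤ) → ℂ) (d : Weyl E) : wmap E b φ d =
    (coact E b d).coeff.sum fun w a => (PowerSeries.C (φ w) : Ch) • a := rfl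

theorem wmap_isWt (φ : (Fin m → ℤ) → ℂ) {w : Fin m → ℤ} {d : Weyl E} (h : IsWt E b w d) :
    wmap E b φ d = (PowerSeries.C (φ w) : Ch) • d := by
  rw [wmap_apply, h.1, AddMonoidAlgebra.coeff_single, Finsupp.sum_single_index (by simp)]

theorem wmap_one (d : Weyl E) : wmap E b 1 d = d := by
  induction d using wt_induction b with
  | hadd d d' h h' => rw [map_add, h, h']
  | hw w d h => rw [wmap_isWt _ h]; simp

open Classical in
variable (E b) in
/-- The projection to the `H`-invariants. -/
def rey (H : Subgroup (Torus m)) : Weyl E →ₗ[Ch] Weyl E :=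
  wmap E b fun w => if ∀ t ∈ H, chi w t = 1 then 1 else 0

variable {H : Subgroup (Torus m)}

theorem rey_of_triv {w : Fin m → ℤ} (hw : ∀ t ∈ H, chi w t = 1) {d : Weyl E} (h : IsWt E b w d) :
    rey E b H d = d := by
  rw [rey, wmap_isWt _ h, if_pos hw, map_one, one_smul]

theorem rey_of_nontriv {w : Fin m → ℤ} (hw : ¬ ∀ t ∈ H, chi w t = 1) {d : Weyl E}
    (h : IsWt E b w d) : rey E b H d = 0 := by
  rw [rey, wmap_isWt _ h, if_neg hw, map_zero, zero_smul]

theorem rey_mem (d : Weyl E) : rey E b H d ∈ qinv E b H := by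
  induction d using wt_induction b with
  | hadd d d' h h' => rw [map_add]; exact add_mem h h'
  | hw w d h =>
    by_cases hw : ∀ t ∈ H, chi w t = 1
    · rw [rey_of_triv hw h]
      intro t ht
      rw [h.2, hw t ht]; simp
    · rw [rey_of_nontriv hw h]; exact zero_mem _

/-- Links the coaction, from which components are extracted, with the torus action, which defines
the invariants. -/
theorem coeff_coact_qact (t : Torus m) (d : Weyl E) (w : Fin m → ℤ) :
    (coact E b (qact E b t d)).coeff w =
      (PowerSeries.C ((chi w t : ℂˣ) : ℂ) : Ch) • (coact E b d).coeff w := by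
  induction d using wt_induction b with
  | hadd d d' h h' =>
    rw [map_add, map_add, map_add, AddMonoidAlgebra.coeff_add, AddMonoidAlgebra.coeff_add,
      Finsupp.add_apply, Finsupp.add_apply, h, h', smul_add]
  | hw w' d h =>
    rw [h.2, map_smul, h.1, AddMonoidAlgebra.coeff_smul_apply, AddMonoidAlgebra.coeff_single]
    by_cases hw : w' = w
    · rw [hw]
    · rw [Finsupp.single_eq_of_ne' hw, smul_zero, smul_zero]

/-- For some $t\in H$ the component is multiplied by $\chi_w(t)\neq1$ and is also fixed. The
difference $\chi_w(t)-1$ is a nonzero complex number, hence a unit of $\mathbf C[[\hbar]]$, so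
possible $\hbar$-torsion of the Weyl algebra does no harm. -/
theorem coeff_coact_eq_zero {d : Weyl E} (hd : d ∈ qinv E b H) {w : Fin m → ℤ}
    (hw : ¬ ∀ t ∈ H, chi w t = 1) : (coact E b d).coeff w = 0 := by
  push Not at hw
  obtain ⟨t, ht, h1⟩ := hw
  have h2 := coeff_coact_qact (b := b) t d w
  rw [hd t ht] at h2
  have h3 : (((chi w t : ℂˣ) : ℂ) - 1) ≠ 0 := by
    rw [sub_ne_zero]
    intro h
    exact h1 (Units.ext h)
  have h4 : (PowerSeries.C (((chi w t : ℂˣ) : ℂ) - 1) : Ch) • (coact E b d).coeff w = 0 := by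
    rw [map_sub, sub_smul, ← h2, map_one, one_smul, sub_self]
  have h5 := congrArg ((PowerSeries.C (((chi w t : ℂˣ) : ℂ) - 1)⁻¹ : Ch) • ·) h4
  simpa only [smul_smul, ← map_mul, inv_mul_cancel₀ h3, map_one, one_smul, smul_zero] using h5

theorem rey_of_mem {d : Weyl E} (hd : d ∈ qinv E b H) : rey E b H d = d := by
  conv_rhs => rw [← wmap_one (b := b) d]
  rw [rey, wmap_apply, wmap_apply]
  refine Finset.sum_congr rfl fun w _ => ?_
  by_cases hw : ∀ t ∈ H, chi w t = 1
  · simp only [if_pos hw]; rfl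
  · rw [coeff_coact_eq_zero hd hw]
    simp only [smul_zero]

/-! Symbols of weight vectors. -/

/-- The symbol map intertwines the quantum and the classical coaction, since it does so on
generators. -/
theorem ccoact_symb (d : Weyl E) (w : Fin m → ℤ) :
    (ccoact E (wt b) (Hypertoric.symb E d)).coeff w = Hypertoric.symb E ((coact E b d).coeff w) := by
  let φ : AddMonoidAlgebra (Weyl E) (Fin m → ℤ) →+* AddMonoidAlgebra (Fun E) (Fin m → ℤ) :=
    AddMonoidAlgebra.mapRingHom _ (Hypertoric.symb E)
  have hφ : ∀ w a, φ (AddMonoidAlgebra.single w a) =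
      AddMonoidAlgebra.single w (Hypertoric.symb E a) := fun w a => by simp [φ]
  have key : ∀ d, ccoact E (wt b) (Hypertoric.symb E d) = φ (coact E b d) := by
    intro d
    have hcoord : ∀ c, ccoact E (wt b) (Hypertoric.symb E (gen E (Gen.coord c))) =
        φ (coact E b (gen E (Gen.coord c))) := fun c => by
      rw [(IsWt.coord c).1, hφ, show gen E (Gen.coord c) = qc E c from rfl, symb_qc,
        (CWt.cf c).1]
    induction d using weyl_induction with
    | hC f =>
      rw [(IsWt.algebraMap f).1, hφ, isSpec_symb, (CWt.algebraMap _).1]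
    | hX a =>
      rcases a with c | ⟨c, hc⟩
      · exact hcoord c
      · rw [(IsWt.inv c hc).1, hφ]
        refine (CWt.inv (CWt.cf c) ?_).1
        rw [← symb_qc, ← map_mul, qc, gen_mul_inv, map_one]
    | hadd d d' h h' => simp only [map_add, h, h']
    | hmul d d' h h' => simp only [map_mul, h, h']
  rw [key]
  simp [φ]

theorem ccoact_scale (t : Torus m) (f : Fun E) (w : Fin m → ℤ) :
    (ccoact E (wt b) (scale E (tscale b t) f)).coeff w =
      ((chi w t : ℂˣ) : ℂ) • (ccoact E (wt b) f).coeff w := by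
  obtain ⟨d, rfl⟩ := symb_surjective E f
  rw [← symb_qact, ccoact_symb, ccoact_symb, coeff_coact_qact, Algebra.smul_def, map_mul,
    isSpec_symb, Algebra.smul_def]
  simp

/-- The projection to the invariants is compatible with the symbol. -/
theorem symb_rey_of_mem {d : Weyl E} (h : Hypertoric.symb E d ∈ invSub E b H) :
    Hypertoric.symb E (rey E b H d) = Hypertoric.symb E d := by
  conv_rhs => rw [← wmap_one (b := b) d]
  rw [rey, wmap_apply, wmap_apply, Finsupp.sum, Finsupp.sum, map_sum, map_sum]
  refine Finset.sum_congr rfl fun w _ => ?_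
  by_cases hw : ∀ t ∈ H, chi w t = 1
  · simp only [if_pos hw]; rfl
  -- The components of nontrivial weight need not vanish in the Weyl algebra, since only the symbol
  -- is assumed invariant. Their symbols do vanish.
  · have h0 : Hypertoric.symb E ((coact E b d).coeff w) = 0 := by
      rw [← ccoact_symb]
      push Not at hw
      obtain ⟨t, ht, h1⟩ := hw
      have h2 := ccoact_scale (b := b) t (Hypertoric.symb E d) w
      rw [h t ht] at h2
      have h3 : (((chi w t : ℂˣ) : ℂ) - 1) ≠ 0 := by
        rw [sub_ne_zero]
        intro h
        exact h1 (Units.ext h)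
      refine (smul_eq_zero.mp ?_).resolve_left h3
      rw [sub_smul, one_smul, ← h2, sub_self]
    rw [Algebra.smul_def, Algebra.smul_def, map_mul, map_mul, h0, mul_zero, mul_zero]

theorem symb_mem_inv {d : Weyl E} (h : d ∈ qinv E b H) : Hypertoric.symb E d ∈ invSub E b H := by
  intro t ht
  rw [← symb_qact, h t ht]

end QuantumWeights

/-! ## The quantum Hamiltonian reduction -/

section Reduction

variable {ι : Type} [DecidableEq ι] [Fintype ι] {E : Set (Coord ι)} {m : ℕ} {b : ι → Fin m → ℤ}

variable (b) in
theorem qmom_commutator_coord (ξ : Fin m → ℂ) (c : Coord ι) :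
    qmom E b ξ * qc E c - qc E c * qmom E b ξ =
      hbar _ * ((PowerSeries.C (pair (wt b c) ξ) : Ch) • qc E c) := by
  have h : ∀ c c' : Coord ι, qc E c * qc E c' = qc E c' * qc E c + omega c c' • hbar (Weyl E) :=
    gen_comm E
  rw [qmom, Finset.sum_mul, Finset.mul_sum, ← Finset.sum_sub_distrib]
  have key : ∀ i, qc E (Sum.inl i) * qc E (Sum.inr i) * qc E c -
      qc E c * (qc E (Sum.inl i) * qc E (Sum.inr i)) =
      hbar (Weyl E) * (omega (Sum.inr i) c • qc E (Sum.inl i) +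
        omega (Sum.inl i) c • qc E (Sum.inr i)) := by
    intro i
    have e : qc E (Sum.inl i) * qc E (Sum.inr i) * qc E c -
      qc E c * (qc E (Sum.inl i) * qc E (Sum.inr i)) =
      qc E (Sum.inl i) * (qc E (Sum.inr i) * qc E c - qc E c * qc E (Sum.inr i)) +
        (qc E (Sum.inl i) * qc E c - qc E c * qc E (Sum.inl i)) * qc E (Sum.inr i) := by
      noncomm_ring
    rw [e, h (Sum.inr i) c, h (Sum.inl i) c, add_sub_cancel_left, add_sub_cancel_left, mul_add,
      mul_smul_comm, mul_smul_comm, mul_smul_comm, smul_mul_assoc, hbar_mul_comm, hbar_mul_comm]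
  have key' : ∀ i, (PowerSeries.C (pair (b i) ξ) : Ch) • (qc E (Sum.inl i) * qc E (Sum.inr i)) *
      qc E c - qc E c * (PowerSeries.C (pair (b i) ξ) : Ch) • (qc E (Sum.inl i) * qc E (Sum.inr i)) =
      (PowerSeries.C (pair (b i) ξ) : Ch) • (hbar (Weyl E) *
        (omega (Sum.inr i) c • qc E (Sum.inl i) + omega (Sum.inl i) c • qc E (Sum.inr i))) :=
    fun i => by rw [smul_mul_assoc, mul_smul_comm, ← smul_sub, key]
  rw [Finset.sum_congr rfl fun i _ => key' i]
  rcases c with j | j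
  · rw [Finset.sum_eq_single j]
    · simp [omega, wt]
    · intro i _ hi; simp [omega, hi]
    · simp
  · rw [Finset.sum_eq_single j]
    · simp only [omega, wt, Sum.elim_inr, pair_neg, map_neg]
      simp
    · intro i _ hi; simp [omega, hi]
    · simp

theorem isWt_qmom (ξ : Fin m → ℂ) : IsWt E b 0 (qmom E b ξ) := by
  rw [qmom]
  refine Finset.sum_induction _ (IsWt E b 0) (fun _ _ => IsWt.add) (IsWt.zero 0) fun i _ => ?_
  have := (IsWt.coord (E := E) (b := b) (Sum.inl i)).mul (IsWt.coord (Sum.inr i))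
  rw [show wt b (Sum.inl i) + wt b (Sum.inr i) = 0 by simp [wt]] at this
  exact this.smul _

/-- The derivation of the Weyl algebra by which `ξ` acts on the components of weight `w` as
`⟨w, ξ⟩`. -/
theorem wmap_pair_mul (ξ : Fin m → ℂ) (d d' : Weyl E) :
    wmap E b (fun w => pair w ξ) (d * d') =
      wmap E b (fun w => pair w ξ) d * d' + d * wmap E b (fun w => pair w ξ) d' := by
  induction d using wt_induction b with
  | hadd d₁ d₂ h₁ h₂ => rw [add_mul, map_add, h₁, h₂, map_add]; noncomm_ring
  | hw w d h =>
    induction d' using wt_induction b with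
    | hadd d₁ d₂ h₁ h₂ => rw [mul_add, map_add, h₁, h₂, map_add]; noncomm_ring
    | hw w' d' h' =>
      rw [wmap_isWt _ h, wmap_isWt _ h', wmap_isWt _ (h.mul h'), pair_add, map_add, add_smul,
        smul_mul_assoc, mul_smul_comm]

/-- Both sides are derivations in $d$ (the right one by `wmap_pair_mul`), so it suffices to compare
them on coordinates and, by conjugation, on their inverses. -/
theorem qmom_commutator (ξ : Fin m → ℂ) (d : Weyl E) :
    qmom E b ξ * d - d * qmom E b ξ = hbar _ * wmap E b (fun w => pair w ξ) d := by
  induction d using weyl_induction with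
  | hC f =>
    rw [Algebra.commutes, sub_self, wmap_isWt _ (IsWt.algebraMap f)]
    simp [pair]
  | hX a =>
    have h1 : ∀ c, qmom E b ξ * gen E (Gen.coord c) - gen E (Gen.coord c) * qmom E b ξ =
        hbar _ * wmap E b (fun w => pair w ξ) (gen E (Gen.coord c)) := fun c => by
      rw [wmap_isWt _ (IsWt.coord c)]
      exact qmom_commutator_coord b ξ c
    rcases a with c | ⟨c, hc⟩
    · exact h1 c
    · have h2 := h1 c
      rw [wmap_isWt _ (IsWt.inv c hc)]
      rw [wmap_isWt _ (IsWt.coord c)] at h2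
      set q := qmom E b ξ
      set x := gen E (Gen.coord c)
      set g := gen E (Gen.inv c hc)
      have e1 : x * g = 1 := gen_mul_inv E c hc
      have e2 : g * x = 1 := gen_inv_mul E c hc
      have e3 : q * g - g * q = -(g * (q * x - x * q) * g) := by
        have : g * (q * x - x * q) * g = g * q * (x * g) - (g * x) * q * g := by noncomm_ring
        rw [this, e1, e2]; noncomm_ring
      rw [e3, h2, mul_smul_comm, mul_smul_comm, smul_mul_assoc, mul_smul_comm, pair_neg, map_neg,
        neg_smul, ← mul_assoc g, ← hbar_mul_comm, mul_assoc, mul_assoc, e1, mul_one]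
  | hadd f g hf hg =>
    rw [map_add, mul_add (hbar _), ← hf, ← hg]; noncomm_ring
  | hmul f g hf hg =>
    have : qmom E b ξ * (f * g) - f * g * qmom E b ξ =
      (qmom E b ξ * f - f * qmom E b ξ) * g + f * (qmom E b ξ * g - g * qmom E b ξ) := by
      noncomm_ring
    rw [this, hf, hg, wmap_pair_mul, mul_add, ← mul_assoc, ← mul_assoc, ← mul_assoc,
      hbar_mul_comm f]

variable {H : Subgroup (Torus m)}

/-- An invariant is a sum of components whose weights are trivial on $H$, and
$\xi\in\operatorname{Lie}H$ pairs to zero with those weights, so the commutator vanishes. This is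
why the invariants in the right ideal form a two-sided ideal. -/
theorem qmom_mul_of_mem {ξ : Fin m → ℂ} (hξ : ξ ∈ lie H) {d : Weyl E} (hd : d ∈ qinv E b H) :
    qmom E b ξ * d = d * qmom E b ξ := by
  rw [← sub_eq_zero, qmom_commutator, ← rey_of_mem hd]
  clear hd
  have : wmap E b (fun w => pair w ξ) (rey E b H d) = 0 := by
    induction d using wt_induction b with
    | hadd d d' h h' => rw [map_add, map_add, h, h', add_zero]
    | hw w d h =>
      by_cases hw : ∀ t ∈ H, chi w t = 1
      · rw [rey_of_triv hw h, wmap_isWt _ h, hξ w hw, map_zero, zero_smul]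
      · rw [rey_of_nontriv hw h, map_zero]
  rw [this, mul_zero]

theorem qmomIdeal_mul {a : Weyl E} (ha : a ∈ qmomIdeal E b H) (d : Weyl E) :
    a * d ∈ qmomIdeal E b H := by
  induction ha using Submodule.span_induction with
  | mem x hx =>
    obtain ⟨ξ, hξ, d', rfl⟩ := hx
    exact Submodule.subset_span ⟨ξ, hξ, d' * d, mul_assoc _ _ _⟩
  | zero => rw [zero_mul]; exact zero_mem _
  | add x y _ _ hx hy => rw [add_mul]; exact add_mem hx hy
  | smul f x _ hx => rw [smul_mul_assoc]; exact Submodule.smul_mem _ _ hx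

theorem mul_qmomIdeal {a d : Weyl E} (hd : d ∈ qinv E b H) (ha : a ∈ qmomIdeal E b H) :
    d * a ∈ qmomIdeal E b H := by
  induction ha using Submodule.span_induction with
  | mem x hx =>
    obtain ⟨ξ, hξ, d', rfl⟩ := hx
    exact Submodule.subset_span ⟨ξ, hξ, d * d', by
      rw [← mul_assoc, ← qmom_mul_of_mem hξ hd, mul_assoc]⟩
  | zero => rw [mul_zero]; exact zero_mem _
  | add x y _ _ hx hy => rw [mul_add]; exact add_mem hx hy
  | smul f x _ hx => rw [mul_smul_comm]; exact Submodule.smul_mem _ _ hx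

/-- Since $\mu_q(\xi)$ has weight zero, the projection acts only on the second factor of
$\mu_q(\xi)d$. -/
theorem rey_mem_qmomIdeal {a : Weyl E} (ha : a ∈ qmomIdeal E b H) :
    rey E b H a ∈ qmomIdeal E b H := by
  induction ha using Submodule.span_induction with
  | mem x hx =>
    obtain ⟨ξ, hξ, d, rfl⟩ := hx
    induction d using wt_induction b with
    | hadd d d' h h' => rw [mul_add, map_add]; exact add_mem h h'
    | hw w d h =>
      have hd : IsWt E b w (qmom E b ξ * d) := by simpa using (isWt_qmom ξ).mul h
      by_cases hw : ∀ t ∈ H, chi w t = 1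
      · rw [rey_of_triv hw hd]
        exact Submodule.subset_span ⟨ξ, hξ, d, rfl⟩
      · rw [rey_of_nontriv hw hd]; exact zero_mem _
  | zero => rw [map_zero]; exact zero_mem _
  | add x y _ _ hx hy => rw [map_add]; exact add_mem hx hy
  | smul f x _ hx => rw [map_smul]; exact Submodule.smul_mem _ _ hx

variable (E b H) in
/-- The two-sided ideal `(Weyl E)^H ∩ μ_q(Lie H) Weyl E` of the algebra of invariants. -/
def qredIdeal : Ideal (qinv E b H) where
  carrier := {a | (a : Weyl E) ∈ qmomIdeal E b H}
  add_mem' := fun ha hb => (qmomIdeal E b H).add_mem ha hb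
  zero_mem' := zero_mem (qmomIdeal E b H)
  smul_mem' := fun c a ha => mul_qmomIdeal c.2 ha

theorem mem_qredIdeal {a : qinv E b H} : a ∈ qredIdeal E b H ↔ (a : Weyl E) ∈ qmomIdeal E b H :=
  Iff.rfl

instance : (qredIdeal E b H).IsTwoSided :=
  ⟨fun {a} c ha => mem_qredIdeal.mpr (qmomIdeal_mul (mem_qredIdeal.mp ha) (c : Weyl E))⟩

/-- The invariants in the right ideal already form a two-sided ideal `qredIdeal`, so the quotient by
the generated relation adds nothing; a map to the quotient by `qredIdeal` detects this. -/
theorem qmk_eq_zero {a : qinv E b H} : qmk E b H a = 0 ↔ (a : Weyl E) ∈ qmomIdeal E b H := by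
  constructor
  · intro h
    let φ : QRed E b H →+* qinv E b H ⧸ qredIdeal E b H :=
      RingQuot.lift ⟨Ideal.Quotient.mk (qredIdeal E b H), by
        rintro a _ ⟨ha⟩
        rw [map_zero]
        exact Ideal.Quotient.eq_zero_iff_mem.mpr (mem_qredIdeal.mpr ha)⟩
    have h1 : φ (qmk E b H a) = Ideal.Quotient.mk (qredIdeal E b H) a := by
      have : qmk E b H a = RingQuot.mkRingHom (RedRel E b H) a := by
        rw [qmk, ← RingQuot.mkAlgHom_coe Ch]; rfl
      rw [this]
      exact RingQuot.lift_mkRingHom_apply _ _ _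
    rw [h, map_zero] at h1
    exact mem_qredIdeal.mp (Ideal.Quotient.eq_zero_iff_mem.mp h1.symm)
  · intro h
    exact (RingQuot.mkAlgHom_rel Ch (RedRel.zero a h)).trans (map_zero _)

theorem qmk_surjective : Function.Surjective (qmk E b H) := RingQuot.mkAlgHom_surjective Ch _

/-- The projection to the invariants, followed by the projection to the reduction. -/
def qmkRey : Weyl E →ₗ[Ch] QRed E b H :=
  (qmk E b H).toLinearMap ∘ₗ
    (rey E b H).codRestrict (Subalgebra.toSubmodule (qinv E b H)) rey_mem

theorem qmkRey_coe (d : qinv E b H) : qmkRey (d : Weyl E) = qmk E b H d := by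
  change qmk E b H ⟨rey E b H d, _⟩ = _
  congr 1
  exact Subtype.ext (rey_of_mem d.2)

theorem qmkRey_of_mem {d : Weyl E} (hd : d ∈ qinv E b H) : qmkRey d = qmk E b H ⟨d, hd⟩ :=
  qmkRey_coe ⟨d, hd⟩

theorem qmkRey_eq_zero {a : Weyl E} (ha : a ∈ qmomIdeal E b H) :
    qmkRey (H := H) (b := b) a = 0 :=
  qmk_eq_zero.mpr (rey_mem_qmomIdeal ha)

theorem qmkRey_of_triv {w : Fin m → ℤ} (hw : ∀ t ∈ H, chi w t = 1) {d : Weyl E}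
    (h : IsWt E b w d) : ∃ hd : d ∈ qinv E b H, qmkRey d = qmk E b H ⟨d, hd⟩ := by
  have hd : d ∈ qinv E b H := by rw [← rey_of_triv hw h]; exact rey_mem d
  exact ⟨hd, qmkRey_of_mem hd⟩

theorem qmkRey_of_nontriv {w : Fin m → ℤ} (hw : ¬ ∀ t ∈ H, chi w t = 1) {d : Weyl E}
    (h : IsWt E b w d) : qmkRey (H := H) (b := b) d = 0 := by
  have : (⟨rey E b H d, rey_mem d⟩ : qinv E b H) = 0 := Subtype.ext (rey_of_nontriv hw h)
  change qmk E b H ⟨rey E b H d, rey_mem d⟩ = 0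
  rw [this, map_zero]

theorem exists_symb_of_mem_momIdeal {f : Fun E} (hf : f ∈ momIdeal E b H) :
    ∃ a ∈ qmomIdeal E b H, symb E a = f := by
  induction hf using Submodule.span_induction with
  | mem x hx =>
    obtain ⟨ξ, hξ, rfl⟩ := hx
    exact ⟨qmom E b ξ, Submodule.subset_span ⟨ξ, hξ, 1, (mul_one _).symm⟩, symb_qmom E b ξ⟩
  | zero => exact ⟨0, zero_mem _, map_zero _⟩
  | add x y _ _ hx hy =>
    obtain ⟨a, ha, rfl⟩ := hx
    obtain ⟨a', ha', rfl⟩ := hy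
    exact ⟨a + a', add_mem ha ha', map_add _ _ _⟩
  | smul r x _ hx =>
    obtain ⟨a, ha, rfl⟩ := hx
    obtain ⟨d, rfl⟩ := symb_surjective E r
    exact ⟨a * d, qmomIdeal_mul ha d, by rw [map_mul, smul_eq_mul, mul_comm]⟩

theorem redMk_eq_zero_iff {f : invSub E b H} : redMk E b H f = 0 ↔ (f : Fun E) ∈ momIdeal E b H :=
  Ideal.Quotient.eq_zero_iff_mem (I := redIdeal E b H)

theorem redMk_surjective : Function.Surjective (redMk E b H) := Ideal.Quotient.mk_surjective

theorem symbRed_qmk_eq (d : qinv E b H) : symbRed E b H (qmk E b H d) =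
    redMk E b H ⟨symb E (d : Weyl E), symb_mem_inv d.2⟩ := symbRed_qmk E b H d

theorem exists_invariant_lift (f : invSub E b H) : ∃ d : qinv E b H, symb E (d : Weyl E) = f := by
  obtain ⟨d, hd⟩ := symb_surjective E (f : Fun E)
  refine ⟨⟨rey E b H d, rey_mem d⟩, ?_⟩
  rw [← hd]
  exact symb_rey_of_mem (by rw [hd]; exact f.2)

theorem symbRed_surjective : Function.Surjective (symbRed E b H) := by
  intro r
  obtain ⟨f, rfl⟩ := redMk_surjective r
  obtain ⟨d, hd⟩ := exists_invariant_lift f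
  exact ⟨qmk E b H d, by rw [symbRed_qmk_eq]; congr 1; exact Subtype.ext hd⟩

/-- A symbol in the classical ideal is the symbol of an element of the quantum ideal. Subtracting
that element leaves a multiple $\hbar w$; here $w$ need not be invariant, and `qmkRey` replaces it
by its invariant part. -/
theorem symbRed_eq_zero {q : QRed E b H} : symbRed E b H q = 0 ↔ ∃ q', q = hbar _ * q' := by
  constructor
  · obtain ⟨d, rfl⟩ := qmk_surjective q
    intro h
    rw [symbRed_qmk_eq] at h
    have h1 : symb E (d : Weyl E) ∈ momIdeal E b H := redMk_eq_zero_iff.mp h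
    obtain ⟨a, ha, hs⟩ := exists_symb_of_mem_momIdeal h1
    obtain ⟨w, hw⟩ := (symb_eq_iff E).mp hs.symm
    refine ⟨qmkRey w, ?_⟩
    rw [← qmkRey_coe, hw, map_add, qmkRey_eq_zero ha, zero_add, hbar, hbar, ← Algebra.smul_def,
      map_smul, Algebra.smul_def]
  · rintro ⟨q', rfl⟩
    rw [map_mul, hbar, isSpec_symbRed]
    simp

theorem symbRed_qmkRey {w : Weyl E} (h : symb E w ∈ invSub E b H) :
    symbRed E b H (qmkRey w) = redMk E b H ⟨symb E w, h⟩ := by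
  change symbRed E b H (qmk E b H ⟨rey E b H w, rey_mem w⟩) = _
  rw [symbRed_qmk_eq]
  congr 1
  exact Subtype.ext (symb_rey_of_mem h)

/-- The commutator of two invariants is $\hbar w$, where $w$ is determined only up to torsion and is
not known to be invariant. Its symbol is an invariant bracket, so projecting $w$ to the invariants
keeps the symbol. -/
theorem qred_commutator (q q' : QRed E b H) : ∃ c, q * q' - q' * q = hbar _ * c ∧
    symbRed E b H c = redBrk E b H (symbRed E b H q) (symbRed E b H q') := by
  obtain ⟨d, rfl⟩ := qmk_surjective q
  obtain ⟨d', rfl⟩ := qmk_surjective q'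
  obtain ⟨w, h1, h2⟩ := commBrk (E := E) (d : Weyl E) d'
  have h3 : symb E w ∈ invSub E b H := by
    rw [h2]; exact brk_mem_inv E b H (symb_mem_inv d.2) (symb_mem_inv d'.2)
  refine ⟨qmkRey w, ?_, ?_⟩
  · rw [← map_mul, ← map_mul, ← map_sub, ← qmkRey_coe]
    change qmkRey ((d : Weyl E) * (d' : Weyl E) - (d' : Weyl E) * (d : Weyl E)) = _
    rw [h1, hbar, hbar, ← Algebra.smul_def, map_smul, Algebra.smul_def]
  · rw [symbRed_qmkRey h3, symbRed_qmk_eq, symbRed_qmk_eq, redBrk_mk]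
    congr 1
    exact Subtype.ext h2

end Reduction

/-! ## Flatness over the polynomials in the products `xᵢ yᵢ` -/

section Flatness

variable {ι : Type} [Fintype ι]

/-- The exponent of the largest power of the products `xᵢ yᵢ` which divides a monomial. -/
def expMin (d : Coord ι →₀ ℕ) : ι →₀ ℕ :=
  Finsupp.equivFunOnFinite.symm fun i => min (d (Sum.inl i)) (d (Sum.inr i))

/-- The exponent which remains when the products `xᵢ yᵢ` are divided out. -/
def expRed (d : Coord ι →₀ ℕ) : Coord ι →₀ ℕ :=
  Finsupp.equivFunOnFinite.symm fun c => d c - expMin d (Sum.elim id id c)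

theorem expMin_apply (d : Coord ι →₀ ℕ) (i : ι) :
    expMin d i = min (d (Sum.inl i)) (d (Sum.inr i)) := rfl

theorem expRed_apply (d : Coord ι →₀ ℕ) (c : Coord ι) :
    expRed d c = d c - expMin d (Sum.elim id id c) := rfl

/-- The exponent of `xᵢ yᵢ`. -/
def expProd (i : ι) : Coord ι →₀ ℕ := Finsupp.single (Sum.inl i) 1 + Finsupp.single (Sum.inr i) 1

theorem expProd_apply [DecidableEq ι] (i : ι) (c : Coord ι) :
    expProd i c = if Sum.elim id id c = i then 1 else 0 := by
  classical
  rcases c with j | j <;> simp [expProd, Finsupp.single_apply, eq_comm]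

theorem expMin_add (i : ι) (d : Coord ι →₀ ℕ) :
    expMin (expProd i + d) = Finsupp.single i 1 + expMin d := by
  classical
  ext j
  rw [expMin_apply, Finsupp.add_apply, Finsupp.add_apply, Finsupp.add_apply, expProd_apply,
    expProd_apply, Finsupp.single_apply, expMin_apply, Sum.elim_inl, Sum.elim_inr, id]
  rcases eq_or_ne j i with rfl | h
  · simp only [if_true]; omega
  · rw [if_neg h, if_neg h.symm]; omega

theorem expRed_add (i : ι) (d : Coord ι →₀ ℕ) : expRed (expProd i + d) = expRed d := by
  classical
  ext c
  rw [expRed_apply, expRed_apply, expMin_add, Finsupp.add_apply, Finsupp.add_apply, expProd_apply,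
    Finsupp.single_apply]
  simp only [eq_comm (a := i)]
  by_cases h : Sum.elim id id c = i
  · simp only [if_pos h]; omega
  · simp only [if_neg h]; omega

/-- The inclusion of the polynomials in the products `xᵢ yᵢ`. -/
def prodHom : MvPolynomial ι ℂ →ₐ[ℂ] MvPolynomial (Coord ι) ℂ :=
  MvPolynomial.aeval fun i => MvPolynomial.X (Sum.inl i) * MvPolynomial.X (Sum.inr i)

theorem prodHom_X (i : ι) :
    prodHom (MvPolynomial.X i) = MvPolynomial.monomial (expProd i) (1 : ℂ) := by
  rw [prodHom, MvPolynomial.aeval_X, MvPolynomial.X, MvPolynomial.X, MvPolynomial.monomial_mul,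
    mul_one]
  rfl

/-- The coordinates with respect to the basis of the polynomial ring over the polynomials in
the products `xᵢ yᵢ` given by monomials. -/
def prodCoord :
    MvPolynomial (Coord ι) ℂ →ₗ[ℂ] ((Coord ι →₀ ℕ) →₀ MvPolynomial ι ℂ) :=
  (MvPolynomial.basisMonomials (Coord ι) ℂ).constr ℂ fun d =>
    Finsupp.single (expRed d) (MvPolynomial.monomial (expMin d) 1)

theorem prodCoord_monomial (d : Coord ι →₀ ℕ) : prodCoord (MvPolynomial.monomial d (1 : ℂ)) =
    Finsupp.single (expRed d) (MvPolynomial.monomial (expMin d) 1) := by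
  have := (MvPolynomial.basisMonomials (Coord ι) ℂ).constr_basis ℂ (fun d =>
    Finsupp.single (expRed d) (MvPolynomial.monomial (expMin d) (1 : ℂ))) d
  rwa [MvPolynomial.coe_basisMonomials] at this

theorem poly_linear_induction {σ : Type*} {P : MvPolynomial σ ℂ → Prop}
    (hadd : ∀ f g, P f → P g → P (f + g)) (hsmul : ∀ (a : ℂ) f, P f → P (a • f))
    (hmon : ∀ d, P (MvPolynomial.monomial d 1)) (f : MvPolynomial σ ℂ) : P f := by
  induction f using MvPolynomial.induction_on' with
  | monomial d a =>
    have := hsmul a _ (hmon d)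
    rwa [MvPolynomial.smul_monomial, smul_eq_mul, mul_one] at this
  | add p q hp hq => exact hadd _ _ hp hq

/-- Multiplication by $x_iy_i$ raises `expMin` and leaves `expRed` unchanged. Together with
`prodCoord_sum` this is the coordinate form of freeness: the monomials divisible by no $x_iy_i$
serve as a basis. -/
theorem prodCoord_mul (p : MvPolynomial ι ℂ) (f : MvPolynomial (Coord ι) ℂ) :
    prodCoord (prodHom p * f) = p • prodCoord f := by
  induction p using MvPolynomial.induction_on generalizing f with
  | C a =>
    rw [← MvPolynomial.algebraMap_eq, AlgHom.commutes, ← Algebra.smul_def, map_smul,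
      algebraMap_smul]
  | add p q hp hq => rw [map_add, add_mul, map_add, hp, hq, add_smul]
  | mul_X p i hp =>
    rw [map_mul prodHom, mul_assoc, hp, mul_smul]
    congr 1
    induction f using poly_linear_induction with
    | hadd f g hf hg => rw [mul_add, map_add, hf, hg, map_add, smul_add]
    | hsmul a f hf => rw [mul_smul_comm, map_smul, hf, map_smul, smul_comm]
    | hmon d =>
      rw [prodHom_X, MvPolynomial.monomial_mul, mul_one, prodCoord_monomial, prodCoord_monomial,
        expMin_add, expRed_add, Finsupp.smul_single, smul_eq_mul, MvPolynomial.X,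
        MvPolynomial.monomial_mul, mul_one]

theorem expProd_sum (d : Coord ι →₀ ℕ) :
    (∑ i, expMin d i • expProd i) + expRed d = d := by
  classical
  ext c
  rw [Finsupp.add_apply, Finsupp.finsetSum_apply, expRed_apply]
  simp only [Finsupp.smul_apply, expProd_apply, smul_eq_mul, mul_ite, mul_one, mul_zero]
  rw [Finset.sum_ite_eq, if_pos (Finset.mem_univ _)]
  rcases c with j | j <;> simp [expMin_apply]

theorem prodCoord_sum (f : MvPolynomial (Coord ι) ℂ) :
    (prodCoord f).sum (fun k p => prodHom p * MvPolynomial.monomial k 1) = f := by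
  induction f using poly_linear_induction with
  | hadd f g hf hg =>
    rw [map_add, Finsupp.sum_add_index' (by simp) (by intros; rw [map_add, add_mul]), hf, hg]
  | hsmul a f hf =>
    rw [map_smul, Finsupp.sum_smul_index' (by simp)]
    conv_rhs => rw [← hf, Finsupp.smul_sum]
    exact Finsupp.sum_congr fun k _ => by rw [map_smul, smul_mul_assoc]
  | hmon d =>
    rw [prodCoord_monomial, Finsupp.sum_single_index (by simp)]
    have h : prodHom (MvPolynomial.monomial (expMin d) (1 : ℂ)) =
        MvPolynomial.monomial (∑ i, expMin d i • expProd i) 1 := by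
      rw [MvPolynomial.monomial_eq, map_one, one_mul, Finsupp.prod_fintype _ _ (by simp), map_prod,
        MvPolynomial.monomial_sum_one]
      exact Finset.prod_congr rfl fun i _ => by
        rw [map_pow, prodHom_X, MvPolynomial.monomial_pow, one_pow]
    rw [h, MvPolynomial.monomial_mul, mul_one, expProd_sum]

variable (E : Set (Coord ι))

/-- A polynomial in the products `xᵢ yᵢ` as a function. -/
def prodFun : MvPolynomial ι ℂ →+* Fun E := (algebraMap _ (Fun E)).comp prodHom.toRingHom

/-- Functions are flat over the polynomials in the products `xᵢ yᵢ`. -/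
theorem prodFun_relation {J : Type} [Fintype J] (L : J → MvPolynomial ι ℂ) (f : J → Fun E)
    (h : ∑ j, prodFun E (L j) * f j = 0) :
    ∃ (K : Finset (Coord ι →₀ ℕ)) (p : J → (Coord ι →₀ ℕ) → MvPolynomial ι ℂ)
      (g : (Coord ι →₀ ℕ) → Fun E), (∀ j, f j = ∑ k ∈ K, prodFun E (p j k) * g k) ∧
        ∀ k, ∑ j, L j * p j k = 0 := by
  classical
  -- A common denominator $s$ reduces the relation to polynomial numerators $q_j$.
  obtain ⟨s, hs⟩ := IsLocalization.exist_integer_multiples_of_finite (mulSet E) f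
  choose q hq using hs
  obtain ⟨v, hv⟩ := (IsLocalization.map_units (Fun E) s).exists_right_inv
  have hinj : Function.Injective (algebraMap (MvPolynomial (Coord ι) ℂ) (Fun E)) :=
    IsLocalization.injective _ (mulSet_le E)
  have hq' : ∀ j, algebraMap _ (Fun E) (q j) =
      algebraMap _ (Fun E) (s : MvPolynomial (Coord ι) ℂ) * f j := fun j => by
    rw [hq, Algebra.smul_def]
  have hf : ∀ j, f j = algebraMap _ (Fun E) (q j) * v := fun j => by
    rw [hq', mul_comm, ← mul_assoc, mul_comm v, hv, one_mul]
  have h0 : ∑ j, prodHom (L j) * q j = 0 := by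
    apply hinj
    rw [map_sum, map_zero]
    calc _ = algebraMap _ (Fun E) (s : MvPolynomial (Coord ι) ℂ) *
        ∑ j, prodFun E (L j) * f j := by
          rw [Finset.mul_sum]
          refine Finset.sum_congr rfl fun j _ => ?_
          rw [map_mul, hq']
          change prodFun E (L j) * _ = _
          ring
      _ = 0 := by rw [h, mul_zero]
  -- The coefficients $p_{jk}$ are the coordinates of $q_j$, and the functions $g_k$ are monomials
  -- divided by $s$. By linearity of `prodCoord` the relation holds coordinate by coordinate.
  refine ⟨Finset.univ.biUnion fun j => (prodCoord (q j)).support, fun j k => prodCoord (q j) k,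
    fun k => algebraMap _ (Fun E) (MvPolynomial.monomial k (1 : ℂ)) * v, fun j => ?_, fun k => ?_⟩
  · rw [hf]
    conv_lhs => rw [← prodCoord_sum (q j)]
    rw [Finsupp.sum_of_support_subset _ (Finset.subset_biUnion_of_mem
      (fun j => (prodCoord (q j)).support) (Finset.mem_univ j)) _ (by simp), map_sum,
      Finset.sum_mul]
    exact Finset.sum_congr rfl fun k _ => by rw [map_mul, mul_assoc]; rfl
  · have := congrArg (fun c => prodCoord c k) h0
    simp only [map_sum, prodCoord_mul] at this
    rw [Finsupp.finsetSum_apply, map_zero] at this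
    simpa using this

end Flatness

/-! ## The `ħ`-torsion of the reduction -/

section Torsion

variable {ι : Type} [DecidableEq ι] [Fintype ι] {E : Set (Coord ι)} {m : ℕ} {b : ι → Fin m → ℤ}

variable (E) in
theorem qc_prod_comm (i j : ι) : Commute (qc E (Sum.inl i) * qc E (Sum.inr i))
    (qc E (Sum.inl j) * qc E (Sum.inr j)) := by
  by_cases hij : i = j
  · rw [hij]
  · have h : ∀ c c' : Coord ι, omega c c' = 0 → Commute (qc E c) (qc E c') := fun c c' h => by
      have := gen_comm E c c'
      rw [h, zero_smul, add_zero] at this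
      exact this
    refine Commute.mul_left (Commute.mul_right (h _ _ ?_) (h _ _ ?_))
      (Commute.mul_right (h _ _ ?_) (h _ _ ?_)) <;> simp [omega, hij]

-- Because the products $x_iy_i$ commute with one another, polynomials in them lift to the Weyl
-- algebra by a ring homomorphism. The components of `qmom` are the images of linear forms, so
-- polynomial relations between those forms hold exactly in the Weyl algebra.
variable (E) in
theorem exists_prodWeyl : ∃ φ : MvPolynomial ι ℂ →+* Weyl E,
    (∀ i, φ (MvPolynomial.X i) = qc E (Sum.inl i) * qc E (Sum.inr i)) ∧
      ∀ a, φ (MvPolynomial.C a) = algebraMap Ch _ (PowerSeries.C a) := by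
  let s : Set (Weyl E) := Set.range fun i => qc E (Sum.inl i) * qc E (Sum.inr i)
  have : IsMulCommutative (Algebra.adjoin Ch s) := Algebra.isMulCommutative_adjoin Ch (by
    rintro _ ⟨i, rfl⟩ _ ⟨j, rfl⟩
    exact qc_prod_comm E i j)
  let _ : CommRing (Algebra.adjoin Ch s) :=
    { (inferInstance : Ring (Algebra.adjoin Ch s)) with mul_comm := this.is_comm.comm }
  let φ : MvPolynomial ι ℂ →+* Algebra.adjoin Ch s := MvPolynomial.eval₂Hom
    ((algebraMap Ch (Algebra.adjoin Ch s)).comp PowerSeries.C)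
    fun i => ⟨_, Algebra.subset_adjoin ⟨i, rfl⟩⟩
  refine ⟨(Algebra.adjoin Ch s).val.toRingHom.comp φ, fun i => ?_, fun a => ?_⟩
  · change ((φ (MvPolynomial.X i) : Algebra.adjoin Ch s) : Weyl E) = _
    rw [MvPolynomial.coe_eval₂Hom, MvPolynomial.eval₂_X]
  · change ((φ (MvPolynomial.C a) : Algebra.adjoin Ch s) : Weyl E) = _
    rw [MvPolynomial.coe_eval₂Hom, MvPolynomial.eval₂_C]
    rfl

theorem exists_sum_of_mem_qmomIdeal {H : Subgroup (Torus m)} {a : Weyl E}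
    (ha : a ∈ qmomIdeal E b H) : ∃ (J : Type) (_ : Fintype J) (ξ : J → Fin m → ℂ) (d : J → Weyl E),
      (∀ j, ξ j ∈ lie H) ∧ a = ∑ j, qmom E b (ξ j) * d j := by
  induction ha using Submodule.span_induction with
  | mem x hx =>
    obtain ⟨ξ, hξ, d, rfl⟩ := hx
    exact ⟨Unit, inferInstance, fun _ => ξ, fun _ => d, fun _ => hξ, by simp⟩
  | zero => exact ⟨Empty, inferInstance, Empty.elim, Empty.elim, fun j => j.elim, by simp⟩
  | add x y _ _ hx hy =>
    obtain ⟨J, _, ξ, d, h1, rfl⟩ := hx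
    obtain ⟨J', _, ξ', d', h1', rfl⟩ := hy
    refine ⟨J ⊕ J', inferInstance, Sum.elim ξ ξ', Sum.elim d d', ?_, ?_⟩
    · rintro (j | j)
      · exact h1 j
      · exact h1' j
    · simp
  | smul f x _ hx =>
    obtain ⟨J, _, ξ, d, h1, rfl⟩ := hx
    exact ⟨J, inferInstance, ξ, fun j => f • d j, h1, by
      rw [Finset.smul_sum]
      exact Finset.sum_congr rfl fun j _ => by rw [mul_smul_comm]⟩

/-- If $a=\sum_j\mu_q(\xi_j)d_j$ has zero symbol, the symbols of the $d_j$ satisfy a linear relation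
over the polynomials in the $x_iy_i$. By flatness it comes from relations between the linear forms
themselves, and these lift. So $a$ is $\hbar$ times an element of the ideal, and only the torsion of
the Weyl algebra remains. -/
theorem qmomIdeal_torsion {H : Subgroup (Torus m)} {k : ℕ} {d w a : Weyl E}
    (ha : a ∈ qmomIdeal E b H) (h : hbar _ * d = hbar _ ^ (k + 1) * w + a) :
    ∃ w' : Weyl E, ∃ a' ∈ qmomIdeal E b H, d = hbar _ ^ k * w' + a' := by
  obtain ⟨J, _, ξ, dj, hξ, rfl⟩ := exists_sum_of_mem_qmomIdeal ha
  obtain ⟨φ, hφX, hφC⟩ := exists_prodWeyl E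
  let L : J → MvPolynomial ι ℂ := fun j => ∑ i, MvPolynomial.C (pair (b i) (ξ j)) * MvPolynomial.X i
  have hL : ∀ j, φ (L j) = qmom E b (ξ j) := fun j => by
    rw [map_sum, qmom]
    exact Finset.sum_congr rfl fun i _ => by rw [map_mul, hφX, hφC, Algebra.smul_def]
  have hsymb : ∀ p, symb E (φ p) = prodFun E p := by
    intro p
    induction p using MvPolynomial.induction_on with
    | C c =>
      rw [hφC, isSpec_symb, PowerSeries.constantCoeff_C, ← MvPolynomial.algebraMap_eq]
      change _ = algebraMap (MvPolynomial (Coord ι) ℂ) (Fun E) (prodHom (algebraMap ℂ _ c))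
      rw [AlgHom.commutes, ← IsScalarTower.algebraMap_apply]
    | add p q hp hq => rw [map_add, map_add, hp, hq, map_add]
    | mul_X p i hp =>
      rw [map_mul, map_mul, hp, map_mul, hφX, map_mul, symb_qc, symb_qc]
      congr 1
      change _ = algebraMap (MvPolynomial (Coord ι) ℂ) (Fun E) (prodHom (MvPolynomial.X i))
      rw [prodHom, MvPolynomial.aeval_X, map_mul]; rfl
  have hs0 : symb E (hbar (Weyl E)) = 0 := (symb_eq_zero E).mpr ⟨1, (mul_one _).symm⟩
  have h0 : ∑ j, prodFun E (L j) * symb E (dj j) = 0 := by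
    have := congrArg (symb E) h
    rw [map_mul, map_add, map_mul, map_pow, hs0, zero_mul, zero_pow k.succ_ne_zero, zero_mul,
      zero_add, map_sum] at this
    rw [this]
    exact Finset.sum_congr rfl fun j _ => by rw [map_mul, ← hL, hsymb]
  obtain ⟨K, p, g, hfg, hrel⟩ := prodFun_relation E L _ h0
  choose γ hγ using fun k => symb_surjective E (g k)
  have hdj : ∀ j, ∃ w', dj j = (∑ k ∈ K, φ (p j k) * γ k) + hbar _ * w' := fun j => by
    rw [← symb_eq_iff, hfg, map_sum]
    exact Finset.sum_congr rfl fun k _ => by rw [map_mul, hsymb, hγ]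
  choose w' hw' using hdj
  -- The leading terms contribute $\varphi(\sum_jL_jp_{jk})\gamma_k=0$, which leaves the terms with
  -- a factor $\hbar$.
  have hsum : ∑ j, qmom E b (ξ j) * dj j = hbar _ * ∑ j, qmom E b (ξ j) * w' j := by
    have e1 : ∀ j, qmom E b (ξ j) * dj j =
        ∑ k ∈ K, φ (L j * p j k) * γ k + hbar _ * (qmom E b (ξ j) * w' j) := fun j => by
      rw [hw' j, mul_add, Finset.mul_sum, ← mul_assoc, ← hbar_mul_comm, mul_assoc]
      congr 1
      exact Finset.sum_congr rfl fun k _ => by rw [map_mul, hL, mul_assoc]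
    rw [Finset.sum_congr rfl fun j _ => e1 j, Finset.sum_add_distrib, Finset.sum_comm,
      ← Finset.mul_sum]
    have e2 : ∀ k, ∑ j, φ (L j * p j k) * γ k = 0 := fun k => by
      rw [← Finset.sum_mul, ← map_sum, hrel, map_zero, zero_mul]
    rw [Finset.sum_congr rfl fun k _ => e2 k, Finset.sum_const_zero, zero_add]
  have hmem : ∑ j, qmom E b (ξ j) * w' j ∈ qmomIdeal E b H :=
    sum_mem fun j _ => Submodule.subset_span ⟨_, hξ j, _, rfl⟩
  -- What is left is annihilated by $\hbar$, hence divisible by $\hbar^k$.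
  have h1 : hbar (Weyl E) ^ 1 * (d - hbar _ ^ k * w - ∑ j, qmom E b (ξ j) * w' j) = 0 := by
    rw [pow_one, mul_sub, mul_sub, h, hsum, pow_succ', mul_assoc]; abel
  obtain ⟨w'', hw''⟩ := weyl_torsion E h1 k
  refine ⟨w + w'', _, hmem, ?_⟩
  rw [mul_add, ← hw'']; abel

variable {H : Subgroup (Torus m)}

theorem qmkRey_hbar_pow_mul (k : ℕ) (w : Weyl E) :
    qmkRey (H := H) (b := b) (hbar _ ^ k * w) = hbar _ ^ k * qmkRey w := by
  have : ∀ (A : Type) [Ring A] [Algebra Ch A] (a : A),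
      hbar A ^ k * a = (PowerSeries.X ^ k : Ch) • a := fun A _ _ a => by
    rw [Algebra.smul_def, map_pow]; rfl
  rw [this, map_smul, this]

/-- An element of the reduction with `ħ q` divisible by `ħ^(k+1)` is divisible by `ħ^k`. -/
theorem qred_torsion {k : ℕ} {q q' : QRed E b H} (h : hbar _ * q = hbar _ ^ (k + 1) * q') :
    ∃ q'', q = hbar _ ^ k * q'' := by
  obtain ⟨d, rfl⟩ := qmk_surjective q
  obtain ⟨d', rfl⟩ := qmk_surjective q'
  have e : hbar (QRed E b H) = qmk E b H (hbar _) := (AlgHom.commutes _ _).symm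
  rw [e, ← map_pow, ← map_mul, ← map_mul, ← sub_eq_zero, ← map_sub, qmk_eq_zero] at h
  obtain ⟨w', a', ha', hd⟩ := qmomIdeal_torsion (d := (d : Weyl E)) (w := (d' : Weyl E)) h
    (add_sub_cancel _ _).symm
  refine ⟨qmkRey w', ?_⟩
  rw [← qmkRey_coe, hd, map_add, qmkRey_eq_zero ha', add_zero, qmkRey_hbar_pow_mul]

end Torsion

/-! ## Completions -/

section CompletionBasics

variable {A : Type*} [Ring A] [Algebra Ch A] {B : Type*} [Ring B] [Algebra Ch B]

theorem map_hbar (φ : A →ₐ[Ch] B) : φ (hbar A) = hbar B := AlgHom.commutes _ _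

theorem compl_ext {f g : Compl A} (h : ∀ k, complEval A k f = complEval A k g) : f = g :=
  Subtype.ext (funext h)

/-- The element of the completion given by a coherent sequence. -/
def complOfSeq (a : ℕ → A) (h : ∀ k, a (k + 1) - a k ∈ hIdeal A k) : Compl A :=
  (⟨fun k => Ideal.Quotient.mk _ (a k), fun k => by
    rw [Ideal.Quotient.factor_mk, Ideal.Quotient.eq]; exact h k⟩ : complSub A)

theorem complEval_complOfSeq (a : ℕ → A) (h) (k : ℕ) :
    complEval A k (complOfSeq a h) = Ideal.Quotient.mk _ (a k) := rfl

theorem complEval_factor (f : Compl A) (k : ℕ) :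
    Ideal.Quotient.factor (hIdeal_succ_le A k) (complEval A (k + 1) f) = complEval A k f :=
  (show complSub A from f).2 k

theorem exists_seq (f : Compl A) : ∃ (a : ℕ → A) (h : ∀ k, a (k + 1) - a k ∈ hIdeal A k),
    f = complOfSeq a h := by
  choose a ha using fun k => Ideal.Quotient.mk_surjective (complEval A k f)
  have h : ∀ k, a (k + 1) - a k ∈ hIdeal A k := fun k => by
    rw [← Ideal.Quotient.eq, ha k, ← complEval_factor, ← ha (k + 1), Ideal.Quotient.factor_mk]
  exact ⟨a, h, compl_ext fun k => (ha k).symm⟩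

variable (A) in
/-- The map to the completion. -/
def toCompl : A →ₐ[Ch] Compl A where
  toFun a := complOfSeq (fun _ => a) fun k => by rw [sub_self]; exact zero_mem _
  map_one' := rfl
  map_mul' _ _ := rfl
  map_zero' := rfl
  map_add' _ _ := rfl
  commutes' _ := rfl

theorem complEval_toCompl (a : A) (k : ℕ) :
    complEval A k (toCompl A a) = Ideal.Quotient.mk _ a := rfl

theorem hbar_pow_mul_comm (k : ℕ) (a : A) : hbar A ^ k * a = a * hbar A ^ k :=
  ((show Commute (hbar A) a from hbar_mul_comm a).pow_left k).eq

theorem hIdeal_antitone {k l : ℕ} (h : k ≤ l) : hIdeal A l ≤ hIdeal A k := by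
  induction l, h using Nat.le_induction with
  | base => exact le_rfl
  | succ l _ ih => exact (hIdeal_succ_le A l).trans ih

theorem mk_eq_zero_iff {k : ℕ} {a : A} : Ideal.Quotient.mk (hIdeal A k) a = 0 ↔
    ∃ r, a = hbar A ^ k * r := by
  rw [Ideal.Quotient.eq_zero_iff_mem, mem_hIdeal]

theorem complEval_hbar_pow (k : ℕ) (g : Compl A) : complEval A k (hbar _ ^ k * g) = 0 := by
  obtain ⟨a, h, rfl⟩ := exists_seq g
  rw [map_mul, map_pow, map_hbar, complEval_complOfSeq]
  change Ideal.Quotient.mk (hIdeal A k) (hbar A ^ k * a k) = 0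
  exact mk_eq_zero_iff.mpr ⟨_, rfl⟩

/-- Sums of series `∑ ħ^i c_i` in the completion. -/
theorem exists_series (c : ℕ → A) : ∃ f : Compl A, ∀ k, complEval A k f =
    Ideal.Quotient.mk _ (∑ i ∈ Finset.range k, hbar A ^ i * c i) :=
  ⟨complOfSeq (fun k => ∑ i ∈ Finset.range k, hbar A ^ i * c i) fun k => by
    rw [Finset.sum_range_succ, add_sub_cancel_left]; exact mem_hIdeal.mpr ⟨_, rfl⟩,
    fun k => rfl⟩

/-- The completion is again complete for its own $\hbar$-adic topology. This needs no finiteness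
assumption because $\hbar$ is a single central element. -/
theorem complEval_eq_zero {k : ℕ} {f : Compl A} :
    complEval A k f = 0 ↔ ∃ g, f = hbar _ ^ k * g := by
  constructor
  · intro hf
    obtain ⟨a, h, rfl⟩ := exists_seq f
    rw [complEval_complOfSeq, mk_eq_zero_iff] at hf
    obtain ⟨r, hr⟩ := hf
    -- The differences of consecutive terms are $\hbar^jc_j$, so from index $k$ on the sequence is
    -- $\hbar^k$ times the partial sums of an $\hbar$-adic series. Choosing the $c_j$ makes division
    -- by $\hbar^k$ possible in the presence of torsion.
    choose c hc using fun j => mem_hIdeal.mp (h j)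
    obtain ⟨g, hg⟩ := exists_series (fun i => c (k + i))
    refine ⟨toCompl A r + g, compl_ext fun l => ?_⟩
    have hsum : ∀ l, a (k + l) = hbar A ^ k *
        (r + ∑ i ∈ Finset.range l, hbar A ^ i * c (k + i)) := by
      intro l
      induction l with
      | zero => simp [hr]
      | succ l ih =>
        rw [Finset.sum_range_succ, ← add_assoc r, mul_add, ← ih, ← mul_assoc, ← pow_add, ← hc,
          ← add_assoc k l 1]
        abel
    have hdiff : ∀ j, a (l + j) - a l ∈ hIdeal A l := by
      intro j
      induction j with
      | zero => simp
      | succ j ih =>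
        have := add_mem (hIdeal_antitone (Nat.le_add_right l j) (h (l + j))) ih
        rwa [sub_add_sub_cancel] at this
    rw [complEval_complOfSeq, map_mul, map_pow, map_hbar, map_add, hg, complEval_toCompl]
    have e : Ideal.Quotient.mk (hIdeal A l) (a l) = Ideal.Quotient.mk _ (a (k + l)) := by
      rw [eq_comm, Ideal.Quotient.eq, add_comm]; exact hdiff k
    rw [e, hsum, map_mul, map_add]
    rfl
  · rintro ⟨g, rfl⟩
    exact complEval_hbar_pow k g

theorem compl_approx (f : Compl A) (k : ℕ) : ∃ a g, f = toCompl A a + hbar _ ^ k * g := by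
  obtain ⟨a, ha⟩ := Ideal.Quotient.mk_surjective (complEval A k f)
  obtain ⟨g, hg⟩ := complEval_eq_zero.mp (show complEval A k (f - toCompl A a) = 0 by
    rw [map_sub, complEval_toCompl, ha, sub_self])
  exact ⟨a, g, by rw [← hg, add_sub_cancel]⟩

theorem compl_separated {f : Compl A} (h : ∀ k, ∃ g, f = hbar _ ^ k * g) : f = 0 :=
  compl_ext fun k => by rw [map_zero]; exact complEval_eq_zero.mpr (h k)

/-- The hypothesis weakens torsion-freeness: multiplication by $\hbar$ detects divisibility with a
loss of one power. An element of the completion killed by $\hbar$ is then divisible by every power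
of $\hbar$. -/
theorem compl_torsion (hA : ∀ (k : ℕ) (q q' : A), hbar A * q = hbar A ^ (k + 1) * q' →
    ∃ q'', q = hbar A ^ k * q'') {f : Compl A} (h : hbar _ * f = 0) : f = 0 := by
  refine compl_separated fun k => ?_
  obtain ⟨a, g, rfl⟩ := compl_approx f k
  have h1 : complEval A (k + 1) (hbar _ * (toCompl A a + hbar _ ^ k * g)) = 0 := by
    rw [h, map_zero]
  rw [mul_add, ← mul_assoc, ← pow_succ', map_add, complEval_hbar_pow, add_zero, map_mul, map_hbar,
    complEval_toCompl] at h1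
  obtain ⟨r, hr⟩ := mk_eq_zero_iff.mp (show Ideal.Quotient.mk (hIdeal A (k + 1)) (hbar A * a) = 0
    from h1)
  obtain ⟨a', rfl⟩ := hA k a r hr
  exact ⟨toCompl A a' + g, by rw [map_mul, map_pow, map_hbar, mul_add]⟩

/-- The map on the quotients by powers of `ħ` induced by an additive map. -/
def lvlAdd (D : A →+ B) (hD : ∀ k a, ∃ r, D (hbar A ^ k * a) = hbar B ^ k * r) (k : ℕ) :
    Lvl A k →+ Lvl B k :=
  QuotientAddGroup.lift (hIdeal A k).toAddSubgroup
    ((QuotientAddGroup.mk' (hIdeal B k).toAddSubgroup).comp D) fun a ha => by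
      obtain ⟨r, rfl⟩ := mem_hIdeal.mp ha
      obtain ⟨r', hr'⟩ := hD k r
      exact (QuotientAddGroup.eq_zero_iff _).mpr (mem_hIdeal.mpr ⟨r', hr'⟩)

theorem lvlAdd_mk (D : A →+ B) (hD) (k : ℕ) (a : A) :
    lvlAdd D hD k (Ideal.Quotient.mk _ a) = Ideal.Quotient.mk _ (D a) := rfl

/-- Functoriality of the completion for additive maps compatible with `ħ`. -/
def complAdd (D : A →+ B) (hD : ∀ k a, ∃ r, D (hbar A ^ k * a) = hbar B ^ k * r) :
    Compl A →+ Compl B where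
  toFun f := (⟨fun k => lvlAdd D hD k (complEval A k f), fun k => by
      obtain ⟨a, h, rfl⟩ := exists_seq f
      beta_reduce
      rw [complEval_complOfSeq, complEval_complOfSeq, lvlAdd_mk, lvlAdd_mk,
        Ideal.Quotient.factor_mk, Ideal.Quotient.eq, ← map_sub]
      obtain ⟨r, hr⟩ := mem_hIdeal.mp (h k)
      obtain ⟨r', hr'⟩ := hD k r
      rw [hr]
      exact mem_hIdeal.mpr ⟨r', hr'⟩⟩ : complSub B)
  map_zero' := compl_ext fun k => map_zero (lvlAdd D hD k)
  map_add' f g := compl_ext fun k => map_add (lvlAdd D hD k) (complEval A k f) (complEval A k g)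

theorem complEval_complAdd (D : A →+ B) (hD) (f : Compl A) {k : ℕ} {a : A}
    (h : complEval A k f = Ideal.Quotient.mk _ a) :
    complEval B k (complAdd D hD f) = Ideal.Quotient.mk _ (D a) := by
  have : complEval B k (complAdd D hD f) = lvlAdd D hD k (complEval A k f) := rfl
  rw [this, h, lvlAdd_mk]

theorem algHom_hbar_pow_mul (φ : A →ₐ[Ch] B) (k : ℕ) (a : A) :
    ∃ r, (φ : A →+ B) (hbar A ^ k * a) = hbar B ^ k * r :=
  ⟨φ a, by change φ _ = _; rw [map_mul, map_pow, map_hbar]⟩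

theorem hbar_pow_mul_eq_smul (k : ℕ) (a : A) : hbar A ^ k * a = (PowerSeries.X ^ k : Ch) • a := by
  rw [Algebra.smul_def, map_pow]; rfl

/-- Functoriality of the completion. -/
def complMap (φ : A →ₐ[Ch] B) : Compl A →ₐ[Ch] Compl B :=
  have key : ∀ (f : Compl A) (k : ℕ) (a : A), complEval A k f = Ideal.Quotient.mk _ a →
      complEval B k (complAdd (φ : A →+ B) (algHom_hbar_pow_mul φ) f) = Ideal.Quotient.mk _ (φ a) := fun f k a h =>
    complEval_complAdd _ _ f h
  { complAdd (φ : A →+ B) (algHom_hbar_pow_mul φ) with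
    map_one' := compl_ext fun k => by
      refine (key 1 k 1 rfl).trans ?_
      rw [map_one, map_one, map_one]
    map_mul' := fun f g => compl_ext fun k => by
      obtain ⟨a, ha⟩ := Ideal.Quotient.mk_surjective (complEval A k f)
      obtain ⟨a', ha'⟩ := Ideal.Quotient.mk_surjective (complEval A k g)
      refine (key (f * g) k (a * a') (by rw [map_mul, map_mul, ha, ha'])).trans ?_
      rw [map_mul, map_mul, map_mul]
      exact congrArg₂ (· * ·) (key f k a ha.symm).symm (key g k a' ha'.symm).symm
    commutes' := fun r => compl_ext fun k => by
      refine (key _ k (algebraMap Ch A r) rfl).trans ?_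
      rw [AlgHom.commutes]; rfl }

theorem complEval_complMap (φ : A →ₐ[Ch] B) (f : Compl A) {k : ℕ} {a : A}
    (h : complEval A k f = Ideal.Quotient.mk _ a) :
    complEval B k (complMap φ f) = Ideal.Quotient.mk _ (φ a) :=
  complEval_complAdd (φ : A →+ B) (algHom_hbar_pow_mul φ) f h

theorem complMap_toCompl (φ : A →ₐ[Ch] B) (a : A) :
    complMap φ (toCompl A a) = toCompl B (φ a) :=
  compl_ext fun _ => complEval_complMap φ _ rfl

/-- The hypotheses say that $\varphi$ is injective and surjective modulo each power of $\hbar$;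
neither $\varphi$ nor the algebras need be separated. -/
theorem complMap_bijective (φ : A →ₐ[Ch] B)
    (hi : ∀ k a r, φ a = hbar B ^ k * r → ∃ r', a = hbar A ^ k * r')
    (hs : ∀ k y, ∃ a r, y = φ a + hbar B ^ k * r) : Function.Bijective (complMap φ) := by
  constructor
  · rw [injective_iff_map_eq_zero]
    intro f hf
    refine compl_ext fun k => ?_
    obtain ⟨a, ha⟩ := Ideal.Quotient.mk_surjective (complEval A k f)
    have h1 := complEval_complMap φ f ha.symm
    rw [hf, map_zero, eq_comm, mk_eq_zero_iff] at h1
    obtain ⟨r, hr⟩ := h1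
    rw [map_zero, ← ha, mk_eq_zero_iff]
    exact hi k a r hr
  · intro g
    obtain ⟨y, hy, rfl⟩ := exists_seq g
    choose a r har using hs
    -- Consecutive preimages are coherent: their difference maps into $\hbar^kB$, so injectivity
    -- modulo $\hbar^k$ applies.
    have h : ∀ k, a (k + 1) (y (k + 1)) - a k (y k) ∈ hIdeal A k := fun k => by
      obtain ⟨s, hs⟩ := mem_hIdeal.mp (hy k)
      refine mem_hIdeal.mpr (hi k _ (s - hbar B * r (k + 1) (y (k + 1)) + r k (y k)) ?_)
      rw [map_sub, mul_add, mul_sub, ← hs, ← mul_assoc, ← pow_succ, eq_sub_of_add_eq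
        (har (k + 1) (y (k + 1))).symm, eq_sub_of_add_eq (har k (y k)).symm]
      abel
    refine ⟨complOfSeq (fun k => a k (y k)) h, compl_ext fun k => ?_⟩
    rw [complEval_complMap φ _ (complEval_complOfSeq _ h k), complEval_complOfSeq, eq_comm,
      Ideal.Quotient.eq, mem_hIdeal]
    exact ⟨r k (y k), by rw [sub_eq_iff_eq_add']; exact har k (y k)⟩

end CompletionBasics

/-! ### Completion and tensor products -/

section CompletionTensor

variable {A : Type*} [Ring A] [Algebra Ch A] {B : Type*} [Ring B] [Algebra Ch B]

variable (A B) in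
/-- The map from the tensor product to the tensor product of the completions. -/
def tensCompl : A ⊗[Ch] B →ₐ[Ch] Compl A ⊗[Ch] Compl B :=
  Algebra.TensorProduct.map (toCompl A) (toCompl B)

theorem commute_complMap_include (f : Compl A) (g : Compl B) :
    Commute (complMap (Algebra.TensorProduct.includeLeft : A →ₐ[Ch] A ⊗[Ch] B) f)
      (complMap (Algebra.TensorProduct.includeRight : B →ₐ[Ch] A ⊗[Ch] B) g) :=
  compl_ext fun k => by
    obtain ⟨a, ha⟩ := Ideal.Quotient.mk_surjective (complEval A k f)
    obtain ⟨a', ha'⟩ := Ideal.Quotient.mk_surjective (complEval B k g)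
    rw [map_mul, map_mul, complEval_complMap _ f ha.symm, complEval_complMap _ g ha'.symm,
      ← map_mul, ← map_mul]
    simp

/-- The map to $\operatorname{Compl}(A\otimes B)$ extends over
$\operatorname{Compl}A\otimes\operatorname{Compl}B$ through $\gamma$, and the canonical map to the
completion detects divisibility by $\hbar^k$. No flatness of completion is involved. -/
theorem tensCompl_injective_mod (k : ℕ) (z : A ⊗[Ch] B) (r : Compl A ⊗[Ch] Compl B)
    (h : tensCompl A B z = hbar _ ^ k * r) : ∃ r', z = hbar _ ^ k * r' := by
  let γ : Compl A ⊗[Ch] Compl B →ₐ[Ch] Compl (A ⊗[Ch] B) := Algebra.TensorProduct.lift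
    (complMap Algebra.TensorProduct.includeLeft) (complMap Algebra.TensorProduct.includeRight)
    commute_complMap_include
  have h1 : ∀ z, γ (tensCompl A B z) = toCompl _ z := by
    intro z
    have : γ.comp (tensCompl A B) = toCompl (A ⊗[Ch] B) := by
      apply Algebra.TensorProduct.ext'
      intro a a'
      simp only [AlgHom.comp_apply, tensCompl, Algebra.TensorProduct.map_tmul, γ,
        Algebra.TensorProduct.lift_tmul, complMap_toCompl]
      rw [← map_mul]
      simp
    exact congrArg (fun f => f z) this
  have h2 := h1 z
  rw [h, map_mul, map_pow, map_hbar] at h2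
  have h3 := congrArg (complEval _ k) h2
  rw [complEval_hbar_pow, complEval_toCompl] at h3
  exact mk_eq_zero_iff.mp h3.symm

theorem tensCompl_surjective_mod (k : ℕ) (y : Compl A ⊗[Ch] Compl B) :
    ∃ z r, y = tensCompl A B z + hbar _ ^ k * r := by
  simp only [hbar_pow_mul_eq_smul]
  induction y using TensorProduct.induction_on with
  | zero => exact ⟨0, 0, by simp⟩
  | tmul f g =>
    obtain ⟨a, f', rfl⟩ := compl_approx f k
    obtain ⟨a', g', rfl⟩ := compl_approx g k
    rw [hbar_pow_mul_eq_smul, hbar_pow_mul_eq_smul]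
    refine ⟨a ⊗ₜ a', toCompl A a ⊗ₜ g' + f' ⊗ₜ (toCompl B a' + (PowerSeries.X ^ k : Ch) • g'), ?_⟩
    rw [TensorProduct.add_tmul, TensorProduct.tmul_add, tensCompl, Algebra.TensorProduct.map_tmul,
      smul_add, TensorProduct.tmul_smul, TensorProduct.smul_tmul', TensorProduct.smul_tmul',
      add_assoc]
  | add x y hx hy =>
    obtain ⟨z, r, rfl⟩ := hx
    obtain ⟨z', r', rfl⟩ := hy
    exact ⟨z + z', r + r', by rw [map_add, smul_add]; abel⟩

end CompletionTensor

/-! ## Complete torsion-free algebras are free -/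

section Free

variable {A : Type*} [Ring A] [Algebra Ch A] {O : Type*} [CommRing O] [Algebra ℂ O]

/-- A linear section of a surjection of complex vector spaces; compatibility with constants is
needed for the expansion in powers of $\hbar$ to be linear. -/
theorem exists_section {p : A →+* O} (hp : IsSpec p) (hs : Function.Surjective p) :
    ∃ s : O →+ A, (∀ o, p (s o) = o) ∧ ∀ (a : ℂ) o, s (a • o) = (PowerSeries.C a : Ch) • s o := by
  let _ : Module ℂ A := Module.compHom A (PowerSeries.C : ℂ →+* Ch)
  let P : A →ₗ[ℂ] O :=
    { toFun := p
      map_add' := map_add p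
      map_smul' := fun a x => by
        change p ((PowerSeries.C a : Ch) • x) = a • p x
        rw [Algebra.smul_def, map_mul, hp, Algebra.smul_def, PowerSeries.constantCoeff_C] }
  obtain ⟨s, hs⟩ := P.exists_rightInverse_of_surjective (LinearMap.range_eq_top.mpr hs)
  exact ⟨s.toAddMonoidHom, fun o => LinearMap.congr_fun hs o, fun a o => map_smul s a o⟩

theorem powerSeries_eq (p : Ch) : ∃ p' : Ch,
    p = PowerSeries.C (PowerSeries.constantCoeff p) + PowerSeries.X * p' := by
  obtain ⟨p', hp'⟩ : PowerSeries.X ∣ (p - PowerSeries.C (PowerSeries.constantCoeff p) : Ch) := by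
    rw [PowerSeries.X_dvd_iff]; simp
  exact ⟨p', by rw [← hp', add_sub_cancel]⟩

/-- With a linear section $s$ of $p$, every element has a unique expansion $\sum_i\hbar^is(o_i)$: it
exists by completeness and is unique by torsion-freeness and separatedness. -/
theorem free_of_complete {p : A →+* O} (hp : IsSpec p) (hs : Function.Surjective p)
    (hker : ∀ a, p a = 0 → ∃ a', a = hbar A * a')
    (htors : ∀ a : A, hbar A * a = 0 → a = 0)
    (hsep : ∀ a : A, (∀ k, ∃ r, a = hbar A ^ k * r) → a = 0)
    (hcompl : ∀ c : ℕ → A, ∃ a, ∀ k, ∃ r, a =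
      (∑ i ∈ Finset.range k, hbar A ^ i * c i) + hbar A ^ k * r) :
    Nonempty (A ≃ₗ[Ch] PowerSeries O) := by
  obtain ⟨s, hps, hsm⟩ := exists_section hp hs
  choose lim hlim using hcompl
  let S : PowerSeries O → A := fun f => lim fun i => s (PowerSeries.coeff i f)
  have hS : ∀ f k, ∃ r, S f =
      (∑ i ∈ Finset.range k, hbar A ^ i * s (PowerSeries.coeff i f)) + hbar A ^ k * r :=
    fun f k => hlim _ k
  have huniq : ∀ f a, (∀ k, ∃ r, a =
      (∑ i ∈ Finset.range k, hbar A ^ i * s (PowerSeries.coeff i f)) + hbar A ^ k * r) →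
      a = S f := by
    intro f a h
    rw [← sub_eq_zero]
    refine hsep _ fun k => ?_
    obtain ⟨r, hr⟩ := h k
    obtain ⟨r', hr'⟩ := hS f k
    exact ⟨r - r', by rw [hr, hr', mul_sub]; abel⟩
  have hadd : ∀ f g, S (f + g) = S f + S g := fun f g => by
    refine (huniq _ _ fun k => ?_).symm
    obtain ⟨r, hr⟩ := hS f k
    obtain ⟨r', hr'⟩ := hS g k
    refine ⟨r + r', ?_⟩
    rw [hr, hr']
    simp only [map_add, mul_add, Finset.sum_add_distrib]
    abel
  have hX : ∀ f, S ((PowerSeries.X : Ch) • f) = hbar A * S f := fun f => by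
    have hf : (PowerSeries.X : Ch) • f = PowerSeries.X * f := by
      rw [Algebra.smul_def]; congr 1; exact PowerSeries.map_X _
    rw [hf]
    refine (huniq _ _ fun k => ?_).symm
    cases k with
    | zero => exact ⟨hbar A * S f, by simp⟩
    | succ k =>
      obtain ⟨r, hr⟩ := hS f k
      refine ⟨r, ?_⟩
      rw [hr, Finset.sum_range_succ', PowerSeries.coeff_zero_X_mul, map_zero, mul_zero, add_zero,
        mul_add, Finset.mul_sum, ← mul_assoc, ← pow_succ']
      congr 1
      exact Finset.sum_congr rfl fun i _ => by
        rw [PowerSeries.coeff_succ_X_mul, ← mul_assoc, ← pow_succ']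
  have hC : ∀ (a : ℂ) f, S ((PowerSeries.C a : Ch) • f) = (PowerSeries.C a : Ch) • S f := by
    intro a f
    have hf : ∀ i, PowerSeries.coeff i ((PowerSeries.C a : Ch) • f) = a • PowerSeries.coeff i f := by
      intro i
      rw [Algebra.smul_def]
      change PowerSeries.coeff i (PowerSeries.map (algebraMap ℂ O) (PowerSeries.C a) * f) = _
      rw [PowerSeries.map_C, PowerSeries.coeff_C_mul, Algebra.smul_def]
    refine (huniq _ _ fun k => ?_).symm
    obtain ⟨r, hr⟩ := hS f k
    refine ⟨(PowerSeries.C a : Ch) • r, ?_⟩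
    rw [hr, smul_add, Finset.smul_sum, mul_smul_comm]
    congr 1
    exact Finset.sum_congr rfl fun i _ => by rw [hf, hsm, mul_smul_comm]
  -- The expansion map is additive, $\mathbf C$-linear and commutes with $\hbar$. Peeling off the
  -- constant term of a scalar $k$ times gives linearity modulo $\hbar^k$, and separatedness removes
  -- the error.
  have hlin : ∀ (k : ℕ) (q : Ch) f, ∃ r, S (q • f) - q • S f = hbar A ^ k * r := by
    intro k
    induction k with
    | zero => intro q f; exact ⟨_, by rw [pow_zero, one_mul]⟩
    | succ k ih =>
      intro q f
      obtain ⟨q', hq'⟩ := powerSeries_eq q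
      obtain ⟨r, hr⟩ := ih q' f
      refine ⟨r, ?_⟩
      have e : (PowerSeries.X : Ch) • q' • S f = hbar A * (q' • S f) := by
        rw [Algebra.smul_def PowerSeries.X]; rfl
      rw [hq', add_smul, add_smul, hadd, hC, mul_smul, hX, mul_smul, e, add_sub_add_left_eq_sub,
        ← mul_sub, hr, ← mul_assoc, ← pow_succ']
  let SL : PowerSeries O →ₗ[Ch] A :=
    { toFun := S
      map_add' := hadd
      map_smul' := fun q f => sub_eq_zero.mp (hsep _ fun k => hlin k q f) }
  have hpS : ∀ f, p (S f) = PowerSeries.constantCoeff f := fun f => by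
    obtain ⟨r, hr⟩ := hS f 1
    have h0 : p (hbar A) = 0 := by rw [hbar, hp]; simp
    rw [hr, Finset.sum_range_one, pow_zero, one_mul, map_add, hps, pow_one, map_mul, h0, zero_mul,
      add_zero, PowerSeries.coeff_zero_eq_constantCoeff_apply]
  refine ⟨(LinearEquiv.ofBijective SL ⟨?_, ?_⟩).symm⟩
  · rw [injective_iff_map_eq_zero]
    intro f hf
    ext n
    rw [map_zero]
    change S f = 0 at hf
    induction n generalizing f with
    | zero =>
      rw [PowerSeries.coeff_zero_eq_constantCoeff_apply, ← hpS, hf, map_zero]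
    | succ n ih =>
      obtain ⟨f', hf'⟩ : PowerSeries.X ∣ f := by
        rw [PowerSeries.X_dvd_iff, ← hpS, hf, map_zero]
      have hf'' : (PowerSeries.X : Ch) • f' = PowerSeries.X * f' := by
        rw [Algebra.smul_def]; congr 1; exact PowerSeries.map_X _
      rw [hf', ← hf'', hX] at hf
      rw [hf', PowerSeries.coeff_succ_X_mul]
      exact ih f' (htors _ hf)
  · intro a
    -- One step of the expansion: subtract the section of the symbol and divide by $\hbar$. The
    -- coefficients are the symbols of the iterated remainders.
    have hstep : ∀ a, ∃ a', a = s (p a) + hbar A * a' := fun a => by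
      obtain ⟨a', ha'⟩ := hker (a - s (p a)) (by rw [map_sub, hps, sub_self])
      exact ⟨a', by rw [← ha', add_sub_cancel]⟩
    choose next hnext using hstep
    refine ⟨PowerSeries.mk fun n => p (next^[n] a), ?_⟩
    refine (huniq _ _ fun k => ⟨next^[k] a, ?_⟩).symm
    induction k with
    | zero => simp
    | succ k ih =>
      rw [Finset.sum_range_succ, PowerSeries.coeff_mk, Function.iterate_succ_apply', pow_succ,
        mul_assoc, add_assoc, ← mul_add, ← hnext]
      exact ih

/-- A diagonal construction: the $k$-th approximation of the series uses the $k$-th approximations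
of its first $k$ terms. -/
theorem compl_series (c : ℕ → Compl A) : ∃ a : Compl A, ∀ k, ∃ r, a =
    (∑ i ∈ Finset.range k, hbar _ ^ i * c i) + hbar _ ^ k * r := by
  choose y hy hc using fun i => exists_seq (c i)
  have hseq : ∀ k, (∑ i ∈ Finset.range (k + 1), hbar A ^ i * y i (k + 1)) -
      (∑ i ∈ Finset.range k, hbar A ^ i * y i k) ∈ hIdeal A k := fun k => by
    rw [Finset.sum_range_succ, add_sub_right_comm, ← Finset.sum_sub_distrib]
    refine add_mem (sum_mem fun i _ => ?_) (mem_hIdeal.mpr ⟨_, rfl⟩)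
    rw [← mul_sub]
    exact Ideal.mul_mem_left _ _ (hy i k)
  refine ⟨complOfSeq (fun k => ∑ i ∈ Finset.range k, hbar A ^ i * y i k) hseq, fun k => ?_⟩
  obtain ⟨g, hg⟩ := (complEval_eq_zero (k := k)).mp
    (show complEval A k (complOfSeq (fun k => ∑ i ∈ Finset.range k, hbar A ^ i * y i k) hseq - ∑ i ∈ Finset.range k, hbar _ ^ i * c i) = 0 by
      rw [map_sub, complEval_complOfSeq, map_sum, map_sum, sub_eq_zero]
      refine Finset.sum_congr rfl fun i _ => ?_
      rw [map_mul, map_mul, map_pow, map_pow, map_hbar, hc, complEval_complOfSeq]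
      rfl)
  exact ⟨g, by rw [← hg, add_sub_cancel]⟩

end Free

/-! ## Gradings -/

section Gradings

variable {ι : Type} [DecidableEq ι] {E : Set (Coord ι)} {m : ℕ} {b : ι → Fin m → ℤ}
  {δ δ' : Coord ι → ℤ}

theorem closure_mul_mem {A : Type*} [NonUnitalNonAssocSemiring A] {S S' S'' : Set A}
    (h : ∀ x ∈ S, ∀ y ∈ S', x * y ∈ AddSubmonoid.closure S'') {x y : A}
    (hx : x ∈ AddSubmonoid.closure S) (hy : y ∈ AddSubmonoid.closure S') :
    x * y ∈ AddSubmonoid.closure S'' := by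
  induction hx using AddSubmonoid.closure_induction with
  | mem x hx =>
    induction hy using AddSubmonoid.closure_induction with
    | mem y hy => exact h x hx y hy
    | zero => rw [mul_zero]; exact zero_mem _
    | add y y' _ _ h h' => rw [mul_add]; exact add_mem h h'
  | zero => rw [zero_mul]; exact zero_mem _
  | add x x' _ _ h h' => rw [add_mul]; exact add_mem h h'

/-- If two gradings of the coordinates differ by a homomorphism $g$ of the weight, a bihomogeneous
element of weight $w$ changes its degree by $g(w)$. With $g=0$ this splits a homogeneous element
into homogeneous weight vectors; with the pairing by a cocharacter it compares two gradings. -/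
theorem mem_closure_isHomog {g : (Fin m → ℤ) →+ ℤ} (hg : ∀ c, δ' c = δ c + g (wt b c)) {N : ℤ}
    {d : Weyl E} (h : IsHomog E δ N d) : d ∈ AddSubmonoid.closure
      {d | ∃ w, IsWt E b w d ∧ IsHomog E δ N d ∧ IsHomog E δ' (N + g w) d} := by
  induction h with
  | zero N => exact zero_mem _
  | const a => exact AddSubmonoid.subset_closure ⟨0, IsWt.algebraMap _, IsHomog.const a, by
      simpa using IsHomog.const a⟩
  | hbar => exact AddSubmonoid.subset_closure ⟨0, IsWt.algebraMap _, IsHomog.hbar, by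
      simpa using IsHomog.hbar⟩
  | coord c => exact AddSubmonoid.subset_closure ⟨_, IsWt.coord c, IsHomog.coord c, by
      rw [← hg]; exact IsHomog.coord c⟩
  | inv c hc => exact AddSubmonoid.subset_closure ⟨_, IsWt.inv c hc, IsHomog.inv c hc, by
      rw [map_neg, ← neg_add, ← hg]; exact IsHomog.inv c hc⟩
  | add _ _ h h' => exact add_mem h h'
  | mul _ _ h h' =>
    refine closure_mul_mem ?_ h h'
    rintro x ⟨w, h1, h2, h3⟩ y ⟨w', h1', h2', h3'⟩
    refine AddSubmonoid.subset_closure ⟨_, h1.mul h1', h2.mul h2', ?_⟩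
    rw [map_add, add_add_add_comm]
    exact h3.mul h3'

variable {H : Subgroup (Torus m)}

/-- Only weights trivial on $H$ survive the projection, and $g$ vanishes on them. Consequently the
two gradings coincide on invariants. -/
theorem isHomog_rey_of {g : (Fin m → ℤ) →+ ℤ} (hg : ∀ c, δ' c = δ c + g (wt b c))
    (hH : ∀ w, (∀ t ∈ H, chi w t = 1) → g w = 0) {N : ℤ} {d : Weyl E} (h : IsHomog E δ N d) :
    IsHomog E δ' N (rey E b H d) := by
  have hm := mem_closure_isHomog hg h
  clear h
  induction hm using AddSubmonoid.closure_induction with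
  | mem x hx =>
    obtain ⟨w, h1, h2, h3⟩ := hx
    by_cases hw : ∀ t ∈ H, chi w t = 1
    · rw [rey_of_triv hw h1]
      simpa [hH w hw] using h3
    · rw [rey_of_nontriv hw h1]; exact IsHomog.zero N
  | zero => rw [map_zero]; exact IsHomog.zero N
  | add x y _ _ hx hy => rw [map_add]; exact hx.add hy

theorem isHomog_rey {N : ℤ} {d : Weyl E} (h : IsHomog E δ N d) :
    IsHomog E δ N (rey E b H d) :=
  isHomog_rey_of (g := 0) (by simp) (by simp) h

theorem isHomog_of_mem {g : (Fin m → ℤ) →+ ℤ} (hg : ∀ c, δ' c = δ c + g (wt b c))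
    (hH : ∀ w, (∀ t ∈ H, chi w t = 1) → g w = 0) {N : ℤ} {d : Weyl E} (hd : d ∈ qinv E b H)
    (h : IsHomog E δ N d) : IsHomog E δ' N d := by
  rw [← rey_of_mem hd]
  exact isHomog_rey_of hg hH h

theorem CWt.zero {Λ : Type} [AddCommGroup Λ] {ω : Coord ι → Λ} (w : Λ) :
    CWt E ω w (0 : Fun E) := by
  simpa using (CWt.smul (E := E) (CWt.smul (ω := ω) (w := w) (f := 0) ⟨by
    rw [map_zero, AddMonoidAlgebra.single_zero], fun χ => by rw [map_zero, smul_zero]⟩ 0) 0)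

theorem CWt.add {Λ : Type} [AddCommGroup Λ] {ω : Coord ι → Λ} {w : Λ} {f f' : Fun E}
    (h : CWt E ω w f) (h' : CWt E ω w f') : CWt E ω w (f + f') := by
  constructor
  · rw [map_add, h.1, h'.1, AddMonoidAlgebra.single_add]
  · intro χ
    rw [map_add, h.2, h'.2, smul_add]

theorem IsHomog.cwt_symb {N : ℤ} {d : Weyl E} (h : IsHomog E δ N d) : CWt E δ N (symb E d) := by
  have hcoord : ∀ c, CWt E δ (δ c) (symb E (gen E (Gen.coord c))) := fun c => by
    rw [show gen E (Gen.coord c) = qc E c from rfl, symb_qc]; exact CWt.cf c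
  induction h with
  | zero N => rw [map_zero]; exact CWt.zero N
  | const a => rw [isSpec_symb]; exact CWt.algebraMap _
  | hbar => rw [(symb_eq_zero E).mpr ⟨1, (mul_one _).symm⟩]; exact CWt.zero 2
  | coord c => exact hcoord c
  | inv c hc => exact (hcoord c).inv (by rw [← map_mul, gen_mul_inv, map_one])
  | add _ _ h h' => rw [map_add]; exact h.add h'
  | mul _ _ h h' => rw [map_mul]; exact h.mul h'

variable (E δ) in
theorem mem_closure_symb_isHomog (f : Fun E) : f ∈ AddSubmonoid.closure
    {f | ∃ N d, IsHomog E δ N d ∧ symb E d = f} := by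
  obtain ⟨d, rfl⟩ := symb_surjective E f
  induction d using weyl_induction with
  | hC f =>
    refine AddSubmonoid.subset_closure ⟨0, _, IsHomog.const (PowerSeries.constantCoeff f), ?_⟩
    rw [isSpec_symb, isSpec_symb, PowerSeries.constantCoeff_C]
  | hX a =>
    rcases a with c | ⟨c, hc⟩
    · exact AddSubmonoid.subset_closure ⟨_, _, IsHomog.coord c, rfl⟩
    · exact AddSubmonoid.subset_closure ⟨_, _, IsHomog.inv c hc, rfl⟩
  | hadd f g hf hg => rw [map_add]; exact add_mem hf hg
  | hmul f g hf hg =>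
    rw [map_mul]
    refine closure_mul_mem ?_ hf hg
    rintro _ ⟨N, d, hd, rfl⟩ _ ⟨N', d', hd', rfl⟩
    exact AddSubmonoid.subset_closure ⟨_, _, hd.mul hd', map_mul _ _ _⟩

theorem exists_isHomog_coeff (f : Fun E) (N : ℤ) :
    ∃ d, IsHomog E δ N d ∧ symb E d = (ccoact E δ f).coeff N := by
  induction mem_closure_symb_isHomog E δ f using AddSubmonoid.closure_induction with
  | mem x hx =>
    obtain ⟨N', d, hd, rfl⟩ := hx
    rw [hd.cwt_symb.1, AddMonoidAlgebra.coeff_single]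
    by_cases h : N' = N
    · subst h; exact ⟨d, hd, by simp⟩
    · exact ⟨0, IsHomog.zero N, by rw [Finsupp.single_eq_of_ne' h, map_zero]⟩
  | zero => exact ⟨0, IsHomog.zero N, by simp⟩
  | add x y _ _ hx hy =>
    obtain ⟨d, h, h1⟩ := hx
    obtain ⟨d', h', h1'⟩ := hy
    exact ⟨d + d', h.add h', by simp [h1, h1']⟩

theorem ccoact_sum (f : Fun E) : (ccoact E δ f).coeff.sum (fun _ a => a) = f := by
  induction mem_closure_symb_isHomog E δ f using AddSubmonoid.closure_induction with
  | mem x hx =>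
    obtain ⟨N', d, hd, rfl⟩ := hx
    rw [hd.cwt_symb.1, AddMonoidAlgebra.coeff_single, Finsupp.sum_single_index rfl]
  | zero => simp
  | add x y _ _ hx hy =>
    rw [map_add, AddMonoidAlgebra.coeff_add, Finsupp.sum_add_index' (by simp) (by simp), hx, hy]

theorem ccoact_scale_pow (l : ℂˣ) (f : Fun E) (N : ℤ) :
    (ccoact E δ (scale E (fun c => l ^ δ c) f)).coeff N =
      ((l ^ N : ℂˣ) : ℂ) • (ccoact E δ f).coeff N := by
  induction mem_closure_symb_isHomog E δ f using AddSubmonoid.closure_induction with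
  | mem x hx =>
    obtain ⟨N', d, hd, rfl⟩ := hx
    have h1 := hd.cwt_symb.2 (zpowersHom ℂˣ l)
    simp only [zpowersHom_apply, toAdd_ofAdd] at h1
    rw [h1, map_smul, hd.cwt_symb.1, AddMonoidAlgebra.coeff_smul_apply,
      AddMonoidAlgebra.coeff_single]
    by_cases h : N' = N
    · rw [h]
    · rw [Finsupp.single_eq_of_ne' h, smul_zero, smul_zero]
  | zero => simp
  | add x y _ _ hx hy =>
    rw [map_add, map_add, map_add, AddMonoidAlgebra.coeff_add, AddMonoidAlgebra.coeff_add,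
      Finsupp.add_apply, Finsupp.add_apply, hx, hy, smul_add]

theorem exists_isHomog_of_scale {f : Fun E} {N : ℤ} (h : ∀ l : ℂˣ,
    scale E (fun c => l ^ δ c) f = ((l ^ N : ℂˣ) : ℂ) • f) :
    ∃ d, IsHomog E δ N d ∧ symb E d = f := by
  obtain ⟨d, hd, hs⟩ := exists_isHomog_coeff (δ := δ) f N
  refine ⟨d, hd, ?_⟩
  rw [hs]
  have h0 : ∀ N', N' ≠ N → (ccoact E δ f).coeff N' = 0 := by
    intro N' hN
    -- A single scalar that is not a root of unity separates all degrees; comparing powers of $2$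
    -- inside $\mathbf R$ suffices.
    let l : ℂˣ := Units.mk0 2 two_ne_zero
    have h1 := ccoact_scale_pow (δ := δ) l f N'
    rw [h l, map_smul, AddMonoidAlgebra.coeff_smul_apply, ← sub_eq_zero, ← sub_smul] at h1
    refine (smul_eq_zero.mp h1).resolve_left ?_
    intro h2
    rw [sub_eq_zero, Units.val_zpow_eq_zpow_val, Units.val_zpow_eq_zpow_val] at h2
    have h3 : ((2 : ℝ) ^ N) = 2 ^ N' := by
      have : (((2 : ℝ) ^ N : ℝ) : ℂ) = (((2 : ℝ) ^ N' : ℝ) : ℂ) := by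
        push_cast; exact h2
      exact_mod_cast this
    exact hN (zpow_right_injective₀ (by norm_num) (by norm_num) h3).symm
  conv_rhs => rw [← ccoact_sum (δ := δ) f]
  rw [Finsupp.sum, Finset.sum_eq_single N]
  · intro N' _ hN; exact h0 N' hN
  · intro hN; simpa using hN

variable [Fintype ι]

/-- The grading of the classical reduction is induced by that of the quantum reduction. -/
theorem mem_redGr_iff {N : ℤ} {r : Red E b H} :
    r ∈ redGr E b H δ N ↔ ∃ q ∈ qredGr E b H δ N, symbRed E b H q = r := by
  constructor
  · rintro ⟨f, hf, rfl⟩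
    obtain ⟨d, hd, hs⟩ := exists_isHomog_of_scale (δ := δ) (f := (f : Fun E)) hf
    have hi : symb E d ∈ invSub E b H := by rw [hs]; exact f.2
    refine ⟨qmk E b H ⟨rey E b H d, rey_mem d⟩, ⟨_, isHomog_rey hd, rfl⟩, ?_⟩
    refine (symbRed_qmkRey hi).trans ?_
    exact congrArg (redMk E b H) (Subtype.ext hs)
  · rintro ⟨_, ⟨d, hd, rfl⟩, rfl⟩
    rw [symbRed_qmk_eq]
    refine ⟨_, fun l => ?_, rfl⟩
    have := hd.cwt_symb.2 (zpowersHom ℂˣ l)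
    simpa only [zpowersHom_apply, toAdd_ofAdd] using this

end Gradings

/-! ## The Euler derivation of the reduction -/

section EulerReduction

variable {ι : Type} [DecidableEq ι] {E : Set (Coord ι)} {m : ℕ} {b : ι → Fin m → ℤ}
  {H : Subgroup (Torus m)}

theorem qact_weylEul (t : Torus m) (d : Weyl E) :
    qact E b t (weylEul E d) = weylEul E (qact E b t d) := by
  induction d using weyl_induction with
  | hC f => rw [weylEul_algebraMap, AlgHom.commutes, AlgHom.commutes, weylEul_algebraMap]
  | hX a =>
    rcases a with c | ⟨c, hc⟩
    · rw [weylEul_coord, (IsWt.coord c).2, weylEul_smul, eulCh_C, zero_smul, add_zero,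
        weylEul_coord]
    · rw [weylEul_inv, map_neg, (IsWt.inv c hc).2, weylEul_smul, eulCh_C, zero_smul, add_zero,
        weylEul_inv, smul_neg]
  | hadd f g hf hg => rw [map_add, map_add, map_add, map_add, hf, hg]
  | hmul f g hf hg => rw [weylEul_mul, map_add, map_mul, map_mul, map_mul, weylEul_mul, hf, hg]

theorem weylEul_mem_qinv {d : Weyl E} (hd : d ∈ qinv E b H) : weylEul E d ∈ qinv E b H :=
  fun t ht => by rw [qact_weylEul, hd t ht]

variable [Fintype ι]

theorem weylEul_qmom (ξ : Fin m → ℂ) : weylEul E (qmom E b ξ) = (2 : ℤ) • qmom E b ξ := by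
  rw [qmom, map_sum, Finset.smul_sum]
  refine Finset.sum_congr rfl fun i _ => ?_
  rw [weylEul_smul, eulCh_C, zero_smul, add_zero, smul_comm, weylEul_mul]
  congr 1
  rw [qc, qc, weylEul_coord, weylEul_coord, two_smul]

theorem weylEul_mem_qmomIdeal {a : Weyl E} (ha : a ∈ qmomIdeal E b H) :
    weylEul E a ∈ qmomIdeal E b H := by
  induction ha using Submodule.span_induction with
  | mem x hx =>
    obtain ⟨ξ, hξ, d, rfl⟩ := hx
    rw [weylEul_mul, weylEul_qmom, smul_mul_assoc]
    have h : ∀ d, qmom E b ξ * d ∈ qmomIdeal E b H := fun d =>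
      Submodule.subset_span ⟨ξ, hξ, d, rfl⟩
    exact add_mem (zsmul_mem (h _) _) (h _)
  | zero => rw [map_zero]; exact zero_mem _
  | add x y _ _ hx hy => rw [map_add]; exact add_mem hx hy
  | smul f x hx h =>
    rw [weylEul_smul]
    exact add_mem (Submodule.smul_mem _ _ h) (Submodule.smul_mem _ _ hx)

/-- The Euler derivation on the invariants. -/
def eulInv : qinv E b H →+ qinv E b H where
  toFun d := ⟨weylEul E d, weylEul_mem_qinv d.2⟩
  map_zero' := Subtype.ext (map_zero _)
  map_add' _ _ := Subtype.ext (map_add _ _ _)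

-- The Euler derivation preserves the invariants and, since each $\mu_q(\xi)$ is homogeneous of
-- degree two, the right ideal of the moment map. It therefore descends along the surjection `qmk`.
variable (E b H) in
theorem exists_eulRed : ∃ D : QRed E b H →+ QRed E b H, ∀ d, D (qmk E b H d) =
    qmk E b H (eulInv d) := by
  let q : qinv E b H →+ QRed E b H := (qmk E b H : qinv E b H →+ QRed E b H)
  have hq : Function.RightInverse (Function.surjInv (qmk_surjective (E := E) (b := b) (H := H))) q :=
    Function.rightInverse_surjInv _
  have hD : q.ker ≤ (q.comp eulInv).ker := fun d hd =>
    qmk_eq_zero.mpr (weylEul_mem_qmomIdeal (qmk_eq_zero.mp hd))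
  let g : {g : qinv E b H →+ QRed E b H // q.ker ≤ g.ker} := ⟨q.comp eulInv, hD⟩
  exact ⟨q.liftOfRightInverse _ hq g, fun d => q.liftOfRightInverse_comp_apply _ hq g d⟩

variable (E b H) in
/-- The Euler derivation of the quantum reduction, for the dilation grading. -/
def eulRed : QRed E b H →+ QRed E b H := (exists_eulRed E b H).choose

theorem eulRed_qmk (d : qinv E b H) : eulRed E b H (qmk E b H d) = qmk E b H (eulInv d) :=
  (exists_eulRed E b H).choose_spec d

theorem eulRed_mul (q q' : QRed E b H) :
    eulRed E b H (q * q') = eulRed E b H q * q' + q * eulRed E b H q' := by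
  obtain ⟨d, rfl⟩ := qmk_surjective q
  obtain ⟨d', rfl⟩ := qmk_surjective q'
  rw [← map_mul, eulRed_qmk, eulRed_qmk, eulRed_qmk, ← map_mul, ← map_mul, ← map_add]
  congr 1
  exact Subtype.ext (weylEul_mul E _ _)

theorem eulRed_smul (f : Ch) (q : QRed E b H) :
    eulRed E b H (f • q) = f • eulRed E b H q + eulCh f • q := by
  obtain ⟨d, rfl⟩ := qmk_surjective q
  rw [← map_smul (qmk E b H), eulRed_qmk, eulRed_qmk, ← map_smul (qmk E b H),
    ← map_smul (qmk E b H), ← map_add]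
  congr 1
  exact Subtype.ext (weylEul_smul E _ _)

theorem eulRed_of_mem {N : ℤ} {q : QRed E b H} (hq : q ∈ qredGr E b H dil N) :
    eulRed E b H q = N • q := by
  obtain ⟨d, hd, rfl⟩ := hq
  rw [eulRed_qmk, ← map_zsmul]
  congr 1
  exact Subtype.ext (weylEul_of_isHomog hd)

theorem eulCh_X_pow (k : ℕ) : eulCh (PowerSeries.X ^ k) = ((2 * k : ℕ) : ℤ) • PowerSeries.X ^ k := by
  induction k with
  | zero =>
    rw [pow_zero, show (1 : Ch) = PowerSeries.C 1 from (map_one _).symm, eulCh_C]; simp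
  | succ k ih =>
    rw [pow_succ, eulCh_mul, ih, eulCh_X]
    simp only [zsmul_eq_mul]
    push_cast
    ring

theorem eulRed_hbar_pow_mul (k : ℕ) (q : QRed E b H) :
    ∃ r, eulRed E b H (hbar _ ^ k * q) = hbar _ ^ k * r := by
  refine ⟨eulRed E b H q + ((2 * k : ℕ) : ℤ) • q, ?_⟩
  rw [hbar_pow_mul_eq_smul, hbar_pow_mul_eq_smul, eulRed_smul, eulCh_X_pow, smul_add,
    smul_assoc, smul_comm]

variable (E b H) in
/-- The Euler derivation of the completed quantum reduction, for the dilation grading. -/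
def eulCompl : Compl (QRed E b H) →+ Compl (QRed E b H) :=
  complAdd (eulRed E b H) eulRed_hbar_pow_mul

theorem complEval_eulCompl (f : Compl (QRed E b H)) {k : ℕ} {q : QRed E b H}
    (h : complEval _ k f = Ideal.Quotient.mk _ q) :
    complEval _ k (eulCompl E b H f) = Ideal.Quotient.mk _ (eulRed E b H q) :=
  complEval_complAdd _ _ f h

theorem eulCompl_toCompl (q : QRed E b H) :
    eulCompl E b H (toCompl _ q) = toCompl _ (eulRed E b H q) :=
  compl_ext fun _ => complEval_eulCompl _ rfl

theorem eulCompl_mul (f g : Compl (QRed E b H)) :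
    eulCompl E b H (f * g) = eulCompl E b H f * g + f * eulCompl E b H g := by
  refine compl_ext fun k => ?_
  obtain ⟨a, ha⟩ := Ideal.Quotient.mk_surjective (complEval _ k f)
  obtain ⟨a', ha'⟩ := Ideal.Quotient.mk_surjective (complEval _ k g)
  rw [complEval_eulCompl (f * g) (q := a * a') (by rw [map_mul, map_mul, ha, ha']),
    map_add (complEval _ k), map_mul (complEval _ k), map_mul (complEval _ k),
    complEval_eulCompl f ha.symm, complEval_eulCompl g ha'.symm, ← ha, ← ha',
    eulRed_mul, map_add, map_mul (Ideal.Quotient.mk _), map_mul (Ideal.Quotient.mk _)]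

theorem eulCompl_smul (r : Ch) (f : Compl (QRed E b H)) :
    eulCompl E b H (r • f) = r • eulCompl E b H f + eulCh r • f := by
  refine compl_ext fun k => ?_
  obtain ⟨a, ha⟩ := Ideal.Quotient.mk_surjective (complEval _ k f)
  rw [complEval_eulCompl (r • f) (q := r • a) (by rw [map_smul, ← ha]; rfl),
    map_add (complEval _ k), map_smul (complEval _ k), map_smul (complEval _ k),
    complEval_eulCompl f ha.symm, ← ha, eulRed_smul, map_add]
  rfl

theorem eulCompl_of_mem {N : ℤ} {f : Compl (QRed E b H)}
    (hf : f ∈ complGr (qredGr E b H dil) N) : eulCompl E b H f = N • f := by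
  refine compl_ext fun k => ?_
  obtain ⟨a, ha, h⟩ := hf k
  rw [complEval_eulCompl f h.symm, eulRed_of_mem ha, map_zsmul, map_zsmul, h]

theorem complSpec_eq {A O : Type*} [Ring A] [Algebra Ch A] [CommRing O] [Algebra ℂ O] (p : A →+* O)
    (hp : IsSpec p) {f : Compl A} {a : A} (h : complEval A 1 f = Ideal.Quotient.mk _ a) :
    complSpec p hp f = p a := by
  have hl : ∀ a ∈ hIdeal A 1, p a = 0 := fun a ha => by
    obtain ⟨r, rfl⟩ := mem_hIdeal.mp ha
    rw [map_mul, pow_one, hbar, hp]; simp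
  change Ideal.Quotient.lift (hIdeal A 1) p hl (complEval A 1 f) = _
  rw [h, Ideal.Quotient.lift_mk]

theorem complSpec_toCompl {A O : Type*} [Ring A] [Algebra Ch A] [CommRing O] [Algebra ℂ O]
    (p : A →+* O) (hp : IsSpec p) (a : A) : complSpec p hp (toCompl A a) = p a :=
  complSpec_eq p hp rfl

theorem complSpec_eq_zero {A O : Type*} [Ring A] [Algebra Ch A] [CommRing O] [Algebra ℂ O]
    (p : A →+* O) (hp : IsSpec p) (hker : ∀ a, p a = 0 → ∃ a', a = hbar A * a') (f : Compl A) :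
    complSpec p hp f = 0 ↔ ∃ g, f = hbar _ * g := by
  constructor
  · intro h
    obtain ⟨a, ha⟩ := Ideal.Quotient.mk_surjective (complEval A 1 f)
    rw [complSpec_eq p hp ha.symm] at h
    obtain ⟨a', rfl⟩ := hker a h
    obtain ⟨g, hg⟩ := (complEval_eq_zero (k := 1) (f := f)).mp (by
      rw [← ha, mk_eq_zero_iff]; exact ⟨a', by rw [pow_one]⟩)
    exact ⟨g, by rw [hg, pow_one]⟩
  · rintro ⟨g, rfl⟩
    have : IsSpec (complSpec p hp) := isSpec_complSpec p hp
    rw [map_mul, hbar, this]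
    simp

/-- The completed quantum Hamiltonian reduction is a graded deformation quantization of the
classical Hamiltonian reduction. -/
theorem isGradedQuantization : IsGradedQuantization (redBrk E b H) (redGr E b H dil) 2
    (complSpec (symbRed E b H) (isSpec_symbRed E b H)) (eulCompl E b H) := by
  have hker := complSpec_eq_zero (symbRed E b H) (isSpec_symbRed E b H)
    fun a h => symbRed_eq_zero.mp h
  have hsurj : Function.Surjective (complSpec (symbRed E b H) (isSpec_symbRed E b H)) := fun r => by
    obtain ⟨q, rfl⟩ := symbRed_surjective r
    exact ⟨toCompl _ q, complSpec_toCompl _ _ _⟩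
  have hlift : ∀ {f g : Compl (QRed E b H)},
      complSpec (symbRed E b H) (isSpec_symbRed E b H) f =
        complSpec (symbRed E b H) (isSpec_symbRed E b H) g → ∃ r, f = g + hbar _ * r :=
    fun {f g} h => by
      obtain ⟨r, hr⟩ := (hker (f - g)).mp (by rw [map_sub, h, sub_self])
      exact ⟨r, by rw [← hr, add_sub_cancel]⟩
  exact
    { spec := isSpec_complSpec _ _
      surjective := hsurj
      ker := hker
      free := free_of_complete (isSpec_complSpec _ _) hsurj (fun a => (hker a).mp)
        (fun a h => compl_torsion (fun k q q' h => qred_torsion h) h)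
        (fun a => compl_separated) compl_series
      commutator := fun f g c hc => by
        -- Both elements are approximated modulo $\hbar^2$ by elements of the uncompleted reduction,
        -- since the error contributes only multiples of $\hbar^2$ to the commutator.
        obtain ⟨q, f', rfl⟩ := compl_approx f 2
        obtain ⟨q', g', rfl⟩ := compl_approx g 2
        obtain ⟨w, h1, h2⟩ := qred_commutator q q'
        have e : ∀ (q : QRed E b H) f', complSpec (symbRed E b H) (isSpec_symbRed E b H)
            (toCompl _ q + hbar _ ^ 2 * f') = symbRed E b H q := fun q f' => by
          rw [map_add, complSpec_toCompl, pow_two, mul_assoc, (hker _).mpr ⟨_, rfl⟩, add_zero]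
        rw [e, e, ← h2, ← complSpec_toCompl _ (isSpec_symbRed E b H)] at hc
        obtain ⟨r, rfl⟩ := hlift hc
        -- The witness collects the cross terms of the two products; $r$ is the discrepancy between
        -- the prescribed lift of the bracket and the one obtained from `qred_commutator`.
        refine ⟨(toCompl _ q * g' + f' * toCompl _ q' + hbar _ ^ 2 * f' * g') -
          (toCompl _ q' * f' + g' * toCompl _ q + hbar _ ^ 2 * g' * f') - r, ?_⟩
        have h3 : toCompl _ q * toCompl _ q' - toCompl _ q' * toCompl _ q =
            hbar (Compl (QRed E b H)) * toCompl _ w := by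
          rw [← map_mul, ← map_mul, ← map_sub, h1, map_mul, map_hbar]
        have h4 : ∀ x : Compl (QRed E b H), x * hbar _ ^ 2 = hbar _ ^ 2 * x := fun x =>
          (hbar_pow_mul_comm 2 x).symm
        have h5 : ∀ x y f' g' : Compl (QRed E b H),
            (x + hbar _ ^ 2 * f') * (y + hbar _ ^ 2 * g') =
            x * y + hbar _ ^ 2 * (x * g' + f' * y + hbar _ ^ 2 * f' * g') := fun x y f' g' => by
          have e1 : x * (hbar _ ^ 2 * g') = hbar _ ^ 2 * (x * g') := by
            rw [← mul_assoc, h4, mul_assoc]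
          have e2 : hbar _ ^ 2 * f' * (hbar _ ^ 2 * g') =
              hbar _ ^ 2 * (hbar _ ^ 2 * f' * g') := by
            rw [← mul_assoc, mul_assoc (hbar _ ^ 2), h4]
            simp only [mul_assoc]
          rw [add_mul, mul_add, mul_add, e1, e2]
          simp only [mul_add, mul_assoc]
          abel
        rw [h5, h5, add_sub_add_comm, h3]
        simp only [mul_add, mul_sub, pow_two, mul_assoc]
        abel
      leibniz := eulCompl_mul
      smul := eulCompl_smul
      euler := fun N f hf => by
        -- The given lift differs from a homogeneous one by $\hbar r$, and $\mathrm{Eu}(\hbar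
        -- r)=\hbar\,\mathrm{Eu}(r)+2\hbar r$ is killed by the projection.
        obtain ⟨q, hq, h1⟩ := mem_redGr_iff.mp hf
        rw [← complSpec_toCompl _ (isSpec_symbRed E b H)] at h1
        obtain ⟨r, rfl⟩ := hlift h1.symm
        have h2 : hbar (Compl (QRed E b H)) * r = (PowerSeries.X : Ch) • r := by
          rw [Algebra.smul_def]; rfl
        rw [map_add, eulCompl_toCompl, eulRed_of_mem hq, h2, eulCompl_smul, ← h2, eulCh_X,
          smul_assoc, ← h2]
        have h3 : (PowerSeries.X : Ch) • eulCompl E b H r = hbar _ * eulCompl E b H r := by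
          rw [Algebra.smul_def]; rfl
        rw [h3]
        simp only [map_add, map_zsmul, (hker _).mpr ⟨_, rfl⟩, add_zero, smul_zero] }

end EulerReduction

/-! ## Characters and cocharacters -/

section Characters

variable {m : ℕ}

theorem ipair_add (w w' e : Fin m → ℤ) : ipair (w + w') e = ipair w e + ipair w' e := by
  simp [ipair, add_mul, Finset.sum_add_distrib]

theorem ipair_neg (w e : Fin m → ℤ) : ipair (-w) e = -ipair w e := by
  simp [ipair]

theorem ipair_sub (w w' e : Fin m → ℤ) : ipair (w - w') e = ipair w e - ipair w' e := by
  rw [sub_eq_add_neg, ipair_add, ipair_neg, sub_eq_add_neg]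

theorem ipair_zsmul (a : ℤ) (w e : Fin m → ℤ) : ipair (a • w) e = a * ipair w e := by
  simp [ipair, Finset.mul_sum, mul_assoc]

theorem ipair_sum {κ : Type*} (s : Finset κ) (w : κ → Fin m → ℤ) (e : Fin m → ℤ) :
    ipair (∑ k ∈ s, w k) e = ∑ k ∈ s, ipair (w k) e := by
  simp only [ipair, Finset.sum_apply, Finset.sum_mul]
  exact Finset.sum_comm

theorem ipair_sum_right {κ : Type*} (s : Finset κ) (w : Fin m → ℤ) (e : κ → Fin m → ℤ) :
    ipair w (∑ k ∈ s, e k) = ∑ k ∈ s, ipair w (e k) := by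
  simp only [ipair, Finset.sum_apply, Finset.mul_sum]
  exact Finset.sum_comm

theorem ipair_zsmul_right (a : ℤ) (w e : Fin m → ℤ) : ipair w (a • e) = a * ipair w e := by
  simp only [ipair, Pi.smul_apply, smul_eq_mul, Finset.mul_sum]
  exact Finset.sum_congr rfl fun _ _ => by ring

theorem ipair_sub_right (w e e' : Fin m → ℤ) : ipair w (e - e') = ipair w e - ipair w e' := by
  simp [ipair, mul_sub]

theorem chi_zsmul (a : ℤ) (w : Fin m → ℤ) (t : Torus m) : chi (a • w) t = chi w t ^ a := by
  simp only [chi, MonoidHom.coe_mk, OneHom.coe_mk, Pi.smul_apply, smul_eq_mul,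
    ← Finset.prod_zpow]
  exact Finset.prod_congr rfl fun _ _ => by rw [mul_comm, zpow_mul]

theorem chi_zero (t : Torus m) : chi 0 t = 1 := by simp [chi]

theorem chi_sub (w w' : Fin m → ℤ) (t : Torus m) : chi (w - w') t = chi w t * (chi w' t)⁻¹ := by
  rw [sub_eq_add_neg, chi_add, chi_neg]

theorem chi_sum {κ : Type*} (s : Finset κ) (w : κ → Fin m → ℤ) (t : Torus m) :
    chi (∑ k ∈ s, w k) t = ∏ k ∈ s, chi (w k) t := by
  classical
  induction s using Finset.induction_on with
  | empty => simp [chi_zero]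
  | insert k s hk ih => rw [Finset.sum_insert hk, Finset.prod_insert hk, chi_add, ih]

theorem chi_zpow (w e : Fin m → ℤ) (s : ℂˣ) : chi w (fun j => s ^ e j) = s ^ ipair w e := by
  have h : ∀ t : Finset (Fin m), ∏ j ∈ t, (s ^ e j) ^ w j = s ^ ∑ j ∈ t, w j * e j := fun t => by
    induction t using Finset.induction_on with
    | empty => simp
    | insert k t hk ih =>
      rw [Finset.sum_insert hk, Finset.prod_insert hk, ih, zpow_add, mul_comm (w k), zpow_mul]
  exact h Finset.univ

theorem zpow_two_eq_one {a : ℤ} (h : (Units.mk0 (2 : ℂ) two_ne_zero) ^ a = 1) : a = 0 := by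
  have h1 : ((2 : ℂ) ^ a) = 1 := by
    have := congrArg (Units.val) h
    rwa [Units.val_zpow_eq_zpow_val] at this
  have h2 : ((2 : ℝ) ^ a) = 2 ^ (0 : ℤ) := by
    have : (((2 : ℝ) ^ a : ℝ) : ℂ) = 1 := by push_cast; exact h1
    rw [zpow_zero]
    exact_mod_cast this
  exact zpow_right_injective₀ (by norm_num) (by norm_num) h2

/-- Evaluation at the point with one coordinate equal to $2$, an element of infinite order, recovers
the corresponding exponent. -/
theorem eq_zero_of_chi_eq_one {w : Fin m → ℤ} (h : ∀ t, chi w t = 1) : w = 0 := by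
  classical
  funext j
  have := h fun i => (Units.mk0 (2 : ℂ) two_ne_zero) ^ (Pi.single j 1 : Fin m → ℤ) i
  rw [chi_zpow] at this
  have h2 := zpow_two_eq_one this
  simpa [ipair, Pi.single_apply] using h2

theorem pair_sum {κ : Type*} (s : Finset κ) (w : κ → Fin m → ℤ) (ξ : Fin m → ℂ) :
    pair (∑ k ∈ s, w k) ξ = ∑ k ∈ s, pair (w k) ξ := by
  simp only [pair, Finset.sum_apply, Int.cast_sum, Finset.sum_mul]
  exact Finset.sum_comm

theorem pair_zsmul (a : ℤ) (w : Fin m → ℤ) (ξ : Fin m → ℂ) :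
    pair (a • w) ξ = a * pair w ξ := by
  simp [pair, Finset.mul_sum, mul_assoc]

theorem pair_zero (ξ : Fin m → ℂ) : pair 0 ξ = 0 := by simp [pair]

theorem pair_add_right (w : Fin m → ℤ) (ξ η : Fin m → ℂ) :
    pair w (ξ + η) = pair w ξ + pair w η := by
  simp [pair, mul_add, Finset.sum_add_distrib]

theorem pair_sub_right (w : Fin m → ℤ) (ξ η : Fin m → ℂ) :
    pair w (ξ - η) = pair w ξ - pair w η := by
  simp [pair, mul_sub]

theorem pair_sum_right {κ : Type*} (s : Finset κ) (w : Fin m → ℤ) (ξ : κ → Fin m → ℂ) :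
    pair w (∑ k ∈ s, ξ k) = ∑ k ∈ s, pair w (ξ k) := by
  simp only [pair, Finset.sum_apply, Finset.mul_sum]
  exact Finset.sum_comm

theorem pair_smul_right (w : Fin m → ℤ) (a : ℂ) (ξ : Fin m → ℂ) :
    pair w (a • ξ) = a * pair w ξ := by
  simp only [pair, Pi.smul_apply, smul_eq_mul, Finset.mul_sum]
  exact Finset.sum_congr rfl fun _ _ => by ring

theorem pair_intCast (w e : Fin m → ℤ) : pair w (fun j => (e j : ℂ)) = (ipair w e : ℂ) := by
  simp [pair, ipair]

theorem lie_top : lie (⊤ : Subgroup (Torus m)) = Set.univ := by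
  refine Set.eq_univ_of_forall fun ξ w hw => ?_
  rw [eq_zero_of_chi_eq_one fun t => hw t trivial, pair_zero]

end Characters

/-! ## Unimodular systems of weights -/

section Unimodular

theorem exists_common_denominator {κ : Type*} [Finite κ] (ξ : κ → ℚ) :
    ∃ N : ℤ, 0 < N ∧ ∃ z : κ → ℤ, ∀ j, (z j : ℚ) = N * ξ j := by
  have := Fintype.ofFinite κ
  have h : ∀ j, ∃ z : ℤ, (z : ℚ) = ((∏ i, (ξ i).den : ℕ) : ℤ) * ξ j := by
    intro j
    obtain ⟨a, ha⟩ := Finset.dvd_prod_of_mem (fun i => (ξ i).den) (Finset.mem_univ j)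
    refine ⟨a * (ξ j).num, ?_⟩
    rw [ha]
    push_cast
    rw [← Rat.den_mul_eq_num]
    ring
  choose z hz using h
  exact ⟨_, by exact_mod_cast Finset.prod_pos fun i _ => (ξ i).den_pos, z, hz⟩

variable {n m : ℕ} {b : Fin n → Fin m → ℤ}

/-- The weights with rational coefficients. -/
def ratWt (b : Fin n → Fin m → ℤ) (i : Fin n) : Fin m → ℚ := fun j => (b i j : ℚ)

theorem linearIndependent_ratWt {G : Set (Fin n)} :
    LinearIndepOn ℚ (ratWt b) G ↔ LinearIndependent ℤ (fun i : G => b i) := by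
  let f : (Fin m → ℤ) →ₗ[ℤ] (Fin m → ℚ) :=
    { toFun := fun w j => (w j : ℚ)
      map_add' := fun _ _ => by funext; simp
      map_smul' := fun _ _ => by funext; simp }
  have hf : LinearMap.ker f = ⊥ := LinearMap.ker_eq_bot.mpr fun w w' h => by
    funext j
    have h1 : (w j : ℚ) = w' j := congrFun h j
    exact_mod_cast h1
  rw [← LinearMap.linearIndependent_iff f hf, LinearIndepOn,
    ← LinearIndependent.iff_fractionRing ℤ ℚ]
  rfl

/-- Otherwise a nonzero rational functional kills all weights. After clearing denominators it is a
cocharacter acting trivially, and its value at $2$ contradicts faithfulness. -/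
theorem span_ratWt (hf : Faithful b) : Submodule.span ℚ (Set.range (ratWt b)) = ⊤ := by
  classical
  by_contra hne
  obtain ⟨f, hf0, hle⟩ := Submodule.exists_le_ker_of_lt_top _ (lt_top_iff_ne_top.mpr hne)
  have hsum : ∀ w : Fin m → ℚ, f w = ∑ j, w j * f (Pi.single j 1) := fun w => by
    conv_lhs => rw [pi_eq_sum_univ' w, map_sum]
    exact Finset.sum_congr rfl fun j _ => by rw [map_smul, smul_eq_mul]
  obtain ⟨N, hN, z, hz⟩ := exists_common_denominator fun j => f (Pi.single j 1)
  have h1 : ∀ i, ipair (b i) z = 0 := fun i => by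
    have h2 : f (ratWt b i) = 0 := hle (Submodule.subset_span ⟨i, rfl⟩)
    rw [hsum] at h2
    have h3 : ((ipair (b i) z : ℤ) : ℚ) = N * ∑ j, ratWt b i j * f (Pi.single j 1) := by
      rw [ipair, Finset.mul_sum]
      push_cast
      exact Finset.sum_congr rfl fun j _ => by rw [hz, ratWt]; ring
    rw [h2, mul_zero] at h3
    exact_mod_cast h3
  have h4 : (fun j => (Units.mk0 (2 : ℂ) two_ne_zero) ^ z j : Torus m) = 1 := hf <| by
    funext i
    simp only
    rw [chi_zpow, h1, zpow_zero, map_one]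
  have h5 : z = 0 := funext fun j => zpow_two_eq_one (congrFun h4 j)
  refine hf0 (LinearMap.ext fun w => ?_)
  rw [hsum]
  refine Finset.sum_eq_zero fun j _ => ?_
  have := hz j
  rw [h5, Pi.zero_apply, Int.cast_zero, eq_comm, mul_eq_zero] at this
  rw [this.resolve_left (by exact_mod_cast hN.ne'), mul_zero]

/-- A linearly independent set of weights of a unimodular faithful action has a dual system of
cocharacters. -/
theorem exists_dual (hf : Faithful b) (hu : Unimodular b) {G : Set (Fin n)}
    (hG : LinearIndepOn ℚ (ratWt b) G) :
    ∃ e : Fin n → Fin m → ℤ, ∀ i ∈ G, ∀ j ∈ G, ipair (b i) (e j) = if i = j then 1 else 0 := by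
  classical
  -- The set is enlarged to a maximal independent set of weights, which is a basis of $\mathbf Q^m$
  -- since the weights span.
  obtain ⟨G', -, hGG', hspan, hli⟩ := exists_linearIndepOn_extension hG (Set.subset_univ G)
  have htop : ⊤ ≤ Submodule.span ℚ (Set.range fun i : G' => ratWt b i) := by
    rw [← span_ratWt hf, Submodule.span_le, ← Set.image_univ]
    refine hspan.trans ?_
    rw [Set.image_eq_range]
  let B := Module.Basis.mk hli htop
  have hcard : Fintype.card G' = m := by
    rw [← Module.finrank_eq_card_basis B]; simp
  let σ : Fin m ≃ G' := (Fintype.equivFinOfCardEq hcard).symm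
  let M : Matrix (Fin m) (Fin m) ℤ := Matrix.of fun k j => b (σ k) j
  have hdet : M.det ≠ 0 := by
    intro h0
    have h1 : LinearIndependent ℚ (M.map (Int.castRingHom ℚ)).row := by
      have := hli.comp σ σ.injective
      exact this
    have h2 := Matrix.linearIndependent_rows_iff_isUnit.mp h1
    rw [Matrix.isUnit_iff_isUnit_det, ← RingHom.mapMatrix_apply, ← RingHom.map_det, h0] at h2
    simp at h2
  -- A nonzero $m\times m$ minor is $\pm1$ by unimodularity, so the inverse matrix is integral.
  have hunit : IsUnit M.det := by
    rcases hu (fun k => (σ k : Fin n)) with h | h | h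
    · exact absurd h hdet
    · rw [show M.det = 1 from h]; exact isUnit_one
    · rw [show M.det = -1 from h]; exact isUnit_one.neg
  have hinv : M * M⁻¹ = 1 := Matrix.mul_nonsing_inv M hunit
  -- The dual cocharacters are the columns of the inverse matrix; outside the basis the value is
  -- irrelevant and is set to zero.
  refine ⟨fun i => if h : i ∈ G' then fun j => M⁻¹ j (σ.symm ⟨i, h⟩) else 0, fun i hi j hj => ?_⟩
  have h1 := congrFun (congrFun hinv (σ.symm ⟨i, hGG' hi⟩)) (σ.symm ⟨j, hGG' hj⟩)
  rw [Matrix.mul_apply, Matrix.one_apply] at h1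
  simp only [dif_pos (hGG' hj)]
  rw [ipair]
  refine Eq.trans (Finset.sum_congr rfl fun k _ => ?_) (h1.trans (by simp))
  change b i k * _ = b (σ (σ.symm ⟨i, hGG' hi⟩)) k * _
  rw [Equiv.apply_symm_apply]

end Unimodular

/-! ## Existence of charts -/

section ExistsChart

variable {n m : ℕ} {b : Fin n → Fin m → ℤ} {p : Coord (Fin n) → ℂ}

/-- On the finite-dimensional $\mathbf Q$-span of the given reals, the inclusion into $\mathbf R$
lies in the open set of real-valued functionals that are positive on the positive $a_c$. Rational
functionals are dense, so one of them lies there too. Applying it to a real relation with integral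
coefficients keeps signs and makes the numbers rational. -/
theorem exists_pos_dual {κ : Type*} [Finite κ] (a : κ → ℝ) :
    ∃ l : ℝ →ₗ[ℚ] ℚ, ∀ c, 0 < a c → 0 < l (a c) := by
  let V := Submodule.span ℚ (Set.range a)
  have : Module.Finite ℚ V := Module.Finite.span_of_finite ℚ (Set.finite_range a)
  let B := Module.finBasis ℚ V
  let a' : κ → V := fun c => ⟨a c, Submodule.subset_span ⟨c, rfl⟩⟩
  let U : Set (Fin (Module.finrank ℚ V) → ℝ) :=
    {y | ∀ c, 0 < a c → 0 < ∑ i, ((B.repr (a' c) i : ℚ) : ℝ) * y i}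
  have hU : IsOpen U := by
    have : U = ⋂ c, {y | 0 < a c → 0 < ∑ i, ((B.repr (a' c) i : ℚ) : ℝ) * y i} := by
      ext; simp [U]
    rw [this]
    refine isOpen_iInter_of_finite fun c => ?_
    by_cases h : 0 < a c
    · simp only [h, true_imp_iff]
      exact isOpen_lt continuous_const (by fun_prop)
    · simp [h]
  have hv : (fun i => ((B i : V) : ℝ)) ∈ U := fun c hc => by
    have h1 := congrArg (Submodule.subtype V) (B.sum_repr (a' c))
    rw [map_sum] at h1
    have h2 : ∑ i, ((B.repr (a' c) i : ℚ) : ℝ) * ((B i : V) : ℝ) = a c := by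
      rw [← show V.subtype (a' c) = a c from rfl, ← h1]
      exact Finset.sum_congr rfl fun i _ => by
        rw [map_smul, Rat.smul_def]; rfl
    rw [h2]; exact hc
  have hd : DenseRange (fun (q : Fin (Module.finrank ℚ V) → ℚ) i => (q i : ℝ)) :=
    DenseRange.piMap fun _ => Rat.denseRange_cast
  obtain ⟨q, hq⟩ := hd.exists_mem_open hU ⟨_, hv⟩
  obtain ⟨l, hl⟩ := LinearMap.exists_extend (B.constr ℚ q)
  refine ⟨l, fun c hc => ?_⟩
  have h1 : l (a c) = ∑ i, B.repr (a' c) i * q i := by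
    have : l (a c) = (l ∘ₗ V.subtype) (a' c) := rfl
    rw [this, hl, Module.Basis.constr_apply_fintype]
    simp [Module.Basis.equivFun_apply]
  have h2 := hq c hc
  rw [h1]
  simp only at h2
  exact_mod_cast h2

/-- On a closed orbit the norm attains its minimum, which gives a relation with positive
coefficients between the weights of the nonzero coordinates. -/
theorem exists_pos_relation (hc : ClosedOrbit b p) : ∃ a : Coord (Fin n) → ℝ,
    (∀ c, p c ≠ 0 → 0 < a c) ∧ (∀ c, p c = 0 → a c = 0) ∧
      ∀ j, ∑ c, (wt b c j : ℝ) * a c = 0 := by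
  classical
  let orb : Torus m → EuclideanSpace ℂ (Coord (Fin n)) := fun t =>
    WithLp.toLp 2 fun c => ((chi (wt b c) t : ℂˣ) : ℂ) * p c
  have hcl : IsClosed (Set.range orb) := by
    have h1 : Set.range orb = (WithLp.ofLp : EuclideanSpace ℂ (Coord (Fin n)) → _) ⁻¹'
        (Set.range fun (t : Torus m) (c : Coord (Fin n)) =>
          ((chi (wt b c) t : ℂˣ) : ℂ) * p c) := by
      ext y
      constructor
      · rintro ⟨t, rfl⟩; exact ⟨t, rfl⟩
      · rintro ⟨t, ht⟩; exact ⟨t, by ext c; exact congrFun ht c⟩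
    rw [h1]
    exact IsClosed.preimage (PiLp.continuous_ofLp 2 _) hc
  obtain ⟨_, ⟨t, rfl⟩, ht⟩ := hcl.exists_infDist_eq_dist ⟨_, Set.mem_range_self 1⟩ 0
  have hmin : ∀ t', ∑ c, ‖orb t c‖ ^ 2 ≤ ∑ c, ‖orb t' c‖ ^ 2 := fun t' => by
    have h1 : dist 0 (orb t) ≤ dist 0 (orb t') := by
      rw [← ht]; exact Metric.infDist_le_dist_of_mem ⟨t', rfl⟩
    rw [dist_zero_left, dist_zero_left] at h1
    rw [← EuclideanSpace.norm_sq_eq, ← EuclideanSpace.norm_sq_eq]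
    exact pow_le_pow_left₀ (norm_nonneg _) h1 2
  refine ⟨fun c => ‖orb t c‖ ^ 2, fun c hc => ?_, fun c hc => ?_, fun j => ?_⟩
  · have : orb t c ≠ 0 := mul_ne_zero (Units.ne_zero _) hc
    positivity
  · have : orb t c = 0 := by
      change _ * p c = 0
      rw [hc, mul_zero]
    simp only [this, norm_zero]
    norm_num
  -- The squared norm is restricted to the one-parameter group $s\mapsto e^s$ in the $j$-th factor
  -- of the torus. Its derivative at the minimum $s=0$ is twice the $j$-th component of the desired
  -- relation.
  · let g : ℝ → ℝ := fun s => ∑ c, Real.exp ((2 * wt b c j : ℝ) * s) * ‖orb t c‖ ^ 2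
    have hg : ∀ s : ℝ, ∑ c, ‖orb (t * fun i => (Units.mk0 (Complex.exp (s : ℂ))
        (Complex.exp_ne_zero _)) ^ (Pi.single j 1 : Fin m → ℤ) i) c‖ ^ 2 = g s := fun s => by
      refine Finset.sum_congr rfl fun c _ => ?_
      have h1 : ipair (wt b c) (Pi.single j 1) = wt b c j := by simp [ipair, Pi.single_apply]
      change ‖((chi (wt b c) (t * _) : ℂˣ) : ℂ) * p c‖ ^ 2 =
        _ * ‖((chi (wt b c) t : ℂˣ) : ℂ) * p c‖ ^ 2
      rw [map_mul, chi_zpow, h1, Units.val_mul, Units.val_zpow_eq_zpow_val, Units.val_mk0,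
        mul_right_comm, norm_mul, norm_zpow, Complex.norm_exp, Complex.ofReal_re, mul_pow, mul_comm,
        ← Real.rpow_intCast, ← Real.exp_mul, ← Real.exp_nat_mul]
      congr 2
      push_cast
      ring
    have hloc : IsLocalMin g 0 := Filter.Eventually.of_forall fun s => by
      rw [← hg s]
      refine le_trans (le_of_eq ?_) (hmin _)
      simp [g]
    have hd : HasDerivAt g (∑ c, Real.exp ((2 * wt b c j : ℝ) * 0) * (2 * wt b c j * 1) *
        ‖orb t c‖ ^ 2) 0 :=
      HasDerivAt.fun_sum fun c _ =>
        (((hasDerivAt_id (0 : ℝ)).const_mul (2 * wt b c j : ℝ)).exp).mul_const _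
    have h0 := hloc.hasDerivAt_eq_zero hd
    simp only [mul_zero, Real.exp_zero, one_mul, mul_one, mul_assoc, ← Finset.mul_sum] at h0
    simpa using h0

/-- The weights are integral, so a $\mathbf Q$-linear functional can be applied to the coefficients
of the real relation; `exists_pos_dual` supplies one that preserves positivity, and denominators are
cleared. -/
theorem exists_int_relation (hc : ClosedOrbit b p) : ∃ k : Coord (Fin n) → ℤ,
    (∀ c, p c ≠ 0 → 0 < k c) ∧ (∀ c, p c = 0 → k c = 0) ∧ ∑ c, k c • wt b c = 0 := by
  obtain ⟨a, h1, h2, h3⟩ := exists_pos_relation hc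
  obtain ⟨l, hl⟩ := exists_pos_dual a
  obtain ⟨N, hN, k, hk⟩ := exists_common_denominator fun c => l (a c)
  refine ⟨k, fun c hc => ?_, fun c hc => ?_, ?_⟩
  · have : (0 : ℚ) < k c := by
      rw [hk]
      exact mul_pos (by exact_mod_cast hN) (hl c (h1 c hc))
    exact_mod_cast this
  · have : (k c : ℚ) = 0 := by rw [hk, h2 c hc, map_zero, mul_zero]
    exact_mod_cast this
  · funext j
    have h4 := congrArg l (h3 j)
    rw [map_sum, map_zero] at h4
    have h5 : (((∑ c, k c • wt b c) j : ℤ) : ℚ) = N * ∑ c, l ((wt b c j : ℝ) * a c) := by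
      simp only [Finset.sum_apply, Finset.mul_sum, Pi.smul_apply, smul_eq_mul]
      push_cast
      refine Finset.sum_congr rfl fun c _ => ?_
      rw [← zsmul_eq_mul ((a c)), map_zsmul, zsmul_eq_mul]
      rw [hk]
      ring
    rw [h4, mul_zero] at h5
    exact_mod_cast h5

/-- The vanishing of the moment map is a complex relation between the $b_i$ with coefficients
$x_iy_i$. A $\mathbf Q$-linear functional on $\mathbf C$ that vanishes at none of the finitely many
nonzero coefficients makes it rational with the same support. -/
theorem exists_int_relation_of_zeroFibre (hp : InZeroFibre b p) : ∃ z : Fin n → ℤ,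
    (∀ i, z i ≠ 0 ↔ p (Sum.inl i) * p (Sum.inr i) ≠ 0) ∧ ∑ i, z i • b i = 0 := by
  obtain ⟨l, hl⟩ := Module.exists_dual_forall_apply_ne_zero (K := ℚ)
    (fun i : {i // p (Sum.inl i) * p (Sum.inr i) ≠ 0} => p (Sum.inl i) * p (Sum.inr i))
    fun i => i.2
  obtain ⟨N, hN, z, hz⟩ := exists_common_denominator fun i => l (p (Sum.inl i) * p (Sum.inr i))
  have hN' : (N : ℚ) ≠ 0 := by exact_mod_cast hN.ne'
  refine ⟨z, fun i => ?_, ?_⟩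
  · rw [← Int.cast_ne_zero (α := ℚ), hz]
    constructor
    · intro h h0
      rw [h0, map_zero, mul_zero] at h
      exact h rfl
    · intro h
      exact mul_ne_zero hN' (hl ⟨i, h⟩)
  · funext j
    have h4 := congrArg l (hp j)
    rw [map_sum, map_zero] at h4
    have h5 : (((∑ i, z i • b i) j : ℤ) : ℚ) =
        N * ∑ i, l ((b i j : ℂ) * (p (Sum.inl i) * p (Sum.inr i))) := by
      simp only [Finset.sum_apply, Finset.mul_sum, Pi.smul_apply, smul_eq_mul]
      push_cast
      refine Finset.sum_congr rfl fun c _ => ?_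
      rw [← zsmul_eq_mul (p (Sum.inl c) * p (Sum.inr c)), map_zsmul, zsmul_eq_mul]
      rw [hz]
      ring
    rw [h4, mul_zero] at h5
    exact_mod_cast h5

/-- A relation between the weights of the nonzero coordinates, involving exactly one of each pair
of conjugate coordinates. -/
theorem exists_sign_relation (hp : InZeroFibre b p) (hc : ClosedOrbit b p) : ∃ z : Fin n → ℤ,
    (∀ i, 0 < z i → p (Sum.inl i) ≠ 0) ∧ (∀ i, z i < 0 → p (Sum.inr i) ≠ 0) ∧
    (∀ i, z i = 0 → p (Sum.inl i) = 0 ∧ p (Sum.inr i) = 0) ∧ ∑ i, z i • b i = 0 := by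
  obtain ⟨k, hk1, hk2, hk3⟩ := exists_int_relation hc
  obtain ⟨y, hy1, hy2⟩ := exists_int_relation_of_zeroFibre hp
  -- If $y_i\neq0$, both coordinates of the pair are nonzero and either sign is allowed; $M$ exceeds
  -- all $|r_i|$, so that $r_i+My_i\neq0$. If $y_i=0$, at most one coordinate of the pair is nonzero
  -- and the sign of $r_i$ says which.
  let r : Fin n → ℤ := fun i => k (Sum.inl i) - k (Sum.inr i)
  let M : ℤ := 1 + ∑ i, |r i|
  have hM : ∀ i, |r i| < M := fun i => by
    have := Finset.single_le_sum (f := fun i => |r i|) (fun i _ => abs_nonneg _)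
      (Finset.mem_univ i)
    simp only [M]
    linarith
  have hB : ∀ i, y i ≠ 0 → r i + M * y i ≠ 0 := fun i hi h0 => by
    have h1 : |r i| = M * |y i| := by
      rw [eq_neg_of_add_eq_zero_left h0, abs_neg, abs_mul,
        abs_of_pos (lt_of_le_of_lt (abs_nonneg _) (hM i))]
    have h2 := hM i
    rw [h1] at h2
    have h3 : 1 ≤ |y i| := Int.one_le_abs hi
    have h4 := lt_of_le_of_lt (abs_nonneg _) (hM i)
    nlinarith
  have hy0 : ∀ i, y i = 0 → p (Sum.inl i) = 0 ∨ p (Sum.inr i) = 0 := fun i hi => by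
    by_contra h
    rw [← mul_eq_zero] at h
    exact (hy1 i).mpr h hi
  have hB' : ∀ i, y i ≠ 0 → p (Sum.inl i) ≠ 0 ∧ p (Sum.inr i) ≠ 0 := fun i hi =>
    mul_ne_zero_iff.mp ((hy1 i).mp hi)
  have hnn : ∀ c, 0 ≤ k c := fun c => by
    by_cases h : p c = 0
    · rw [hk2 c h]
    · exact (hk1 c h).le
  refine ⟨fun i => r i + M * y i, fun i hi => ?_, fun i hi => ?_, fun i hi => ?_, ?_⟩
  all_goals try simp only at hi
  · by_cases h : y i = 0
    · intro h0
      rw [h, mul_zero, add_zero] at hi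
      simp only [r, hk2 _ h0] at hi
      have := hnn (Sum.inr i)
      omega
    · exact (hB' i h).1
  · by_cases h : y i = 0
    · intro h0
      rw [h, mul_zero, add_zero] at hi
      simp only [r, hk2 _ h0] at hi
      have := hnn (Sum.inl i)
      omega
    · exact (hB' i h).2
  · by_cases h : y i = 0
    · rw [h, mul_zero, add_zero] at hi
      simp only [r] at hi
      rcases hy0 i h with h0 | h0
      · refine ⟨h0, ?_⟩
        by_contra h1
        have := hk1 _ h1
        rw [hk2 _ h0] at hi
        omega
      · refine ⟨?_, h0⟩
        by_contra h1
        have := hk1 _ h1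
        rw [hk2 _ h0] at hi
        omega
    · exact absurd hi (hB i h)
  · have h1 : ∑ i, r i • b i = 0 := by
      rw [← hk3, Fintype.sum_sum_type, ← Finset.sum_add_distrib]
      exact Finset.sum_congr rfl fun i _ => by
        simp only [r, wt, add_smul, neg_smul, sub_eq_add_neg, Sum.elim_inl, Sum.elim_inr, smul_neg]
    simp only [add_smul, Finset.sum_add_distrib, h1, mul_smul, ← Finset.smul_sum, hy2, smul_zero,
      add_zero]

theorem exists_isChart (hf : Faithful b) (hu : Unimodular b) (hp : InZeroFibre b p)
    (hc : ClosedOrbit b p) : ∃ E e, IsChart b p E e := by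
  classical
  obtain ⟨z, hpos, hneg, hzero, hrel⟩ := exists_sign_relation hp hc
  -- $G$ is a maximal independent set among the indices with $z_i\neq0$.
  obtain ⟨G, hGI, -, hspan, hli⟩ := exists_linearIndepOn_extension
    (linearIndepOn_empty ℚ (ratWt b)) (Set.empty_subset {i | z i ≠ 0})
  obtain ⟨d, hd⟩ := exists_dual hf hu hli
  -- The rational coefficients of such a $b_i$ in terms of $G$ are its pairings with the dual
  -- cocharacters, hence integers. So the equations $t^{b_j}=1$ for $j\in G$ already imply all
  -- equations defining the stabilizer.
  have hcomb : ∀ i, z i ≠ 0 → b i = ∑ j ∈ G.toFinset, ipair (b i) (d j) • b j := fun i hi => by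
    have h1 : ∀ w ∈ Submodule.span ℚ (ratWt b '' G), ∀ l,
        w l = ∑ j ∈ G.toFinset, (∑ k, w k * d j k) * b j l := fun w hw => by
      induction hw using Submodule.span_induction with
      | mem w hw =>
        obtain ⟨i, hi, rfl⟩ := hw
        intro l
        have h3 : ∀ j ∈ G.toFinset, (∑ k, ratWt b i k * d j k) * (b j l : ℚ) =
            if i = j then (b j l : ℚ) else 0 := fun j hj => by
          have h4 := congrArg (Int.cast (R := ℚ)) (hd i hi j (Set.mem_toFinset.mp hj))
          rw [ipair] at h4
          push_cast at h4
          rw [show ∑ k, ratWt b i k * (d j k : ℚ) = _ from h4, ite_mul, one_mul, zero_mul]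
        rw [Finset.sum_congr rfl h3, Finset.sum_ite_eq, if_pos (Set.mem_toFinset.mpr hi)]
        rfl
      | zero => simp
      | add w w' _ _ h h' =>
        intro l
        simp only [Pi.add_apply, add_mul, Finset.sum_add_distrib, h l, h' l]
      | smul a w _ h =>
        intro l
        rw [Pi.smul_apply, h l, smul_eq_mul, Finset.mul_sum]
        refine Finset.sum_congr rfl fun j _ => ?_
        simp only [Pi.smul_apply, smul_eq_mul, mul_assoc, ← Finset.mul_sum]
    funext l
    have h2 := h1 _ (hspan ⟨i, hi, rfl⟩) l
    have h6 : ((b i l : ℤ) : ℚ) = (((∑ j ∈ G.toFinset, ipair (b i) (d j) • b j) l : ℤ) : ℚ) := by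
      simp only [Finset.sum_apply, Pi.smul_apply, smul_eq_mul, ipair]
      push_cast
      exact h2
    exact_mod_cast h6
  have hsign : ∀ i ∈ G, ipair (b i) (∑ j ∈ G.toFinset, (z j).sign • d j) = (z i).sign :=
    fun i hi => by
      rw [ipair_sum_right, Finset.sum_eq_single i]
      · rw [ipair_zsmul_right, hd i hi i hi, if_pos rfl, mul_one]
      · intro j hj hij
        rw [ipair_zsmul_right, hd i hi j (Set.mem_toFinset.mp hj), if_neg hij.symm, mul_zero]
      · intro h; exact absurd (Set.mem_toFinset.mpr hi) h
  -- The sign of $z_i$ selects $x_i$ or $y_i$, and $|z_i|$ is its exponent in the invariant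
  -- monomial. Twisting the dual cocharacters by the signs gives the selected coordinates with index
  -- in $G$ weight one.
  refine ⟨{c | Sum.elim (fun i => 0 < z i) (fun i => z i < 0) c},
    ∑ j ∈ G.toFinset, (z j).sign • d j, ?_, ?_, G.toFinset, ?_, ?_, ?_⟩
  · rintro (i | i) hi
    · exact hpos i hi
    · exact hneg i hi
  · refine ⟨Sum.elim (fun i => (z i).toNat) (fun i => (-z i).toNat), ?_, ?_⟩
    · rintro (i | i)
      · change (z i).toNat ≠ 0 ↔ 0 < z i; omega
      · change (-z i).toNat ≠ 0 ↔ z i < 0; omega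
    · rw [← hrel, Fintype.sum_sum_type, ← Finset.sum_add_distrib]
      refine Finset.sum_congr rfl fun i _ => ?_
      simp only [Sum.elim_inl, Sum.elim_inr, wt, smul_neg, ← sub_eq_add_neg, ← sub_smul]
      congr 1
      omega
  · exact (linearIndependent_ratWt.mp hli).comp
      (fun i : G.toFinset => ⟨i, Set.mem_toFinset.mp i.2⟩)
      fun i j h => Subtype.ext (congrArg (fun i : G => (i : Fin n)) h)
  · intro t
    constructor
    · intro ht i hi
      rw [Set.mem_toFinset] at hi
      have hz : z i ≠ 0 := hGI hi
      rcases lt_or_gt_of_ne hz with h | h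
      · have h1 := ht (Sum.inr i)
        have h2 := mul_right_cancel₀ (hneg i h) (h1.trans (one_mul _).symm)
        have h3 : chi (-b i) t = 1 := Units.ext h2
        rwa [chi_neg, inv_eq_one] at h3
      · have h1 := ht (Sum.inl i)
        exact Units.ext (mul_right_cancel₀ (hpos i h) (h1.trans (one_mul _).symm))
    · intro ht c
      have key : ∀ i, z i ≠ 0 → chi (b i) t = 1 := fun i hi => by
        rw [hcomb i hi, chi_sum]
        exact Finset.prod_eq_one fun j hj => by rw [chi_zsmul, ht j hj, one_zpow]
      rcases c with i | i
      · by_cases hi : z i = 0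
        · rw [(hzero i hi).1, mul_zero]
        · rw [show wt b (Sum.inl i) = b i from rfl, key i hi, Units.val_one, one_mul]
      · by_cases hi : z i = 0
        · rw [(hzero i hi).2, mul_zero]
        · rw [show wt b (Sum.inr i) = -b i from rfl, chi_neg, key i hi, inv_one, Units.val_one,
            one_mul]
  · intro i hi
    rw [Set.mem_toFinset] at hi
    have hz : z i ≠ 0 := hGI hi
    have hs := hsign i hi
    rcases lt_or_gt_of_ne hz with h | h
    · right
      refine ⟨h, not_lt.mpr h.le, ?_⟩
      rw [ipair_neg, hs, Int.sign_eq_neg_one_of_neg h, neg_neg]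
    · left
      exact ⟨h, not_lt.mpr h.le, by rw [hs, Int.sign_eq_one_of_pos h]⟩

end ExistsChart

/-! ## Slices -/

section Slices

/-- The index of a coordinate. -/
def cidx {ι : Type} : Coord ι → ι := Sum.elim id id

/-- Coordinates `u k` which do not vanish near a point with stabilizer `H`, and whose weights are a
basis, dual to `e`, of the lattice of characters which are trivial on `H`. -/
structure Slice {ι : Type} (E : Set (Coord ι)) {m : ℕ} (b : ι → Fin m → ℤ) (F : Finset ι)
    (H : Subgroup (Torus m)) (κ : Type) [Fintype κ] [DecidableEq κ] where
  u : κ → Coord ι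
  e : κ → Fin m → ℤ
  mem : ∀ k, u k ∈ E
  swap_notMem : ∀ k, (u k).swap ∉ E
  dual : ∀ k l, ipair (wt b (u k)) (e l) = if k = l then 1 else 0
  cidx_notMem : ∀ c ∈ E, cidx c ∉ F
  chi_eq_one : ∀ i ∉ F, ∀ t ∈ H, chi (b i) t = 1
  mem_iff : ∀ t, t ∈ H ↔ ∀ k, chi (wt b (u k)) t = 1

/-- The weights of the $u_k$ and the cocharacters `e k` split the torus as $H$ times a torus. A
character trivial on $H$ is therefore determined by its pairings with the `e k`. -/
theorem Slice.perp {ι : Type} {E : Set (Coord ι)} {m : ℕ} {b : ι → Fin m → ℤ} {F : Finset ι}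
    {H : Subgroup (Torus m)} {κ : Type} [Fintype κ] [DecidableEq κ] (s : Slice E b F H κ)
    (w : Fin m → ℤ) :
    (∀ t ∈ H, chi w t = 1) ↔ w = ∑ k, ipair w (s.e k) • wt b (s.u k) := by
  constructor
  · intro hw
    rw [← sub_eq_zero]
    refine eq_zero_of_chi_eq_one fun t => ?_
    -- The projection of $t$ to $H$ along the subtorus generated by the `e k`.
    let t' : Torus m := t * ∏ k, fun j => (chi (wt b (s.u k)) t)⁻¹ ^ s.e k j
    have h1 : ∀ w, chi w t' = chi (w - ∑ k, ipair w (s.e k) • wt b (s.u k)) t := fun w => by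
      rw [map_mul, map_prod, chi_sub, chi_sum, ← Finset.prod_inv_distrib]
      congr 1
      refine Finset.prod_congr rfl fun k _ => ?_
      rw [chi_zpow, chi_zsmul, inv_zpow]
    rw [← h1]
    refine hw t' ((s.mem_iff t').mpr fun k => ?_)
    rw [h1]
    have h2 : ∑ l, ipair (wt b (s.u k)) (s.e l) • wt b (s.u l) = wt b (s.u k) := by
      simp [s.dual]
    rw [h2, sub_self, chi_zero]
  · intro hw t ht
    rw [hw, chi_sum]
    refine Finset.prod_eq_one fun k _ => ?_
    rw [chi_zsmul, (s.mem_iff t).mp ht k, one_zpow]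

variable {n m : ℕ} {b : Fin n → Fin m → ℤ} {p : Coord (Fin n) → ℂ} {E : Set (Coord (Fin n))}
  {e : Fin m → ℤ}

/-- For each $i\in G$ the chart provides one coordinate in $E$, of weight $\pm b_i$; the dual
cocharacter takes the same sign. Coordinates in $E$ have index outside $F$ because the stabilizer
fixes every nonzero coordinate of the point. -/
theorem exists_slice (hf : Faithful b) (hu : Unimodular b) (h : IsChart b p E e) :
    ∃ (G : Finset (Fin n)) (s : Slice E b (nontriv b p) (stab b p) G),
      ∀ k, ipair (wt b (s.u k)) e = 1 := by
  classical
  obtain ⟨G, hli, hstab, hsl⟩ := h.slice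
  obtain ⟨d, hd⟩ := exists_dual hf hu (G := (G : Set (Fin n))) (linearIndependent_ratWt.mpr hli)
  have hu : ∀ k : G, ∃ (c : Coord (Fin n)) (s : ℤ), c ∈ E ∧ c.swap ∉ E ∧ wt b c = s • b k ∧
      b k = s • wt b c ∧ s * s = 1 ∧ ipair (wt b c) e = 1 := fun k => by
    rcases hsl k k.2 with ⟨h1, h2, h3⟩ | ⟨h1, h2, h3⟩
    · exact ⟨Sum.inl k, 1, h1, h2, (one_smul _ _).symm, (one_smul _ _).symm, by norm_num, h3⟩
    · refine ⟨Sum.inr k, -1, h1, h2, ?_, ?_, by norm_num, h3⟩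
      · rw [neg_one_smul]; rfl
      · rw [neg_one_smul, wt, Sum.elim_inr, neg_neg]
  choose u s hmem hswap hwt hwt' hss he using hu
  have hdual : ∀ k l : G, ipair (wt b (u k)) (s l • d l) = if k = l then 1 else 0 := fun k l => by
    rw [hwt, ipair_zsmul, ipair_zsmul_right, hd k k.2 l l.2]
    by_cases hkl : k = l
    · subst hkl; simp [hss]
    · rw [if_neg hkl, if_neg fun h => hkl (Subtype.ext h), mul_zero, mul_zero]
  have hchi : ∀ c, p c ≠ 0 → ∀ t ∈ stab b p, chi (wt b c) t = 1 := fun c hc t ht =>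
    Units.ext (mul_right_cancel₀ hc ((ht c).trans (one_mul _).symm))
  refine ⟨G, ⟨u, fun k => s k • d k, hmem, hswap, hdual, ?_, ?_, ?_⟩, he⟩
  · intro c hc hF
    obtain ⟨t, ht, hne⟩ := (Finset.mem_filter.mp hF).2
    have h1 := hchi c (h.ne_zero c hc) t ht
    rcases c with i | i
    · exact hne h1
    · rw [show wt b (Sum.inr i) = -b i from rfl, chi_neg, inv_eq_one] at h1
      exact hne h1
  · intro i hi t ht
    by_contra hne
    exact hi (Finset.mem_filter.mpr ⟨Finset.mem_univ i, t, ht, hne⟩)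
  · intro t
    constructor
    · exact fun ht k => hchi _ (h.ne_zero _ (hmem k)) t ht
    · intro ht
      refine (hstab t).mpr fun i hi => ?_
      rw [hwt' ⟨i, hi⟩, chi_zsmul, ht, one_zpow]

end Slices

/-! ## Commutators of coordinates -/

section Coordinates

variable {ι : Type} [DecidableEq ι]

theorem omega_eq_zero {c c' : Coord ι} (h : c' ≠ c.swap) : omega c c' = 0 := by
  rcases c with i | i <;> rcases c' with j | j <;> try rfl
  all_goals
    by_cases hij : i = j
    · subst hij; exact absurd rfl h
    · simp [omega, hij]

theorem omega_swap (c c' : Coord ι) : omega c' c = -omega c c' := by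
  rcases c with i | i <;> rcases c' with j | j <;> try rfl
  all_goals
    by_cases hij : i = j
    · subst hij; simp [omega]
    · simp [omega, hij, Ne.symm hij]

theorem cidx_swap (c : Coord ι) : cidx c.swap = cidx c := by
  rcases c with i | i <;> rfl

theorem eq_or_eq_swap {c c' : Coord ι} (h : cidx c = cidx c') : c = c' ∨ c = c'.swap := by
  rcases c with i | i <;> rcases c' with j | j <;> simp_all [cidx]

theorem wt_swap {m : ℕ} (b : ι → Fin m → ℤ) (c : Coord ι) : wt b c.swap = -wt b c := by
  rcases c with i | i <;> simp [wt]

variable {E : Set (Coord ι)}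

theorem qc_comm (c c' : Coord ι) :
    qc E c * qc E c' = qc E c' * qc E c + omega c c' • hbar (Weyl E) := gen_comm E c c'

theorem commute_qc {c c' : Coord ι} (h : c' ≠ c.swap) : Commute (qc E c) (qc E c') := by
  have := qc_comm (E := E) c c'
  rwa [omega_eq_zero h, zero_smul, add_zero] at this

theorem commute_qc_of_cidx {c c' : Coord ι} (h : cidx c ≠ cidx c') :
    Commute (qc E c) (qc E c') :=
  commute_qc fun h' => h (by rw [h', cidx_swap])

variable (E) in
/-- The product `xᵢ yᵢ`. -/
def xy (i : ι) : Weyl E := qc E (Sum.inl i) * qc E (Sum.inr i)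

theorem commute_xy {c : Coord ι} {i : ι} (h : cidx c ≠ i) : Commute (qc E c) (xy E i) :=
  (commute_qc_of_cidx h).mul_right (commute_qc_of_cidx h)

theorem commute_xy_xy (i j : ι) : Commute (xy E i) (xy E j) := by
  by_cases h : i = j
  · rw [h]
  · exact (commute_xy (c := Sum.inl i) h).mul_left (commute_xy (c := Sum.inr i) h)

/-- The commutator of $x_iy_i$ with $x_i$ or $y_i$ is $\hbar x_i$ or $-\hbar y_i$. Scaling by
$\langle b_i,e\rangle$ absorbs the sign into the weight of the coordinate. -/
theorem xy_mul_qc {m : ℕ} (b : ι → Fin m → ℤ) (e : Fin m → ℤ) (c : Coord ι) :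
    ipair (b (cidx c)) e • (xy E (cidx c) * qc E c) =
      ipair (b (cidx c)) e • (qc E c * xy E (cidx c)) +
        ipair (wt b c) e • (hbar _ * qc E c) := by
  rcases c with i | i
  · have h := qc_comm (E := E) (Sum.inr i) (Sum.inl i)
    simp only [omega, if_true, one_smul] at h
    simp only [cidx, xy, wt, Sum.elim_inl, id, mul_assoc]
    rw [h, mul_add, smul_add, hbar_mul_comm]
  · have h := qc_comm (E := E) (Sum.inl i) (Sum.inr i)
    simp only [omega, if_true] at h
    simp only [cidx, xy, wt, Sum.elim_inr, id, ipair_neg, neg_smul]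
    rw [← mul_assoc (qc E (Sum.inr i))]
    rw [show qc E (Sum.inr i) * qc E (Sum.inl i) =
      qc E (Sum.inl i) * qc E (Sum.inr i) + hbar _ by rw [h]; simp, add_mul, smul_add]
    abel

end Coordinates

namespace Slice

variable {ι : Type} [DecidableEq ι] {E : Set (Coord ι)} {m : ℕ} {b : ι → Fin m → ℤ} {F : Finset ι}
  {H : Subgroup (Torus m)} {κ : Type} [Fintype κ] [DecidableEq κ] (s : Slice E b F H κ)

theorem u_notMem (k : κ) : cidx (s.u k) ∉ F := s.cidx_notMem _ (s.mem k)

theorem u_injective : Function.Injective s.u := fun k l h => by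
  by_contra hne
  have h1 := s.dual k l
  rw [if_neg hne, h, s.dual, if_pos rfl] at h1
  exact one_ne_zero h1

/-- Only one coordinate of the pair to which $u_l$ belongs lies in $E$. -/
theorem cidx_u_injective {k l : κ} (h : cidx (s.u k) = cidx (s.u l)) : k = l := by
  rcases eq_or_eq_swap h with h | h
  · exact s.u_injective h
  · exact absurd (h ▸ s.mem k) (s.swap_notMem l)

/-! ### Monomials in the invertible coordinates -/

/-- The invertible element `u k`. -/
def uq (k : κ) : (Weyl E)ˣ :=
  ⟨gen E (Gen.coord (s.u k)), gen E (Gen.inv (s.u k) (s.mem k)), gen_mul_inv _ _ _,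
    gen_inv_mul _ _ _⟩

theorem uq_val (k : κ) : ((s.uq k : (Weyl E)ˣ) : Weyl E) = qc E (s.u k) := rfl

theorem commute_u (k l : κ) : Commute (qc E (s.u k)) (qc E (s.u l)) := by
  by_cases h : k = l
  · rw [h]
  · exact commute_qc_of_cidx fun h' => h (s.cidx_u_injective h')

theorem commute_uq (k l : κ) : Commute (s.uq k) (s.uq l) := Units.ext (s.commute_u k l)

theorem pairwise_commute_uq : Pairwise fun k l => ∀ x y : Multiplicative ℤ,
    Commute (zpowersHom (Weyl E)ˣ (s.uq k) x) (zpowersHom (Weyl E)ˣ (s.uq l) y) :=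
  fun k l _ x y => (s.commute_uq k l).zpow_zpow _ _

/-- The monomial in the invertible coordinates with given exponents. -/
def mono (w : κ → ℤ) : (Weyl E)ˣ :=
  MonoidHom.noncommPiCoprod (fun k => zpowersHom (Weyl E)ˣ (s.uq k))
    (s.pairwise_commute_uq) fun k => Multiplicative.ofAdd (w k)

theorem mono_add (w w' : κ → ℤ) : s.mono (w + w') = s.mono w * s.mono w' := by
  rw [mono, mono, mono, ← map_mul]; rfl

theorem mono_zero : s.mono 0 = 1 := by
  exact map_one (MonoidHom.noncommPiCoprod _ s.pairwise_commute_uq)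

theorem mono_neg (w : κ → ℤ) : s.mono (-w) = (s.mono w)⁻¹ := by
  rw [eq_inv_iff_mul_eq_one, ← mono_add, neg_add_cancel, mono_zero]

theorem mono_single (k : κ) : s.mono (Pi.single k 1) = s.uq k := by
  rw [mono]
  have : (fun l => Multiplicative.ofAdd ((Pi.single k 1 : κ → ℤ) l)) =
      Pi.mulSingle k (Multiplicative.ofAdd (1 : ℤ)) := by
    funext l
    by_cases h : l = k
    · subst h; simp
    · simp [h]
  rw [this, MonoidHom.noncommPiCoprod_mulSingle]
  simp

theorem exponent_induction {P : (κ → ℤ) → Prop} (h0 : P 0) (hadd : ∀ w w', P w → P w' → P (w + w'))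
    (hneg : ∀ w, P w → P (-w)) (hs : ∀ k, P (Pi.single k 1)) (w : κ → ℤ) : P w := by
  let S : AddSubgroup (κ → ℤ) :=
    { carrier := {w | P w}
      add_mem' := fun h h' => hadd _ _ h h'
      zero_mem' := h0
      neg_mem' := fun h => hneg _ h }
  have h : ∑ k, w k • (Pi.single k 1 : κ → ℤ) ∈ S :=
    sum_mem fun k _ => zsmul_mem (show Pi.single k 1 ∈ S from hs k) _
  have h2 : ∑ k, w k • (Pi.single k 1 : κ → ℤ) = w := by
    funext l; simp [Pi.single_apply]
  rw [h2] at h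
  exact h

theorem commute_mono {x : Weyl E} (h : ∀ k, Commute x (qc E (s.u k))) (w : κ → ℤ) :
    Commute x (s.mono w : (Weyl E)ˣ) := by
  induction w using exponent_induction with
  | h0 => rw [mono_zero]; exact Commute.one_right x
  | hadd w w' hw hw' => rw [mono_add, Units.val_mul]; exact hw.mul_right hw'
  | hneg w hw => rw [mono_neg]; exact hw.units_inv_right
  | hs k => rw [mono_single]; exact h k

theorem commute_mono_mono (w w' : κ → ℤ) :
    Commute ((s.mono w : (Weyl E)ˣ) : Weyl E) (s.mono w' : (Weyl E)ˣ) :=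
  s.commute_mono (fun k => (s.commute_mono (fun l => s.commute_u k l) w).symm) w'

theorem commute_qc_uinv {c : Coord ι} {k : κ} (h : c ≠ (s.u k).swap) :
    Commute (qc E c) ((s.uq k)⁻¹ : (Weyl E)ˣ) :=
  Commute.units_inv_right (u := s.uq k) (commute_qc fun h' => h (by rw [h', Sum.swap_swap]))

theorem commute_qc_mono {c : Coord ι} (h : ∀ k, c ≠ (s.u k).swap) (w : κ → ℤ) :
    Commute (qc E c) (s.mono w : (Weyl E)ˣ) :=
  s.commute_mono (fun k => commute_qc fun h' => h k (by rw [h', Sum.swap_swap])) w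

theorem commute_uinv_mono (k : κ) (w : κ → ℤ) :
    Commute (((s.uq k)⁻¹ : (Weyl E)ˣ) : Weyl E) (s.mono w : (Weyl E)ˣ) :=
  (s.commute_mono (fun l => s.commute_u k l) w).units_inv_left (u := s.uq k)

theorem ne_swap_u_of_mem {c : Coord ι} (h : cidx c ∈ F) (k : κ) : c ≠ (s.u k).swap := fun h' =>
  s.u_notMem k (by rwa [h', cidx_swap] at h)

/-- The sign in the commutator `[v, u] = ± ħ`, where `v` is the coordinate conjugate to `u`. -/
def sgn (k : κ) : ℤ := omega (s.u k).swap (s.u k)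

/-- The coordinate conjugate to $u_k$ acts on monomials in the $u$ as $\pm\hbar\,\partial/\partial
u_k$. -/
theorem swap_u_mul_mono (k : κ) (w : κ → ℤ) : qc E (s.u k).swap * (s.mono w : (Weyl E)ˣ) =
    (s.mono w : (Weyl E)ˣ) * qc E (s.u k).swap +
      (w k * s.sgn k) • (hbar _ * (((s.uq k)⁻¹ : (Weyl E)ˣ) * (s.mono w : (Weyl E)ˣ))) := by
  induction w using exponent_induction with
  | h0 => simp [mono_zero]
  | hadd w w' hw hw' =>
    have hc := (s.commute_uinv_mono k w).eq
    rw [mono_add, Units.val_mul, ← mul_assoc, hw, add_mul, mul_assoc, hw', mul_add, Pi.add_apply,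
      add_mul (w k), add_smul, smul_mul_assoc, mul_smul_comm, ← mul_assoc, add_assoc, add_comm (_ • _)]
    congr 3
    · simp only [mul_assoc]
    · rw [← mul_assoc, ← hbar_mul_comm, mul_assoc, ← mul_assoc (s.mono w : Weyl E), ← hc]
      simp only [mul_assoc]
  | hneg w hw =>
    have hc := (s.commute_uinv_mono k w).eq
    have h1 : ((s.mono w : (Weyl E)ˣ) : Weyl E) * ((s.mono w)⁻¹ : (Weyl E)ˣ) = 1 :=
      Units.mul_inv _
    have h2 : (((s.mono w)⁻¹ : (Weyl E)ˣ) : Weyl E) * (s.mono w : (Weyl E)ˣ) = 1 :=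
      Units.inv_mul _
    have h3 := congrArg (fun x => (((s.mono w)⁻¹ : (Weyl E)ˣ) : Weyl E) * x *
      (((s.mono w)⁻¹ : (Weyl E)ˣ) : Weyl E)) hw
    simp only [mul_add, add_mul, mul_smul_comm, smul_mul_assoc] at h3
    rw [mul_assoc, mul_assoc, h1, mul_one, ← mul_assoc, h2, one_mul, hc, mul_assoc, mul_assoc,
      mul_assoc, ← mul_assoc _ (hbar _), ← hbar_mul_comm, mul_assoc,
      ← mul_assoc _ (s.mono w : Weyl E), h2, one_mul] at h3
    rw [mono_neg, h3, Pi.neg_apply, neg_mul, neg_smul, add_neg_cancel_right]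
  | hs l =>
    rw [mono_single, uq_val, qc_comm]
    congr 1
    by_cases h : k = l
    · subst h
      rw [Pi.single_eq_same, one_mul, ← uq_val, Units.inv_mul, mul_one]; rfl
    · rw [omega_eq_zero fun h' => h (s.u_injective (by rw [h', Sum.swap_swap])), Pi.single_eq_of_ne h]
      simp

theorem isWt_mono (w : κ → ℤ) : IsWt E b (∑ k, w k • wt b (s.u k)) ((s.mono w : (Weyl E)ˣ) : Weyl E) := by
  -- The exponents $w$ and $-w$ are treated together, so that the negation step of the induction is
  -- a swap.
  suffices IsWt E b (∑ k, w k • wt b (s.u k)) ((s.mono w : (Weyl E)ˣ) : Weyl E) ∧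
      IsWt E b (∑ k, (-w) k • wt b (s.u k)) ((s.mono (-w) : (Weyl E)ˣ) : Weyl E) from this.1
  induction w using exponent_induction with
  | h0 => simpa [mono_zero] using IsWt.one (E := E) (b := b)
  | hadd w w' hw hw' =>
    rw [neg_add]
    simp only [mono_add, Units.val_mul, Pi.add_apply, add_smul, Finset.sum_add_distrib]
    exact ⟨hw.1.mul hw'.1, hw.2.mul hw'.2⟩
  | hneg w hw => rw [neg_neg]; exact hw.symm
  | hs l =>
    rw [mono_neg, mono_single]
    constructor
    · simpa [Pi.single_apply] using
        (show IsWt E b (wt b (s.u l)) (s.uq l : Weyl E) from IsWt.coord (s.u l))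
    · simpa [Pi.single_apply] using
        (show IsWt E b (-wt b (s.u l)) ((s.uq l)⁻¹ : (Weyl E)ˣ) from IsWt.inv (s.u l) (s.mem l))

theorem isHomog_mono {δ : Coord ι → ℤ} (hδ : ∀ k, δ (s.u k) = 1) (w : κ → ℤ) :
    IsHomog E δ (∑ k, w k) ((s.mono w : (Weyl E)ˣ) : Weyl E) := by
  suffices IsHomog E δ (∑ k, w k) ((s.mono w : (Weyl E)ˣ) : Weyl E) ∧
      IsHomog E δ (∑ k, (-w) k) ((s.mono (-w) : (Weyl E)ˣ) : Weyl E) from this.1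
  induction w using exponent_induction with
  | h0 =>
    have : IsHomog E δ 0 (1 : Weyl E) := by simpa using IsHomog.const (E := E) (δ := δ) 1
    simpa [mono_zero] using this
  | hadd w w' hw hw' =>
    rw [neg_add]
    simp only [mono_add, Units.val_mul, Pi.add_apply, Finset.sum_add_distrib]
    exact ⟨hw.1.mul hw'.1, hw.2.mul hw'.2⟩
  | hneg w hw => rw [neg_neg]; exact hw.symm
  | hs l =>
    rw [mono_neg, mono_single]
    constructor
    · simpa [hδ] using
        (show IsHomog E δ (δ (s.u l)) (s.uq l : Weyl E) from IsHomog.coord (s.u l))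
    · simpa [hδ] using
        (show IsHomog E δ (-δ (s.u l)) ((s.uq l)⁻¹ : (Weyl E)ˣ) from IsHomog.inv (s.u l) (s.mem l))

/-! ### The automorphism which makes the slice coordinates invariant -/

/-- The function `∑_{j ∈ F} ⟨b_j, e_k⟩ x_j y_j`. -/
def num (k : κ) : Weyl E := ∑ j ∈ F, ipair (b j) (s.e k) • xy E j

theorem commute_num {c : Coord ι} (h : cidx c ∉ F) (k : κ) : Commute (qc E c) (s.num k) :=
  Commute.sum_right _ _ _ fun j hj =>
    (commute_xy (fun h' => h (h' ▸ hj))).smul_right _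

theorem commute_num_num (k l : κ) : Commute (s.num k) (s.num l) :=
  Commute.sum_right _ _ _ fun j hj => Commute.smul_right
    (Commute.sum_left _ _ _ fun i hi => (commute_xy_xy i j).smul_left _) _

/-- Up to the factor $\hbar$, commutation with `num k` multiplies a coordinate with index in $F$ by
the pairing of its weight with `e k`. Only the summand with the same index contributes. -/
theorem num_mul_qc {c : Coord ι} (h : cidx c ∈ F) (k : κ) :
    s.num k * qc E c = qc E c * s.num k + ipair (wt b c) (s.e k) • (hbar _ * qc E c) := by
  rw [num, Finset.sum_mul, Finset.mul_sum, ← Finset.sum_erase_add _ _ h,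
    ← Finset.sum_erase_add (a := cidx c) F (fun i => qc E c * _) h, add_assoc, smul_mul_assoc,
    mul_smul_comm, ← xy_mul_qc]
  congr 1
  refine Finset.sum_congr rfl fun j hj => ?_
  rw [smul_mul_assoc, mul_smul_comm, (commute_xy (Finset.ne_of_mem_erase hj).symm).eq]

theorem commute_num_uinv (k l : κ) : Commute (s.num k) ((s.uq l)⁻¹ : (Weyl E)ˣ) :=
  Commute.units_inv_right (u := s.uq l) (s.commute_num (s.u_notMem l) k).symm

theorem commute_num_mono (k : κ) (w : κ → ℤ) : Commute (s.num k) (s.mono w : (Weyl E)ˣ) :=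
  s.commute_mono (fun l => (s.commute_num (s.u_notMem l) k).symm) w

/-- The exponents of the correction of a slice coordinate. -/
def expo (ε : ℤ) (c : Coord ι) : κ → ℤ := fun k => -ε * ipair (wt b c) (s.e k)

/-- The values of the automorphism `corr ε` on the coordinates. -/
def corrCoord (ε : ℤ) (c : Coord ι) : Weyl E :=
  if cidx c ∈ F then qc E c * (s.mono (s.expo ε c) : (Weyl E)ˣ)
  else qc E c + ∑ k, if c = (s.u k).swap then
    (ε * s.sgn k) • ((((s.uq k)⁻¹ : (Weyl E)ˣ) : Weyl E) * s.num k) else 0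

theorem corrCoord_mem (ε : ℤ) {c : Coord ι} (h : cidx c ∈ F) :
    s.corrCoord ε c = qc E c * (s.mono (s.expo ε c) : (Weyl E)ˣ) := if_pos h

theorem corrCoord_swap (ε : ℤ) (k : κ) : s.corrCoord ε (s.u k).swap = qc E (s.u k).swap +
    (ε * s.sgn k) • ((((s.uq k)⁻¹ : (Weyl E)ˣ) : Weyl E) * s.num k) := by
  rw [corrCoord, if_neg (by rw [cidx_swap]; exact s.u_notMem k), Finset.sum_eq_single k]
  · rw [if_pos rfl]
  · intro l _ hl
    rw [if_neg fun h => hl (s.cidx_u_injective (by rw [← cidx_swap (s.u l), ← h, cidx_swap]))]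
  · intro h; exact absurd (Finset.mem_univ _) h

theorem corrCoord_of_ne (ε : ℤ) {c : Coord ι} (h : cidx c ∉ F) (h' : ∀ k, c ≠ (s.u k).swap) :
    s.corrCoord ε c = qc E c := by
  rw [corrCoord, if_neg h, Finset.sum_eq_zero fun k _ => if_neg (h' k), add_zero]

theorem corrCoord_of_mem (ε : ℤ) {c : Coord ι} (h : c ∈ E) : s.corrCoord ε c = qc E c :=
  s.corrCoord_of_ne ε (s.cidx_notMem c h) fun k h' => s.swap_notMem k (h' ▸ h)

theorem corrCoord_comm_mem_mem (ε : ℤ) {c c' : Coord ι} (h : cidx c ∈ F) (h' : cidx c' ∈ F) :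
    s.corrCoord ε c * s.corrCoord ε c' =
      s.corrCoord ε c' * s.corrCoord ε c + omega c c' • hbar (Weyl E) := by
  have h1 := fun w => (s.commute_qc_mono (s.ne_swap_u_of_mem h) w).eq
  have h2 := fun w => (s.commute_qc_mono (s.ne_swap_u_of_mem h') w).eq
  rw [s.corrCoord_mem ε h, s.corrCoord_mem ε h', mul_assoc, ← mul_assoc _ (qc E c'), ← h2,
    mul_assoc, ← mul_assoc, qc_comm, add_mul]
  congr 1
  · rw [(s.commute_mono_mono _ _).eq, mul_assoc, ← mul_assoc (qc E c), h1]
    simp only [mul_assoc]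
  · by_cases h0 : omega c c' = 0
    · rw [h0, zero_smul, zero_mul]
    · have hw := wt_add_of_omega_ne_zero b h0
      have : s.expo ε c + s.expo ε c' = 0 := by
        funext k
        simp only [expo, Pi.add_apply, Pi.zero_apply, ← mul_add, ← ipair_add, hw]
        simp [ipair]
      rw [← Units.val_mul, ← mono_add, this, mono_zero, Units.val_one, mul_one]

/-- Two noncommuting effects cancel. The conjugate of $u_k$ differentiates the monomial attached to
$c$, with exponent $-\varepsilon\langle w,e_k\rangle$, while its correction
$\varepsilon\,u_k^{-1}\mathrm{num}_k$ has the opposite commutator with $c$; both carry the sign `sgn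
k`. This cancellation dictates the correction term. -/
theorem corrCoord_comm_swap_mem (ε : ℤ) (k : κ) {c : Coord ι} (h : cidx c ∈ F) :
    s.corrCoord ε (s.u k).swap * s.corrCoord ε c =
      s.corrCoord ε c * s.corrCoord ε (s.u k).swap + omega (s.u k).swap c • hbar (Weyl E) := by
  have hne : cidx (s.u k).swap ≠ cidx c := fun h' => s.u_notMem k (by rwa [← h', cidx_swap] at h)
  have h0 : omega (s.u k).swap c = 0 := by
    refine omega_eq_zero fun h' => hne ?_
    rw [h', cidx_swap (Sum.swap _)]
  have e1 : qc E (s.u k).swap * qc E c = qc E c * qc E (s.u k).swap := (commute_qc_of_cidx hne).eq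
  have e2 : qc E c * ((s.uq k)⁻¹ : (Weyl E)ˣ) = ((s.uq k)⁻¹ : (Weyl E)ˣ) * qc E c :=
    (s.commute_qc_uinv (s.ne_swap_u_of_mem h k)).eq
  have e3 := (s.commute_num_mono k (s.expo ε c)).eq
  have e4 := (s.commute_uinv_mono k (s.expo ε c)).eq
  have e5 := s.num_mul_qc h k
  have e6 := s.swap_u_mul_mono k (s.expo ε c)
  rw [h0, zero_smul, add_zero, s.corrCoord_mem ε h, corrCoord_swap, add_mul, mul_add, ← mul_assoc,
    e1, mul_assoc, e6, mul_add, ← mul_assoc (qc E c), add_assoc]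
  congr 1
  rw [smul_mul_assoc, mul_smul_comm, mul_smul_comm, mul_assoc, ← mul_assoc (s.num k), e5, add_mul,
    mul_add, smul_add]
  have l1 : (((s.uq k)⁻¹ : (Weyl E)ˣ) : Weyl E) * (qc E c * s.num k * (s.mono (s.expo ε c) : (Weyl E)ˣ)) =
      qc E c * (s.mono (s.expo ε c) : (Weyl E)ˣ) * ((((s.uq k)⁻¹ : (Weyl E)ˣ) : Weyl E) * s.num k) := by
    rw [mul_assoc (qc E c), e3, ← mul_assoc, ← e2, mul_assoc, mul_assoc, ← mul_assoc _ _ (s.num k),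
      e4, mul_assoc]
  have l2 : (((s.uq k)⁻¹ : (Weyl E)ˣ) : Weyl E) * ((ipair (wt b c) (s.e k) • (hbar _ * qc E c)) *
      (s.mono (s.expo ε c) : (Weyl E)ˣ)) = ipair (wt b c) (s.e k) •
      (qc E c * (hbar _ * ((((s.uq k)⁻¹ : (Weyl E)ˣ) : Weyl E) * (s.mono (s.expo ε c) : (Weyl E)ˣ)))) := by
    rw [smul_mul_assoc, mul_smul_comm, mul_assoc, ← mul_assoc _ (hbar _), ← hbar_mul_comm,
      mul_assoc, ← mul_assoc _ (qc E c), ← e2, ← mul_assoc (qc E c), ← hbar_mul_comm]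
    simp only [mul_assoc]
  rw [l1, l2, smul_smul, add_left_comm, ← add_smul]
  simp only [expo]
  rw [show -ε * ipair (wt b c) (s.e k) * s.sgn k + ε * s.sgn k * ipair (wt b c) (s.e k) = 0 by ring,
    zero_smul, add_zero]

theorem corrCoord_comm_swap_of_ne (ε : ℤ) (k : κ) {c : Coord ι} (h : cidx c ∉ F)
    (h' : ∀ k, c ≠ (s.u k).swap) : s.corrCoord ε (s.u k).swap * s.corrCoord ε c =
      s.corrCoord ε c * s.corrCoord ε (s.u k).swap + omega (s.u k).swap c • hbar (Weyl E) := by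
  have e1 : Commute (qc E c) ((((s.uq k)⁻¹ : (Weyl E)ˣ) : Weyl E) * s.num k) :=
    (s.commute_qc_uinv (h' k)).mul_right (s.commute_num h k)
  rw [s.corrCoord_of_ne ε h h', corrCoord_swap, add_mul, mul_add, qc_comm, smul_mul_assoc,
    mul_smul_comm, e1.eq]
  abel

theorem corrCoord_comm_swap_swap (ε : ℤ) (k l : κ) :
    s.corrCoord ε (s.u k).swap * s.corrCoord ε (s.u l).swap =
      s.corrCoord ε (s.u l).swap * s.corrCoord ε (s.u k).swap +
        omega (s.u k).swap (s.u l).swap • hbar (Weyl E) := by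
  by_cases hkl : k = l
  · subst hkl
    rw [omega_eq_zero, zero_smul, add_zero]
    rcases s.u k with i | i <;> simp
  · have hne : cidx (s.u k) ≠ cidx (s.u l) := fun h => hkl (s.cidx_u_injective h)
    have h0 : omega (s.u k).swap (s.u l).swap = 0 := omega_eq_zero fun h => hne (by
      rw [← cidx_swap (s.u l), h, cidx_swap, cidx_swap])
    have hF : ∀ k, cidx (s.u k).swap ∉ F := fun k => by rw [cidx_swap]; exact s.u_notMem k
    have hs : ∀ {k l}, k ≠ l → (s.u k).swap ≠ (s.u l).swap := fun h h' =>
      h (s.cidx_u_injective (by rw [← cidx_swap (s.u _), h', cidx_swap]))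
    rw [h0, zero_smul, add_zero, corrCoord_swap, corrCoord_swap]
    refine Commute.add_left (Commute.add_right ?_ (Commute.smul_right ?_ _))
      (Commute.smul_left (Commute.add_right ?_ (Commute.smul_right ?_ _)) _)
    · exact commute_qc_of_cidx (by rwa [cidx_swap, cidx_swap])
    · exact (s.commute_qc_uinv (hs hkl)).mul_right (s.commute_num (hF k) l)
    · exact ((s.commute_qc_uinv (hs (Ne.symm hkl))).mul_right (s.commute_num (hF l) k)).symm
    · refine Commute.mul_left (Commute.mul_right ?_ (s.commute_num_uinv l k).symm)
        (Commute.mul_right (s.commute_num_uinv k l) (s.commute_num_num k l))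
      exact Commute.units_val (((s.commute_uq k l).inv_inv))

/-- Coordinates are of three kinds: index in $F$, conjugate to some $u_k$, and all others. The
relations are preserved as they would be by formal conjugation with
$\exp(-\frac{\varepsilon}{\hbar}\sum_k\log(u_k)\,\mathrm{num}_k)$. -/
theorem corrCoord_comm (ε : ℤ) (c c' : Coord ι) : s.corrCoord ε c * s.corrCoord ε c' =
    s.corrCoord ε c' * s.corrCoord ε c + omega c c' • hbar (Weyl E) := by
  have symm : ∀ {c c'}, s.corrCoord ε c' * s.corrCoord ε c =
      s.corrCoord ε c * s.corrCoord ε c' + omega c' c • hbar (Weyl E) →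
      s.corrCoord ε c * s.corrCoord ε c' =
        s.corrCoord ε c' * s.corrCoord ε c + omega c c' • hbar (Weyl E) := fun {c c'} h => by
    rw [h, omega_swap c' c]; simp
  have hcases : ∀ c, cidx c ∈ F ∨ (∃ k, c = (s.u k).swap) ∨ (cidx c ∉ F ∧ ∀ k, c ≠ (s.u k).swap) :=
    fun c => by
      by_cases h1 : cidx c ∈ F
      · exact Or.inl h1
      · by_cases h2 : ∃ k, c = (s.u k).swap
        · exact Or.inr (Or.inl h2)
        · exact Or.inr (Or.inr ⟨h1, not_exists.mp h2⟩)
  rcases hcases c with h | ⟨k, rfl⟩ | ⟨h1, h2⟩ <;> rcases hcases c' with h' | ⟨l, rfl⟩ | ⟨h1', h2'⟩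
  · exact s.corrCoord_comm_mem_mem ε h h'
  · exact symm (s.corrCoord_comm_swap_mem ε l h)
  · rw [s.corrCoord_mem ε h, s.corrCoord_of_ne ε h1' h2']
    have hne : cidx c ≠ cidx c' := fun e => h1' (e ▸ h)
    rw [omega_eq_zero fun e => hne (by rw [e, cidx_swap]), zero_smul, add_zero]
    exact Commute.mul_left (commute_qc_of_cidx hne) (s.commute_qc_mono h2' _).symm
  · exact s.corrCoord_comm_swap_mem ε k h'
  · exact s.corrCoord_comm_swap_swap ε k l
  · exact s.corrCoord_comm_swap_of_ne ε k h1' h2'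
  · rw [s.corrCoord_mem ε h', s.corrCoord_of_ne ε h1 h2]
    have hne : cidx c ≠ cidx c' := fun e => h1 (e ▸ h')
    rw [omega_eq_zero fun e => hne (by rw [e, cidx_swap]), zero_smul, add_zero]
    exact Commute.mul_right (commute_qc_of_cidx hne) (s.commute_qc_mono h2 _)
  · exact symm (s.corrCoord_comm_swap_of_ne ε l h1 h2)
  · rw [s.corrCoord_of_ne ε h1 h2, s.corrCoord_of_ne ε h1' h2', qc_comm]

/-- The automorphism which multiplies the coordinates with index in `F` by monomials in the
invertible coordinates `u k`, and corrects the coordinates conjugate to the `u k` so as to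
preserve the commutators. -/
def corr (ε : ℤ) : Weyl E →ₐ[Ch] Weyl E :=
  liftWeyl E (fun
    | Gen.coord c => s.corrCoord ε c
    | Gen.inv c hc => gen E (Gen.inv c hc))
    (s.corrCoord_comm ε)
    (fun c hc => by simp only [s.corrCoord_of_mem ε hc]; exact gen_mul_inv E c hc)
    (fun c hc => by simp only [s.corrCoord_of_mem ε hc]; exact gen_inv_mul E c hc)

theorem corr_qc (ε : ℤ) (c : Coord ι) : s.corr ε (qc E c) = s.corrCoord ε c :=
  liftWeyl_gen E _ _ _ _ (Gen.coord c)

theorem corr_inv (ε : ℤ) (c : Coord ι) (hc : c ∈ E) :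
    s.corr ε (gen E (Gen.inv c hc)) = gen E (Gen.inv c hc) :=
  liftWeyl_gen E _ _ _ _ (Gen.inv c hc)

theorem corr_uinv (ε : ℤ) (k : κ) : s.corr ε (((s.uq k)⁻¹ : (Weyl E)ˣ) : Weyl E) =
    ((s.uq k)⁻¹ : (Weyl E)ˣ) :=
  s.corr_inv ε (s.u k) (s.mem k)

theorem corr_mono (ε : ℤ) (w : κ → ℤ) :
    s.corr ε ((s.mono w : (Weyl E)ˣ) : Weyl E) = (s.mono w : (Weyl E)ˣ) := by
  suffices Units.map (s.corr ε : Weyl E →* Weyl E) (s.mono w) = s.mono w from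
    congrArg Units.val this
  induction w using exponent_induction with
  | h0 => rw [mono_zero, map_one]
  | hadd w w' hw hw' => rw [mono_add, map_mul, hw, hw']
  | hneg w hw => rw [mono_neg, map_inv, hw]
  | hs k =>
    rw [mono_single]
    refine Units.ext ((s.corr_qc ε (s.u k)).trans ?_)
    rw [s.corrCoord_of_mem ε (s.mem k), uq_val]

/-- Conjugate coordinates have opposite weights, so their monomial factors cancel. Hence `num k` is
fixed as well, which is what makes `corr (-ε)` inverse to `corr ε`. -/
theorem corr_xy (ε : ℤ) {i : ι} (hi : i ∈ F) : s.corr ε (xy E i) = xy E i := by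
  have h1 : cidx (Sum.inl i : Coord ι) ∈ F := hi
  have h2 : cidx (Sum.inr i : Coord ι) ∈ F := hi
  rw [xy, map_mul, corr_qc, corr_qc, s.corrCoord_mem ε h1, s.corrCoord_mem ε h2, mul_assoc,
    (s.commute_qc_mono (s.ne_swap_u_of_mem h2) _).eq, ← mul_assoc _ _ (qc E (Sum.inr i)),
    ← Units.val_mul, ← mono_add]
  have : s.expo ε (Sum.inl i) + s.expo ε (Sum.inr i) = 0 := by
    funext k
    simp [expo, wt, ipair_neg]
  rw [this, mono_zero, Units.val_one, one_mul]

theorem corr_num (ε : ℤ) (k : κ) : s.corr ε (s.num k) = s.num k := by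
  rw [num, map_sum]
  exact Finset.sum_congr rfl fun j hj => by rw [map_zsmul, s.corr_xy ε hj]

/-- Exponents and correction terms are linear in $\varepsilon$, and the monomials and the `num k`
that occur in them are fixed. -/
theorem corr_corr (ε : ℤ) (d : Weyl E) : s.corr (-ε) (s.corr ε d) = d := by
  suffices (s.corr (-ε)).comp (s.corr ε) = AlgHom.id Ch _ from congrArg (fun f => f d) this
  apply algHom_ext_weyl
  rintro (c | ⟨c, hc⟩)
  · change s.corr (-ε) (s.corr ε (qc E c)) = qc E c
    rw [corr_qc]
    by_cases h : cidx c ∈ F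
    · rw [s.corrCoord_mem ε h, map_mul, corr_mono, corr_qc, s.corrCoord_mem (-ε) h, mul_assoc,
        ← Units.val_mul, ← mono_add]
      have : s.expo (-ε) c + s.expo ε c = 0 := by
        funext k
        simp [expo]
      rw [this, mono_zero, Units.val_one, mul_one]
    · by_cases h' : ∃ k, c = (s.u k).swap
      · obtain ⟨k, rfl⟩ := h'
        rw [corrCoord_swap, map_add, map_zsmul, map_mul, corr_uinv, corr_num, corr_qc,
          corrCoord_swap, add_assoc, ← add_smul]
        simp
      · rw [s.corrCoord_of_ne ε h (not_exists.mp h'), corr_qc,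
          s.corrCoord_of_ne _ h (not_exists.mp h')]
  · change s.corr (-ε) (s.corr ε (gen E (Gen.inv c hc))) = gen E (Gen.inv c hc)
    rw [corr_inv, corr_inv]

end Slice

/-! ## Homomorphisms compatible with weights and degrees -/

section Transfer

variable {ι ι' : Type} [DecidableEq ι] [DecidableEq ι'] {E : Set (Coord ι)} {E' : Set (Coord ι')}
  {m : ℕ} {b : ι → Fin m → ℤ} {b' : ι' → Fin m → ℤ}

theorem IsWt.map (f : Weyl E →ₐ[Ch] Weyl E') (h : (Fin m → ℤ) →+ (Fin m → ℤ))
    (hc : ∀ c, IsWt E' b' (h (wt b c)) (f (gen E (Gen.coord c))))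
    (hi : ∀ c hc, IsWt E' b' (-h (wt b c)) (f (gen E (Gen.inv c hc))))
    {w : Fin m → ℤ} {d : Weyl E} (hd : IsWt E b w d) : IsWt E' b' (h w) (f d) := by
  have key : ∀ d : Weyl E, d ∈ AddSubmonoid.closure
      {d | ∃ w, IsWt E b w d ∧ IsWt E' b' (h w) (f d)} := fun d => by
    induction d using weyl_induction with
    | hC r =>
      exact AddSubmonoid.subset_closure ⟨0, IsWt.algebraMap r, by
        rw [map_zero, AlgHom.commutes]; exact IsWt.algebraMap r⟩
    | hX a =>
      rcases a with c | ⟨c, hc'⟩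
      · exact AddSubmonoid.subset_closure ⟨_, IsWt.coord c, hc c⟩
      · exact AddSubmonoid.subset_closure ⟨_, IsWt.inv c hc', by rw [map_neg]; exact hi c hc'⟩
    | hadd x y hx hy => exact add_mem hx hy
    | hmul x y hx hy =>
      refine closure_mul_mem ?_ hx hy
      rintro x ⟨w, h1, h2⟩ y ⟨w', h1', h2'⟩
      exact AddSubmonoid.subset_closure ⟨_, h1.mul h1', by
        rw [map_add, map_mul]; exact h2.mul h2'⟩
  -- A weight vector may be presented as a sum of terms of other weights that cancel. Extracting the
  -- component of weight $w$ discards those terms before the homomorphism is applied.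
  have key2 : ∀ d : Weyl E, IsWt E' b' (h w) (f (wmap E b (Pi.single w 1) d)) := fun d => by
    induction key d using AddSubmonoid.closure_induction with
    | mem x hx =>
      obtain ⟨w', h1, h2⟩ := hx
      rw [wmap_isWt _ h1]
      by_cases hw : w' = w
      · subst hw; simpa using h2
      · rw [Pi.single_eq_of_ne hw, map_zero, zero_smul, map_zero]; exact IsWt.zero _
    | zero => rw [map_zero, map_zero]; exact IsWt.zero _
    | add x y _ _ hx hy => rw [map_add, map_add]; exact hx.add hy
  have := key2 d
  rw [wmap_isWt _ hd] at this
  simpa using this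

theorem IsHomog.map_mem {A : Type*} [Ring A] [Algebra Ch A] (f : Weyl E →ₐ[Ch] A)
    (Γ : ℤ → AddSubmonoid A) {δ : Coord ι → ℤ}
    (h0 : ∀ a : ℂ, algebraMap Ch A (PowerSeries.C a) ∈ Γ 0) (hh : Hypertoric.hbar A ∈ Γ 2)
    (hmul : ∀ i j, ∀ x ∈ Γ i, ∀ y ∈ Γ j, x * y ∈ Γ (i + j))
    (hc : ∀ c, f (gen E (Gen.coord c)) ∈ Γ (δ c))
    (hi : ∀ c hc, f (gen E (Gen.inv c hc)) ∈ Γ (-δ c))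
    {N : ℤ} {d : Weyl E} (hd : IsHomog E δ N d) : f d ∈ Γ N := by
  induction hd with
  | zero N => rw [map_zero]; exact zero_mem _
  | const a => rw [AlgHom.commutes]; exact h0 a
  | hbar => rw [map_hbar]; exact hh
  | coord c => exact hc c
  | inv c hc => exact hi c hc
  | add _ _ h h' => rw [map_add]; exact add_mem h h'
  | mul _ _ h h' => rw [map_mul]; exact hmul _ _ _ h _ h'

variable (E) in
/-- The homogeneous elements, as an additive submonoid. -/
def homogSub (δ : Coord ι → ℤ) (N : ℤ) : AddSubmonoid (Weyl E) where
  carrier := {d | IsHomog E δ N d}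
  zero_mem' := IsHomog.zero N
  add_mem' h h' := h.add h'

theorem IsHomog.map (f : Weyl E →ₐ[Ch] Weyl E') {δ : Coord ι → ℤ} {δ' : Coord ι' → ℤ}
    (hc : ∀ c, IsHomog E' δ' (δ c) (f (gen E (Gen.coord c))))
    (hi : ∀ c hc, IsHomog E' δ' (-δ c) (f (gen E (Gen.inv c hc))))
    {N : ℤ} {d : Weyl E} (hd : IsHomog E δ N d) : IsHomog E' δ' N (f d) :=
  hd.map_mem f (homogSub E' δ') IsHomog.const IsHomog.hbar (fun _ _ _ hx _ hy => IsHomog.mul hx hy)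
    hc hi

theorem IsWt.zsmul {w : Fin m → ℤ} {d : Weyl E} (h : IsWt E b w d) (z : ℤ) :
    IsWt E b w (z • d) := by
  rw [← Int.cast_smul_eq_zsmul Ch]
  exact h.smul _

theorem IsWt.sum {κ : Type*} (t : Finset κ) {w : Fin m → ℤ} {d : κ → Weyl E}
    (h : ∀ k ∈ t, IsWt E b w (d k)) : IsWt E b w (∑ k ∈ t, d k) :=
  Finset.sum_induction d (IsWt E b w) (fun _ _ => IsWt.add) (IsWt.zero w) h

theorem IsHomog.zsmul {δ : Coord ι → ℤ} {N : ℤ} {d : Weyl E} (h : IsHomog E δ N d) (z : ℤ) :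
    IsHomog E δ N (z • d) := by
  have := (IsHomog.const (E := E) (δ := δ) (z : ℂ)).mul h
  rw [zero_add, map_intCast, map_intCast, ← zsmul_eq_mul] at this
  exact this

theorem IsHomog.sum {κ : Type*} (t : Finset κ) {δ : Coord ι → ℤ} {N : ℤ} {d : κ → Weyl E}
    (h : ∀ k ∈ t, IsHomog E δ N (d k)) : IsHomog E δ N (∑ k ∈ t, d k) :=
  Finset.sum_induction d (IsHomog E δ N) (fun _ _ => IsHomog.add) (IsHomog.zero N) h

end Transfer

/-! ## Subsets of the coordinates -/

section Restrict

variable {ι : Type} [DecidableEq ι] {P : ι → Prop}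

/-- The inclusion of the coordinates with index in a subset. -/
abbrev cval : Coord {i // P i} → Coord ι := Sum.map Subtype.val Subtype.val

/-- A coordinate with index in a subset. -/
def clift : (c : Coord ι) → P (cidx c) → Coord {i // P i}
  | Sum.inl i, h => Sum.inl ⟨i, h⟩
  | Sum.inr i, h => Sum.inr ⟨i, h⟩

theorem cval_clift (c : Coord ι) (h : P (cidx c)) : cval (clift c h) = c := by
  rcases c with i | i <;> rfl

theorem clift_cval (c : Coord {i // P i}) (h : P (cidx (cval c))) : clift (cval c) h = c := by
  rcases c with i | i <;> rfl

theorem cidx_cval (c : Coord {i // P i}) : cidx (cval c) = ((cidx c : {i // P i}) : ι) := by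
  rcases c with i | i <;> rfl

theorem omega_cval (c c' : Coord {i // P i}) : omega (cval c) (cval c') = omega c c' := by
  rcases c with i | i <;> rcases c' with j | j <;> simp [omega, Subtype.ext_iff]

theorem wt_cval {m : ℕ} (b : ι → Fin m → ℤ) (c : Coord {i // P i}) :
    wt b (cval c) = wt (fun i : {i // P i} => b i) c := by
  rcases c with i | i <;> rfl

variable {E : Set (Coord ι)} {E' : Set (Coord {i // P i})}

/-- The inclusion of the Weyl algebra of a subset of the coordinates. -/
def incl (hE : ∀ c ∈ E', cval c ∈ E) : Weyl E' →ₐ[Ch] Weyl E :=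
  liftWeyl E' (fun
    | Gen.coord c => gen E (Gen.coord (cval c))
    | Gen.inv c hc => gen E (Gen.inv (cval c) (hE c hc)))
    (fun c c' => by simp only; rw [gen_comm, omega_cval])
    (fun c hc => gen_mul_inv _ _ _) (fun c hc => gen_inv_mul _ _ _)

theorem incl_qc (hE : ∀ c ∈ E', cval c ∈ E) (c : Coord {i // P i}) :
    incl hE (qc E' c) = qc E (cval c) :=
  liftWeyl_gen E' _ _ _ _ (Gen.coord c)

theorem incl_inv (hE : ∀ c ∈ E', cval c ∈ E) (c : Coord {i // P i}) (hc : c ∈ E') :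
    incl hE (gen E' (Gen.inv c hc)) = gen E (Gen.inv (cval c) (hE c hc)) :=
  liftWeyl_gen E' _ _ _ _ (Gen.inv c hc)

theorem incl_xy (hE : ∀ c ∈ E', cval c ∈ E) (i : {i // P i}) : incl hE (xy E' i) = xy E i := by
  rw [xy, map_mul, incl_qc, incl_qc]; rfl

theorem commute_incl {P' : ι → Prop} {E'' : Set (Coord {i // P' i})} (hE : ∀ c ∈ E', cval c ∈ E)
    (hE' : ∀ c ∈ E'', cval c ∈ E) (hP : ∀ i, P i → ¬ P' i) (d : Weyl E') (d' : Weyl E'') :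
    Commute (incl hE d) (incl hE' d') := by
  have hne : ∀ (c : Coord {i // P i}) (c' : Coord {i // P' i}),
      Commute (qc E (cval c)) (qc E (cval c')) := fun c c' => commute_qc_of_cidx fun h => by
    rw [cidx_cval, cidx_cval] at h
    exact hP _ (cidx c).2 (h ▸ (cidx c').2)
  have h1 : ∀ (c : Coord {i // P i}) (d' : Weyl E''), Commute (qc E (cval c)) (incl hE' d') :=
    fun c d' => by
      induction d' using weyl_induction with
      | hC r => rw [AlgHom.commutes]; exact (Algebra.commutes _ _).symm
      | hX a =>
        rcases a with c' | ⟨c', hc'⟩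
        · exact (incl_qc hE' c').symm ▸ hne c c'
        · rw [incl_inv]
          exact (Commute.inv_of_mul_eq_one (gen_mul_inv E _ _) (gen_inv_mul E _ _)
            (hne c c').symm).symm
      | hadd x y hx hy => rw [map_add]; exact hx.add_right hy
      | hmul x y hx hy => rw [map_mul]; exact hx.mul_right hy
  induction d using weyl_induction with
  | hC r => rw [AlgHom.commutes]; exact Algebra.commutes _ _
  | hX a =>
    rcases a with c | ⟨c, hc⟩
    · exact (incl_qc hE c).symm ▸ h1 c d'
    · rw [incl_inv]
      exact Commute.inv_of_mul_eq_one (gen_mul_inv E _ _) (gen_inv_mul E _ _) (h1 c d')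
  | hadd x y hx hy => rw [map_add]; exact hx.add_left hy
  | hmul x y hx hy => rw [map_mul]; exact hx.mul_left hy

end Restrict

/-! ## The Weyl algebra as a tensor product -/

section Split

variable {ι : Type} [DecidableEq ι] (E : Set (Coord ι)) (F : Finset ι)

/-- The coordinates in `E` with index outside `F`. -/
abbrev offSet : Set (Coord {i // i ∉ F}) := cval ⁻¹' E

/-- The Weyl algebra of the coordinates with index outside `F`. -/
abbrev WOff : Type := Weyl (offSet E F)

/-- The Weyl algebra of the coordinates with index in `F`. -/
abbrev WOn : Type := Weyl (∅ : Set (Coord {i // i ∈ F}))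

/-- The inclusion of the Weyl algebra of the coordinates with index outside `F`. -/
abbrev inclOff : WOff E F →ₐ[Ch] Weyl E := incl fun _ h => h

/-- The inclusion of the Weyl algebra of the coordinates with index in `F`. -/
abbrev inclOn : WOn F →ₐ[Ch] Weyl E := incl fun _ h => absurd h (Set.notMem_empty _)

/-- The map from the tensor product of the two Weyl algebras. -/
def join : WOff E F ⊗[Ch] WOn F →ₐ[Ch] Weyl E :=
  Algebra.TensorProduct.lift (inclOff E F) (inclOn E F)
    fun d d' => commute_incl _ _ (fun i h h' => h h') d d'

theorem join_tmul (d : WOff E F) (d' : WOn F) :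
    join E F (d ⊗ₜ d') = inclOff E F d * inclOn E F d' :=
  Algebra.TensorProduct.lift_tmul _ _ _ _ _

variable {E F}

open Classical in
theorem split_comm (c c' : Coord ι) :
    let g : Coord ι → WOff E F ⊗[Ch] WOn F := fun c => if h : cidx c ∈ F
      then 1 ⊗ₜ qc _ (clift c h) else qc _ (clift (P := (· ∉ F)) c h) ⊗ₜ 1
    g c * g c' = g c' * g c + omega c c' • hbar (WOff E F ⊗[Ch] WOn F) := by
  intro g
  have hω : ∀ {P : ι → Prop} {c c' : Coord ι} (h : P (cidx c)) (h' : P (cidx c')),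
      omega (clift c h) (clift c' h') = omega c c' := fun h h' => by
    rw [← omega_cval, cval_clift, cval_clift]
  have h0 : ∀ {c c' : Coord ι}, cidx c ∈ F → cidx c' ∉ F → omega c c' = 0 := fun h h' =>
    omega_eq_zero fun e => h' (by rwa [e, cidx_swap])
  have hl : (1 : WOff E F) ⊗ₜ[Ch] hbar (WOn F) = hbar _ := by
    rw [hbar, Algebra.algebraMap_eq_smul_one, TensorProduct.tmul_smul, hbar,
      Algebra.algebraMap_eq_smul_one]
    rfl
  have hr : hbar (WOff E F) ⊗ₜ[Ch] (1 : WOn F) = hbar _ := by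
    rw [hbar, Algebra.algebraMap_eq_smul_one, ← TensorProduct.smul_tmul', hbar,
      Algebra.algebraMap_eq_smul_one]
    rfl
  by_cases h : cidx c ∈ F <;> by_cases h' : cidx c' ∈ F
  · simp only [g, dif_pos h, dif_pos h', Algebra.TensorProduct.tmul_mul_tmul, one_mul]
    rw [qc_comm, hω, TensorProduct.tmul_add, ← hl]
    congr 1
    exact map_zsmul (TensorProduct.mk Ch (WOff E F) (WOn F) 1) _ _
  · simp only [g, dif_pos h, dif_neg h', Algebra.TensorProduct.tmul_mul_tmul, one_mul, mul_one]
    rw [h0 h h', zero_smul, add_zero]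
  · simp only [g, dif_neg h, dif_pos h', Algebra.TensorProduct.tmul_mul_tmul, one_mul, mul_one]
    rw [omega_swap, h0 h' h, neg_zero, zero_smul, add_zero]
  · simp only [g, dif_neg h, dif_neg h', Algebra.TensorProduct.tmul_mul_tmul, one_mul]
    rw [qc_comm, hω, TensorProduct.add_tmul, ← hr]
    congr 1

open Classical in
/-- The inverse of `join`. -/
def split (hE : ∀ c ∈ E, cidx c ∉ F) : Weyl E →ₐ[Ch] WOff E F ⊗[Ch] WOn F :=
  liftWeyl E (fun
    | Gen.coord c => if h : cidx c ∈ F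
      then 1 ⊗ₜ qc _ (clift c h) else qc _ (clift (P := (· ∉ F)) c h) ⊗ₜ 1
    | Gen.inv c hc => gen _ (Gen.inv (clift (P := (· ∉ F)) c (hE c hc)) (by
        rw [Set.mem_preimage, cval_clift]; exact hc)) ⊗ₜ 1)
    split_comm
    (fun c hc => by
      simp only
      rw [dif_neg (hE c hc), Algebra.TensorProduct.tmul_mul_tmul, qc, gen_mul_inv, one_mul]; rfl)
    (fun c hc => by
      simp only
      rw [dif_neg (hE c hc), Algebra.TensorProduct.tmul_mul_tmul, qc, gen_inv_mul, one_mul]; rfl)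

variable (hE : ∀ c ∈ E, cidx c ∉ F)

theorem split_qc_on {c : Coord ι} (h : cidx c ∈ F) :
    split hE (qc E c) = 1 ⊗ₜ qc _ (clift c h) :=
  (liftWeyl_gen E _ _ _ _ (Gen.coord c)).trans (dif_pos h)

theorem split_qc_off {c : Coord ι} (h : cidx c ∉ F) :
    split hE (qc E c) = qc _ (clift (P := (· ∉ F)) c h) ⊗ₜ 1 :=
  (liftWeyl_gen E _ _ _ _ (Gen.coord c)).trans (dif_neg h)

theorem split_inv (c : Coord ι) (hc : c ∈ E) : split hE (gen E (Gen.inv c hc)) =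
    gen _ (Gen.inv (clift (P := (· ∉ F)) c (hE c hc)) (by
        rw [Set.mem_preimage, cval_clift]; exact hc)) ⊗ₜ 1 :=
  liftWeyl_gen E _ _ _ _ (Gen.inv c hc)

theorem gen_inv_congr {c c' : Coord ι} (h : c = c') (hc : c ∈ E) (hc' : c' ∈ E) :
    gen E (Gen.inv c hc) = gen E (Gen.inv c' hc') := by
  subst h; rfl

theorem join_split (d : Weyl E) : join E F (split hE d) = d := by
  suffices (join E F).comp (split hE) = AlgHom.id Ch _ from congrArg (fun f => f d) this
  apply algHom_ext_weyl
  rintro (c | ⟨c, hc⟩)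
  · change join E F (split hE (qc E c)) = qc E c
    by_cases h : cidx c ∈ F
    · rw [split_qc_on hE h, join_tmul, map_one, one_mul, incl_qc, cval_clift]
    · rw [split_qc_off hE h, join_tmul, map_one, mul_one, incl_qc, cval_clift]
  · change join E F (split hE (gen E (Gen.inv c hc))) = gen E (Gen.inv c hc)
    rw [split_inv, join_tmul, map_one, mul_one, incl_inv]
    exact gen_inv_congr (cval_clift _ _) _ _

theorem split_inclOff (d : WOff E F) : split hE (inclOff E F d) = d ⊗ₜ 1 := by
  suffices (split hE).comp (inclOff E F) = Algebra.TensorProduct.includeLeft from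
    congrArg (fun f => f d) this
  apply algHom_ext_weyl
  rintro (c | ⟨c, hc⟩)
  · change split hE (inclOff E F (qc _ c)) = qc _ c ⊗ₜ 1
    rw [incl_qc, split_qc_off hE (by rw [cidx_cval]; exact (cidx c).2), clift_cval]
  · change split hE (inclOff E F (gen _ (Gen.inv c hc))) = gen _ (Gen.inv c hc) ⊗ₜ 1
    rw [incl_inv, split_inv]
    congr 1
    exact gen_inv_congr (clift_cval _ _) _ _

theorem split_inclOn (d : WOn F) : split hE (inclOn E F d) = 1 ⊗ₜ d := by
  suffices (split hE).comp (inclOn E F) = Algebra.TensorProduct.includeRight from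
    congrArg (fun f => f d) this
  apply algHom_ext_weyl
  rintro (c | ⟨c, hc⟩)
  · change split hE (inclOn E F (qc _ c)) = 1 ⊗ₜ qc _ c
    rw [incl_qc, split_qc_on hE (by rw [cidx_cval]; exact (cidx c).2), clift_cval]
  · exact absurd hc (Set.notMem_empty _)

theorem split_join (x : WOff E F ⊗[Ch] WOn F) : split hE (join E F x) = x := by
  induction x with
  | zero => rw [map_zero, map_zero]
  | add x y hx hy => rw [map_add, map_add, hx, hy]
  | tmul a c =>
    rw [join_tmul, map_mul, split_inclOff, split_inclOn, Algebra.TensorProduct.tmul_mul_tmul,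
      mul_one, one_mul]

end Split

/-! ### Homomorphisms out of the quantum reduction -/

theorem mem_qinv_of_isWt {ι : Type} [DecidableEq ι] {E : Set (Coord ι)} {m : ℕ}
    {b : ι → Fin m → ℤ} {H : Subgroup (Torus m)} {w : Fin m → ℤ} (hw : ∀ t ∈ H, chi w t = 1)
    {d : Weyl E} (h : IsWt E b w d) : d ∈ qinv E b H := by
  rw [← rey_of_triv hw h]; exact rey_mem d

section Lift

variable {ι : Type} [DecidableEq ι] [Fintype ι] {E : Set (Coord ι)} {m : ℕ} {b : ι → Fin m → ℤ}
  {H : Subgroup (Torus m)}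

/-- A homomorphism from the invariants which kills the moment map factors through the quantum
Hamiltonian reduction. -/
def qredLift {B : Type*} [Ring B] [Algebra Ch B] (f : qinv E b H →ₐ[Ch] B)
    (hf : ∀ a : qinv E b H, (a : Weyl E) ∈ qmomIdeal E b H → f a = 0) : QRed E b H →ₐ[Ch] B :=
  RingQuot.liftAlgHom Ch ⟨f, by rintro a _ ⟨ha⟩; rw [map_zero]; exact hf a ha⟩

theorem qredLift_qmk {B : Type*} [Ring B] [Algebra Ch B] (f : qinv E b H →ₐ[Ch] B) (hf)
    (a : qinv E b H) : qredLift f hf (qmk E b H a) = f a :=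
  RingQuot.liftAlgHom_mkAlgHom_apply Ch _ _ _

theorem qmom_eq (ξ : Fin m → ℂ) :
    qmom E b ξ = ∑ i, (PowerSeries.C (pair (b i) ξ) : Ch) • xy E i := rfl

theorem qmom_add (ξ η : Fin m → ℂ) : qmom E b (ξ + η) = qmom E b ξ + qmom E b η := by
  simp only [qmom_eq, pair_add_right, map_add, add_smul, Finset.sum_add_distrib]

theorem map_mem_qmomIdeal {ι' : Type} [DecidableEq ι'] [Fintype ι'] {E' : Set (Coord ι')}
    {b' : ι' → Fin m → ℤ} {H' : Subgroup (Torus m)} (f : Weyl E →ₐ[Ch] Weyl E')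
    (hf : ∀ ξ ∈ lie H, ∃ η ∈ lie H', f (qmom E b ξ) = qmom E' b' η) {a : Weyl E}
    (ha : a ∈ qmomIdeal E b H) : f a ∈ qmomIdeal E' b' H' := by
  induction ha using Submodule.span_induction with
  | mem x hx =>
    obtain ⟨ξ, hξ, d, rfl⟩ := hx
    obtain ⟨η, hη, h⟩ := hf ξ hξ
    exact Submodule.subset_span ⟨η, hη, f d, by rw [map_mul, h]⟩
  | zero => rw [map_zero]; exact zero_mem _
  | add x y _ _ hx hy => rw [map_add]; exact add_mem hx hy
  | smul r x _ hx => rw [map_smul]; exact Submodule.smul_mem _ _ hx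

end Lift

/-! ### Factorization of the Weyl algebra, its weights and its moment map -/

namespace Slice

variable {ι : Type} [DecidableEq ι] {E : Set (Coord ι)} {m : ℕ} {b : ι → Fin m → ℤ} {F : Finset ι}
  {H : Subgroup (Torus m)} {κ : Type} [Fintype κ] [DecidableEq κ] (s : Slice E b F H κ)

/-- The correction of weights which makes the weights of the `u k` zero. -/
def hat : (Fin m → ℤ) →+ (Fin m → ℤ) :=
  AddMonoidHom.mk' (fun w => w - ∑ k, ipair w (s.e k) • wt b (s.u k)) fun w w' => by
    simp only [ipair_add, add_smul, Finset.sum_add_distrib]; abel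

theorem hat_apply (w : Fin m → ℤ) : s.hat w = w - ∑ k, ipair w (s.e k) • wt b (s.u k) := rfl

theorem hat_eq_zero {w : Fin m → ℤ} : s.hat w = 0 ↔ ∀ t ∈ H, chi w t = 1 := by
  rw [s.perp, hat_apply, sub_eq_zero]

theorem ipair_hat (w : Fin m → ℤ) (k : κ) : ipair (s.hat w) (s.e k) = 0 := by
  rw [hat_apply, ipair_sub, ipair_sum]
  simp only [ipair_zsmul, s.dual, mul_ite, mul_one, mul_zero, Finset.sum_ite_eq',
    Finset.mem_univ, if_true, sub_self]

theorem hat_hat (w : Fin m → ℤ) : s.hat (s.hat w) = s.hat w := by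
  rw [hat_apply (w := s.hat w)]
  simp [ipair_hat]

/-- The projection of the Lie algebra to that of `H`. -/
def hatLie (ξ : Fin m → ℂ) : Fin m → ℂ :=
  ξ - ∑ k, pair (wt b (s.u k)) ξ • fun j => (s.e k j : ℂ)

theorem mem_lie {ξ : Fin m → ℂ} : ξ ∈ lie H ↔ ∀ k, pair (wt b (s.u k)) ξ = 0 := by
  constructor
  · exact fun h k => h _ fun t ht => (s.mem_iff t).mp ht k
  · intro h w hw
    rw [(s.perp w).mp hw, pair_sum]
    exact Finset.sum_eq_zero fun k _ => by rw [pair_zsmul, h, mul_zero]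

theorem hatLie_mem (ξ : Fin m → ℂ) : s.hatLie ξ ∈ lie H := by
  refine s.mem_lie.mpr fun k => ?_
  rw [hatLie, pair_sub_right, pair_sum_right]
  simp [pair_smul_right, pair_intCast, s.dual]

theorem pair_of_notMem (s : Slice E b F H κ) {i : ι} (hi : i ∉ F) {ξ : Fin m → ℂ} (h : ξ ∈ lie H) :
    pair (b i) ξ = 0 := h _ (s.chi_eq_one i hi)

/-! ### The two factors -/

variable (b F) in
/-- The weights of the coordinates with index outside `F`. -/
abbrev offWt : {i // i ∉ F} → Fin m → ℤ := fun i => b i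

variable (b F) in
/-- The weights of the coordinates with index in `F`. -/
abbrev onWt : {i // i ∈ F} → Fin m → ℤ := fun i => b i

/-- The Weyl algebra of the coordinates with index outside `F`, embedded as the centralizer of the
image of `toOn`. -/
def toOff : WOff E F →ₐ[Ch] Weyl E := (s.corr 1).comp (inclOff E F)

/-- The Weyl algebra of the coordinates with index in `F`, embedded such that the weights become
trivial on the subtorus generated by the `e k`. -/
def toOn : WOn F →ₐ[Ch] Weyl E := (s.corr 1).comp (inclOn E F)

theorem commute_toOff_toOn (a : WOff E F) (c : WOn F) : Commute (s.toOff a) (s.toOn c) := by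
  have h : Commute (inclOff E F a) (inclOn E F c) := commute_incl _ _ (fun i h h' => h h') a c
  exact h.map (s.corr 1)

/-- The isomorphism of the tensor product of the two Weyl algebras with the Weyl algebra. -/
def theta : WOff E F ⊗[Ch] WOn F →ₐ[Ch] Weyl E := (s.corr 1).comp (join E F)

theorem theta_tmul (a : WOff E F) (c : WOn F) : s.theta (a ⊗ₜ c) = s.toOff a * s.toOn c := by
  change s.corr 1 (join E F (a ⊗ₜ c)) = _
  rw [join_tmul, map_mul]; rfl

/-- The inverse of `theta`. -/
def psi : Weyl E →ₐ[Ch] WOff E F ⊗[Ch] WOn F := (split s.cidx_notMem).comp (s.corr (-1))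

theorem theta_psi (d : Weyl E) : s.theta (s.psi d) = d := by
  change s.corr 1 (join E F (split s.cidx_notMem (s.corr (-1) d))) = d
  rw [join_split]
  have := s.corr_corr (-1) d
  rwa [neg_neg] at this

theorem psi_theta (x : WOff E F ⊗[Ch] WOn F) : s.psi (s.theta x) = x := by
  have h : s.psi (s.theta x) = split s.cidx_notMem (s.corr (-1) (s.corr 1 (join E F x))) := rfl
  rw [h, s.corr_corr 1, split_join]

theorem toOff_qc (c : Coord {i // i ∉ F}) :
    s.toOff (gen _ (Gen.coord c)) = s.corrCoord 1 (cval c) := by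
  change s.corr 1 (inclOff E F (qc _ c)) = _
  rw [incl_qc, corr_qc]

theorem toOff_inv (c : Coord {i // i ∉ F}) (hc : c ∈ offSet E F) :
    s.toOff (gen _ (Gen.inv c hc)) = gen E (Gen.inv (cval c) hc) := by
  change s.corr 1 (inclOff E F (gen _ (Gen.inv c hc))) = _
  rw [incl_inv, corr_inv]

theorem toOn_qc (c : Coord {i // i ∈ F}) :
    s.toOn (gen _ (Gen.coord c)) = s.corrCoord 1 (cval c) := by
  change s.corr 1 (inclOn E F (qc _ c)) = _
  rw [incl_qc, corr_qc]

theorem cidx_cval_off (c : Coord {i // i ∉ F}) : cidx (cval c) ∉ F := by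
  rw [cidx_cval]; exact (cidx c).2

theorem cidx_cval_on (c : Coord {i // i ∈ F}) : cidx (cval c) ∈ F := by
  rw [cidx_cval]; exact (cidx c).2

/-! ### Weights -/

theorem isWt_num (k : κ) : IsWt E b 0 (s.num k) :=
  IsWt.sum _ fun j _ => by
    have := (IsWt.coord (E := E) (b := b) (Sum.inl j)).mul (IsWt.coord (Sum.inr j))
    rw [wt, Sum.elim_inl, Sum.elim_inr, add_neg_cancel] at this
    exact this.zsmul _

theorem isWt_uinv (k : κ) :
    IsWt E b (-wt b (s.u k)) (((s.uq k)⁻¹ : (Weyl E)ˣ) : Weyl E) := IsWt.inv _ (s.mem k)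

theorem isWt_corrCoord_off {c : Coord ι} (h : cidx c ∉ F) :
    IsWt E b (wt b c) (s.corrCoord 1 c) := by
  rw [corrCoord, if_neg h]
  refine IsWt.add (IsWt.coord c) (IsWt.sum _ fun k _ => ?_)
  split_ifs with hk
  · rw [hk, wt_swap]
    have := (s.isWt_uinv k).mul (s.isWt_num k)
    rw [add_zero] at this
    exact this.zsmul _
  · exact IsWt.zero _

theorem isWt_corrCoord_on {c : Coord ι} (h : cidx c ∈ F) :
    IsWt E b (s.hat (wt b c)) (s.corrCoord 1 c) := by
  rw [s.corrCoord_mem 1 h, hat_apply, sub_eq_add_neg, ← Finset.sum_neg_distrib]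
  have := (show IsWt E b (wt b c) (qc E c) from IsWt.coord c).mul (s.isWt_mono (s.expo 1 c))
  simpa only [expo, neg_one_mul, neg_smul] using this

theorem isWt_toOff {w : Fin m → ℤ} {a : WOff E F} (h : IsWt _ (offWt b F) w a) :
    IsWt E b w (s.toOff a) :=
  h.map s.toOff (AddMonoidHom.id _)
    (fun c => by
      rw [toOff_qc, AddMonoidHom.id_apply, ← wt_cval]
      exact s.isWt_corrCoord_off (cidx_cval_off c))
    (fun c hc => by
      rw [toOff_inv, AddMonoidHom.id_apply, ← wt_cval]
      exact IsWt.inv _ _)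

theorem isWt_toOn {w : Fin m → ℤ} {a : WOn F} (h : IsWt _ (onWt b F) w a) :
    IsWt E b (s.hat w) (s.toOn a) :=
  h.map s.toOn s.hat
    (fun c => by
      rw [toOn_qc, ← wt_cval]
      exact s.isWt_corrCoord_on (cidx_cval_on c))
    (fun c hc => absurd hc (Set.notMem_empty _))

theorem mem_qinv_off (s : Slice E b F H κ) (a : WOff E F) : a ∈ qinv _ (offWt b F) H := by
  have hc : ∀ c : Coord {i // i ∉ F}, ∀ t ∈ H, chi (wt (offWt b F) c) t = 1 := fun c t ht => by
    rcases c with i | i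
    · exact s.chi_eq_one i i.2 t ht
    · simp only [wt, Sum.elim_inr, chi_neg, inv_eq_one]
      exact s.chi_eq_one i i.2 t ht
  induction a using weyl_induction with
  | hC r => exact Subalgebra.algebraMap_mem _ r
  | hX a =>
    rcases a with c | ⟨c, hc'⟩
    · exact mem_qinv_of_isWt (hc c) (IsWt.coord c)
    · exact mem_qinv_of_isWt (fun t ht => by rw [chi_neg, hc c t ht, inv_one]) (IsWt.inv c hc')
  | hadd x y hx hy => exact add_mem hx hy
  | hmul x y hx hy => exact mul_mem hx hy

/-- $H$ acts trivially on the coordinates outside $F$, so weights that actually occur there are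
trivial on $H$. -/
theorem eq_zero_or_hat_eq_zero {w : Fin m → ℤ} {a : WOff E F} (h : IsWt _ (offWt b F) w a) :
    a = 0 ∨ s.hat w = 0 := by
  by_cases hw : ∀ t ∈ H, chi w t = 1
  · exact Or.inr (s.hat_eq_zero.mpr hw)
  · left
    have := coeff_coact_eq_zero (s.mem_qinv_off a) hw
    rwa [h.1, AddMonoidAlgebra.coeff_single, Finsupp.single_eq_same] at this

/-- Writing an invariant as its own projection reduces the claim to weight vectors, where
`isWt_toOff` applies. -/
theorem toOff_mem {a : WOff E F} (ha : a ∈ qinv _ (offWt b F) ⊤) : s.toOff a ∈ qinv E b ⊤ := by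
  have key : ∀ a, s.toOff (rey _ (offWt b F) ⊤ a) ∈ qinv E b ⊤ := fun a => by
    induction a using wt_induction (offWt b F) with
    | hadd d d' h h' => rw [map_add, map_add]; exact add_mem h h'
    | hw w d h =>
      by_cases hw : ∀ t ∈ (⊤ : Subgroup (Torus m)), chi w t = 1
      · rw [rey_of_triv hw h]
        exact mem_qinv_of_isWt hw (s.isWt_toOff h)
      · rw [rey_of_nontriv hw h, map_zero]; exact zero_mem _
  rw [← rey_of_mem ha]
  exact key a

theorem toOn_mem {a : WOn F} (ha : a ∈ qinv _ (onWt b F) H) : s.toOn a ∈ qinv E b ⊤ := by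
  have key : ∀ a, s.toOn (rey _ (onWt b F) H a) ∈ qinv E b ⊤ := fun a => by
    induction a using wt_induction (onWt b F) with
    | hadd d d' h h' => rw [map_add, map_add]; exact add_mem h h'
    | hw w d h =>
      by_cases hw : ∀ t ∈ H, chi w t = 1
      · rw [rey_of_triv hw h]
        exact mem_qinv_of_isWt (w := s.hat w)
          (fun t _ => by rw [s.hat_eq_zero.mpr hw, chi_zero]) (s.isWt_toOn h)
      · rw [rey_of_nontriv hw h, map_zero]; exact zero_mem _
  rw [← rey_of_mem ha]
  exact key a

/-! ### Moment maps -/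

variable [Fintype ι]

/-- The automorphism sends $u_kv_k$ to $u_kv_k\pm\mathrm{num}_k$, with plus if $u_k$ is an $x$ and
minus if it is a $y$. The weight of $u_k$ is $\pm b$ with the same sign, so after scaling the
correction has a uniform form. -/
theorem corr_xy_u (k : κ) (ξ : Fin m → ℂ) :
    (PowerSeries.C (pair (b (cidx (s.u k))) ξ) : Ch) • s.corr 1 (xy E (cidx (s.u k))) =
      (PowerSeries.C (pair (b (cidx (s.u k))) ξ) : Ch) • xy E (cidx (s.u k)) +
        (PowerSeries.C (pair (wt b (s.u k)) ξ) : Ch) • s.num k := by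
  have h1 := s.corr_qc 1 (s.u k)
  rw [s.corrCoord_of_mem 1 (s.mem k)] at h1
  have h2 := s.corr_qc 1 (s.u k).swap
  rw [corrCoord_swap] at h2
  have h3 : qc E (s.u k) * ((s.uq k)⁻¹ : (Weyl E)ˣ) = 1 := (s.uq k).mul_inv
  have h4 : (((s.uq k)⁻¹ : (Weyl E)ˣ) : Weyl E) * qc E (s.u k) = 1 := (s.uq k).inv_mul
  have h5 := (s.commute_num (s.u_notMem k) k).eq
  have h6 : s.sgn k = omega (s.u k).swap (s.u k) := rfl
  generalize s.u k = c at *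
  rcases c with i | i
  · simp only [cidx, Sum.elim_inl, id, xy, map_mul, wt, Sum.swap_inl] at *
    rw [h1, h2, h6, mul_add, smul_add]
    simp only [omega, if_true, mul_one, one_smul, ← mul_assoc, h3, one_mul]
  · simp only [cidx, Sum.elim_inr, id, xy, map_mul, wt, Sum.swap_inr] at *
    rw [h1, h2, h6, add_mul, smul_add, pair_neg]
    simp only [omega, if_true, one_mul, neg_smul, one_smul, neg_mul, mul_assoc, ← h5]
    rw [← mul_assoc _ (qc E (Sum.inr i)), h4, one_mul, map_neg, neg_smul, smul_neg]

theorem corr_xy_off {i : ι} (hi : i ∉ F) (ξ : Fin m → ℂ) :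
    (PowerSeries.C (pair (b i) ξ) : Ch) • s.corr 1 (xy E i) =
      (PowerSeries.C (pair (b i) ξ) : Ch) • xy E i + ∑ k, if cidx (s.u k) = i then
        (PowerSeries.C (pair (wt b (s.u k)) ξ) : Ch) • s.num k else 0 := by
  by_cases h : ∃ k, cidx (s.u k) = i
  · obtain ⟨k, rfl⟩ := h
    rw [corr_xy_u, Finset.sum_eq_single k]
    · rw [if_pos rfl]
    · intro l _ hl
      rw [if_neg fun h => hl (s.cidx_u_injective h)]
    · intro h; exact absurd (Finset.mem_univ _) h
  · have hne : ∀ c : Coord ι, cidx c = i → s.corr 1 (qc E c) = qc E c := fun c hc => by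
      rw [corr_qc, s.corrCoord_of_ne 1 (by rwa [hc])]
      intro k hk
      exact h ⟨k, by rw [← hc, hk, cidx_swap]⟩
    rw [xy, map_mul, hne _ rfl, hne _ rfl, Finset.sum_eq_zero, add_zero]
    exact fun k _ => if_neg fun hk => h ⟨k, hk⟩

theorem sum_off_add_sum_on {M : Type*} [AddCommMonoid M] (f : ι → M) :
    ∑ i, f i = ∑ i : {i // i ∉ F}, f i + ∑ i ∈ F, f i := by
  rw [← Finset.sum_filter_add_sum_filter_not Finset.univ (· ∉ F) f]
  congr 1
  · exact Finset.sum_subtype _ (by simp) _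
  · simp

/-- The coordinates outside $F$ do not see the component $\hat\xi$ of $\xi$ in
$\operatorname{Lie}H$. The corrections add $\sum_k\langle u_k,\xi\rangle\,\mathrm{num}_k$, where
$u_k$ stands for its weight; this is precisely the part of $\mu_q(\xi-\hat\xi)$ with indices in $F$.
-/
theorem toOff_qmom (ξ : Fin m → ℂ) : s.toOff (qmom _ (offWt b F) ξ) = qmom E b (ξ - s.hatLie ξ) := by
  rw [qmom_eq, map_sum, qmom_eq, sum_off_add_sum_on (F := F)]
  have h1 : ∀ i : {i // i ∉ F}, s.toOff ((PowerSeries.C (pair (offWt b F i) ξ) : Ch) • xy _ i) =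
      (PowerSeries.C (pair (b i) (ξ - s.hatLie ξ)) : Ch) • xy E i +
      ∑ k, if cidx (s.u k) = i then
        (PowerSeries.C (pair (wt b (s.u k)) ξ) : Ch) • s.num k else 0 := fun i => by
    rw [map_smul, pair_sub_right, s.pair_of_notMem i.2 (s.hatLie_mem ξ), sub_zero,
      ← s.corr_xy_off i.2]
    change _ • s.corr 1 (inclOff E F (xy _ i)) = _
    rw [incl_xy]
  rw [Finset.sum_congr rfl fun i _ => h1 i, Finset.sum_add_distrib, Finset.sum_comm]
  congr 1
  have h2 : ∀ k, (∑ i : {i // i ∉ F}, if cidx (s.u k) = i then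
      (PowerSeries.C (pair (wt b (s.u k)) ξ) : Ch) • s.num k else 0) =
      (PowerSeries.C (pair (wt b (s.u k)) ξ) : Ch) • s.num k := fun k => by
    rw [Finset.sum_eq_single ⟨cidx (s.u k), s.u_notMem k⟩]
    · rw [if_pos rfl]
    · intro i _ hi
      rw [if_neg fun h => hi (Subtype.ext h.symm)]
    · intro h; exact absurd (Finset.mem_univ _) h
  rw [Finset.sum_congr rfl fun k _ => h2 k]
  simp only [num, Finset.smul_sum]
  rw [Finset.sum_comm]
  refine Finset.sum_congr rfl fun j _ => ?_
  rw [hatLie, sub_sub_cancel, pair_sum_right, map_sum, Finset.sum_smul]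
  refine Finset.sum_congr rfl fun k _ => ?_
  rw [pair_smul_right, pair_intCast, map_mul, map_intCast, mul_smul, Int.cast_smul_eq_zsmul]

/-- Elements of $\operatorname{Lie}H$ pair to zero with the weights outside $F$, and the products
$x_iy_i$ with $i\in F$ are fixed by the automorphism. -/
theorem toOn_qmom {η : Fin m → ℂ} (hη : η ∈ lie H) :
    s.toOn (qmom _ (onWt b F) η) = qmom E b η := by
  rw [qmom_eq, map_sum, qmom_eq, sum_off_add_sum_on (F := F),
    Finset.sum_eq_zero (s := (Finset.univ : Finset {i // i ∉ F})), zero_add,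
    Finset.sum_subtype F (p := (· ∈ F)) (fun _ => Iff.rfl)]
  · refine Finset.sum_congr rfl fun i _ => ?_
    rw [map_smul]
    change _ • s.corr 1 (inclOn E F (xy _ i)) = _
    rw [incl_xy, s.corr_xy 1 i.2]
  · intro i _
    rw [s.pair_of_notMem i.2 hη, map_zero, zero_smul]

/-- The two previous formulas add up because $\xi=(\xi-\hat\xi)+\hat\xi$. The moment map is thus a
sum of the moment maps of the two factors. -/
theorem psi_qmom (ξ : Fin m → ℂ) : s.psi (qmom E b ξ) =
    qmom _ (offWt b F) ξ ⊗ₜ 1 + 1 ⊗ₜ qmom _ (onWt b F) (s.hatLie ξ) := by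
  rw [← s.psi_theta (_ ⊗ₜ 1 + _)]
  congr 1
  rw [map_add, theta_tmul, theta_tmul, map_one, map_one, one_mul, mul_one, toOff_qmom,
    s.toOn_qmom (s.hatLie_mem ξ), ← qmom_add, sub_add_cancel]

end Slice

namespace Slice

variable {ι : Type} [DecidableEq ι] {E : Set (Coord ι)} {m : ℕ} {b : ι → Fin m → ℤ} {F : Finset ι}
  {H : Subgroup (Torus m)} {κ : Type} [Fintype κ] [DecidableEq κ] (s : Slice E b F H κ)

/-! ### Degrees -/

/-- The degrees of the coordinates for which `toOn` is homogeneous. -/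
def degOn : Coord {i // i ∈ F} → ℤ := fun c => 1 - ∑ k, ipair (wt (onWt b F) c) (s.e k)

theorem isHomog_num {δ : Coord ι → ℤ} (hδ : ∀ j ∈ F, δ (Sum.inl j) + δ (Sum.inr j) = 2) (k : κ) :
    IsHomog E δ 2 (s.num k) :=
  IsHomog.sum _ fun j hj => by
    have := (IsHomog.coord (E := E) (δ := δ) (Sum.inl j)).mul (IsHomog.coord (Sum.inr j))
    rw [hδ j hj] at this
    exact this.zsmul _

theorem isHomog_corrCoord_off {δ : Coord ι → ℤ}
    (hδ : ∀ j ∈ F, δ (Sum.inl j) + δ (Sum.inr j) = 2) (hδ' : ∀ c, cidx c ∉ F → δ c = 1) (ε : ℤ)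
    {c : Coord ι} (h : cidx c ∉ F) : IsHomog E δ 1 (s.corrCoord ε c) := by
  rw [corrCoord, if_neg h]
  have h1 := IsHomog.coord (E := E) (δ := δ) c
  rw [hδ' c h] at h1
  refine IsHomog.add h1 (IsHomog.sum _ fun k _ => ?_)
  split_ifs with hk
  · have h2 : IsHomog E δ (-δ (s.u k)) (((s.uq k)⁻¹ : (Weyl E)ˣ) : Weyl E) :=
      IsHomog.inv _ (s.mem k)
    rw [hδ' _ (s.u_notMem k)] at h2
    exact (h2.mul (s.isHomog_num hδ k)).zsmul _
  · exact IsHomog.zero _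

theorem isHomog_corrCoord_on {δ : Coord ι → ℤ} (hδ' : ∀ c, cidx c ∉ F → δ c = 1) (ε : ℤ)
    {c : Coord ι} (h : cidx c ∈ F) :
    IsHomog E δ (δ c + ∑ k, s.expo ε c k) (s.corrCoord ε c) := by
  rw [s.corrCoord_mem ε h]
  exact (IsHomog.coord c).mul (s.isHomog_mono (fun k => hδ' _ (s.u_notMem k)) _)

theorem isHomog_toOff {N : ℤ} {a : WOff E F} (h : IsHomog _ dil N a) :
    IsHomog E dil N (s.toOff a) :=
  h.map s.toOff
    (fun c => by
      rw [toOff_qc]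
      exact s.isHomog_corrCoord_off (fun _ _ => rfl) (fun _ _ => rfl) 1 (cidx_cval_off c))
    (fun c hc => by
      rw [toOff_inv]
      exact IsHomog.inv (δ := dil) _ _)

theorem isHomog_toOn {N : ℤ} {a : WOn F} (h : IsHomog _ s.degOn N a) :
    IsHomog E dil N (s.toOn a) :=
  h.map s.toOn
    (fun c => by
      rw [toOn_qc]
      have := s.isHomog_corrCoord_on (δ := dil) (fun _ _ => rfl) 1 (cidx_cval_on c)
      rw [show dil (cval c) + ∑ k, s.expo 1 (cval c) k = s.degOn c from ?_] at this
      · exact this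
      · simp only [dil, expo, degOn, neg_one_mul, Finset.sum_neg_distrib, wt_cval, sub_eq_add_neg])
    (fun c hc => absurd hc (Set.notMem_empty _))

/-- The degrees of the coordinates on all of `T^*𝔸^ι`, given by `degOn` for those with index in
`F`. -/
def degSplit : Coord ι → ℤ :=
  fun c => if cidx c ∈ F then 1 - ∑ k, ipair (wt b c) (s.e k) else 1

theorem isHomog_corr_neg {N : ℤ} {d : Weyl E} (h : IsHomog E dil N d) :
    IsHomog E s.degSplit N (s.corr (-1) d) := by
  have h1 : ∀ c, cidx c ∉ F → s.degSplit c = 1 := fun c hc => if_neg hc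
  have h2 : ∀ j ∈ F, s.degSplit (Sum.inl j) + s.degSplit (Sum.inr j) = 2 := fun j hj => by
    have e1 : cidx (Sum.inl j : Coord ι) ∈ F := hj
    have e2 : cidx (Sum.inr j : Coord ι) ∈ F := hj
    rw [degSplit, degSplit, if_pos e1, if_pos e2]
    simp only [wt, Sum.elim_inl, Sum.elim_inr, ipair_neg, Finset.sum_neg_distrib]
    ring
  refine h.map (s.corr (-1)) (fun c => ?_) (fun c hc => ?_)
  · rw [show s.corr (-1) (gen E (Gen.coord c)) = _ from s.corr_qc (-1) c]
    by_cases hc : cidx c ∈ F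
    · have := s.isHomog_corrCoord_on h1 (-1) hc
      rw [show s.degSplit c + ∑ k, s.expo (-1) c k = dil c from ?_] at this
      · exact this
      · simp only [degSplit, if_pos hc, expo, neg_neg, one_mul, dil]
        ring
    · exact s.isHomog_corrCoord_off h2 h1 (-1) hc
  · rw [corr_inv, dil, ← h1 c (s.cidx_notMem c hc)]
    exact IsHomog.inv c hc

/-- The homogeneous elements of the tensor product of the two Weyl algebras. -/
def tensHomog (N : ℤ) : AddSubmonoid (WOff E F ⊗[Ch] WOn F) := AddSubmonoid.closure
  {x | ∃ i j, i + j = N ∧ ∃ a, IsHomog _ dil i a ∧ ∃ c, IsHomog _ s.degOn j c ∧ x = a ⊗ₜ c}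

theorem tmul_mem_tensHomog {i j : ℤ} {a : WOff E F} {c : WOn F} (ha : IsHomog _ dil i a)
    (hc : IsHomog _ s.degOn j c) : a ⊗ₜ c ∈ s.tensHomog (i + j) :=
  AddSubmonoid.subset_closure ⟨i, j, rfl, a, ha, c, hc, rfl⟩

theorem psi_mem_tensHomog {N : ℤ} {d : Weyl E} (h : IsHomog E dil N d) :
    s.psi d ∈ s.tensHomog N := by
  have h1 : IsHomog (offSet E F) dil 0 1 := by
    simpa using IsHomog.const (E := offSet E F) (δ := dil) 1
  have h1' : IsHomog ∅ s.degOn 0 1 := by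
    simpa using IsHomog.const (E := (∅ : Set (Coord {i // i ∈ F}))) (δ := s.degOn) 1
  have hconst : ∀ a : ℂ, algebraMap Ch (WOff E F ⊗[Ch] WOn F) (PowerSeries.C a) ∈
      s.tensHomog 0 := fun a => by
    rw [Algebra.TensorProduct.algebraMap_apply]
    have := s.tmul_mem_tensHomog (IsHomog.const a) h1'
    rwa [add_zero] at this
  have hhbar : hbar (WOff E F ⊗[Ch] WOn F) ∈ s.tensHomog 2 := by
    rw [hbar, Algebra.TensorProduct.algebraMap_apply]
    have := s.tmul_mem_tensHomog (IsHomog.hbar) h1'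
    rwa [add_zero] at this
  have hmul : ∀ i j x, x ∈ s.tensHomog i → ∀ y, y ∈ s.tensHomog j → x * y ∈ s.tensHomog (i + j) := by
    intro i j x hx y hy
    refine closure_mul_mem ?_ hx hy
    rintro _ ⟨i, j, rfl, a, ha, c, hc, rfl⟩ _ ⟨i', j', rfl, a', ha', c', hc', rfl⟩
    rw [Algebra.TensorProduct.tmul_mul_tmul, add_add_add_comm]
    exact AddSubmonoid.subset_closure ⟨_, _, rfl, _, ha.mul ha', _, hc.mul hc', rfl⟩
  have hcoord : ∀ c, split s.cidx_notMem (qc E c) ∈ s.tensHomog (s.degSplit c) := by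
    intro c
    by_cases hc : cidx c ∈ F
    · rw [split_qc_on _ hc]
      have := s.tmul_mem_tensHomog h1 (IsHomog.coord (clift c hc))
      rw [zero_add, degOn, ← wt_cval, cval_clift] at this
      rwa [degSplit, if_pos hc]
    · rw [split_qc_off _ hc]
      have := s.tmul_mem_tensHomog (IsHomog.coord (clift (P := (· ∉ F)) c hc)) h1'
      rw [add_zero] at this
      rwa [degSplit, if_neg hc]
  have hinv : ∀ c (hc : c ∈ E), split s.cidx_notMem (gen E (Gen.inv c hc)) ∈
      s.tensHomog (-s.degSplit c) := by
    intro c hc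
    rw [split_inv, degSplit, if_neg (s.cidx_notMem c hc)]
    have := s.tmul_mem_tensHomog (IsHomog.inv (E := offSet E F) (δ := dil)
      (clift (P := (· ∉ F)) c (s.cidx_notMem c hc))
      (by rw [Set.mem_preimage, cval_clift]; exact hc)) h1'
    rwa [add_zero] at this
  exact (s.isHomog_corr_neg h).map_mem (split s.cidx_notMem) s.tensHomog hconst hhbar hmul hcoord
    hinv

/-! ### The isomorphism of the quantum Hamiltonian reductions -/

variable [Fintype ι]

variable (E b F) in
/-- The reduction of the cotangent bundle of the coordinate space with indices outside `F`. -/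
abbrev QOff : Type := QRed (offSet E F) (offWt b F) ⊤

variable (b F H) in
/-- The reduction of the cotangent bundle of the coordinate space with indices in `F`. -/
abbrev QOn : Type := QRed (∅ : Set (Coord {i // i ∈ F})) (onWt b F) H

/-- The restriction of `toOff` to the invariants. -/
def toOffInv : qinv (offSet E F) (offWt b F) ⊤ →ₐ[Ch] qinv E b ⊤ :=
  (s.toOff.comp (qinv _ _ _).val).codRestrict _ fun a => s.toOff_mem a.2

/-- The restriction of `toOn` to the invariants. -/
def toOnInv : qinv (∅ : Set (Coord {i // i ∈ F})) (onWt b F) H →ₐ[Ch] qinv E b ⊤ :=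
  (s.toOn.comp (qinv _ _ _).val).codRestrict _ fun a => s.toOn_mem a.2

/-- The homomorphism of reductions induced by `toOff`. -/
def redOff : QOff E b F →ₐ[Ch] QRed E b ⊤ :=
  qredLift ((qmk E b ⊤).comp s.toOffInv) fun a ha => qmk_eq_zero.mpr
    (map_mem_qmomIdeal (a := (a : WOff E F)) s.toOff
      (fun ξ _ => ⟨_, by rw [lie_top]; trivial, s.toOff_qmom ξ⟩) ha)

/-- The homomorphism of reductions induced by `toOn`. -/
def redOn : QOn b F H →ₐ[Ch] QRed E b ⊤ :=
  qredLift ((qmk E b ⊤).comp s.toOnInv) fun a ha => qmk_eq_zero.mpr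
    (map_mem_qmomIdeal (a := (a : WOn F)) s.toOn
      (fun ξ hξ => ⟨_, by rw [lie_top]; trivial, s.toOn_qmom hξ⟩) ha)

theorem redOff_qmk (a) : s.redOff (qmk _ _ _ a) = qmk E b ⊤ (s.toOffInv a) := qredLift_qmk _ _ a

theorem redOn_qmk (a) : s.redOn (qmk _ _ _ a) = qmk E b ⊤ (s.toOnInv a) := qredLift_qmk _ _ a

/-- The homomorphism from the tensor product of the reductions. -/
def redJoin : QOff E b F ⊗[Ch] QOn b F H →ₐ[Ch] QRed E b ⊤ :=
  Algebra.TensorProduct.lift s.redOff s.redOn fun q q' => by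
    obtain ⟨a, rfl⟩ := qmk_surjective q
    obtain ⟨c, rfl⟩ := qmk_surjective q'
    rw [redOff_qmk, redOn_qmk]
    have h : Commute (s.toOffInv a) (s.toOnInv c) :=
      Subtype.ext (s.commute_toOff_toOn (a : WOff E F) (c : WOn F)).eq
    exact h.map (qmk E b ⊤)

theorem redJoin_tmul (q : QOff E b F) (q' : QOn b F H) :
    s.redJoin (q ⊗ₜ q') = s.redOff q * s.redOn q' := Algebra.TensorProduct.lift_tmul _ _ _ _ _

theorem redJoin_qmk (a : qinv (offSet E F) (offWt b F) ⊤)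
    (c : qinv (∅ : Set (Coord {i // i ∈ F})) (onWt b F) H) :
    s.redJoin (qmk _ _ _ a ⊗ₜ qmk _ _ _ c) = qmk E b ⊤ (s.toOffInv a * s.toOnInv c) := by
  rw [redJoin_tmul, redOff_qmk, redOn_qmk, map_mul]

/-- The tensor product of the projections to the reductions. -/
def reyTens : WOff E F ⊗[Ch] WOn F →ₗ[Ch] QOff E b F ⊗[Ch] QOn b F H :=
  TensorProduct.map qmkRey qmkRey

/-- For weight vectors $a$ and $c$ of weights $w$ and $w'$, the image of $a\otimes c$ has weight
$w+\widehat{w'}$. If $a\neq0$ then $\hat w=0$, so this sum vanishes exactly when $w=0$ and $w'$ is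
trivial on $H$. Projecting to invariants before or after `theta` therefore keeps the same terms. -/
theorem qmkRey_theta (x : WOff E F ⊗[Ch] WOn F) :
    qmkRey (s.theta x) = s.redJoin (reyTens (b := b) (H := H) x) := by
  induction x with
  | zero => rw [map_zero, map_zero, map_zero, map_zero]
  | add x y hx hy => rw [map_add, map_add, map_add, map_add, hx, hy]
  | tmul a c =>
    rw [theta_tmul, reyTens, TensorProduct.map_tmul]
    induction a using wt_induction (offWt b F) with
    | hadd a a' h h' => rw [map_add, add_mul, map_add, h, h', map_add, TensorProduct.add_tmul, map_add]
    | hw w a ha =>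
      induction c using wt_induction (onWt b F) with
      | hadd c c' h h' =>
        rw [map_add, mul_add, map_add, h, h', map_add, TensorProduct.tmul_add, map_add]
      | hw w' c hc =>
        have hm := (s.isWt_toOff ha).mul (s.isWt_toOn hc)
        rcases s.eq_zero_or_hat_eq_zero ha with rfl | h0
        · rw [map_zero, zero_mul, map_zero, map_zero, TensorProduct.zero_tmul, map_zero]
        by_cases hw : ∀ t ∈ (⊤ : Subgroup (Torus m)), chi w t = 1
        · by_cases hw' : ∀ t ∈ H, chi w' t = 1
          · obtain ⟨h1, e1⟩ := qmkRey_of_triv hw ha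
            obtain ⟨h2, e2⟩ := qmkRey_of_triv hw' hc
            rw [e1, e2, redJoin_qmk, ← qmkRey_coe]
            rfl
          · rw [qmkRey_of_nontriv hw' hc, TensorProduct.tmul_zero, map_zero]
            refine qmkRey_of_nontriv (fun h => hw' ?_) hm
            rw [eq_zero_of_chi_eq_one fun t => hw t trivial, zero_add] at h
            exact s.hat_eq_zero.mp (eq_zero_of_chi_eq_one fun t => h t trivial)
        · rw [qmkRey_of_nontriv hw ha, TensorProduct.zero_tmul, map_zero]
          refine qmkRey_of_nontriv (fun h => hw ?_) hm
          have h1 : w + s.hat w' = 0 := eq_zero_of_chi_eq_one fun t => h t trivial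
          -- Applying the idempotent `hat` to $w+\widehat{w'}=0$ kills the first summand.
          have h2 : s.hat w' = 0 := by
            have := congrArg s.hat h1
            rwa [map_add, h0, hat_hat, zero_add, map_zero] at this
          rw [h2, add_zero] at h1
          intro t _
          rw [h1, chi_zero]

theorem redJoin_surjective : Function.Surjective s.redJoin := fun q => by
  obtain ⟨d, rfl⟩ := qmk_surjective q
  exact ⟨reyTens (s.psi d), by rw [← qmkRey_theta, theta_psi, qmkRey_coe]⟩

/-- By `psi_qmom`, multiplication by $\mu_q(\xi)$ turns a pure tensor into a sum of two tensors,
each with one factor in its own moment ideal. -/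
theorem reyTens_psi {d : Weyl E} (hd : d ∈ qmomIdeal E b ⊤) :
    reyTens (b := b) (H := H) (s.psi d) = 0 := by
  induction hd using Submodule.span_induction with
  | mem x hx =>
    obtain ⟨ξ, hξ, d, rfl⟩ := hx
    rw [map_mul, psi_qmom]
    induction s.psi d with
    | zero => rw [mul_zero, map_zero]
    | add x y hx hy => rw [mul_add, map_add, hx, hy, add_zero]
    | tmul a c =>
      have h1 : qmom _ (offWt b F) ξ * a ∈ qmomIdeal (offSet E F) (offWt b F) ⊤ :=
        Submodule.subset_span ⟨ξ, by rw [lie_top]; trivial, a, rfl⟩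
      have h2 : qmom _ (onWt b F) (s.hatLie ξ) * c ∈ qmomIdeal ∅ (onWt b F) H :=
        Submodule.subset_span ⟨_, s.hatLie_mem ξ, c, rfl⟩
      rw [add_mul, Algebra.TensorProduct.tmul_mul_tmul, Algebra.TensorProduct.tmul_mul_tmul,
        one_mul, one_mul, map_add, reyTens, TensorProduct.map_tmul, TensorProduct.map_tmul,
        qmkRey_eq_zero h1, qmkRey_eq_zero h2, TensorProduct.zero_tmul, TensorProduct.tmul_zero,
        add_zero]
  | zero => rw [map_zero, map_zero]
  | add x y _ _ hx hy => rw [map_add, map_add, hx, hy, add_zero]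
  | smul r x _ hx => rw [map_smul, map_smul, hx, smul_zero]

/-- The lift is chosen with invariant image, so that vanishing in the reduction means membership of
that image in the moment ideal. -/
theorem exists_reyTens_eq (y : QOff E b F ⊗[Ch] QOn b F H) :
    ∃ x : WOff E F ⊗[Ch] WOn F, reyTens x = y ∧ s.theta x ∈ qinv E b ⊤ := by
  induction y with
  | zero => exact ⟨0, map_zero _, by rw [map_zero]; exact zero_mem _⟩
  | add x y hx hy =>
    obtain ⟨x, rfl, h⟩ := hx
    obtain ⟨y, rfl, h'⟩ := hy
    exact ⟨x + y, map_add _ _ _, by rw [map_add]; exact add_mem h h'⟩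
  | tmul q q' =>
    obtain ⟨a, rfl⟩ := qmk_surjective q
    obtain ⟨c, rfl⟩ := qmk_surjective q'
    refine ⟨(a : WOff E F) ⊗ₜ (c : WOn F), ?_, ?_⟩
    · rw [reyTens, TensorProduct.map_tmul, qmkRey_coe, qmkRey_coe]
    · rw [theta_tmul]
      exact mul_mem (s.toOff_mem a.2) (s.toOn_mem c.2)

/-- If the image of an invariant lift lies in the moment ideal, pulling it back by `psi`, the
inverse of `theta`, shows that the tensor vanishes in the product of the reductions. -/
theorem redJoin_injective : Function.Injective s.redJoin := by
  rw [injective_iff_map_eq_zero]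
  intro y hy
  obtain ⟨x, rfl, hx⟩ := s.exists_reyTens_eq y
  rw [← qmkRey_theta, qmkRey_of_mem hx, qmk_eq_zero] at hy
  have := s.reyTens_psi hy
  rwa [psi_theta] at this

/-- The quantum Hamiltonian reduction as a tensor product. -/
def redEquiv : QOff E b F ⊗[Ch] QOn b F H ≃ₐ[Ch] QRed E b ⊤ :=
  AlgEquiv.ofBijective s.redJoin ⟨s.redJoin_injective, s.redJoin_surjective⟩

/-! ### The isomorphism respects the gradings -/

/-- The cocharacters $\sum_ke_k$ and $e$ both pair to $1$ with the weight of every $u_k$, and these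
weights generate the characters trivial on $H$. -/
theorem degree_correction {e : Fin m → ℤ} (he : ∀ k, ipair (wt b (s.u k)) e = 1) {w : Fin m → ℤ} (hw : ∀ t ∈ H, chi w t = 1) :
    ipair w (∑ k, s.e k - e) = 0 := by
  rw [(s.perp w).mp hw, ipair_sum]
  refine Finset.sum_eq_zero fun k _ => ?_
  rw [ipair_zsmul, ipair_sub_right, ipair_sum_right, he]
  simp [s.dual]

end Slice

/-! ### Graded pieces of the quantum reduction -/

section QredGr

variable {ι : Type} [DecidableEq ι] [Fintype ι] {E : Set (Coord ι)} {m : ℕ} {b : ι → Fin m → ℤ}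
  {H : Subgroup (Torus m)} {δ : Coord ι → ℤ}

theorem qredGr_zero {N : ℤ} : (0 : QRed E b H) ∈ qredGr E b H δ N :=
  ⟨0, IsHomog.zero N, map_zero _⟩

theorem qredGr_add {N : ℤ} {q q' : QRed E b H} (h : q ∈ qredGr E b H δ N)
    (h' : q' ∈ qredGr E b H δ N) : q + q' ∈ qredGr E b H δ N := by
  obtain ⟨d, hd, rfl⟩ := h
  obtain ⟨d', hd', rfl⟩ := h'
  exact ⟨d + d', hd.add hd', map_add _ _ _⟩

theorem qredGr_neg {N : ℤ} {q : QRed E b H} (h : q ∈ qredGr E b H δ N) :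
    -q ∈ qredGr E b H δ N := by
  obtain ⟨d, hd, rfl⟩ := h
  refine ⟨-d, ?_, map_neg _ _⟩
  have := hd.zsmul (-1)
  rwa [neg_one_smul] at this

theorem qredGr_mul {N N' : ℤ} {q q' : QRed E b H} (h : q ∈ qredGr E b H δ N)
    (h' : q' ∈ qredGr E b H δ N') : q * q' ∈ qredGr E b H δ (N + N') := by
  obtain ⟨d, hd, rfl⟩ := h
  obtain ⟨d', hd', rfl⟩ := h'
  exact ⟨d * d', hd.mul hd', map_mul _ _ _⟩

theorem qmkRey_mem_qredGr {N : ℤ} {d : Weyl E} (h : IsHomog E δ N d) :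
    qmkRey (b := b) (H := H) d ∈ qredGr E b H δ N :=
  ⟨⟨rey E b H d, rey_mem d⟩, isHomog_rey h, rfl⟩

end QredGr

/-! ### Compatibility of the factorization with the gradings -/

namespace Slice

variable {ι : Type} [DecidableEq ι] [Fintype ι] {E : Set (Coord ι)} {m : ℕ} {b : ι → Fin m → ℤ}
  {F : Finset ι} {H : Subgroup (Torus m)} {κ : Type} [Fintype κ] [DecidableEq κ]
  (s : Slice E b F H κ) {e : Fin m → ℤ}

variable (b F) in
/-- The degrees of the coordinates with index in `F` for the dilation action corrected by the
one-parameter subgroup `-e`. -/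
def degCorr (e : Fin m → ℤ) : Coord {i // i ∈ F} → ℤ := fun c => 1 - ipair (wt (onWt b F) c) e

/-- The pairing with a one-parameter subgroup. -/
def ipairHom (e : Fin m → ℤ) : (Fin m → ℤ) →+ ℤ where
  toFun w := ipair w e
  map_zero' := by simp [ipair]
  map_add' w w' := by simp [ipair, add_mul, Finset.sum_add_distrib]

/-- The two gradings differ by the cocharacter $\sum_ke_k-e$, which is invisible on $H$-invariants.
-/
theorem qredGr_degOn (he : ∀ k, ipair (wt b (s.u k)) e = 1) (N : ℤ) :
    qredGr ∅ (onWt b F) H s.degOn N = qredGr ∅ (onWt b F) H (degCorr b F e) N := by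
  have h1 : ∀ c, s.degOn c =
      degCorr b F e c + (-ipairHom (∑ k, s.e k - e)) (wt (onWt b F) c) := fun c => by
    change 1 - _ = 1 - _ + -ipair _ _
    rw [ipair_sub_right, ipair_sum_right]
    ring
  have h2 : ∀ c, degCorr b F e c =
      s.degOn c + ipairHom (∑ k, s.e k - e) (wt (onWt b F) c) := fun c => by
    rw [h1, AddMonoidHom.neg_apply, neg_add_cancel_right]
  have h3 : ∀ w : Fin m → ℤ, (∀ t ∈ H, chi w t = 1) → ipairHom (∑ k, s.e k - e) w = 0 :=
    fun w hw => s.degree_correction he hw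
  ext q
  constructor
  · rintro ⟨d, hd, rfl⟩
    exact ⟨d, isHomog_of_mem h2 h3 d.2 hd, rfl⟩
  · rintro ⟨d, hd, rfl⟩
    exact ⟨d, isHomog_of_mem h1 (fun w hw => by rw [AddMonoidHom.neg_apply, h3 w hw, neg_zero])
      d.2 hd, rfl⟩

theorem redJoin_mem_qredGr (he : ∀ k, ipair (wt b (s.u k)) e = 1) {N : ℤ}
    {z : QOff E b F ⊗[Ch] QOn b F H}
    (hz : z ∈ tensGr (qredGr (offSet E F) (offWt b F) ⊤ dil)
      (qredGr ∅ (onWt b F) H (degCorr b F e)) N) :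
    s.redJoin z ∈ qredGr E b ⊤ dil N := by
  induction hz using AddSubgroup.closure_induction with
  | mem x hx =>
    obtain ⟨i, j, rfl, q, hq, q', hq', rfl⟩ := hx
    rw [← s.qredGr_degOn he] at hq'
    rw [redJoin_tmul]
    obtain ⟨d, hd, rfl⟩ := hq
    obtain ⟨d', hd', rfl⟩ := hq'
    rw [redOff_qmk, redOn_qmk]
    exact qredGr_mul ⟨_, s.isHomog_toOff hd, rfl⟩ ⟨_, s.isHomog_toOn hd', rfl⟩
  | zero => rw [map_zero]; exact qredGr_zero
  | add x y _ _ hx hy => rw [map_add]; exact qredGr_add hx hy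
  | neg x _ hx => rw [map_neg]; exact qredGr_neg hx

theorem exists_redJoin_eq (he : ∀ k, ipair (wt b (s.u k)) e = 1) {N : ℤ} {q : QRed E b ⊤}
    (hq : q ∈ qredGr E b ⊤ dil N) :
    ∃ z ∈ tensGr (qredGr (offSet E F) (offWt b F) ⊤ dil)
      (qredGr ∅ (onWt b F) H (degCorr b F e)) N, s.redJoin z = q := by
  obtain ⟨d, hd, rfl⟩ := hq
  refine ⟨reyTens (s.psi d), ?_, by rw [← qmkRey_theta, theta_psi, qmkRey_coe]⟩
  have hm := s.psi_mem_tensHomog hd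
  generalize s.psi d = x at hm
  induction hm using AddSubmonoid.closure_induction with
  | mem x hx =>
    obtain ⟨i, j, rfl, a, ha, c, hc, rfl⟩ := hx
    rw [reyTens, TensorProduct.map_tmul]
    refine AddSubgroup.subset_closure ⟨i, j, rfl, _, qmkRey_mem_qredGr ha, _, ?_, rfl⟩
    rw [← s.qredGr_degOn he]
    exact qmkRey_mem_qredGr hc
  | zero => rw [map_zero]; exact AddSubgroup.zero_mem _
  | add x y _ _ hx hy => rw [map_add]; exact AddSubgroup.add_mem _ hx hy

end Slice

/-! ## Tensor products of algebras over `ℂ[[ħ]]` and their specializations -/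

section Spec

variable {A B R : Type*} [Ring A] [Algebra Ch A] [Ring B] [Algebra Ch B] [Ring R] [Algebra Ch R]
  {O O' O'' : Type*} [CommRing O] [Algebra ℂ O] [CommRing O'] [Algebra ℂ O'] [CommRing O'']
  [Algebra ℂ O'']

/-- `p` is surjective, with kernel generated by `ħ`. -/
structure IsSpecialization (p : A →+* O) : Prop where
  spec : IsSpec p
  surjective : Function.Surjective p
  ker : ∀ a, p a = 0 ↔ ∃ a', a = hbar A * a'

/-- The commutator of `A` induces the bracket `P` on the specialization. -/
def InducesBracket (p : A →+* O) (P : O →ₗ[ℂ] O →ₗ[ℂ] O) : Prop :=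
  ∀ a a', ∃ c, a * a' - a' * a = hbar A * c ∧ p c = P (p a) (p a')

theorem IsSpec.hbar_mul {p : A →+* O} (hp : IsSpec p) (a : A) : p (hbar A * a) = 0 := by
  rw [map_mul, hbar, hp]; simp

theorem IsSpec.comp_algHom {r : R →+* O''} (hr : IsSpec r) (f : A →ₐ[Ch] R) :
    IsSpec (r.comp f.toRingHom) := fun c =>
  (congrArg r (AlgHom.commutes f c)).trans (hr c)

/-- The homomorphism out of the specialization induced by a homomorphism which sets `ħ` to zero. -/
def IsSpecialization.lift {p : A →+* O} (hp : IsSpecialization p) (f : A →+* O'')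
    (hf : IsSpec f) : O →ₐ[ℂ] O'' :=
  { RingHom.liftOfSurjective p hp.surjective ⟨f, fun a ha => by
      obtain ⟨a', rfl⟩ := (hp.ker a).mp ha
      exact hf.hbar_mul a'⟩ with
    commutes' := fun z => by
      change RingHom.liftOfSurjective p hp.surjective _ (algebraMap ℂ O z) = _
      have h := hp.spec (PowerSeries.C z)
      rw [PowerSeries.constantCoeff_C] at h
      rw [← h]
      refine (RingHom.liftOfRightInverse_comp_apply _ _ _ _ _).trans ?_
      change f _ = _
      rw [hf, PowerSeries.constantCoeff_C] }

theorem IsSpecialization.lift_apply {p : A →+* O} (hp : IsSpecialization p) (f : A →+* O'')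
    (hf : IsSpec f) (a : A) : hp.lift f hf (p a) = f a :=
  RingHom.liftOfRightInverse_comp_apply _ _ _ _ _

variable {p : A →+* O} {q : B →+* O'} {r : R →+* O''} (hp : IsSpecialization p)
  (hq : IsSpecialization q) (hr : IsSpecialization r) (θ : A ⊗[Ch] B ≃ₐ[Ch] R)

theorem IsSpecialization.tensSpec_surjective :
    Function.Surjective (tensSpec p hp.spec q hq.spec) := fun y => by
  induction y with
  | zero => exact ⟨0, map_zero _⟩
  | tmul o o' =>
    obtain ⟨a, rfl⟩ := hp.surjective o
    obtain ⟨c, rfl⟩ := hq.surjective o'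
    exact ⟨a ⊗ₜ c, tensSpec_tmul _ _ _ _ _ _⟩
  | add y y' h h' =>
    obtain ⟨z, rfl⟩ := h
    obtain ⟨z', rfl⟩ := h'
    exact ⟨z + z', map_add _ _ _⟩

/-- The homomorphism of specializations induced by `θ`. -/
def specJoin : O ⊗[ℂ] O' →ₐ[ℂ] O'' :=
  Algebra.TensorProduct.lift
    (hp.lift _ (hr.spec.comp_algHom (θ.toAlgHom.comp Algebra.TensorProduct.includeLeft)))
    (hq.lift _ (hr.spec.comp_algHom (θ.toAlgHom.comp Algebra.TensorProduct.includeRight)))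
    fun _ _ => Commute.all _ _

theorem specJoin_tensSpec (z : A ⊗[Ch] B) :
    specJoin hp hq hr θ (tensSpec p hp.spec q hq.spec z) = r (θ z) := by
  induction z with
  | zero => rw [map_zero, map_zero, map_zero, map_zero]
  | add z z' h h' => rw [map_add, map_add, map_add, map_add, h, h']
  | tmul a c =>
    rw [tensSpec_tmul, specJoin, Algebra.TensorProduct.lift_tmul, hp.lift_apply, hq.lift_apply]
    change r (θ (a ⊗ₜ 1)) * r (θ (1 ⊗ₜ c)) = _
    rw [← map_mul, ← map_mul, Algebra.TensorProduct.tmul_mul_tmul, mul_one, one_mul]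

/-- Injectivity uses only that the tensor product of the projections is surjective and kills
$\hbar$: an element dying in $O''$ lifts to a multiple of $\hbar$ because $\theta$ fixes $\hbar$. -/
theorem specJoin_bijective : Function.Bijective (specJoin hp hq hr θ) := by
  constructor
  · rw [injective_iff_map_eq_zero]
    intro y hy
    obtain ⟨z, rfl⟩ := hp.tensSpec_surjective hq y
    rw [specJoin_tensSpec, hr.ker] at hy
    obtain ⟨w, hw⟩ := hy
    have h : z = hbar _ * θ.symm w := by
      rw [← θ.symm_apply_apply z, hw, map_mul]
      congr 1
      exact AlgHom.commutes θ.symm.toAlgHom _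
    rw [h]
    exact (isSpec_tensSpec p hp.spec q hq.spec).hbar_mul _
  · intro o
    obtain ⟨w, rfl⟩ := hr.surjective o
    exact ⟨_, (specJoin_tensSpec hp hq hr θ (θ.symm w)).trans (by rw [θ.apply_symm_apply])⟩

/-- The isomorphism of specializations induced by `θ`. -/
def specEquiv : O'' ≃ₐ[ℂ] O ⊗[ℂ] O' :=
  (AlgEquiv.ofBijective _ (specJoin_bijective hp hq hr θ)).symm

theorem specEquiv_apply (z : A ⊗[Ch] B) :
    specEquiv hp hq hr θ (r (θ z)) = tensSpec p hp.spec q hq.spec z := by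
  rw [specEquiv, AlgEquiv.symm_apply_eq]
  exact (specJoin_tensSpec hp hq hr θ z).symm

theorem InducesBracket.tensSpec {P : O →ₗ[ℂ] O →ₗ[ℂ] O} {P' : O' →ₗ[ℂ] O' →ₗ[ℂ] O'}
    (hP : InducesBracket p P) (hP' : InducesBracket q P') (hp : IsSpec p) (hq : IsSpec q) :
    InducesBracket (tensSpec p hp q hq) (tensBrk P P') := by
  intro z z'
  induction z with
  | zero => exact ⟨0, by simp, by simp⟩
  | add z₁ z₂ h₁ h₂ =>
    obtain ⟨c₁, e₁, f₁⟩ := h₁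
    obtain ⟨c₂, e₂, f₂⟩ := h₂
    exact ⟨c₁ + c₂, by rw [mul_add (hbar _), ← e₁, ← e₂]; noncomm_ring, by
      rw [map_add, map_add, map_add, LinearMap.add_apply, f₁, f₂]⟩
  | tmul a d =>
    induction z' with
    | zero => exact ⟨0, by simp, by simp⟩
    | add z₁ z₂ h₁ h₂ =>
      obtain ⟨c₁, e₁, f₁⟩ := h₁
      obtain ⟨c₂, e₂, f₂⟩ := h₂
      exact ⟨c₁ + c₂, by rw [mul_add (hbar _), ← e₁, ← e₂]; noncomm_ring, by
        rw [map_add, map_add, map_add, f₁, f₂]⟩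
    | tmul a' d' =>
      obtain ⟨c, e, f⟩ := hP a a'
      obtain ⟨c', e', f'⟩ := hP' d d'
      -- From $[a\otimes d,a'\otimes d']=[a,a']\otimes dd'+a'a\otimes[d,d']$.
      refine ⟨c ⊗ₜ (d * d') + (a' * a) ⊗ₜ c', ?_, ?_⟩
      · have h1 : ∀ x y, hbar (A ⊗[Ch] B) * (x ⊗ₜ y) = (hbar A * x) ⊗ₜ y := fun x y => by
          rw [hbar, Algebra.TensorProduct.algebraMap_apply, Algebra.TensorProduct.tmul_mul_tmul,
            one_mul]
          rfl
        have h2 : ∀ x y, hbar (A ⊗[Ch] B) * (x ⊗ₜ y) = x ⊗ₜ (hbar B * y) := fun x y => by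
          rw [h1, hbar, hbar, ← Algebra.smul_def, ← Algebra.smul_def, TensorProduct.smul_tmul]
        rw [mul_add, h1, h2, ← e, ← e', Algebra.TensorProduct.tmul_mul_tmul,
          Algebra.TensorProduct.tmul_mul_tmul, TensorProduct.sub_tmul, TensorProduct.tmul_sub]
        abel
      · rw [map_add, tensSpec_tmul, tensSpec_tmul, tensSpec_tmul, tensSpec_tmul, f, f', tensBrk,
          LinearMap.add_apply, LinearMap.add_apply, TensorProduct.map₂_apply_tmul,
          TensorProduct.map₂_apply_tmul, TensorProduct.map_tmul, TensorProduct.map_tmul, map_mul,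
          map_mul, LinearMap.mul_apply', LinearMap.mul_apply', mul_comm (p a')]

/-- Both brackets are reductions of commutators divided by $\hbar$, and $\theta$ preserves
commutators. The quotient by $\hbar$ is unique only up to $\hbar$-torsion, which `htors` makes
invisible after specialization. -/
theorem specEquiv_bracket {P : O →ₗ[ℂ] O →ₗ[ℂ] O} {P' : O' →ₗ[ℂ] O' →ₗ[ℂ] O'}
    {P'' : O'' →ₗ[ℂ] O'' →ₗ[ℂ] O''} (hP : InducesBracket p P) (hP' : InducesBracket q P')
    (hP'' : InducesBracket r P'') (htors : ∀ x : R, hbar R * x = 0 → ∃ y, x = hbar R * y)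
    (f g : O'') : specEquiv hp hq hr θ (P'' f g) =
      tensBrk P P' (specEquiv hp hq hr θ f) (specEquiv hp hq hr θ g) := by
  obtain ⟨x, rfl⟩ := hr.surjective f
  obtain ⟨y, rfl⟩ := hr.surjective g
  obtain ⟨z, rfl⟩ := θ.surjective x
  obtain ⟨z', rfl⟩ := θ.surjective y
  obtain ⟨c, e, h⟩ := hP'' (θ z) (θ z')
  obtain ⟨c', e', h'⟩ := hP.tensSpec hP' hp.spec hq.spec z z'
  have hθ : θ (hbar _) = hbar R := AlgHom.commutes θ.toAlgHom _
  have he := congrArg θ e'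
  rw [map_sub, map_mul, map_mul, map_mul, hθ] at he
  obtain ⟨y, hy⟩ := htors (c - θ c') (by rw [mul_sub, ← e, ← he, sub_self])
  have hc : r c = r (θ c') := by
    rw [← sub_eq_zero, ← map_sub, hy]
    exact hr.spec.hbar_mul y
  rw [← h, hc, specEquiv_apply, specEquiv_apply, specEquiv_apply, h']

theorem tensSpec_mem_tensRedGr (hp : IsSpec p) (hq : IsSpec q) {gA : ℤ → Set A} {gB : ℤ → Set B}
    {gO : ℤ → Submodule ℂ O} {gO' : ℤ → Submodule ℂ O'} (hA : ∀ i, ∀ a ∈ gA i, p a ∈ gO i)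
    (hB : ∀ i, ∀ c ∈ gB i, q c ∈ gO' i) {N : ℤ} {z : A ⊗[Ch] B} (hz : z ∈ tensGr gA gB N) :
    tensSpec p hp q hq z ∈ tensRedGr gO gO' N := by
  induction hz using AddSubgroup.closure_induction with
  | mem x hx =>
    obtain ⟨i, j, rfl, a, ha, c, hc, rfl⟩ := hx
    rw [tensSpec_tmul]
    exact Submodule.subset_span ⟨i, j, rfl, _, hA i a ha, _, hB j c hc, rfl⟩
  | zero => rw [map_zero]; exact zero_mem _
  | add x y _ _ hx hy => rw [map_add]; exact add_mem hx hy
  | neg x _ hx => rw [map_neg]; exact neg_mem hx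

theorem map_specEquiv {gA : ℤ → Set A} {gB : ℤ → Set B} {gR : ℤ → Set R}
    {gO : ℤ → Submodule ℂ O} {gO' : ℤ → Submodule ℂ O'} {gO'' : ℤ → Submodule ℂ O''}
    (hA : ∀ i o, o ∈ gO i ↔ ∃ a ∈ gA i, p a = o) (hB : ∀ i o, o ∈ gO' i ↔ ∃ a ∈ gB i, q a = o)
    (hR : ∀ i o, o ∈ gO'' i ↔ ∃ a ∈ gR i, r a = o)
    (hθ : ∀ N, ∀ z ∈ tensGr gA gB N, θ z ∈ gR N)
    (hθ' : ∀ N, ∀ x ∈ gR N, ∃ z ∈ tensGr gA gB N, θ z = x) (N : ℤ) :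
    (gO'' N).map (specEquiv hp hq hr θ).toLinearMap = tensRedGr gO gO' N := by
  apply le_antisymm
  · rintro _ ⟨o, ho, rfl⟩
    obtain ⟨x, hx, rfl⟩ := (hR N o).mp ho
    obtain ⟨z, hz, rfl⟩ := hθ' N x hx
    change specEquiv hp hq hr θ (r (θ z)) ∈ _
    rw [specEquiv_apply]
    exact tensSpec_mem_tensRedGr hp.spec hq.spec (fun i a ha => (hA i _).mpr ⟨a, ha, rfl⟩)
      (fun i a ha => (hB i _).mpr ⟨a, ha, rfl⟩) hz
  · refine Submodule.span_le.mpr ?_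
    rintro _ ⟨i, j, rfl, o, ho, o', ho', rfl⟩
    obtain ⟨a, ha, rfl⟩ := (hA i o).mp ho
    obtain ⟨c, hc, rfl⟩ := (hB j o').mp ho'
    refine ⟨r (θ (a ⊗ₜ c)), (hR _ _).mpr ⟨_, hθ _ _ (AddSubgroup.subset_closure
      ⟨i, j, rfl, a, ha, c, hc, rfl⟩), rfl⟩, ?_⟩
    change specEquiv hp hq hr θ (r (θ _)) = _
    rw [specEquiv_apply, tensSpec_tmul]

/-! ### The isomorphism of the completions -/

theorem complMap_tensCompl_bijective :
    Function.Bijective (complMap ((tensCompl A B).comp θ.symm.toAlgHom)) := by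
  refine complMap_bijective _ (fun k x t h => ?_) fun k y => ?_
  · obtain ⟨z, h'⟩ := tensCompl_injective_mod k (θ.symm x) t h
    refine ⟨θ z, ?_⟩
    rw [← θ.apply_symm_apply x, h', map_mul, map_pow]
    congr 2
    exact AlgHom.commutes θ.toAlgHom _
  · obtain ⟨z, t, rfl⟩ := tensCompl_surjective_mod k y
    refine ⟨θ z, t, ?_⟩
    change _ = tensCompl A B (θ.symm (θ z)) + _
    rw [θ.symm_apply_apply]

/-- The isomorphism of completions induced by `θ`. -/
def complTensEquiv : Compl R ≃ₐ[Ch] Compl (Compl A ⊗[Ch] Compl B) :=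
  AlgEquiv.ofBijective _ (complMap_tensCompl_bijective θ)

theorem complTensEquiv_toCompl (z : A ⊗[Ch] B) :
    complTensEquiv θ (toCompl R (θ z)) = toCompl _ (tensCompl A B z) := by
  refine (complMap_toCompl _ _).trans ?_
  change toCompl _ (tensCompl A B (θ.symm (θ z))) = _
  rw [θ.symm_apply_apply]

theorem tensSpec_complSpec (hp : IsSpec p) (hq : IsSpec q) (z : A ⊗[Ch] B) :
    tensSpec (complSpec p hp) (isSpec_complSpec p hp) (complSpec q hq) (isSpec_complSpec q hq)
      (tensCompl A B z) = tensSpec p hp q hq z := by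
  induction z with
  | zero => rw [map_zero, map_zero, map_zero]
  | add z z' h h' => rw [map_add, map_add, map_add, h, h']
  | tmul a c =>
    rw [tensCompl, Algebra.TensorProduct.map_tmul, tensSpec_tmul, tensSpec_tmul,
      complSpec_toCompl, complSpec_toCompl]

theorem complSpec_complTensEquiv (x : Compl R) :
    complSpec (tensSpec (complSpec p hp.spec) (isSpec_complSpec p hp.spec)
      (complSpec q hq.spec) (isSpec_complSpec q hq.spec)) (isSpec_tensSpec _ _ _ _)
      (complTensEquiv θ x) = specEquiv hp hq hr θ (complSpec r hr.spec x) := by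
  obtain ⟨a, g, rfl⟩ := compl_approx x 1
  obtain ⟨z, rfl⟩ := θ.surjective a
  have hΦ : complTensEquiv θ (hbar _) = hbar _ := AlgHom.commutes (complTensEquiv θ).toAlgHom _
  rw [pow_one, map_add, map_add, map_add, map_mul (complTensEquiv θ), hΦ,
    (isSpec_complSpec _ _).hbar_mul, (isSpec_complSpec _ _).hbar_mul, add_zero, add_zero,
    complTensEquiv_toCompl, complSpec_toCompl, complSpec_toCompl, tensSpec_complSpec,
    specEquiv_apply]

/-- Homogeneous elements of the completions are approximated by homogeneous elements of the original
algebras modulo each $\hbar^k$; hence the same holds for their tensors. -/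
theorem exists_tensCompl_of_mem_tensGr {gA : ℤ → Set A} {gB : ℤ → Set B} {N : ℤ}
    {t : Compl A ⊗[Ch] Compl B} (ht : t ∈ tensGr (complGr gA) (complGr gB) N) (k : ℕ) :
    ∃ z ∈ tensGr gA gB N, ∃ y, t = tensCompl A B z + hbar _ ^ k * y := by
  induction ht using AddSubgroup.closure_induction with
  | mem x hx =>
    obtain ⟨i, j, rfl, f, hf, g, hg, rfl⟩ := hx
    obtain ⟨a, ha, e⟩ := hf k
    obtain ⟨c, hc, e'⟩ := hg k
    obtain ⟨f', h⟩ := complEval_eq_zero.mp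
      (show complEval A k (f - toCompl A a) = 0 by rw [map_sub, complEval_toCompl, e, sub_self])
    obtain ⟨g', h'⟩ := complEval_eq_zero.mp
      (show complEval B k (g - toCompl B c) = 0 by rw [map_sub, complEval_toCompl, e', sub_self])
    refine ⟨a ⊗ₜ c, AddSubgroup.subset_closure ⟨i, j, rfl, a, ha, c, hc, rfl⟩,
      toCompl A a ⊗ₜ g' + f' ⊗ₜ g, ?_⟩
    rw [sub_eq_iff_eq_add', hbar_pow_mul_eq_smul] at h h'
    rw [h, hbar_pow_mul_eq_smul, tensCompl, Algebra.TensorProduct.map_tmul,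
      TensorProduct.add_tmul, smul_add, TensorProduct.smul_tmul', ← add_assoc]
    congr 1
    rw [h', TensorProduct.tmul_add, TensorProduct.tmul_smul]
    rfl
  | zero => exact ⟨0, AddSubgroup.zero_mem _, 0, by simp⟩
  | add x y _ _ hx hy =>
    obtain ⟨z, hz, w, rfl⟩ := hx
    obtain ⟨z', hz', w', rfl⟩ := hy
    exact ⟨z + z', AddSubgroup.add_mem _ hz hz', w + w', by rw [map_add, mul_add]; abel⟩
  | neg x _ hx =>
    obtain ⟨z, hz, w, rfl⟩ := hx
    exact ⟨-z, AddSubgroup.neg_mem _ hz, -w, by rw [map_neg, mul_neg]; abel⟩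

theorem complTensEquiv_symm_mem {gA : ℤ → Set A} {gB : ℤ → Set B} {gR : ℤ → Set R} {N : ℤ}
    (hθ : ∀ z ∈ tensGr gA gB N, θ z ∈ gR N) {f : Compl (Compl A ⊗[Ch] Compl B)}
    (hf : f ∈ complGr (tensGr (complGr gA) (complGr gB)) N) :
    (complTensEquiv θ).symm f ∈ complGr gR N := by
  intro k
  obtain ⟨t, ht, e⟩ := hf k
  obtain ⟨z, hz, y, rfl⟩ := exists_tensCompl_of_mem_tensGr ht k
  refine ⟨θ z, hθ z hz, ?_⟩
  obtain ⟨g, hg⟩ := complEval_eq_zero.mp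
    (show complEval _ k (f - complTensEquiv θ (toCompl R (θ z))) = 0 by
      rw [map_sub, complTensEquiv_toCompl, complEval_toCompl, ← e, map_add, add_sub_cancel_left]
      exact mk_eq_zero_iff.mpr ⟨y, rfl⟩)
  have hΦ : (complTensEquiv θ).symm (hbar _) = hbar _ :=
    AlgHom.commutes (complTensEquiv θ).symm.toAlgHom _
  rw [sub_eq_iff_eq_add'.mp hg, map_add, map_mul, map_pow, hΦ, AlgEquiv.symm_apply_apply, map_add,
    complEval_toCompl, complEval_eq_zero.mpr ⟨_, rfl⟩, add_zero]

end Spec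

/-! ## Transport of graded quantizations -/

/-- An isomorphism of `ℂ`-algebras induces an isomorphism of modules of power series. -/
def psEquiv {O O' : Type*} [CommRing O] [Algebra ℂ O] [CommRing O'] [Algebra ℂ O']
    (φ : O ≃ₐ[ℂ] O') : PowerSeries O ≃ₗ[Ch] PowerSeries O' :=
  { toFun := PowerSeries.map (φ : O →+* O')
    invFun := PowerSeries.map (φ.symm : O' →+* O)
    left_inv := fun f => by ext; simp
    right_inv := fun f => by ext; simp
    map_add' := map_add _
    map_smul' := fun c f => by
      rw [Algebra.smul_def, Algebra.smul_def, map_mul, RingHom.id_apply]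
      congr 1
      ext k
      change PowerSeries.coeff k (PowerSeries.map _ (PowerSeries.map (algebraMap ℂ O) c)) =
        PowerSeries.coeff k (PowerSeries.map (algebraMap ℂ O') c)
      simp }

/-- Applied to the isomorphism of completions, this gives freeness and completeness properties of
the completed tensor product without a separate argument. -/
theorem IsGradedQuantization.transport {A A' O O' : Type*} [Ring A] [Algebra Ch A] [Ring A']
    [Algebra Ch A'] [CommRing O] [Algebra ℂ O] [CommRing O'] [Algebra ℂ O']
    {P : O →ₗ[ℂ] O →ₗ[ℂ] O} {grO : ℤ → Submodule ℂ O} {k : ℤ} {pr : A →+* O} {Eu : A →+ A}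
    (h : IsGradedQuantization P grO k pr Eu) {P' : O' →ₗ[ℂ] O' →ₗ[ℂ] O'}
    {grO' : ℤ → Submodule ℂ O'} {pr' : A' →+* O'} {Eu' : A' →+ A'} (φ : O ≃ₐ[ℂ] O')
    (Φ : A ≃ₐ[Ch] A') (hP : ∀ f g, φ (P f g) = P' (φ f) (φ g))
    (hgr : ∀ N, (grO N).map φ.toLinearMap = grO' N) (hEu : ∀ a, Φ (Eu a) = Eu' (Φ a))
    (hpr : ∀ a, pr' (Φ a) = φ (pr a)) : IsGradedQuantization P' grO' k pr' Eu' := by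
  have hΦ : Φ (hbar A) = hbar A' := AlgHom.commutes Φ.toAlgHom _
  constructor
  · intro f
    have := hpr (algebraMap Ch A f)
    rw [h.spec, AlgEquiv.commutes, AlgEquiv.commutes] at this
    exact this
  · intro o
    obtain ⟨a, ha⟩ := h.surjective (φ.symm o)
    exact ⟨Φ a, by rw [hpr, ha, φ.apply_symm_apply]⟩
  · intro a'
    obtain ⟨a, rfl⟩ := Φ.surjective a'
    rw [hpr, map_eq_zero_iff φ φ.injective, h.ker]
    constructor
    · rintro ⟨c, rfl⟩
      exact ⟨Φ c, by rw [map_mul, hΦ]⟩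
    · rintro ⟨c, hc⟩
      obtain ⟨c, rfl⟩ := Φ.surjective c
      exact ⟨c, Φ.injective (by rw [hc, map_mul, hΦ])⟩
  · obtain ⟨L⟩ := h.free
    exact ⟨Φ.symm.toLinearEquiv.trans (L.trans (psEquiv φ))⟩
  · intro a b c hc
    obtain ⟨a, rfl⟩ := Φ.surjective a
    obtain ⟨b, rfl⟩ := Φ.surjective b
    obtain ⟨c, rfl⟩ := Φ.surjective c
    rw [hpr, hpr, hpr, ← hP] at hc
    obtain ⟨d, hd⟩ := h.commutator a b c (φ.injective hc)
    exact ⟨Φ d, by rw [← map_mul, ← map_mul, ← map_sub, hd, map_add, map_mul, map_mul, map_pow, hΦ]⟩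
  · intro a b
    obtain ⟨a, rfl⟩ := Φ.surjective a
    obtain ⟨b, rfl⟩ := Φ.surjective b
    rw [← map_mul, ← hEu, ← hEu, ← hEu, h.leibniz, map_add, map_mul, map_mul]
  · intro f a
    obtain ⟨a, rfl⟩ := Φ.surjective a
    rw [← map_smul, ← hEu, ← hEu, h.smul, map_add, map_smul, map_smul]
  · intro N a ha
    obtain ⟨a, rfl⟩ := Φ.surjective a
    rw [hpr, ← hgr] at ha
    obtain ⟨o, ho, e⟩ := ha
    rw [← hEu, hpr, hpr, h.euler N a (by rwa [← φ.injective e]), map_zsmul]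

theorem isSpecialization_symbRed {ι : Type} [DecidableEq ι] [Fintype ι] (E : Set (Coord ι)) {m : ℕ}
    (b : ι → Fin m → ℤ) (H : Subgroup (Torus m)) : IsSpecialization (symbRed E b H) :=
  ⟨isSpec_symbRed E b H, symbRed_surjective, fun _ => symbRed_eq_zero⟩

end Hypertoric
end

/-! ### The theorem on the local structure of quantized hypertoric cones -/

open Hypertoric

theorem theorem5p2 {n m : ℕ} (b : Fin n → Fin m → ℤ) (hfaithful : Faithful b)
    (hunimodular : Unimodular b) (p : Coord (Fin n) → ℂ) (hp : InZeroFibre b p)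
    (hclosed : ClosedOrbit b p) :
    (∃ E e, IsChart b p E e) ∧
    ∀ E e, IsChart b p E e →
      ∃ (EuX : AX b E →+ AX b E) (EuZS : AZS b p E →+ AZS b p E)
        (φ : OX b E ≃ₐ[ℂ] OZS b p E) (Φ : AX b E ≃ₐ[Ch] AZS b p E),
        -- the Euler derivations are those given by the degrees of the coordinates
        (∀ N, ∀ a ∈ grAX b E N, EuX a = N • a) ∧
        (∀ N, ∀ a ∈ grAZS b p E e N, EuZS a = N • a) ∧
        -- both sides are `ℂ^×`-compatible deformation quantizations
        IsGradedQuantization (brkX b E) (grOX b E) 2 (prX b E) EuX ∧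
        IsGradedQuantization (brkZS b p E) (grOZS b p E e) 2 (prZS b p E) EuZS ∧
        -- `φ` is a `ℂ^×`-Poisson isomorphism
        (∀ f g, φ (brkX b E f g) = brkZS b p E (φ f) (φ g)) ∧
        (∀ N, (grOX b E N).map φ.toLinearMap = grOZS b p E e N) ∧
        -- `Φ` is graded and lifts `φ`
        (∀ a, Φ (EuX a) = EuZS (Φ a)) ∧
        (∀ a, prZS b p E (Φ a) = φ (prX b E a)) := by
  refine ⟨exists_isChart hfaithful hunimodular hp hclosed, fun E e h => ?_⟩
  obtain ⟨G, s, hs⟩ := exists_slice hfaithful hunimodular h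
  have hZ := isSpecialization_symbRed (EZ b p E) (bZ b p) ⊤
  have hS := isSpecialization_symbRed (∅ : Set (Coord {i // i ∈ nontriv b p})) (bS b p) (stab b p)
  have hX := isSpecialization_symbRed E b ⊤
  -- The data of the two factors agree definitionally with those of the slice for $F$ equal to
  -- `nontriv b p`.
  let θ : QRed (EZ b p E) (bZ b p) ⊤ ⊗[Ch] QRed ∅ (bS b p) (stab b p) ≃ₐ[Ch] QRed E b ⊤ :=
    s.redEquiv
  let φ : OX b E ≃ₐ[ℂ] OZS b p E := specEquiv hZ hS hX θ
  let Φ : AX b E ≃ₐ[Ch] AZS b p E := complTensEquiv θ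
  -- The Euler derivation of the tensor product is defined by transport. That it multiplies by the
  -- degree defined through $e$ is checked at the end, by moving homogeneous elements back through
  -- $\Phi$.
  let EuZS : AZS b p E →+ AZS b p E :=
    (Φ : AX b E →+ AZS b p E).comp ((eulCompl E b ⊤).comp (Φ.symm : AZS b p E →+ AX b E))
  have hEu : ∀ a, Φ (eulCompl E b ⊤ a) = EuZS (Φ a) := fun a => by
    change _ = Φ (eulCompl E b ⊤ (Φ.symm (Φ a)))
    rw [Φ.symm_apply_apply]
  have hpr : ∀ a, prZS b p E (Φ a) = φ (prX b E a) := complSpec_complTensEquiv hZ hS hX θ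
  have hP : ∀ f g, φ (brkX b E f g) = brkZS b p E (φ f) (φ g) :=
    specEquiv_bracket hZ hS hX θ qred_commutator qred_commutator qred_commutator fun x hx => by
      -- Torsion in the reduction is divisible by $\hbar$: this is the case $k=1$ with right-hand
      -- side zero.
      obtain ⟨y, hy⟩ := qred_torsion (k := 1) (q := x) (q' := 0) (by rw [hx, mul_zero])
      exact ⟨y, by rw [hy, pow_one]⟩
  have hgr : ∀ N, (grOX b E N).map φ.toLinearMap = grOZS b p E e N :=
    map_specEquiv hZ hS hX θ (fun _ _ => mem_redGr_iff) (fun _ _ => mem_redGr_iff)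
      (fun _ _ => mem_redGr_iff) (fun N z hz => s.redJoin_mem_qredGr hs hz)
      fun N x hx => s.exists_redJoin_eq hs hx
  refine ⟨eulCompl E b ⊤, EuZS, φ, Φ, fun N a ha => eulCompl_of_mem ha, fun N a ha => ?_,
    isGradedQuantization, isGradedQuantization.transport φ Φ hP hgr hEu hpr, hP, hgr, hEu, hpr⟩
  obtain ⟨a, rfl⟩ := Φ.surjective a
  rw [← hEu, ← map_zsmul]
  congr 1
  refine eulCompl_of_mem ?_
  have := complTensEquiv_symm_mem θ (fun z hz => s.redJoin_mem_qredGr hs hz) ha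
  rwa [show (complTensEquiv θ).symm (Φ a) = a from Φ.symm_apply_apply a] at this
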